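/- **Setting.** Let $\tilde M$ be a smooth $n$-dimensional manifold without boundary (Hausdorff, second countable), $g$ a smooth Riemannian metric on $\tilde M$, and $x\in C^\infty(\tilde M)$ a real function with $dx\neq 0$ on $\{x=0\}$; let $X=\{x\ge 0\}$, a manifold with boundary $\partial X=\{x=0\}$ and boundary defining function $x$. Let $g_{\mathrm{sc}}=x^{-4}dx^2+x^{-2}\tilde h$ be a scattering metric on $X$: $\tilde h$ is a smooth symmetric 2-cotensor, $g_{\mathrm{sc}}$ is positive definite on $\{x>0\}$, and $\tilde h$ is positive definite on $\ker dx$ at $\partial X$ (i.e. $g_{\mathrm{sc}}$ is positive definite on the fibres of the scattering tangent bundle up to $\partial X$). All pointwise norms of tensors and all volumes below are those of $g_{\mathrm{sc}}$; $L^2_{\mathrm{sc}}$ denotes the resulting $L^2$ spaces. For $r\in\mathbb R$ let $H^{1,r}_{\mathrm{sc}}(X)=x^rH^{1,0}_{\mathrm{sc}}(X)$ be the space of one-forms $U$ on $\{x>0\}$ with $$\|U\|_{H^{1,r}_{\mathrm{sc}}(X)}^2=\|\nabla(x^{-r}U)\|_{L^2_{\mathrm{sc}}(X)}^2+\|x^{-r}U\|_{L^2_{\mathrm{sc}}(X)}^2<\infty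 ,$$ where $\nabla$ is the Levi-Civita connection of $g_{\mathrm{sc}}$, acting in the sense of distributions on $\{x>0\}$. Let $\Omega\subset\{x>0\}$ be (the interior of) a domain in $X$ with compact closure in $\tilde M$ that is a manifold with corners, with an artificial boundary contained in $\partial X$ and an interior boundary which is smooth and transversal to $\partial X$: every $p\in\overline\Omega$ has an open neighbourhood $V$ and a function $\rho\in C^\infty(V)$ with $\Omega\cap V=\{q\in V: x(q)>0,\ \rho(q)>0\}$ such that, if $\rho(p)=0$, then $d\rho(p)\ne0$, and if $\rho(p)=x(p)=0$, then $dx(p)$ and $d\rho(p)$ are linearly independent. Let $\bar H^{1,r}_{\mathrm{sc}}(\Omega)$ be the space of restrictions to $\Omega$ of elements of $H^{1,r}_{\mathrm{sc}}(X)$, with the quotient norm $\|u\|_{\bar H^{1,r}_{\mathrm{sc}}(\Omega)}=\inf\{\|U\|_{H^{1,r}_{\mathrm{sc}}(X)}:U|_\Omega=u\}$. Let $d^s$ be the symmetric gradient on one-forms of the metric $g$ (not $g_{\mathrm{sc}}$), $(d^su)_{ij}=\frac12(\nabla^g_iu_j+\nabla^g_ju_i)$ in the sense of distributions, and, for $F>0$,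 $d^s_F=e^{-F/x}\,d^s\,e^{F/x}$. **Lemma 4.5 (generalized Korn inequality).** For every $F>0$ and $r\in\mathbb R$ there is a constant $C$ such that for all (real or complex) one-forms $u\in\bar H^{1,r}_{\mathrm{sc}}(\Omega)$ one has $x^{-r}d^s_Fu\in L^2_{\mathrm{sc}}(\Omega)$ and $$\|u\|_{\bar H^{1,r}_{\mathrm{sc}}(\Omega)}\le C\left(\|x^{-r}d^s_Fu\|_{L^2_{\mathrm{sc}}(\Omega)}+\|x^{-r}u\|_{L^2_{\mathrm{sc}}(\Omega)}\right).$$ -/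

import Mathlib

open scoped Manifold ContDiff Topology ENNReal NNReal
open MeasureTheory Set

noncomputable section

namespace ScGeom

variable {n : ℕ} {M : Type*} [TopologicalSpace M] [ChartedSpace (EuclideanSpace ℝ (Fin n)) M]

/-- The tangent space `T_p M` of an `n`-manifold without boundary. -/
abbrev T (n : ℕ) {M : Type*} [TopologicalSpace M] [ChartedSpace (EuclideanSpace ℝ (Fin n)) M]
    (p : M) : Type := TangentSpace (𝓡 n) p

/-- A (rough, not necessarily continuous) field of `𝕜`-valued covectors, i.e. a one-form. -/
abbrev OneForm (n : ℕ) (M : Type*) [TopologicalSpace M]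
    [ChartedSpace (EuclideanSpace ℝ (Fin n)) M] (𝕜 : Type*) [RCLike 𝕜] : Type _ :=
  (p : M) → T n p →L[ℝ] 𝕜

/-- A (rough) field of `𝕜`-valued covariant 2-tensors. -/
abbrev TwoTensor (n : ℕ) (M : Type*) [TopologicalSpace M]
    [ChartedSpace (EuclideanSpace ℝ (Fin n)) M] (𝕜 : Type*) [RCLike 𝕜] : Type _ :=
  (p : M) → T n p →L[ℝ] T n p →L[ℝ] 𝕜

/-- Multiplication of a one-form by a real function. -/
def mulOne {𝕜 : Type*} [RCLike 𝕜] (f : M → ℝ) (u : OneForm n M 𝕜) : OneForm n M 𝕜 :=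
  fun p => f p • u p

/-- Multiplication of a 2-tensor by a real function. -/
def mulTwo {𝕜 : Type*} [RCLike 𝕜] (f : M → ℝ) (τ : TwoTensor n M 𝕜) : TwoTensor n M 𝕜 :=
  fun p => f p • τ p

/-- The differential `df` of a real function, as a one-form. -/
def dForm (f : M → ℝ) (p : M) : T n p →L[ℝ] ℝ := mfderiv (𝓡 n) 𝓘(ℝ, ℝ) f p

/-! ### Local coordinates -/

/-- The `i`-th standard basis vector of `ℝⁿ`. -/
def stdVec (i : Fin n) : EuclideanSpace ℝ (Fin n) := EuclideanSpace.single i (1 : ℝ)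

/-- Partial derivative `∂ᵢ f` on `ℝⁿ`. -/
def pderiv (i : Fin n) (f : EuclideanSpace ℝ (Fin n) → ℝ) (y : EuclideanSpace ℝ (Fin n)) : ℝ :=
  fderiv ℝ f y (stdVec i)

/-- The coordinate vector `∂ᵢ` of the chart `e`, at the point of `M` with coordinates `y`. -/
def coordVec (e : OpenPartialHomeomorph M (EuclideanSpace ℝ (Fin n))) (i : Fin n)
    (y : EuclideanSpace ℝ (Fin n)) : T n (e.symm y) :=
  mfderiv (𝓡 n) (𝓡 n) e.symm y (stdVec i)

/-- The component `uᵢ = u(∂ᵢ)` of a one-form in the chart `e`. -/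
def compOne {𝕜 : Type*} [RCLike 𝕜] (e : OpenPartialHomeomorph M (EuclideanSpace ℝ (Fin n)))
    (u : OneForm n M 𝕜) (i : Fin n) (y : EuclideanSpace ℝ (Fin n)) : 𝕜 :=
  u (e.symm y) (coordVec e i y)

/-- The component `τᵢⱼ = τ(∂ᵢ, ∂ⱼ)` of a 2-tensor in the chart `e`. -/
def compTwo {𝕜 : Type*} [RCLike 𝕜] (e : OpenPartialHomeomorph M (EuclideanSpace ℝ (Fin n)))
    (τ : TwoTensor n M 𝕜) (i j : Fin n) (y : EuclideanSpace ℝ (Fin n)) : 𝕜 :=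
  τ (e.symm y) (coordVec e i y) (coordVec e j y)

/-- The matrix `(hᵢⱼ)` of a metric `h` in the chart `e`. -/
def gram (e : OpenPartialHomeomorph M (EuclideanSpace ℝ (Fin n))) (h : TwoTensor n M ℝ)
    (y : EuclideanSpace ℝ (Fin n)) : Matrix (Fin n) (Fin n) ℝ :=
  Matrix.of fun i j => compTwo e h i j y

/-- The Christoffel symbol `Γᵏᵢⱼ = ½ ∑ₗ hᵏˡ (∂ᵢ hⱼₗ + ∂ⱼ hᵢₗ - ∂ₗ hᵢⱼ)` of the Levi-Civita
connection of `h` in the chart `e`. -/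
def christoffel (e : OpenPartialHomeomorph M (EuclideanSpace ℝ (Fin n))) (h : TwoTensor n M ℝ)
    (k i j : Fin n) (y : EuclideanSpace ℝ (Fin n)) : ℝ :=
  (1 / 2 : ℝ) * ∑ l, (gram e h y)⁻¹ k l *
    (pderiv i (compTwo e h j l) y + pderiv j (compTwo e h i l) y - pderiv l (compTwo e h i j) y)

/-- The coordinate image in the chart `e` of the part of `O` that lies in the chart. -/
def chartDomain (e : OpenPartialHomeomorph M (EuclideanSpace ℝ (Fin n))) (O : Set M) :
    Set (EuclideanSpace ℝ (Fin n)) :=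
  e.target ∩ e.symm ⁻¹' O

/-- Test functions on an open subset `V` of `ℝⁿ`: elements of `C_c^∞(V)`. -/
def IsTest (V : Set (EuclideanSpace ℝ (Fin n))) (φ : EuclideanSpace ℝ (Fin n) → ℝ) : Prop :=
  ContDiff ℝ ∞ φ ∧ HasCompactSupport φ ∧ tsupport φ ⊆ V

/-- The one-form `u` has locally integrable components on the open set `O`. -/
def LocIntOne {𝕜 : Type*} [RCLike 𝕜] (O : Set M) (u : OneForm n M 𝕜) : Prop :=
  ∀ e ∈ atlas (EuclideanSpace ℝ (Fin n)) M, ∀ i, LocallyIntegrableOn (compOne e u i) (chartDomain e O)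

/-- The 2-tensor `τ` has locally integrable components on the open set `O`. -/
def LocIntTwo {𝕜 : Type*} [RCLike 𝕜] (O : Set M) (τ : TwoTensor n M 𝕜) : Prop :=
  ∀ e ∈ atlas (EuclideanSpace ℝ (Fin n)) M, ∀ i j,
    LocallyIntegrableOn (compTwo e τ i j) (chartDomain e O)

/-- `W = ∇u` weakly (in the sense of distributions) on the open set `O`, where `∇` is the
Levi-Civita connection of `h`; in coordinates `Wᵢⱼ = ∂ᵢ uⱼ - ∑ₖ Γᵏᵢⱼ uₖ`. -/
def IsWeakGrad {𝕜 : Type*} [RCLike 𝕜] (h : TwoTensor n M ℝ) (O : Set M)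
    (u : OneForm n M 𝕜) (W : TwoTensor n M 𝕜) : Prop :=
  LocIntOne O u ∧ LocIntTwo O W ∧
  ∀ e ∈ atlas (EuclideanSpace ℝ (Fin n)) M, ∀ φ, IsTest (chartDomain e O) φ → ∀ i j,
    ∫ y, pderiv i φ y • compOne e u j y =
      -∫ y, φ y • (compTwo e W i j y + ∑ k, christoffel e h k i j y • compOne e u k y)

/-- `S = dˢu` weakly (in the sense of distributions) on the open set `O`, where `dˢ` is the
symmetric gradient of the metric `h`; in coordinates
`Sᵢⱼ = ½ (∂ᵢ uⱼ + ∂ⱼ uᵢ) - ∑ₖ Γᵏᵢⱼ uₖ`. -/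
def IsWeakSymGrad {𝕜 : Type*} [RCLike 𝕜] (h : TwoTensor n M ℝ) (O : Set M)
    (u : OneForm n M 𝕜) (S : TwoTensor n M 𝕜) : Prop :=
  LocIntOne O u ∧ LocIntTwo O S ∧
  ∀ e ∈ atlas (EuclideanSpace ℝ (Fin n)) M, ∀ φ, IsTest (chartDomain e O) φ → ∀ i j,
    ∫ y, (1 / 2 : ℝ) • (pderiv i φ y • compOne e u j y + pderiv j φ y • compOne e u i y) =
      -∫ y, φ y • (compTwo e S i j y + ∑ k, christoffel e h k i j y • compOne e u k y)

/-- `S = dˢ_F u` weakly on `O ⊆ {x > 0}`, where `dˢ_F = e^{-F/x} dˢ e^{F/x}` and `dˢ` is the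
symmetric gradient of `h`: that is, `e^{F/x} S = dˢ (e^{F/x} u)`. -/
def IsWeakSymGradF {𝕜 : Type*} [RCLike 𝕜] (x : M → ℝ) (F : ℝ) (h : TwoTensor n M ℝ) (O : Set M)
    (u : OneForm n M 𝕜) (S : TwoTensor n M 𝕜) : Prop :=
  IsWeakSymGrad h O (mulOne (fun p => Real.exp (F / x p)) u)
    (mulTwo (fun p => Real.exp (F / x p)) S)

/-! ### Volume, fibre norms and `L²` norms of a metric -/

/-- The Riemannian volume of `h` on the domain of the chart `e` (extended by zero):
the density `√(det hᵢⱼ) dy` transported to `M`. -/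
def chartVol [MeasurableSpace M] (h : TwoTensor n M ℝ)
    (e : OpenPartialHomeomorph M (EuclideanSpace ℝ (Fin n))) : Measure M :=
  ((volume.restrict e.target).withDensity
    fun y => ENNReal.ofReal (Real.sqrt (gram e h y).det)).map e.symm

/-- The Riemannian volume measure of `h`: the chart volumes agree on overlaps of charts, and
their supremum in the lattice of measures is the measure that restricts to each of them. -/
def vol [MeasurableSpace M] (h : TwoTensor n M ℝ) : Measure M :=
  ⨆ e ∈ atlas (EuclideanSpace ℝ (Fin n)) M, chartVol h e

/-- The inverse `(hⁱʲ)` of the matrix of `h` at `p`, in the standard basis of `T_p M`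
(the fibre norms below do not depend on the basis). -/
def invGram (h : TwoTensor n M ℝ) (p : M) : Matrix (Fin n) (Fin n) ℝ :=
  (Matrix.of fun i j : Fin n => h p (stdVec i : EuclideanSpace ℝ (Fin n))
    (stdVec j : EuclideanSpace ℝ (Fin n)))⁻¹

/-- `|u|²_h = ∑ hⁱʲ uᵢ ūⱼ` at `p`. -/
def normSqOne {𝕜 : Type*} [RCLike 𝕜] (h : TwoTensor n M ℝ) (u : OneForm n M 𝕜) (p : M) : ℝ :=
  ∑ i, ∑ j, invGram h p i j *
    RCLike.re (u p (stdVec i : EuclideanSpace ℝ (Fin n)) *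
      star (u p (stdVec j : EuclideanSpace ℝ (Fin n))))

/-- `|τ|²_h = ∑ hⁱᵃ hʲᵇ τᵢⱼ τ̄ₐᵦ` at `p`. -/
def normSqTwo {𝕜 : Type*} [RCLike 𝕜] (h : TwoTensor n M ℝ) (τ : TwoTensor n M 𝕜) (p : M) : ℝ :=
  ∑ i, ∑ j, ∑ a, ∑ b, invGram h p i a * invGram h p j b *
    RCLike.re (τ p (stdVec i : EuclideanSpace ℝ (Fin n)) (stdVec j : EuclideanSpace ℝ (Fin n)) *
      star (τ p (stdVec a : EuclideanSpace ℝ (Fin n)) (stdVec b : EuclideanSpace ℝ (Fin n))))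

/-- The `L²(O)` norm of a one-form with respect to `h`. -/
def l2One {𝕜 : Type*} [RCLike 𝕜] [MeasurableSpace M] (h : TwoTensor n M ℝ) (O : Set M)
    (u : OneForm n M 𝕜) : ℝ≥0∞ :=
  (∫⁻ p in O, ENNReal.ofReal (normSqOne h u p) ∂vol h) ^ (1 / 2 : ℝ)

/-- The `L²(O)` norm of a 2-tensor with respect to `h`. -/
def l2Two {𝕜 : Type*} [RCLike 𝕜] [MeasurableSpace M] (h : TwoTensor n M ℝ) (O : Set M)
    (τ : TwoTensor n M 𝕜) : ℝ≥0∞ :=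
  (∫⁻ p in O, ENNReal.ofReal (normSqTwo h τ p) ∂vol h) ^ (1 / 2 : ℝ)

/-! ### Scattering geometry on `X = {x ≥ 0}` -/

/-- `x` is a boundary defining function of `X = {x ≥ 0}`, a manifold with boundary `{x = 0}`. -/
structure IsBdf (x : M → ℝ) : Prop where
  smooth : ContMDiff (𝓡 n) 𝓘(ℝ, ℝ) ∞ x
  dx_ne_zero : ∀ p, x p = 0 → dForm (n := n) x p ≠ 0

/-- The bilinear form `x⁻⁴ dx² + x⁻² h`. -/
def scForm (x : M → ℝ) (h : TwoTensor n M ℝ) : TwoTensor n M ℝ := fun p =>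
  ((x p) ^ 4)⁻¹ • (dForm x p).smulRight (dForm x p) + ((x p) ^ 2)⁻¹ • h p

variable [IsManifold (𝓡 n) ∞ M]

/-- A scattering metric `x⁻⁴ dx² + x⁻² h` on `X = {x ≥ 0}`, with `h` a smooth symmetric 2-cotensor,
positive definite on the fibres of the scattering tangent bundle. Over `{x > 0}` this is the
usual tangent bundle. Over `{x = 0}` it is spanned by `x²∂ₓ`, which has length one and is
orthogonal to the remaining generators, and by `x∂_y`, on which the form is `h(∂_y, ∂_y)`, so that
positivity there means that `h` is positive on `ker dx`. -/
structure ScMetric (n : ℕ) {M : Type*} [TopologicalSpace M]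
    [ChartedSpace (EuclideanSpace ℝ (Fin n)) M] [IsManifold (𝓡 n) ∞ M] (x : M → ℝ) where
  h : TwoTensor n M ℝ
  symm : ∀ p (v w : T n p), h p v w = h p w v
  smooth : ContMDiff (𝓡 n)
    ((𝓡 n).prod 𝓘(ℝ, EuclideanSpace ℝ (Fin n) →L[ℝ] EuclideanSpace ℝ (Fin n) →L[ℝ] ℝ)) ∞
    (fun p : M => Bundle.TotalSpace.mk'
      (EuclideanSpace ℝ (Fin n) →L[ℝ] EuclideanSpace ℝ (Fin n) →L[ℝ] ℝ)
      (E := fun p : M => T n p →L[ℝ] T n p →L[ℝ] ℝ) p (h p))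
  pos_interior : ∀ p, 0 < x p → ∀ v : T n p, v ≠ 0 → 0 < scForm x h p v v
  pos_boundary : ∀ p, x p = 0 → ∀ v : T n p, v ≠ 0 → dForm x p v = 0 → 0 < h p v v

/-- The scattering metric as a metric on `{x > 0}`. -/
def ScMetric.form {x : M → ℝ} (gsc : ScMetric n x) : TwoTensor n M ℝ := scForm x gsc.h

/-- A domain `Ω` in `X = {x ≥ 0}` that is a manifold with corners with compact closure, whose
boundary hypersurfaces are the artificial boundary, contained in `{x = 0}`, and an interior
boundary, which is smooth and transversal to `{x = 0}`. `Ω` stands for the interior, so that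
`Ω ⊆ {x > 0}`; near each point of its closure it is `{x > 0, ρ > 0}` for a smooth `ρ`, a local
defining function of the interior boundary where `ρ` vanishes. -/
structure IsScDomain (x : M → ℝ) (Ω : Set M) : Prop where
  isCompact_closure : IsCompact (closure Ω)
  local_form : ∀ p ∈ closure Ω, ∃ V : Set M, ∃ ρ : M → ℝ, IsOpen V ∧ p ∈ V ∧
    ContMDiffOn (𝓡 n) 𝓘(ℝ, ℝ) ∞ ρ V ∧ Ω ∩ V = {q ∈ V | 0 < x q ∧ 0 < ρ q} ∧
    (ρ p = 0 → dForm (n := n) ρ p ≠ 0 ∧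
      (x p = 0 → LinearIndependent ℝ ![dForm (n := n) x p, dForm (n := n) ρ p]))

/-- The norm of `H_sc^{1,r}(X) = x^r H_sc^{1,0}(X)` on one-forms, with value `∞` outside the space:
`‖U‖² = ‖∇(x^{-r} U)‖² + ‖x^{-r} U‖²` with `L²` norms, `∇` and volume those of the scattering
metric. The infimum runs over the weak gradients, which are all equal almost everywhere. -/
def scH1Norm {𝕜 : Type*} [RCLike 𝕜] [MeasurableSpace M] {x : M → ℝ} (gsc : ScMetric n x) (r : ℝ)
    (U : OneForm n M 𝕜) : ℝ≥0∞ :=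
  ⨅ (W : TwoTensor n M 𝕜)
    (_ : IsWeakGrad gsc.form {p | 0 < x p} (mulOne (fun p => x p ^ (-r)) U) W),
    (l2Two gsc.form {p | 0 < x p} W ^ 2 +
      l2One gsc.form {p | 0 < x p} (mulOne (fun p => x p ^ (-r)) U) ^ 2) ^ (1 / 2 : ℝ)

/-- The quotient norm of the space of restrictions to `Ω` of elements of `H_sc^{1,r}(X)`, with
value `∞` outside the space: the infimum of the norms of the extensions to `X`. -/
def scBarH1Norm {𝕜 : Type*} [RCLike 𝕜] [MeasurableSpace M] {x : M → ℝ} (gsc : ScMetric n x)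
    (Ω : Set M) (r : ℝ) (u : OneForm n M 𝕜) : ℝ≥0∞ :=
  ⨅ (U : OneForm n M 𝕜) (_ : ∀ p ∈ Ω, U p = u p), scH1Norm gsc r U

end ScGeom

end

/-!
# The generalized Korn inequality for scattering metrics

Put `φ = F/x + r log x` and `v = x^{-r} u`. Then `x^{-r} e^{-F/x} dˢ e^{F/x} u` is the symmetric part
of `∇v + (Γ_sc - Γ_g) v + dφ ⊗ v`, where `∇` is the covariant derivative of the scattering metric and
the difference of the two connections is a tensor (`conjSymGrad`, `isWeakSymGrad_conjSymGrad`). The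
powers of `x` have disappeared, and what is needed is an extension of `v` from `Ω` to `x > 0` whose
`H¹` norm is controlled by the `L²` norms on `Ω` of this expression and of `v`.

Near a boundary point take coordinates in which `x` is a linear form `α`, with `α(e) = 1`, and compose
them with the projective involution `inversion`, `z ↦ (z + e)/α(z) - e`. It turns a neighbourhood of
the boundary into a neighbourhood of infinity in a cone, on which the scattering metric becomes
`dα² + h(…)` with `h` smooth up to the boundary: it is uniformly equivalent to the Euclidean metric and
its connection coefficients are bounded. So are those of the smooth metric `g`, and `1/x` being the
coordinate `α`, so is `dφ`. Moreover the inversion maps the half space `β > 0` to itself for each linear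
form `β` with `β(e) = 0`, and also for `β = α`; by transversality `Ω` can be taken to be such a half
space. At points with `x > 0` any chart flattening the interior boundary does the same
(`IsAdaptedChart`, `IsScDomain.exists_isAdaptedChart`). Hence in these charts every term beyond the
flat symmetric gradient is of order zero with bounded coefficients, and the problem is Korn's
inequality on a Euclidean half space for one-forms cut off by a partition of unity
(`IsAdaptedChart.exists_extension`, `exists_extension`).

On the whole space, integrating by parts twice in `∫ |∂ᵢwⱼ + ∂ⱼwᵢ|²` produces
`2 ∫ |∂w|² + 2 ∫ |div w|²` (`integral_grad_mul_grad_comm`, `korn_whole_space`). A half space is reduced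
to this case by extending `w` as `3 A₁^* w - 2 A₂^* w`, with `A_l` the map that fixes `β = 0` and
multiplies the normal coordinate by `-l` (`reflForm`). Traces match in all components, so that the
extension is in `H¹`, and because it consists of pullbacks by linear maps its symmetric gradient is the
same combination of pullbacks of the symmetric gradient, for which `β ≤ 0` contributes no more than
`β > 0` (`exists_korn_extension`).

Weak derivatives are handled without approximating the functions: changes of variables and
reflections are transferred to the test fields, and `IsWeakDeriv.integral_rough` allows test fields
that are merely bounded with bounded divergence, by mollification.
-/

set_option linter.unusedSectionVars false

noncomputable section

namespace ScGeom

/-! ### Weak derivatives on open subsets of Euclidean space -/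

/-- The model space `ℝⁿ`. -/
abbrev EE (n : ℕ) : Type := EuclideanSpace ℝ (Fin n)

variable {n : ℕ} {𝕜 : Type*} [RCLike 𝕜]

/-- `G` is the weak total derivative of the scalar function `f` on `D`, both being locally
integrable there. -/
structure IsWeakDeriv (D : Set (EE n)) (f : EE n → 𝕜) (G : EE n → EE n →L[ℝ] 𝕜) : Prop where
  locInt : LocallyIntegrableOn f D
  locIntGrad : LocallyIntegrableOn G D
  integral_eq : ∀ φ, IsTest D φ → ∀ v, ∫ y, fderiv ℝ φ y v • f y = -∫ y, φ y • G y v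

lemma sum_smul_stdVec (v : EE n) : ∑ i, v i • (stdVec i : EE n) = v := by
  have := (EuclideanSpace.basisFun (Fin n) ℝ).sum_repr v
  simpa [stdVec] using this

lemma norm_stdVec (i : Fin n) : ‖(stdVec i : EE n)‖ = 1 := by simp [stdVec]

lemma abs_apply_le_norm (v : EE n) (i : Fin n) : |v i| ≤ ‖v‖ := by
  simpa using PiLp.norm_apply_le v i

lemma clm_apply_eq_sum {F : Type*} [NormedAddCommGroup F] [NormedSpace ℝ F]
    (L : EE n →L[ℝ] F) (v : EE n) : L v = ∑ i, v i • L (stdVec i) := by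
  conv_lhs => rw [← sum_smul_stdVec v]
  simp

/-- A locally integrable function times a bounded function supported in a compact set. -/
lemma integrable_bdd_smul {F : Type*} [NormedAddCommGroup F] [NormedSpace ℝ F]
    {D K : Set (EE n)} {f : EE n → F} (hf : LocallyIntegrableOn f D) (hK : IsCompact K)
    (hKD : K ⊆ D) {ψ : EE n → ℝ} (hψ : AEStronglyMeasurable ψ volume) {B : ℝ}
    (hB : ∀ y, |ψ y| ≤ B) (h0 : ∀ y, y ∉ K → ψ y = 0) :
    Integrable (fun y => ψ y • f y) := by
  have h1 : IntegrableOn f K := hf.integrableOn_compact_subset hKD hK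
  have h2 : IntegrableOn (fun y => ψ y • f y) K :=
    Integrable.bdd_smul h1 B hψ.restrict (Filter.Eventually.of_forall hB)
  refine (integrableOn_iff_integrable_of_support_subset ?_).1 h2
  intro y hy
  by_contra h
  exact hy (by simp [h0 y h])

lemma IsTest.mono {D D' : Set (EE n)} {φ : EE n → ℝ} (h : IsTest D φ) (hD : D ⊆ D') :
    IsTest D' φ := ⟨h.1, h.2.1, h.2.2.trans hD⟩

lemma IsTest.eq_zero {D : Set (EE n)} {φ : EE n → ℝ} (_ : IsTest D φ) {y : EE n}
    (hy : y ∉ tsupport φ) : φ y = 0 := image_eq_zero_of_notMem_tsupport hy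

lemma IsTest.fderiv_eq_zero {D : Set (EE n)} {φ : EE n → ℝ} (_ : IsTest D φ) {y : EE n}
    (hy : y ∉ tsupport φ) : fderiv ℝ φ y = 0 :=
  image_eq_zero_of_notMem_tsupport (fun h => hy (tsupport_fderiv_subset ℝ h))

lemma IsTest.continuous_fderiv {D : Set (EE n)} {φ : EE n → ℝ} (h : IsTest D φ) :
    Continuous (fderiv ℝ φ) := h.1.continuous_fderiv (by simp)

lemma IsTest.differentiable {D : Set (EE n)} {φ : EE n → ℝ} (h : IsTest D φ) :
    Differentiable ℝ φ := h.1.differentiable (by simp)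

lemma IsTest.exists_bound {D : Set (EE n)} {φ : EE n → ℝ} (h : IsTest D φ) :
    ∃ B, ∀ y, |φ y| ≤ B := h.1.continuous.bounded_above_of_compact_support h.2.1

lemma IsTest.exists_bound_fderiv {D : Set (EE n)} {φ : EE n → ℝ} (h : IsTest D φ) :
    ∃ B, ∀ y, ‖fderiv ℝ φ y‖ ≤ B :=
  h.continuous_fderiv.bounded_above_of_compact_support (h.2.1.fderiv ℝ)

lemma IsTest.integrable_smul {F : Type*} [NormedAddCommGroup F] [NormedSpace ℝ F]
    {D : Set (EE n)} {φ : EE n → ℝ} (h : IsTest D φ) {f : EE n → F}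
    (hf : LocallyIntegrableOn f D) : Integrable (fun y => φ y • f y) := by
  obtain ⟨B, hB⟩ := h.exists_bound
  exact integrable_bdd_smul hf h.2.1 h.2.2 h.1.continuous.aestronglyMeasurable hB
    fun y hy => h.eq_zero hy

lemma IsTest.integrable_fderiv_smul {F : Type*} [NormedAddCommGroup F] [NormedSpace ℝ F]
    {D : Set (EE n)} {φ : EE n → ℝ} (h : IsTest D φ) {f : EE n → F}
    (hf : LocallyIntegrableOn f D) (v : EE n) :
    Integrable (fun y => fderiv ℝ φ y v • f y) := by
  obtain ⟨B, hB⟩ := h.exists_bound_fderiv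
  exact integrable_bdd_smul hf h.2.1 h.2.2
    (h.continuous_fderiv.clm_apply continuous_const).aestronglyMeasurable
    (B := B * ‖v‖) (fun y => (ContinuousLinearMap.le_opNorm _ _).trans (mul_le_mul_of_nonneg_right (hB y) (norm_nonneg v)))
    fun y hy => by simp [h.fderiv_eq_zero hy]

/-- Convolution with a normalised bump function. -/
def mollify (η : ContDiffBump (0 : EE n)) (h : EE n → ℝ) : EE n → ℝ :=
  convolution (η.normed volume) h (ContinuousLinearMap.lsmul ℝ ℝ) volume

/-- Mollification at scale at most `δ` turns functions vanishing off `K` into test functions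
supported in the `δ`-thickening of `K`. -/
lemma isTest_mollify {η : ContDiffBump (0 : EE n)} {D K : Set (EE n)} {δ : ℝ}
    (hη : η.rOut ≤ δ) (hK : IsCompact K) (hKD : Metric.cthickening δ K ⊆ D) {h : EE n → ℝ}
    (hh : LocallyIntegrable h) (h0 : ∀ y, y ∉ K → h y = 0) :
    IsTest D (mollify η h) ∧ tsupport (mollify η h) ⊆ Metric.cthickening δ K := by
  have hs : Function.support (mollify η h) ⊆ Metric.cthickening δ K := by
    refine (support_convolution_subset _).trans ?_
    rintro _ ⟨a, ha, b, hb, rfl⟩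
    rw [ContDiffBump.support_normed_eq] at ha
    have hbK : b ∈ K := by
      by_contra hb'
      exact hb (h0 b hb')
    refine Metric.mem_cthickening_of_dist_le _ b δ K hbK ?_
    have : dist a 0 < η.rOut := ha
    simp only [dist_eq_norm, sub_zero, add_sub_cancel_right] at this ⊢
    linarith
  have hc : IsCompact (Metric.cthickening δ K) := hK.cthickening
  have ht : tsupport (mollify η h) ⊆ Metric.cthickening δ K :=
    closure_minimal hs hc.isClosed
  refine ⟨⟨?_, HasCompactSupport.of_support_subset_isCompact hc hs, ht.trans hKD⟩, ht⟩
  exact η.hasCompactSupport_normed.contDiff_convolution_left _ η.contDiff_normed hh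

lemma abs_mollify_le (η : ContDiffBump (0 : EE n)) {h : EE n → ℝ} {B : ℝ}
    (hB : ∀ y, |h y| ≤ B) (y : EE n) : |mollify η h y| ≤ B := by
  unfold mollify
  rw [convolution_def, ← Real.norm_eq_abs]
  have hi : Integrable (fun t : EE n => η.normed volume t * B) :=
    (η.integrable_normed).mul_const B
  refine (norm_integral_le_of_norm_le hi (Filter.Eventually.of_forall fun t => ?_)).trans ?_
  · simp only [ContinuousLinearMap.lsmul_apply, smul_eq_mul, norm_mul, Real.norm_eq_abs]
    rw [abs_of_nonneg (η.nonneg_normed t)]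
    exact mul_le_mul_of_nonneg_left (hB _) (η.nonneg_normed t)
  · rw [integral_mul_const, η.integral_normed, one_mul]

/-- The derivative of a mollification falls on the bump function. -/
lemma fderiv_mollify_apply (η : ContDiffBump (0 : EE n)) {h : EE n → ℝ}
    (hh : LocallyIntegrable h) (s v : EE n) :
    fderiv ℝ (mollify η h) s v = ∫ t, fderiv ℝ (η.normed volume) (s - t) v * h t ∧
    Integrable (fun t => fderiv ℝ (η.normed volume) (s - t) v * h t) := by
  have hc1 : ContDiff ℝ 1 (η.normed (volume : Measure (EE n))) := η.contDiff_normed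
  have h1 := (η.hasCompactSupport_normed (μ := volume)).hasFDerivAt_convolution_left
    (ContinuousLinearMap.lsmul ℝ ℝ) hc1 hh s
  have h2 : ConvolutionExistsAt (fderiv ℝ (η.normed volume)) h s
      (ContinuousLinearMap.precompL (EE n) (ContinuousLinearMap.lsmul ℝ ℝ : ℝ →L[ℝ] ℝ →L[ℝ] ℝ))
      volume :=
    ((η.hasCompactSupport_normed (μ := volume)).fderiv ℝ).convolutionExists_left _
      (hc1.continuous_fderiv (by simp)) hh s
  have h3 := h2.integrable_swap
  have h4 := h3.apply_continuousLinearMap v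
  constructor
  · unfold mollify
    rw [h1.fderiv, convolution_eq_swap, ContinuousLinearMap.integral_apply h3]
    simp [ContinuousLinearMap.precompL_apply]
  · simpa [ContinuousLinearMap.precompL_apply] using h4

/-- Testing a weak derivative against a bounded compactly supported vector field `Ψ` whose weak
divergence is the bounded function `ψ`: mollify the field and pass to the limit. -/
theorem IsWeakDeriv.integral_rough {D : Set (EE n)} (hD : IsOpen D) {f : EE n → 𝕜}
    {G : EE n → EE n →L[ℝ] 𝕜} (h : IsWeakDeriv D f G) {K : Set (EE n)} (hK : IsCompact K)
    (hKD : K ⊆ D) {ψ : EE n → ℝ} {Ψ : EE n → EE n} (hψ : AEStronglyMeasurable ψ volume)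
    (hΨ : AEStronglyMeasurable Ψ volume) {B : ℝ} (hψB : ∀ y, |ψ y| ≤ B) (hΨB : ∀ y, ‖Ψ y‖ ≤ B)
    (hψ0 : ∀ y, y ∉ K → ψ y = 0) (hΨ0 : ∀ y, y ∉ K → Ψ y = 0)
    (hdiv : ∀ g : EE n → ℝ, ContDiff ℝ ∞ g → HasCompactSupport g →
      ∫ y, ψ y * g y = -∫ y, fderiv ℝ g y (Ψ y)) :
    ∫ y, ψ y • f y = -∫ y, G y (Ψ y) := by
  obtain ⟨δ, hδ, hδD⟩ := hK.exists_cthickening_subset_open hD hKD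
  have hK' : IsCompact (Metric.cthickening δ K) := hK.cthickening
  let η : ℕ → ContDiffBump (0 : EE n) := fun k =>
    ⟨δ / (k + 1) / 2, δ / (k + 1), by positivity, half_lt_self (by positivity)⟩
  have hηδ : ∀ k, (η k).rOut ≤ δ := fun k => by
    change δ / (k + 1) ≤ δ
    apply div_le_self hδ.le
    linarith [k.cast_nonneg (α := ℝ)]
  have hη0 : Filter.Tendsto (fun k => (η k).rOut) Filter.atTop (𝓝 0) := by
    change Filter.Tendsto (fun k : ℕ => δ / ((k : ℝ) + 1)) Filter.atTop (𝓝 0)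
    exact tendsto_const_div_atTop_nhds_zero_nat δ |>.comp (Filter.tendsto_add_atTop_nat 1) |>.congr
      (fun k => by simp)
  have hη2 : ∀ᶠ k in Filter.atTop, (η k).rOut ≤ 2 * (η k).rIn :=
    Filter.Eventually.of_forall fun k => by
      change δ / (k + 1) ≤ 2 * (δ / (k + 1) / 2)
      linarith
  have hcomp : ∀ i : Fin n, AEStronglyMeasurable (fun y => Ψ y i) volume := fun i =>
    (EuclideanSpace.proj (𝕜 := ℝ) i).continuous.comp_aestronglyMeasurable hΨ
  have hΨi : ∀ i y, |Ψ y i| ≤ B := fun i y => (abs_apply_le_norm _ _).trans (hΨB y)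
  have lint : ∀ {p : EE n → ℝ}, AEStronglyMeasurable p volume → (∀ y, |p y| ≤ B) →
      LocallyIntegrable p := fun {p} hp hb =>
    (memLp_top_of_bound hp B (Filter.Eventually.of_forall hb)).locallyIntegrable le_top
  have lψ := lint hψ hψB
  have lΨ := fun i => lint (hcomp i) (hΨi i)
  have hΨi0 : ∀ i y, y ∉ K → Ψ y i = 0 := fun i y hy => by simp [hΨ0 y hy]
  have hfK : IntegrableOn f (Metric.cthickening δ K) := h.locInt.integrableOn_compact_subset hδD hK'
  have hGK : IntegrableOn G (Metric.cthickening δ K) :=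
    h.locIntGrad.integrableOn_compact_subset hδD hK'
  -- the divergence of the mollified field is the mollified divergence
  have hdivk : ∀ k s, ∑ i, fderiv ℝ (mollify (η k) (fun y => Ψ y i)) s (stdVec i)
      = mollify (η k) ψ s := by
    intro k s
    have e1 : ∑ i, fderiv ℝ (mollify (η k) (fun y => Ψ y i)) s (stdVec i)
        = ∫ t, fderiv ℝ ((η k).normed volume) (s - t) (Ψ t) := by
      rw [Finset.sum_congr rfl fun i _ => (fderiv_mollify_apply (η k) (lΨ i) s (stdVec i)).1,
        ← integral_finsetSum _ fun i _ => (fderiv_mollify_apply (η k) (lΨ i) s (stdVec i)).2]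
      congr 1
      ext t
      rw [clm_apply_eq_sum _ (Ψ t)]
      exact Finset.sum_congr rfl fun i _ => by simp [mul_comm]
    have hcd : ContDiff ℝ ∞ (fun t => (η k).normed (volume : Measure (EE n)) (s - t)) :=
      (η k).contDiff_normed.comp (contDiff_const.sub contDiff_id)
    have hcs : HasCompactSupport (fun t => (η k).normed (volume : Measure (EE n)) (s - t)) :=
      ((η k).hasCompactSupport_normed).comp_homeomorph (Homeomorph.subLeft s)
    have e2 := hdiv _ hcd hcs
    have e3 : ∀ t v, fderiv ℝ (fun t => (η k).normed (volume : Measure (EE n)) (s - t)) t v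
        = - fderiv ℝ ((η k).normed volume) (s - t) v := by
      intro t v
      have hd : DifferentiableAt ℝ ((η k).normed (volume : Measure (EE n))) (s - t) :=
        ((η k).contDiff_normed (n := 1)).differentiable (by simp) _
      have := (hd.hasFDerivAt.comp t ((hasFDerivAt_id t).const_sub s)).fderiv
      change fderiv ℝ ((η k).normed (volume : Measure (EE n)) ∘ fun t => s - t) t v = _
      erw [this]
      simp
    rw [e1]
    simp only [e3, integral_neg, neg_neg] at e2
    rw [← e2]
    unfold mollify
    rw [convolution_eq_swap]
    congr 1
    ext t
    simp [mul_comm]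
  have hT : ∀ k i, IsTest D (mollify (η k) (fun y => Ψ y i)) := fun k i =>
    (isTest_mollify (hηδ k) hK hδD (lΨ i) (hΨi0 i)).1
  have hTs : ∀ k i, tsupport (mollify (η k) (fun y => Ψ y i)) ⊆ Metric.cthickening δ K :=
    fun k i => (isTest_mollify (hηδ k) hK hδD (lΨ i) (hΨi0 i)).2
  have hTψ : ∀ k, IsTest D (mollify (η k) ψ) := fun k =>
    (isTest_mollify (hηδ k) hK hδD lψ hψ0).1
  have hTψs : ∀ k, tsupport (mollify (η k) ψ) ⊆ Metric.cthickening δ K :=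
    fun k => (isTest_mollify (hηδ k) hK hδD lψ hψ0).2
  -- the mollified field consists of test functions
  have key : ∀ k, ∫ y, mollify (η k) ψ y • f y
      = ∑ i, -∫ y, mollify (η k) (fun y => Ψ y i) y • G y (stdVec i) := by
    intro k
    rw [← Finset.sum_congr rfl fun i _ => (h.integral_eq _ (hT k i) (stdVec i)),
      ← integral_finsetSum _ fun i _ => (hT k i).integrable_fderiv_smul h.locInt _]
    congr 1
    ext y
    rw [← hdivk k y, Finset.sum_smul]
  -- bounded almost everywhere convergence of the mollifications
  have lim1 : Filter.Tendsto (fun k => ∫ y, mollify (η k) ψ y • f y) Filter.atTop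
      (𝓝 (∫ y, ψ y • f y)) := by
    refine tendsto_integral_of_dominated_convergence
      ((Metric.cthickening δ K).indicator fun y => B * ‖f y‖) ?_ ?_ ?_ ?_
    · exact fun k => ((hTψ k).integrable_smul h.locInt).aestronglyMeasurable
    · exact (integrable_indicator_iff hK'.measurableSet).2 (hfK.norm.const_mul B)
    · refine fun k => Filter.Eventually.of_forall fun y => ?_
      by_cases hy : y ∈ Metric.cthickening δ K
      · rw [indicator_of_mem hy, norm_smul]
        gcongr
        exact abs_mollify_le _ hψB y
      · rw [indicator_of_notMem hy, image_eq_zero_of_notMem_tsupport (fun h => hy (hTψs k h))]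
        simp
    · filter_upwards [ContDiffBump.ae_convolution_tendsto_right_of_locallyIntegrable (μ := volume)
        hη0 hη2 lψ] with y hy
      exact hy.smul_const _
  have lim2 : ∀ i, Filter.Tendsto
      (fun k => ∫ y, mollify (η k) (fun y => Ψ y i) y • G y (stdVec i)) Filter.atTop
      (𝓝 (∫ y, Ψ y i • G y (stdVec i))) := by
    intro i
    have hGi : LocallyIntegrableOn (fun y => G y (stdVec i)) D :=
      fun y hy => let ⟨t, ht, h'⟩ := h.locIntGrad y hy; ⟨t, ht, h'.apply_continuousLinearMap _⟩
    refine tendsto_integral_of_dominated_convergence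
      ((Metric.cthickening δ K).indicator fun y => B * ‖G y (stdVec i)‖) ?_ ?_ ?_ ?_
    · exact fun k => ((hT k i).integrable_smul hGi).aestronglyMeasurable
    · exact (integrable_indicator_iff hK'.measurableSet).2
        ((hGi.integrableOn_compact_subset hδD hK').norm.const_mul B)
    · refine fun k => Filter.Eventually.of_forall fun y => ?_
      by_cases hy : y ∈ Metric.cthickening δ K
      · rw [indicator_of_mem hy, norm_smul]
        gcongr
        exact abs_mollify_le _ (hΨi i) y
      · rw [indicator_of_notMem hy, image_eq_zero_of_notMem_tsupport (fun h => hy (hTs k i h))]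
        simp
    · filter_upwards [ContDiffBump.ae_convolution_tendsto_right_of_locallyIntegrable (μ := volume)
        hη0 hη2 (lΨ i)] with y hy
      exact hy.smul_const _
  have lim3 := tendsto_nhds_unique (lim1.congr key)
    (tendsto_finsetSum _ fun i _ => (lim2 i).neg)
  rw [lim3, Finset.sum_neg_distrib, ← integral_finsetSum]
  · congr 2
    ext y
    rw [clm_apply_eq_sum (G y)]
  · intro i _
    have hGi : LocallyIntegrableOn (fun y => G y (stdVec i)) D :=
      fun y hy => let ⟨t, ht, h'⟩ := h.locIntGrad y hy; ⟨t, ht, h'.apply_continuousLinearMap _⟩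
    exact integrable_bdd_smul hGi hK hKD (hcomp i) (hΨi i) (hΨi0 i)

end ScGeom
end

noncomputable section

namespace ScGeom

variable {n : ℕ} {𝕜 : Type*} [RCLike 𝕜]

lemma locallyIntegrableOn_zero_fun {F : Type*} [NormedAddCommGroup F] {D : Set (EE n)} :
    LocallyIntegrableOn (fun _ : EE n => (0 : F)) D := fun _ _ =>
  ⟨univ, Filter.univ_mem, integrable_zero _ _ _⟩

lemma locallyIntegrableOn_add {F : Type*} [NormedAddCommGroup F] {D : Set (EE n)}
    {f g : EE n → F} (hf : LocallyIntegrableOn f D) (hg : LocallyIntegrableOn g D) :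
    LocallyIntegrableOn (fun y => f y + g y) D := fun y hy =>
  let ⟨s, hs, h⟩ := hf y hy
  let ⟨t, ht, h'⟩ := hg y hy
  ⟨s ∩ t, Filter.inter_mem hs ht,
    (h.mono_set inter_subset_left).add (h'.mono_set inter_subset_right)⟩

lemma locallyIntegrableOn_finsetSum {F ι : Type*} [NormedAddCommGroup F] [Fintype ι]
    {D : Set (EE n)} {f : ι → EE n → F} (h : ∀ i, LocallyIntegrableOn (f i) D) :
    LocallyIntegrableOn (fun y => ∑ i, f i y) D := by
  intro y hy
  have := fun i => h i y hy
  simp only [IntegrableAtFilter] at this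
  choose t ht h' using this
  exact ⟨⋂ i, t i, Filter.iInter_mem.2 ht,
    integrable_finsetSum _ fun i _ => (h' i).mono_set (iInter_subset _ i)⟩

/-- Local integrability of a linear-map-valued function may be checked on the coordinate
vectors. -/
lemma locallyIntegrableOn_clm_iff {F : Type*} [NormedAddCommGroup F] [NormedSpace ℝ F]
    {D : Set (EE n)} {G : EE n → EE n →L[ℝ] F} :
    LocallyIntegrableOn G D ↔ ∀ i, LocallyIntegrableOn (fun y => G y (stdVec i)) D := by
  constructor
  · intro h i y hy
    obtain ⟨t, ht, h'⟩ := h y hy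
    exact ⟨t, ht, h'.apply_continuousLinearMap _⟩
  · intro h
    have h1 : ∀ i, LocallyIntegrableOn (fun y => ContinuousLinearMap.smulRightL ℝ (EE n) F
        (EuclideanSpace.proj (𝕜 := ℝ) i) (G y (stdVec i))) D := by
      intro i y hy
      obtain ⟨t, ht, h'⟩ := h i y hy
      exact ⟨t, ht, ContinuousLinearMap.integrable_comp _ h'⟩
    have h2 : LocallyIntegrableOn (fun y => ∑ i, ContinuousLinearMap.smulRightL ℝ (EE n) F
        (EuclideanSpace.proj (𝕜 := ℝ) i) (G y (stdVec i))) D :=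
      locallyIntegrableOn_finsetSum h1
    convert h2 using 2 with y
    ext v
    rw [clm_apply_eq_sum (G y) v]
    simp

lemma locallyIntegrableOn_clm_apply {F : Type*} [NormedAddCommGroup F] [NormedSpace ℝ F]
    {D : Set (EE n)} {G : EE n → EE n →L[ℝ] F} (h : LocallyIntegrableOn G D) (v : EE n) :
    LocallyIntegrableOn (fun y => G y v) D := fun y hy =>
  let ⟨t, ht, h'⟩ := h y hy
  ⟨t, ht, h'.apply_continuousLinearMap _⟩

lemma locallyIntegrableOn_congr_eqOn {F : Type*} [NormedAddCommGroup F] {D : Set (EE n)}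
    (hD : IsOpen D) {f g : EE n → F} (h : LocallyIntegrableOn f D) (hfg : EqOn f g D) :
    LocallyIntegrableOn g D :=
  h.congr ((ae_restrict_iff' hD.measurableSet).2 (Filter.Eventually.of_forall hfg))

lemma IsWeakDeriv.congr {D : Set (EE n)} (hD : IsOpen D) {f f' : EE n → 𝕜}
    {G G' : EE n → EE n →L[ℝ] 𝕜} (h : IsWeakDeriv D f G) (hf : EqOn f f' D) (hG : EqOn G G' D) :
    IsWeakDeriv D f' G' := by
  refine ⟨locallyIntegrableOn_congr_eqOn hD h.locInt hf,
    locallyIntegrableOn_congr_eqOn hD h.locIntGrad hG, fun φ hφ v => ?_⟩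
  have e1 : (fun y => fderiv ℝ φ y v • f' y) = fun y => fderiv ℝ φ y v • f y := by
    funext y
    by_cases hy : y ∈ tsupport φ
    · rw [hf (hφ.2.2 hy)]
    · simp [hφ.fderiv_eq_zero hy]
  have e2 : (fun y => φ y • G' y v) = fun y => φ y • G y v := by
    funext y
    by_cases hy : y ∈ tsupport φ
    · rw [hG (hφ.2.2 hy)]
    · simp [hφ.eq_zero hy]
  rw [e1, e2]
  exact h.integral_eq φ hφ v

lemma IsWeakDeriv.mono {D D' : Set (EE n)} {f : EE n → 𝕜} {G : EE n → EE n →L[ℝ] 𝕜}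
    (h : IsWeakDeriv D f G) (hD : D' ⊆ D) : IsWeakDeriv D' f G :=
  ⟨h.locInt.mono_set hD, h.locIntGrad.mono_set hD, fun φ hφ v => h.integral_eq φ (hφ.mono hD) v⟩

lemma IsWeakDeriv.zero (D : Set (EE n)) : IsWeakDeriv D (fun _ => (0 : 𝕜)) (fun _ => 0) :=
  ⟨locallyIntegrableOn_zero_fun, locallyIntegrableOn_zero_fun, fun φ hφ v => by simp⟩

lemma IsWeakDeriv.add {D : Set (EE n)} {f f' : EE n → 𝕜}
    {G G' : EE n → EE n →L[ℝ] 𝕜} (h : IsWeakDeriv D f G) (h' : IsWeakDeriv D f' G') :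
    IsWeakDeriv D (fun y => f y + f' y) (fun y => G y + G' y) := by
  refine ⟨locallyIntegrableOn_add h.locInt h'.locInt,
    locallyIntegrableOn_add h.locIntGrad h'.locIntGrad, fun φ hφ v => ?_⟩
  have i1 := hφ.integrable_smul (locallyIntegrableOn_clm_apply h.locIntGrad v)
  have i2 := hφ.integrable_smul (locallyIntegrableOn_clm_apply h'.locIntGrad v)
  simp only [smul_add, add_apply]
  rw [integral_add (hφ.integrable_fderiv_smul h.locInt v) (hφ.integrable_fderiv_smul h'.locInt v),
    integral_add i1 i2, h.integral_eq φ hφ v, h'.integral_eq φ hφ v]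
  ring

lemma IsWeakDeriv.const_smul {D : Set (EE n)} {f : EE n → 𝕜}
    {G : EE n → EE n →L[ℝ] 𝕜} (h : IsWeakDeriv D f G) (c : ℝ) :
    IsWeakDeriv D (fun y => c • f y) (fun y => c • G y) := by
  refine ⟨h.locInt.smul c, h.locIntGrad.smul c, fun φ hφ v => ?_⟩
  simp only [smul_apply, smul_comm _ c, integral_smul, h.integral_eq φ hφ v,
    smul_neg]

lemma IsWeakDeriv.sum {D : Set (EE n)} {ι : Type*} (s : Finset ι) {f : ι → EE n → 𝕜}
    {G : ι → EE n → EE n →L[ℝ] 𝕜} (h : ∀ i ∈ s, IsWeakDeriv D (f i) (G i)) :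
    IsWeakDeriv D (fun y => ∑ i ∈ s, f i y) (fun y => ∑ i ∈ s, G i y) := by
  classical
  induction s using Finset.induction_on with
  | empty => simpa using IsWeakDeriv.zero D
  | insert a s ha ih =>
    simp only [Finset.sum_insert ha]
    exact (h a (by simp)).add (ih fun i hi => h i (by simp [hi]))

/-! ### Product rule -/

lemma IsTest.differentiableAt_of_contDiffOn {D : Set (EE n)} (hD : IsOpen D)
    {a : EE n → ℝ} (ha : ContDiffOn ℝ ∞ a D) {y : EE n} (hy : y ∈ D) : DifferentiableAt ℝ a y :=
  ((ha.contDiffAt (hD.mem_nhds hy)).differentiableAt (by simp))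

/-- A test function on `D` times a function smooth on `D` only is again a test function. -/
lemma IsTest.mul {D : Set (EE n)} (hD : IsOpen D) {φ a : EE n → ℝ} (hφ : IsTest D φ)
    (ha : ContDiffOn ℝ ∞ a D) : IsTest D (fun y => a y * φ y) := by
  have hsupp : tsupport (fun y => a y * φ y) ⊆ tsupport φ :=
    closure_mono fun y hy => right_ne_zero_of_mul hy
  refine ⟨contDiff_iff_contDiffAt.2 fun y => ?_, ?_, hsupp.trans hφ.2.2⟩
  · by_cases hy : y ∈ tsupport φ
    · exact (ha.contDiffAt (hD.mem_nhds (hφ.2.2 hy))).mul hφ.1.contDiffAt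
    · have : (fun y => a y * φ y) =ᶠ[𝓝 y] fun _ => 0 := by
        filter_upwards [(isClosed_tsupport φ).isOpen_compl.mem_nhds hy] with z hz
        simp [hφ.eq_zero hz]
      exact contDiffAt_const.congr_of_eventuallyEq this
  · exact HasCompactSupport.of_support_subset_isCompact hφ.2.1.isCompact
      ((subset_tsupport _).trans hsupp)

lemma IsTest.fderiv_mul {D : Set (EE n)} (hD : IsOpen D) {φ a : EE n → ℝ} (hφ : IsTest D φ)
    (ha : ContDiffOn ℝ ∞ a D) (y v : EE n) :
    fderiv ℝ (fun y => a y * φ y) y v = a y * fderiv ℝ φ y v + φ y * fderiv ℝ a y v := by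
  by_cases hy : y ∈ tsupport φ
  · have h := _root_.fderiv_mul (IsTest.differentiableAt_of_contDiffOn hD ha (hφ.2.2 hy))
      (hφ.differentiable y)
    change fderiv ℝ (a * φ) y v = _
    rw [h]
    simp
  · have : y ∉ tsupport (fun y => a y * φ y) := fun h =>
      hy (closure_mono (fun y (hy : a y * φ y ≠ 0) => right_ne_zero_of_mul hy) h)
    rw [(hφ.mul hD ha).fderiv_eq_zero this, hφ.fderiv_eq_zero hy, hφ.eq_zero hy]
    simp

/-- The Leibniz rule: `φ a` is a test function whenever `φ` is, for `a` smooth on `D`. -/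
lemma IsWeakDeriv.smul {D : Set (EE n)} (hD : IsOpen D) {f : EE n → 𝕜}
    {G : EE n → EE n →L[ℝ] 𝕜} (h : IsWeakDeriv D f G) {a : EE n → ℝ} (ha : ContDiffOn ℝ ∞ a D) :
    IsWeakDeriv D (fun y => a y • f y) (fun y => a y • G y + (fderiv ℝ a y).smulRight (f y)) := by
  have hda : ∀ v, ContinuousOn (fun y => fderiv ℝ a y v) D := fun v =>
    (ha.continuousOn_fderiv_of_isOpen hD (by simp)).clm_apply continuousOn_const
  have l1 : LocallyIntegrableOn (fun y => a y • f y) D :=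
    h.locInt.continuousOn_smul hD.isLocallyClosed ha.continuousOn
  have l2 : LocallyIntegrableOn (fun y => a y • G y) D :=
    h.locIntGrad.continuousOn_smul hD.isLocallyClosed ha.continuousOn
  have l3 : LocallyIntegrableOn (fun y => (fderiv ℝ a y).smulRight (f y)) D :=
    locallyIntegrableOn_clm_iff.2 fun i => by
      simpa using h.locInt.continuousOn_smul hD.isLocallyClosed (hda (stdVec i))
  refine ⟨l1, locallyIntegrableOn_add l2 l3, fun φ hφ v => ?_⟩
  have e := h.integral_eq _ (hφ.mul hD ha) v
  have i1 := hφ.integrable_fderiv_smul l1 v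
  have i2 : Integrable fun y => φ y • (fderiv ℝ a y v • f y) :=
    hφ.integrable_smul (h.locInt.continuousOn_smul hD.isLocallyClosed (hda v))
  have i3 := hφ.integrable_smul (locallyIntegrableOn_clm_apply l2 v)
  have e1 : ∫ y, fderiv ℝ (fun y => a y * φ y) y v • f y
      = (∫ y, fderiv ℝ φ y v • a y • f y) + ∫ y, φ y • (fderiv ℝ a y v • f y) := by
    rw [← integral_add i1 i2]
    congr 1
    ext y
    rw [hφ.fderiv_mul hD ha, add_smul, mul_smul, mul_smul, smul_comm (a y)]
  have e2 : ∫ y, φ y • (a y • G y + (fderiv ℝ a y).smulRight (f y)) v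
      = (∫ y, φ y • (a y • G y) v) + ∫ y, φ y • (fderiv ℝ a y v • f y) := by
    rw [← integral_add i3 i2]
    congr 1
    ext y
    simp [smul_add]
  have e3 : ∫ y, (a y * φ y) • G y v = ∫ y, φ y • (a y • G y) v := by
    congr 1
    ext y
    simp [mul_smul, smul_comm (a y)]
  rw [e2, ← e3]
  rw [e1, ] at e
  rw [neg_add, ← e]
  ring

/-! ### Locality -/

/-- A weak derivative may be checked locally. -/
theorem IsWeakDeriv.of_local {D : Set (EE n)} {f : EE n → 𝕜}
    {G : EE n → EE n →L[ℝ] 𝕜}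
    (h : ∀ y ∈ D, ∃ N, IsOpen N ∧ y ∈ N ∧ IsWeakDeriv (D ∩ N) f G) : IsWeakDeriv D f G := by
  have hnh : ∀ y ∈ D, ∀ N, IsOpen N → y ∈ N → 𝓝[D ∩ N] y = 𝓝[D] y := fun y _ N hN hyN =>
    nhdsWithin_inter_of_mem' (mem_nhdsWithin_of_mem_nhds (hN.mem_nhds hyN))
  have l1 : LocallyIntegrableOn f D := by
    intro y hy
    obtain ⟨N, hN, hyN, h'⟩ := h y hy
    have := h'.locInt y ⟨hy, hyN⟩
    rwa [hnh y hy N hN hyN] at this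
  have l2 : LocallyIntegrableOn G D := by
    intro y hy
    obtain ⟨N, hN, hyN, h'⟩ := h y hy
    have := h'.locIntGrad y ⟨hy, hyN⟩
    rwa [hnh y hy N hN hyN] at this
  refine ⟨l1, l2, fun φ hφ v => ?_⟩
  choose! N hN hyN h' using h
  obtain ⟨t, htD, htK⟩ := hφ.2.1.isCompact.elim_nhds_subcover N
    (fun y hy => (hN y (hφ.2.2 hy)).mem_nhds (hyN y (hφ.2.2 hy)))
  obtain ⟨ρ, hρ⟩ := SmoothPartitionOfUnity.exists_isSubordinate 𝓘(ℝ, EE n)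
    (isClosed_tsupport φ) (fun i : t => N i)
    (fun i => hN i (hφ.2.2 (htD i i.2))) (by simpa [iUnion_subtype] using htK)
  have hρs : ∀ i : t, ContDiffOn ℝ ∞ (ρ i) univ := fun i =>
    ((ρ i).contMDiff.contDiff).contDiffOn
  have hφu : IsTest univ φ := hφ.mono (subset_univ _)
  have hTi : ∀ i : t, IsTest (D ∩ N i) (fun y => ρ i y * φ y) := by
    intro i
    have h1 := hφu.mul isOpen_univ (hρs i)
    refine ⟨h1.1, h1.2.1, subset_inter ?_ ?_⟩
    · exact (closure_mono fun y (hy : ρ i y * φ y ≠ 0) => right_ne_zero_of_mul hy).trans hφ.2.2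
    · exact Subset.trans
        (closure_mono fun y (hy : ρ i y * φ y ≠ 0) => left_ne_zero_of_mul hy) (hρ i)
  have hsum : ∀ y, φ y = ∑ i, ρ i y * φ y := by
    intro y
    by_cases hy : y ∈ tsupport φ
    · rw [← Finset.sum_mul, ← finsum_eq_sum_of_fintype, ρ.sum_eq_one hy, one_mul]
    · simp [hφ.eq_zero hy]
  have hsum' : ∀ y, fderiv ℝ φ y v = ∑ i, fderiv ℝ (fun y => ρ i y * φ y) y v := by
    intro y
    have : φ = fun y => ∑ i, ρ i y * φ y := funext hsum
    conv_lhs => rw [this]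
    rw [fderiv_fun_sum fun i _ => (hTi i).differentiable y]
    simp
  have e1 : ∫ y, fderiv ℝ φ y v • f y
      = ∑ i, ∫ y, fderiv ℝ (fun y => ρ i y * φ y) y v • f y := by
    rw [← integral_finsetSum _ fun i _ => ((hTi i).mono inter_subset_left).integrable_fderiv_smul l1 v]
    congr 1
    ext y
    rw [hsum' y, Finset.sum_smul]
  have e2 : ∫ y, φ y • G y v = ∑ i, ∫ y, (ρ i y * φ y) • G y v := by
    rw [← integral_finsetSum _ fun i _ => ((hTi i).mono inter_subset_left).integrable_smul
      (locallyIntegrableOn_clm_apply l2 v)]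
    congr 1
    ext y
    conv_lhs => rw [hsum y, Finset.sum_smul]
  rw [e1, e2, ← Finset.sum_neg_distrib]
  refine Finset.sum_congr rfl fun i _ => ?_
  exact (h' i (hφ.2.2 (htD i i.2))).integral_eq _ (hTi i) v

/-! ### Change of variables -/

lemma IsTest.integral_fderiv_eq_zero {D : Set (EE n)} {φ : EE n → ℝ} (hφ : IsTest D φ)
    (v : EE n) : ∫ y, fderiv ℝ φ y v = 0 := by
  have hi : Integrable (fun y => fderiv ℝ φ y v) :=
    (hφ.continuous_fderiv.clm_apply continuous_const).integrable_of_hasCompactSupport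
      ((hφ.2.1.fderiv ℝ).comp_left (g := fun L : EE n →L[ℝ] ℝ => L v) rfl)
  have := integral_mul_fderiv_eq_neg_fderiv_mul_of_integrable (μ := (volume : Measure (EE n)))
    (f := fun _ => (1 : ℝ)) (g := φ) (v := v) (by simp) (by simpa using hi)
    (by simpa using hφ.1.continuous.integrable_of_hasCompactSupport hφ.2.1)
    (fun _ _ => differentiableAt_const _) (fun y _ => hφ.differentiable y)
  simpa using this

lemma exists_bound_of_continuousOn {F : Type*} [NormedAddCommGroup F] {D K : Set (EE n)}
    {h : EE n → F} (hh : ContinuousOn h D) (hK : IsCompact K) (hKD : K ⊆ D)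
    (h0 : ∀ y, y ∉ K → h y = 0) : ∃ B, 0 ≤ B ∧ ∀ y, ‖h y‖ ≤ B := by
  obtain ⟨B, hB⟩ := hK.exists_bound_of_continuousOn (hh.mono hKD)
  refine ⟨max B 0, le_max_right _ _, fun y => ?_⟩
  by_cases hy : y ∈ K
  · exact (hB y hy).trans (le_max_left _ _)
  · simp [h0 y hy]

/-- Local integrability is invariant under diffeomorphisms, since the Jacobian is bounded away from
zero on compact sets. -/
lemma locallyIntegrableOn_comp {F : Type*} [NormedAddCommGroup F] [NormedSpace ℝ F]
    (Φ : OpenPartialHomeomorph (EE n) (EE n)) (h1 : ContDiffOn ℝ ∞ Φ Φ.source)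
    (h2 : ContDiffOn ℝ ∞ Φ.symm Φ.target) {f : EE n → F} (hf : LocallyIntegrableOn f Φ.target) :
    LocallyIntegrableOn (fun y => f (Φ y)) Φ.source := by
  rw [locallyIntegrableOn_iff Φ.open_source.isLocallyClosed]
  intro K hK hKc
  have hd : ∀ y ∈ Φ.source, HasFDerivAt Φ (fderiv ℝ Φ y) y := fun y hy =>
    ((h1.contDiffAt (Φ.open_source.mem_nhds hy)).differentiableAt (by simp)).hasFDerivAt
  have hd2 : ∀ y ∈ Φ.target, HasFDerivAt Φ.symm (fderiv ℝ Φ.symm y) y := fun y hy =>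
    ((h2.contDiffAt (Φ.open_target.mem_nhds hy)).differentiableAt (by simp)).hasFDerivAt
  have hdet : ∀ y ∈ Φ.source, (fderiv ℝ Φ y).det ≠ 0 := by
    intro y hy h0
    have hc := (hd2 (Φ y) (Φ.map_source hy)).comp y (hd y hy)
    have hid : (Φ.symm ∘ Φ) =ᶠ[𝓝 y] id := by
      filter_upwards [Φ.open_source.mem_nhds hy] with z hz using Φ.left_inv hz
    have := hc.unique ((hasFDerivAt_id y).congr_of_eventuallyEq hid)
    have h3 := congrArg ContinuousLinearMap.det this
    have h4 : ((fderiv ℝ Φ.symm (Φ y)).comp (fderiv ℝ Φ y)).det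
        = (fderiv ℝ Φ.symm (Φ y)).det * (fderiv ℝ Φ y).det := LinearMap.det_comp _ _
    rw [h4, h0, mul_zero] at h3
    have h5 : (ContinuousLinearMap.id ℝ (EE n)).det = 1 := LinearMap.det_id
    rw [h5] at h3
    exact zero_ne_one h3
  have himg : IntegrableOn f (Φ '' K) :=
    hf.integrableOn_compact_subset (by
      rintro _ ⟨y, hy, rfl⟩
      exact Φ.map_source (hK hy)) (hKc.image_of_continuousOn (h1.continuousOn.mono hK))
  rw [integrableOn_image_iff_integrableOn_abs_det_fderiv_smul volume hKc.measurableSet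
    (fun y hy => (hd y (hK hy)).hasFDerivWithinAt) (Φ.injOn.mono hK)] at himg
  have hcont : ContinuousOn (fun y => |(fderiv ℝ Φ y).det|⁻¹) K := by
    refine ContinuousOn.inv₀ ?_ fun y hy => abs_ne_zero.2 (hdet y (hK hy))
    exact (ContinuousLinearMap.continuous_det.comp_continuousOn
      ((h1.continuousOn_fderiv_of_isOpen Φ.open_source (by simp)).mono hK)).abs
  refine (himg.continuousOn_smul hcont hKc).congr_fun (fun y hy => ?_) hKc.measurableSet
  simp only
  rw [inv_smul_smul₀ (abs_ne_zero.2 (hdet y (hK hy)))]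

/-- The change of variables formula for a diffeomorphism; no integrability is needed. -/
lemma setIntegral_source_eq {F : Type*} [NormedAddCommGroup F] [NormedSpace ℝ F]
    (Φ : OpenPartialHomeomorph (EE n) (EE n)) (h2 : ContDiffOn ℝ ∞ Φ.symm Φ.target)
    (p : EE n → F) : ∫ y in Φ.source, p y
      = ∫ z in Φ.target, |(fderiv ℝ Φ.symm z).det| • p (Φ.symm z) := by
  have hd2 : ∀ y ∈ Φ.target, HasFDerivAt Φ.symm (fderiv ℝ Φ.symm y) y := fun y hy =>
    ((h2.contDiffAt (Φ.open_target.mem_nhds hy)).differentiableAt (by simp)).hasFDerivAt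
  have := integral_image_eq_integral_abs_det_fderiv_smul (volume : Measure (EE n))
    Φ.open_target.measurableSet (fun z hz => (hd2 z hz).hasFDerivWithinAt) Φ.symm.injOn p
  rwa [Φ.symm_image_target_eq_source] at this

/-- Weak derivatives obey the chain rule under diffeomorphisms. -/
theorem IsWeakDeriv.comp (Φ : OpenPartialHomeomorph (EE n) (EE n))
    (h1 : ContDiffOn ℝ ∞ Φ Φ.source) (h2 : ContDiffOn ℝ ∞ Φ.symm Φ.target)
    {f : EE n → 𝕜} {G : EE n → EE n →L[ℝ] 𝕜} (h : IsWeakDeriv Φ.target f G) :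
    IsWeakDeriv Φ.source (fun y => f (Φ y)) (fun y => (G (Φ y)).comp (fderiv ℝ Φ y)) := by
  have hcΦ : ContinuousOn (fderiv ℝ Φ) Φ.source :=
    h1.continuousOn_fderiv_of_isOpen Φ.open_source (by simp)
  have hd : ∀ y ∈ Φ.source, HasFDerivAt Φ (fderiv ℝ Φ y) y := fun y hy =>
    ((h1.contDiffAt (Φ.open_source.mem_nhds hy)).differentiableAt (by simp)).hasFDerivAt
  have lG := locallyIntegrableOn_comp Φ h1 h2 h.locIntGrad
  refine ⟨locallyIntegrableOn_comp Φ h1 h2 h.locInt, locallyIntegrableOn_clm_iff.2 fun i => ?_,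
    fun φ hφ v => ?_⟩
  · have : LocallyIntegrableOn
        (fun y => ∑ j, (fderiv ℝ Φ y (stdVec i)) j • (G (Φ y) (stdVec j))) Φ.source := by
      refine locallyIntegrableOn_finsetSum fun j => ?_
      refine LocallyIntegrableOn.continuousOn_smul Φ.open_source.isLocallyClosed
        (locallyIntegrableOn_clm_iff.1 lG j) ?_
      exact (EuclideanSpace.proj (𝕜 := ℝ) j).continuous.comp_continuousOn
        (hcΦ.clm_apply continuousOn_const)
    convert this using 2 with y
    simp only [ContinuousLinearMap.comp_apply]
    rw [clm_apply_eq_sum (G (Φ y))]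
  -- transport the test field `φ v` to the target; its divergence transports accordingly
  set K := Φ '' tsupport φ with hK
  have hKD : K ⊆ Φ.target := by
    rintro _ ⟨y, hy, rfl⟩
    exact Φ.map_source (hφ.2.2 hy)
  have hKc : IsCompact K := hφ.2.1.isCompact.image_of_continuousOn (h1.continuousOn.mono hφ.2.2)
  have hKn : ∀ z ∈ Φ.target, z ∉ K → Φ.symm z ∉ tsupport φ := fun z hz hzK hn =>
    hzK ⟨_, hn, Φ.right_inv hz⟩
  let J : EE n → ℝ := fun z => |(fderiv ℝ Φ.symm z).det|
  have hJ : ContinuousOn J Φ.target := (ContinuousLinearMap.continuous_det.comp_continuousOn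
      (h2.continuousOn_fderiv_of_isOpen Φ.open_target (by simp))).abs
  let ψ : EE n → ℝ := Φ.target.indicator fun z => J z * fderiv ℝ φ (Φ.symm z) v
  let Ψ : EE n → EE n := Φ.target.indicator fun z =>
    (J z * φ (Φ.symm z)) • fderiv ℝ Φ (Φ.symm z) v
  have hψc : ContinuousOn (fun z => J z * fderiv ℝ φ (Φ.symm z) v) Φ.target :=
    hJ.mul ((hφ.continuous_fderiv.comp_continuousOn h2.continuousOn).clm_apply continuousOn_const)
  have hΨc : ContinuousOn (fun z => (J z * φ (Φ.symm z)) • fderiv ℝ Φ (Φ.symm z) v) Φ.target := by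
    refine (hJ.mul (hφ.1.continuous.comp_continuousOn h2.continuousOn)).smul ?_
    exact (hcΦ.comp h2.continuousOn Φ.mapsTo_symm).clm_apply continuousOn_const
  have hψ0 : ∀ z, z ∉ K → ψ z = 0 := fun z hz => by
    by_cases hzt : z ∈ Φ.target
    · simp [ψ, hzt, hφ.fderiv_eq_zero (hKn z hzt hz)]
    · simp [ψ, hzt]
  have hΨ0 : ∀ z, z ∉ K → Ψ z = 0 := fun z hz => by
    by_cases hzt : z ∈ Φ.target
    · simp [Ψ, hzt, hφ.eq_zero (hKn z hzt hz)]
    · simp [Ψ, hzt]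
  obtain ⟨B1, hB10, hB1⟩ := exists_bound_of_continuousOn (h := ψ)
    (hψc.congr fun z hz => by simp [ψ, hz]) hKc hKD hψ0
  obtain ⟨B2, hB20, hB2⟩ := exists_bound_of_continuousOn (h := Ψ)
    (hΨc.congr fun z hz => by simp [Ψ, hz]) hKc hKD hΨ0
  have key := h.integral_rough Φ.open_target hKc hKD (ψ := ψ) (Ψ := Ψ)
    ((aestronglyMeasurable_indicator_iff Φ.open_target.measurableSet).2
      (hψc.aestronglyMeasurable Φ.open_target.measurableSet))
    ((aestronglyMeasurable_indicator_iff Φ.open_target.measurableSet).2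
      (hΨc.aestronglyMeasurable Φ.open_target.measurableSet)) (B := max B1 B2)
    (fun z => (hB1 z).trans (le_max_left _ _)) (fun z => (hB2 z).trans (le_max_right _ _))
    hψ0 hΨ0 (by
      intro g hg hgc
      have hgΦ : ContDiffOn ℝ ∞ (fun y => g (Φ y)) Φ.source := hg.comp_contDiffOn h1
      have e0 := (hφ.mul Φ.open_source hgΦ).integral_fderiv_eq_zero v
      have hgd : ∀ y ∈ Φ.source, fderiv ℝ (fun y => g (Φ y)) y v
          = fderiv ℝ g (Φ y) (fderiv ℝ Φ y v) := by
        intro y hy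
        have := (((hg.differentiable (by simp)) (Φ y)).hasFDerivAt.comp y (hd y hy)).fderiv
        change fderiv ℝ (g ∘ Φ) y v = _
        rw [this]; rfl
      have e1 : ∫ z, ψ z * g z = ∫ y in Φ.source, g (Φ y) * fderiv ℝ φ y v := by
        rw [setIntegral_source_eq Φ h2, ← integral_indicator Φ.open_target.measurableSet]
        congr 1
        ext z
        by_cases hz : z ∈ Φ.target
        · simp [ψ, J, hz]; ring
        · simp [ψ, hz]
      have e2 : ∫ z, fderiv ℝ g z (Ψ z)
          = ∫ y in Φ.source, φ y * fderiv ℝ (fun y => g (Φ y)) y v := by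
        rw [setIntegral_source_eq Φ h2, ← integral_indicator Φ.open_target.measurableSet]
        congr 1
        ext z
        by_cases hz : z ∈ Φ.target
        · simp [Ψ, J, hz, hgd _ (Φ.map_target hz)]; ring
        · simp [Ψ, hz]
      have s1 : ∫ y in Φ.source, g (Φ y) * fderiv ℝ φ y v = ∫ y, g (Φ y) * fderiv ℝ φ y v :=
        setIntegral_eq_integral_of_forall_compl_eq_zero fun y hy => by
          rw [hφ.fderiv_eq_zero fun h => hy (hφ.2.2 h)]; simp
      have s2 : ∫ y in Φ.source, φ y * fderiv ℝ (fun y => g (Φ y)) y v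
          = ∫ y, φ y * fderiv ℝ (fun y => g (Φ y)) y v :=
        setIntegral_eq_integral_of_forall_compl_eq_zero fun y hy => by
          rw [hφ.eq_zero fun h => hy (hφ.2.2 h)]; simp
      have lg : LocallyIntegrableOn (fun y => g (Φ y)) Φ.source :=
        hgΦ.continuousOn.locallyIntegrableOn Φ.open_source.measurableSet
      have lg' : LocallyIntegrableOn (fun y => fderiv ℝ (fun y => g (Φ y)) y v) Φ.source :=
        ((hgΦ.continuousOn_fderiv_of_isOpen Φ.open_source (by simp)).clm_apply
          continuousOn_const).locallyIntegrableOn Φ.open_source.measurableSet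
      have i1 : Integrable (fun y => g (Φ y) * fderiv ℝ φ y v) := by
        simpa [mul_comm] using hφ.integrable_fderiv_smul lg v
      have i2 : Integrable (fun y => φ y * fderiv ℝ (fun y => g (Φ y)) y v) := by
        simpa using hφ.integrable_smul lg'
      rw [e1, e2, s1, s2]
      have e3 : ∫ y, fderiv ℝ (fun y => g (Φ y) * φ y) y v
          = (∫ y, g (Φ y) * fderiv ℝ φ y v) + ∫ y, φ y * fderiv ℝ (fun y => g (Φ y)) y v := by
        rw [← integral_add i1 i2]
        congr 1
        ext y
        rw [hφ.fderiv_mul Φ.open_source hgΦ]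
      rw [e3] at e0
      linarith)
  have s1 : ∫ y, fderiv ℝ φ y v • f (Φ y) = ∫ y in Φ.source, fderiv ℝ φ y v • f (Φ y) :=
    (setIntegral_eq_integral_of_forall_compl_eq_zero fun y hy => by
      rw [hφ.fderiv_eq_zero fun h => hy (hφ.2.2 h)]; simp).symm
  have s2 : ∫ y, φ y • ((G (Φ y)).comp (fderiv ℝ Φ y)) v
      = ∫ y in Φ.source, φ y • ((G (Φ y)).comp (fderiv ℝ Φ y)) v :=
    (setIntegral_eq_integral_of_forall_compl_eq_zero fun y hy => by
      rw [hφ.eq_zero fun h => hy (hφ.2.2 h)]; simp).symm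
  rw [s1, s2, setIntegral_source_eq Φ h2, setIntegral_source_eq Φ h2]
  have k1 : ∫ z, ψ z • f z
      = ∫ z in Φ.target, |(fderiv ℝ Φ.symm z).det| • fderiv ℝ φ (Φ.symm z) v • f (Φ (Φ.symm z)) := by
    rw [← integral_indicator Φ.open_target.measurableSet]
    congr 1
    ext z
    by_cases hz : z ∈ Φ.target
    · simp [ψ, J, hz, mul_smul]
    · simp [ψ, hz]
  have k2 : ∫ z, G z (Ψ z) = ∫ z in Φ.target, |(fderiv ℝ Φ.symm z).det| • φ (Φ.symm z) •
      ((G (Φ (Φ.symm z))).comp (fderiv ℝ Φ (Φ.symm z))) v := by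
    rw [← integral_indicator Φ.open_target.measurableSet]
    congr 1
    ext z
    by_cases hz : z ∈ Φ.target
    · simp [Ψ, J, hz, mul_smul]
    · simp [Ψ, hz]
  rw [← k1, ← k2, key]

end ScGeom
end

noncomputable section

namespace ScGeom

variable {n : ℕ} {𝕜 : Type*} [RCLike 𝕜]

/-! ### Korn's inequality on Euclidean space -/

/-- The cross correlation of `a` and `b`, paired with `p`. -/
def pairCorr (p : EE n → ℝ) (a b : EE n → 𝕜) : 𝕜 := ∫ z, p z • ∫ x, a x * b (x - z)

lemma MemLp.comp_sub_const {b : EE n → 𝕜} (hb : MemLp b 2 volume) (z : EE n) :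
    MemLp (fun x => b (x - z)) 2 volume :=
  hb.comp_measurePreserving (measurePreserving_sub_right volume z)

/-- By the Cauchy–Schwarz inequality, uniformly in the translation `z`. -/
lemma integral_norm_mul_comp_sub_le {a b : EE n → 𝕜} (ha : MemLp a 2 volume)
    (hb : MemLp b 2 volume) (z : EE n) :
    ∫ x, ‖a x * b (x - z)‖ ≤ (∫ x, ‖a x‖ ^ 2) + ∫ x, ‖b x‖ ^ 2 := by
  have i1 : Integrable (fun x => ‖a x‖ ^ 2) := ha.integrable_norm_pow (by simp)
  have i2 : Integrable (fun x => ‖b (x - z)‖ ^ 2) :=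
    (MemLp.comp_sub_const hb z).integrable_norm_pow (by simp)
  have e : ∫ x, ‖b x‖ ^ 2 = ∫ x, ‖b (x - z)‖ ^ 2 :=
    (integral_sub_right_eq_self (fun x => ‖b x‖ ^ 2) z).symm
  rw [e, ← integral_add i1 i2]
  refine integral_mono_of_nonneg (Filter.Eventually.of_forall fun x => norm_nonneg _)
    (i1.add i2) (Filter.Eventually.of_forall fun x => ?_)
  simp only [norm_mul]
  nlinarith [sq_nonneg (‖a x‖ - ‖b (x - z)‖), sq_nonneg (‖a x‖), sq_nonneg (‖b (x - z)‖)]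

lemma integrable_pairCorr {p : EE n → ℝ} (hp : Continuous p) (hpc : HasCompactSupport p)
    {a b : EE n → 𝕜} (ha : MemLp a 2 volume) (hb : MemLp b 2 volume) :
    Integrable (fun q : EE n × EE n => p q.2 • (a q.1 * b (q.1 - q.2)))
      (volume.prod volume) := by
  have hm : AEStronglyMeasurable (fun q : EE n × EE n => p q.2 • (a q.1 * b (q.1 - q.2)))
      (volume.prod volume) := by
    refine ((hp.comp continuous_snd).aestronglyMeasurable).smul (AEStronglyMeasurable.mul ?_ ?_)
    · exact ha.1.comp_fst
    · exact hb.1.comp_quasiMeasurePreserving (quasiMeasurePreserving_sub volume volume)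
  rw [integrable_prod_iff' hm]
  constructor
  · refine Filter.Eventually.of_forall fun z => ?_
    exact (ha.integrable_mul (MemLp.comp_sub_const hb z)).smul (p z)
  · have hi : Integrable (fun z => |p z| * ((∫ x, ‖a x‖ ^ 2) + ∫ x, ‖b x‖ ^ 2)) :=
      ((hp.integrable_of_hasCompactSupport hpc).abs).mul_const _
    refine hi.mono' (hm.norm.prod_swap.integral_prod_right') (Filter.Eventually.of_forall fun z => ?_)
    rw [Real.norm_of_nonneg (integral_nonneg fun _ => norm_nonneg _)]
    simp only [norm_smul, Real.norm_eq_abs]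
    rw [integral_const_mul]
    exact mul_le_mul_of_nonneg_left (integral_norm_mul_comp_sub_le ha hb z) (abs_nonneg _)

/-- Fubini, with the weight `p` convolved onto `b`. -/
lemma pairCorr_eq_integral_left {p : EE n → ℝ} (hp : Continuous p) (hpc : HasCompactSupport p)
    {a b : EE n → 𝕜} (ha : MemLp a 2 volume) (hb : MemLp b 2 volume) :
    pairCorr p a b = ∫ x, a x * ∫ s, p (x - s) • b s := by
  unfold pairCorr
  simp_rw [← integral_smul]
  rw [integral_integral_swap (f := fun z x => p z • (a x * b (x - z)))
    (integrable_pairCorr hp hpc ha hb).swap]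
  congr 1
  funext x
  rw [← integral_sub_left_eq_self (fun s => p (x - s) • b s) volume x, ← integral_const_mul]
  congr 1
  funext z
  simp

/-- Fubini, with the weight `p` convolved onto `a`. -/
lemma pairCorr_eq_integral_right {p : EE n → ℝ} (hp : Continuous p) (hpc : HasCompactSupport p)
    {a b : EE n → 𝕜} (ha : MemLp a 2 volume) (hb : MemLp b 2 volume) :
    pairCorr p a b = ∫ s, b s * ∫ x, p (x - s) • a x := by
  have hneg : pairCorr p a b = pairCorr (fun z => p (-z)) b a := by
    unfold pairCorr
    rw [← integral_neg_eq_self]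
    congr 1
    funext z
    congr 1
    rw [← integral_sub_right_eq_self _ z]
    congr 1
    funext x
    rw [mul_comm]
    simp
  have := pairCorr_eq_integral_left (p := fun z => p (-z)) (hp.comp continuous_neg)
    (hpc.comp_homeomorph (Homeomorph.neg _)) hb ha
  rw [hneg, this]
  simp

lemma IsTest.comp_const_sub {φ : EE n → ℝ} (hφ : IsTest univ φ) (x : EE n) :
    IsTest univ (fun s => φ (x - s)) ∧
      ∀ s v, fderiv ℝ (fun s => φ (x - s)) s v = -fderiv ℝ φ (x - s) v := by
  refine ⟨⟨hφ.1.comp (contDiff_const.sub contDiff_id),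
    hφ.2.1.comp_homeomorph (Homeomorph.subLeft x), subset_univ _⟩, fun s v => ?_⟩
  have h : HasFDerivAt (fun s => φ (x - s)) ((fderiv ℝ φ (x - s)).comp
      (-ContinuousLinearMap.id ℝ (EE n))) s :=
    (hφ.differentiable (x - s)).hasFDerivAt.comp s ((hasFDerivAt_id s).const_sub x)
  rw [h.fderiv]
  simp

lemma IsTest.comp_sub_const {φ : EE n → ℝ} (hφ : IsTest univ φ) (s : EE n) :
    IsTest univ (fun x => φ (x - s)) ∧
      ∀ x v, fderiv ℝ (fun x => φ (x - s)) x v = fderiv ℝ φ (x - s) v := by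
  refine ⟨⟨hφ.1.comp (contDiff_id.sub contDiff_const),
    hφ.2.1.comp_homeomorph (Homeomorph.subRight s), subset_univ _⟩, fun x v => ?_⟩
  have h : HasFDerivAt (fun x => φ (x - s)) ((fderiv ℝ φ (x - s)).comp
      (ContinuousLinearMap.id ℝ (EE n))) x :=
    (hφ.differentiable (x - s)).hasFDerivAt.comp x ((hasFDerivAt_id x).sub_const s)
  rw [h.fderiv]
  simp

lemma IsTest.fderiv_apply {D : Set (EE n)} {φ : EE n → ℝ} (hφ : IsTest D φ) (v : EE n) :
    IsTest D (fun y => fderiv ℝ φ y v) := by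
  have hs : Function.support (fun y => fderiv ℝ φ y v) ⊆ tsupport φ := fun y hy => by
    by_contra h
    exact hy (by simp [hφ.fderiv_eq_zero h])
  refine ⟨(hφ.1.fderiv_right (m := ∞) (by simp)).clm_apply contDiff_const,
    HasCompactSupport.of_support_subset_isCompact hφ.2.1 hs,
    (closure_minimal hs (isClosed_tsupport _)).trans hφ.2.2⟩

lemma IsTest.fderiv_fderiv_comm {D : Set (EE n)} {φ : EE n → ℝ} (hφ : IsTest D φ)
    (y u v : EE n) :
    fderiv ℝ (fun y => fderiv ℝ φ y u) y v = fderiv ℝ (fun y => fderiv ℝ φ y v) y u := by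
  have hd : DifferentiableAt ℝ (fderiv ℝ φ) y :=
    (hφ.1.fderiv_right (m := ∞) (by simp)).differentiable (by simp) y
  have h := (hφ.1.contDiffAt (x := y)).isSymmSndFDerivAt (by
    rw [minSmoothness_of_isRCLikeNormedField]; exact WithTop.coe_le_coe.2 le_top)
  rw [fderiv_clm_apply hd (differentiableAt_const _), fderiv_clm_apply hd (differentiableAt_const _)]
  simpa using h v u

/-- Both derivatives in a correlation of gradients can be moved to the weight `η`; the result is
symmetric in the two directions of differentiation. -/
lemma pairCorr_grad {f h : EE n → 𝕜} {Gf Gh : EE n → EE n →L[ℝ] 𝕜} (hf : IsWeakDeriv univ f Gf)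
    (hh : IsWeakDeriv univ h Gh) (lf : MemLp f 2 volume) (lh : MemLp h 2 volume)
    {u v : EE n} (lGf : MemLp (fun y => Gf y v) 2 volume) (lGh : MemLp (fun y => Gh y u) 2 volume)
    {η : EE n → ℝ} (hη : IsTest univ η) :
    pairCorr η (fun y => Gf y v) (fun y => Gh y u)
      = -pairCorr (fun y => fderiv ℝ (fun y => fderiv ℝ η y u) y v) f h := by
  have h1 := hη.fderiv_apply u
  have h2 := h1.fderiv_apply v
  rw [pairCorr_eq_integral_left hη.1.continuous hη.2.1 lGf lGh]
  have e1 : ∀ x, ∫ s, η (x - s) • Gh s u = ∫ s, fderiv ℝ η (x - s) u • h s := by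
    intro x
    have := hh.integral_eq _ (hη.comp_const_sub x).1 u
    simp only [(hη.comp_const_sub x).2, neg_smul, integral_neg, neg_inj] at this
    exact this.symm
  simp_rw [e1]
  rw [← pairCorr_eq_integral_left h1.1.continuous h1.2.1 lGf lh,
    pairCorr_eq_integral_right h1.1.continuous h1.2.1 lGf lh]
  have e2 : ∀ s, ∫ x, fderiv ℝ η (x - s) u • Gf x v
      = -∫ x, fderiv ℝ (fun y => fderiv ℝ η y u) (x - s) v • f x := by
    intro s
    have := hf.integral_eq _ (h1.comp_sub_const s).1 v
    simp only [(h1.comp_sub_const s).2] at this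
    rw [this, neg_neg]
  simp_rw [e2, mul_neg, integral_neg]
  rw [← pairCorr_eq_integral_right h2.1.continuous h2.2.1 lf lh]

/-- Correlations of `L²` functions are continuous, because translation is continuous in `L²`. -/
lemma continuous_integral_mul_comp_sub {a b : EE n → 𝕜} (ha : MemLp a 2 volume)
    (hb : MemLp b 2 volume) : Continuous fun z => ∫ x, a x * b (x - z) := by
  have hsa : MemLp (fun x => star (a x)) 2 volume := ha.star
  let g : C(EE n, C(EE n, EE n)) :=
    ContinuousMap.curry ⟨fun p : EE n × EE n => p.2 - p.1, by fun_prop⟩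
  have hg : ∀ z, MeasurePreserving (g z) volume volume := fun z =>
    measurePreserving_sub_right volume z
  have hc : Continuous fun z => Lp.compMeasurePreserving (g z) (hg z) (hb.toLp b) :=
    Continuous.compMeasurePreservingLp continuous_const g.continuous hg (by simp)
  have hc2 : Continuous fun z => inner 𝕜 (hsa.toLp _)
      (Lp.compMeasurePreserving (g z) (hg z) (hb.toLp b)) := continuous_const.inner hc
  convert hc2 using 2 with z
  rw [L2.inner_def, Lp.toLp_compMeasurePreserving]
  refine integral_congr_ae ?_
  filter_upwards [hsa.coeFn_toLp, (hb.comp_measurePreserving (hg z)).coeFn_toLp] with x h1 h2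
  rw [h1, h2]
  simp [g, mul_comm]

/-- Integrating by parts twice, `∫ ∂ᵥf ∂ᵤh = ∫ ∂ᵤf ∂ᵥh` for `f, h ∈ H¹(ℝⁿ)`. The correlation of
the gradients vanishes as a distribution and is continuous, hence vanishes at the origin. -/
theorem integral_grad_mul_grad_comm {f h : EE n → 𝕜} {Gf Gh : EE n → EE n →L[ℝ] 𝕜}
    (hf : IsWeakDeriv univ f Gf) (hh : IsWeakDeriv univ h Gh) (lf : MemLp f 2 volume)
    (lh : MemLp h 2 volume) (lGf : ∀ v, MemLp (fun y => Gf y v) 2 volume)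
    (lGh : ∀ v, MemLp (fun y => Gh y v) 2 volume) (u v : EE n) :
    ∫ x, Gf x v * Gh x u = ∫ x, Gf x u * Gh x v := by
  set C : EE n → 𝕜 := fun z => (∫ x, Gf x v * Gh (x - z) u) - ∫ x, Gf x u * Gh (x - z) v
  have c1 := continuous_integral_mul_comp_sub (lGf v) (lGh u)
  have c2 := continuous_integral_mul_comp_sub (lGf u) (lGh v)
  have hC : Continuous C := c1.sub c2
  have hz : ∀ᵐ z, C z = 0 := by
    refine ae_eq_zero_of_integral_contDiff_smul_eq_zero hC.locallyIntegrable fun η hη hηc => ?_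
    have hT : IsTest univ η := ⟨hη, hηc, subset_univ _⟩
    have e1 := pairCorr_grad hf hh lf lh (lGf v) (lGh u) hT
    have e2 := pairCorr_grad hf hh lf lh (lGf u) (lGh v) hT
    simp only [C, smul_sub]
    rw [integral_sub]
    · change pairCorr η (fun y => Gf y v) (fun y => Gh y u)
        - pairCorr η (fun y => Gf y u) (fun y => Gh y v) = 0
      rw [e1, e2]
      simp_rw [hT.fderiv_fderiv_comm _ u v]
      simp
    · exact (hη.continuous.smul c1).integrable_of_hasCompactSupport hηc.smul_right
    · exact (hη.continuous.smul c2).integrable_of_hasCompactSupport hηc.smul_right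
  have hC0 : C = fun _ => 0 := (hC.ae_eq_iff_eq volume continuous_const).1 hz
  have := congrFun hC0 0
  simpa [C, sub_eq_zero] using this

/-- The vector-valued version of `IsWeakDeriv`: `G y v a` is the derivative in the direction `v`
of the component `w(a)` of the one-form `w`. -/
def IsWeakDeriv₁ (D : Set (EE n)) (w : EE n → EE n →L[ℝ] 𝕜)
    (G : EE n → EE n →L[ℝ] EE n →L[ℝ] 𝕜) : Prop :=
  ∀ a, IsWeakDeriv D (fun y => w y a) (fun y => (G y).flip a)

/-- The symmetric part of a bilinear form. -/
def symPart (τ : EE n →L[ℝ] EE n →L[ℝ] 𝕜) : EE n →L[ℝ] EE n →L[ℝ] 𝕜 :=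
  (1 / 2 : ℝ) • (τ + τ.flip)

lemma symPart_apply (τ : EE n →L[ℝ] EE n →L[ℝ] 𝕜) (v w : EE n) :
    symPart τ v w = (1 / 2 : ℝ) • (τ v w + τ w v) := rfl

lemma IsWeakDeriv.star {D : Set (EE n)} {f : EE n → 𝕜} {G : EE n → EE n →L[ℝ] 𝕜}
    (h : IsWeakDeriv D f G) : IsWeakDeriv D (fun y => star (f y))
      (fun y => (RCLike.conjCLE : 𝕜 ≃L[ℝ] 𝕜).toContinuousLinearMap.comp (G y)) := by
  refine ⟨fun y hy => ?_, locallyIntegrableOn_clm_iff.2 fun i y hy => ?_, fun φ hφ v => ?_⟩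
  · obtain ⟨t, ht, h'⟩ := h.locInt y hy
    exact ⟨t, ht, (RCLike.conjCLE : 𝕜 ≃L[ℝ] 𝕜).toContinuousLinearMap.integrable_comp h'⟩
  · obtain ⟨t, ht, h'⟩ := locallyIntegrableOn_clm_iff.1 h.locIntGrad i y hy
    exact ⟨t, ht, (RCLike.conjCLE : 𝕜 ≃L[ℝ] 𝕜).toContinuousLinearMap.integrable_comp h'⟩
  · have := congrArg (starRingEnd 𝕜) (h.integral_eq φ hφ v)
    rw [← integral_conj, map_neg, ← integral_conj] at this
    simpa [RCLike.real_smul_eq_coe_mul] using this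

/-- The operator norm of a bilinear form is at most its Hilbert–Schmidt norm. -/
lemma norm_le_sum_norm_stdVec (τ : EE n →L[ℝ] EE n →L[ℝ] 𝕜) :
    ‖τ‖ ^ 2 ≤ ∑ i, ∑ j, ‖τ (stdVec i) (stdVec j)‖ ^ 2 := by
  have h1 : ∀ {F : Type _} [NormedAddCommGroup F] [NormedSpace ℝ F] (L : EE n →L[ℝ] F),
      ‖L‖ ^ 2 ≤ ∑ i, ‖L (stdVec i)‖ ^ 2 := by
    intro F _ _ L
    have : ‖L‖ ≤ Real.sqrt (∑ i, ‖L (stdVec i)‖ ^ 2) := by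
      refine L.opNorm_le_bound (Real.sqrt_nonneg _) fun v => ?_
      rw [clm_apply_eq_sum L v]
      refine (norm_sum_le _ _).trans ?_
      simp only [norm_smul]
      have := Real.sum_mul_le_sqrt_mul_sqrt Finset.univ (fun i => ‖v i‖)
        (fun i => ‖L (stdVec i)‖)
      rw [mul_comm, EuclideanSpace.norm_eq]
      exact this
    calc ‖L‖ ^ 2 ≤ Real.sqrt (∑ i, ‖L (stdVec i)‖ ^ 2) ^ 2 := by gcongr
      _ = _ := Real.sq_sqrt (Finset.sum_nonneg fun _ _ => sq_nonneg _)
  refine (h1 τ).trans (Finset.sum_le_sum fun i _ => ?_)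
  have : ‖τ (stdVec i)‖ ≤ Real.sqrt (∑ j, ‖τ (stdVec i) (stdVec j)‖ ^ 2) := by
    refine (τ (stdVec i)).opNorm_le_bound (Real.sqrt_nonneg _) fun v => ?_
    rw [clm_apply_eq_sum (τ (stdVec i)) v]
    refine (norm_sum_le _ _).trans ?_
    simp only [norm_smul]
    have := Real.sum_mul_le_sqrt_mul_sqrt Finset.univ (fun i => ‖v i‖)
      (fun j => ‖τ (stdVec i) (stdVec j)‖)
    rw [mul_comm, EuclideanSpace.norm_eq]
    exact this
  calc ‖τ (stdVec i)‖ ^ 2 ≤ Real.sqrt (∑ j, ‖τ (stdVec i) (stdVec j)‖ ^ 2) ^ 2 := by gcongr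
    _ = _ := Real.sq_sqrt (Finset.sum_nonneg fun _ _ => sq_nonneg _)

/-- **Korn's inequality on `ℝⁿ`** for one-forms in `H¹`. -/
theorem korn_whole_space {w : EE n → EE n →L[ℝ] 𝕜} {G : EE n → EE n →L[ℝ] EE n →L[ℝ] 𝕜}
    (h : IsWeakDeriv₁ univ w G) (hw : ∀ a, MemLp (fun y => w y a) 2 volume)
    (hG : ∀ v a, MemLp (fun y => G y v a) 2 volume) :
    ∫⁻ y, ENNReal.ofReal (‖G y‖ ^ 2)
      ≤ ENNReal.ofReal (4 * n ^ 2) * ∫⁻ y, ENNReal.ofReal (‖symPart (G y)‖ ^ 2) := by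
  let g : Fin n → Fin n → EE n → 𝕜 := fun i j y => G y (stdVec i) (stdVec j)
  have lg : ∀ i j, MemLp (g i j) 2 volume := fun i j => hG _ _
  have lgs : ∀ i j, MemLp (fun y => star (g i j y)) 2 volume := fun i j => (lg i j).star
  have isq : ∀ i j, Integrable fun y => ‖g i j y‖ ^ 2 := fun i j =>
    (lg i j).integrable_norm_pow (by simp)
  have icr : ∀ i j k l, Integrable fun y => g i j y * star (g k l y) := fun i j k l =>
    (lg i j).integrable_mul (lgs k l)
  -- `∫ |div w|²` appears after exchanging the two derivatives, and it is nonnegative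
  have hcomm : ∀ i j, ∫ y, g i j y * star (g j i y) = ∫ y, g j j y * star (g i i y) := by
    intro i j
    have := integral_grad_mul_grad_comm (h (stdVec j)) (h (stdVec i)).star (hw _) (hw _).star
      (fun v => hG v _) (fun v => (hG v _).star) (stdVec j) (stdVec i)
    simpa [g] using this
  have hdiv : 0 ≤ ∑ i, ∑ j, RCLike.re (∫ y, g i j y * star (g j i y)) := by
    have hc' : ∀ i j, RCLike.re (∫ y, g i j y * star (g j i y))
        = RCLike.re (∫ y, g j j y * star (g i i y)) := fun i j => by rw [hcomm i j]
    rw [Finset.sum_congr rfl fun i _ => Finset.sum_congr rfl fun j _ => hc' i j]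
    have : ∑ i, ∑ j, RCLike.re (∫ y, g j j y * star (g i i y))
        = RCLike.re (∫ y, (∑ j, g j j y) * star (∑ i, g i i y)) := by
      simp_rw [star_sum, Finset.sum_mul_sum]
      rw [integral_finsetSum _ fun j _ => integrable_finsetSum _ fun i _ => icr j j i i, map_sum,
        Finset.sum_comm]
      refine Finset.sum_congr rfl fun j _ => ?_
      rw [integral_finsetSum _ fun i _ => icr j j i i, map_sum]
    rw [this]
    have e : ∀ y, (∑ j, g j j y) * star (∑ i, g i i y) = ((‖∑ j, g j j y‖ ^ 2 : ℝ) : 𝕜) := by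
      intro y
      rw [RCLike.star_def, RCLike.mul_conj]
      norm_cast
    simp_rw [e]
    rw [integral_ofReal, RCLike.ofReal_re]
    exact integral_nonneg fun y => sq_nonneg _
  -- hence the cross terms in `∑ |gᵢⱼ + gⱼᵢ|²` can be dropped
  have hsq : ∀ y, ∑ i, ∑ j, ‖g i j y + g j i y‖ ^ 2
      = 2 * (∑ i, ∑ j, ‖g i j y‖ ^ 2) + 2 * ∑ i, ∑ j, RCLike.re (g i j y * star (g j i y)) := by
    intro y
    have e : ∀ i j, ‖g i j y + g j i y‖ ^ 2
        = ‖g i j y‖ ^ 2 + ‖g j i y‖ ^ 2 + 2 * RCLike.re (g i j y * star (g j i y)) := by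
      intro i j
      have := @norm_add_sq 𝕜 𝕜 _ _ _ (g j i y) (g i j y)
      rw [add_comm (g i j y), this]
      simp
      ring
    simp_rw [e, Finset.sum_add_distrib]
    rw [Finset.sum_comm (f := fun i j => ‖g j i y‖ ^ 2)]
    simp_rw [← Finset.mul_sum]
    ring
  have isum : Integrable fun y => ∑ i, ∑ j, ‖g i j y‖ ^ 2 :=
    integrable_finsetSum _ fun i _ => integrable_finsetSum _ fun j _ => isq i j
  have isum2 : Integrable fun y => ∑ i, ∑ j, RCLike.re (g i j y * star (g j i y)) :=
    integrable_finsetSum _ fun i _ => integrable_finsetSum _ fun j _ => (icr i j j i).re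
  have isum3 : Integrable fun y => ∑ i, ∑ j, ‖g i j y + g j i y‖ ^ 2 := by
    simp_rw [hsq]
    exact (isum.const_mul 2).add (isum2.const_mul 2)
  have hint : ∫ y, ∑ i, ∑ j, ‖g i j y‖ ^ 2 ≤ ∫ y, ∑ i, ∑ j, ‖g i j y + g j i y‖ ^ 2 := by
    simp_rw [hsq]
    rw [integral_add (isum.const_mul 2) (isum2.const_mul 2), integral_const_mul,
      integral_const_mul]
    have e : ∫ y, ∑ i, ∑ j, RCLike.re (g i j y * star (g j i y))
        = ∑ i, ∑ j, RCLike.re (∫ y, g i j y * star (g j i y)) := by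
      rw [integral_finsetSum _ fun i _ => integrable_finsetSum _ fun j _ => (icr i j j i).re]
      refine Finset.sum_congr rfl fun i _ => ?_
      rw [integral_finsetSum _ fun j _ => (icr i j j i).re]
      refine Finset.sum_congr rfl fun j _ => ?_
      exact integral_re (icr i j j i)
    rw [e]
    have h0 : 0 ≤ ∫ y, ∑ i, ∑ j, ‖g i j y‖ ^ 2 :=
      integral_nonneg fun y => Finset.sum_nonneg fun _ _ => Finset.sum_nonneg fun _ _ => sq_nonneg _
    linarith
  calc ∫⁻ y, ENNReal.ofReal (‖G y‖ ^ 2)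
      ≤ ∫⁻ y, ENNReal.ofReal (∑ i, ∑ j, ‖g i j y‖ ^ 2) :=
        lintegral_mono fun y => ENNReal.ofReal_le_ofReal (norm_le_sum_norm_stdVec (G y))
    _ = ENNReal.ofReal (∫ y, ∑ i, ∑ j, ‖g i j y‖ ^ 2) :=
        (ofReal_integral_eq_lintegral_ofReal isum (Filter.Eventually.of_forall fun y =>
          Finset.sum_nonneg fun _ _ => Finset.sum_nonneg fun _ _ => sq_nonneg _)).symm
    _ ≤ ENNReal.ofReal (∫ y, ∑ i, ∑ j, ‖g i j y + g j i y‖ ^ 2) := ENNReal.ofReal_le_ofReal hint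
    _ = ∫⁻ y, ENNReal.ofReal (∑ i, ∑ j, ‖g i j y + g j i y‖ ^ 2) :=
        ofReal_integral_eq_lintegral_ofReal isum3 (Filter.Eventually.of_forall fun y =>
          Finset.sum_nonneg fun _ _ => Finset.sum_nonneg fun _ _ => sq_nonneg _)
    _ ≤ ∫⁻ y, ENNReal.ofReal (4 * n ^ 2) * ENNReal.ofReal (‖symPart (G y)‖ ^ 2) := by
        refine lintegral_mono fun y => ?_
        rw [← ENNReal.ofReal_mul (by positivity)]
        refine ENNReal.ofReal_le_ofReal ?_
        have : ∀ i j, ‖g i j y + g j i y‖ ^ 2 ≤ 4 * ‖symPart (G y)‖ ^ 2 := by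
          intro i j
          have e : g i j y + g j i y = (2 : ℝ) • symPart (G y) (stdVec i) (stdVec j) := by
            rw [symPart_apply, smul_smul]; norm_num [g]
          have e2 : ‖symPart (G y) (stdVec i) (stdVec j)‖ ≤ ‖symPart (G y)‖ := by
            refine ((symPart (G y)).le_opNorm₂ _ _).trans ?_
            simp [norm_stdVec]
          rw [e, norm_smul]
          have := norm_nonneg (symPart (G y) (stdVec i) (stdVec j))
          norm_num
          nlinarith
        refine (Finset.sum_le_sum fun i _ => Finset.sum_le_sum fun j _ => this i j).trans ?_
        simp
        apply le_of_eq
        ring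
    _ = ENNReal.ofReal (4 * n ^ 2) * ∫⁻ y, ENNReal.ofReal (‖symPart (G y)‖ ^ 2) :=
        lintegral_const_mul' _ _ ENNReal.ofReal_ne_top

end ScGeom
end

noncomputable section

namespace ScGeom

variable {n : ℕ} {𝕜 : Type*} [RCLike 𝕜]

/-! ### Extension across a hyperplane by reflections -/

/-- The linear map that fixes `ker β` and sends `b` to `-l b` when `β b = 1`. -/
def reflMap (β : EE n →L[ℝ] ℝ) (b : EE n) (l : ℝ) : EE n →L[ℝ] EE n :=
  ContinuousLinearMap.id ℝ (EE n) - (1 + l) • β.smulRight b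

lemma reflMap_apply (β : EE n →L[ℝ] ℝ) (b : EE n) (l : ℝ) (y : EE n) :
    reflMap β b l y = y - ((1 + l) * β y) • b := by
  simp [reflMap, mul_smul]

lemma apply_reflMap {β : EE n →L[ℝ] ℝ} {b : EE n} (hb : β b = 1) (l : ℝ) (y : EE n) :
    β (reflMap β b l y) = -l * β y := by
  rw [reflMap_apply, map_sub, map_smul, hb, smul_eq_mul]
  ring

lemma reflMap_reflMap_inv {β : EE n →L[ℝ] ℝ} {b : EE n} (hb : β b = 1) {l : ℝ} (hl : l ≠ 0)
    (y : EE n) : reflMap β b l⁻¹ (reflMap β b l y) = y := by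
  rw [reflMap_apply β b l⁻¹, apply_reflMap hb, reflMap_apply]
  have : (1 + l⁻¹) * (-l * β y) = -((1 + l) * β y) := by field_simp; ring
  rw [this]
  simp

lemma reflMap_of_apply_eq_zero {β : EE n →L[ℝ] ℝ} {b : EE n} {l : ℝ} {y : EE n} (hy : β y = 0) :
    reflMap β b l y = y := by simp [reflMap_apply, hy]

/-- `reflMap` as a linear equivalence. -/
def reflEquiv {β : EE n →L[ℝ] ℝ} {b : EE n} (hb : β b = 1) {l : ℝ} (hl : l ≠ 0) :
    EE n ≃L[ℝ] EE n :=
  ContinuousLinearEquiv.equivOfInverse (reflMap β b l) (reflMap β b l⁻¹)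
    (reflMap_reflMap_inv hb hl)
    (fun y => by simpa using reflMap_reflMap_inv hb (inv_ne_zero hl) y)

lemma det_clequiv_ne_zero (A : EE n ≃L[ℝ] EE n) :
    LinearMap.det ((A : EE n →L[ℝ] EE n) : EE n →ₗ[ℝ] EE n) ≠ 0 :=
  (LinearEquiv.isUnit_det' A.toLinearEquiv).ne_zero

/-- The factor by which a linear equivalence changes integrals. -/
def jac (A : EE n ≃L[ℝ] EE n) : ℝ :=
  |(LinearMap.det ((A : EE n →L[ℝ] EE n) : EE n →ₗ[ℝ] EE n))⁻¹|

lemma jac_pos (A : EE n ≃L[ℝ] EE n) : 0 < jac A :=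
  abs_pos.2 (inv_ne_zero (det_clequiv_ne_zero A))

lemma map_clequiv_volume (A : EE n ≃L[ℝ] EE n) :
    Measure.map A (volume : Measure (EE n)) = ENNReal.ofReal (jac A) • volume :=
  Measure.map_linearMap_addHaar_eq_smul_addHaar volume (det_clequiv_ne_zero A)

lemma integral_comp_clequiv {F : Type*} [NormedAddCommGroup F] [NormedSpace ℝ F]
    (A : EE n ≃L[ℝ] EE n) (q : EE n → F) : ∫ y, q (A y) = jac A • ∫ y, q y := by
  have h : MeasurableEmbedding A := A.toHomeomorph.measurableEmbedding
  rw [← h.integral_map q, map_clequiv_volume, integral_smul_measure,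
    ENNReal.toReal_ofReal (jac_pos A).le]

lemma lintegral_comp_clequiv (A : EE n ≃L[ℝ] EE n) (q : EE n → ℝ≥0∞) :
    ∫⁻ y, q (A y) = ENNReal.ofReal (jac A) * ∫⁻ y, q y := by
  have h : MeasurableEmbedding A := A.toHomeomorph.measurableEmbedding
  rw [← h.lintegral_map q, map_clequiv_volume, lintegral_smul_measure, smul_eq_mul]

/-- The chain rule for a linear change of variables on the whole space. -/
lemma IsWeakDeriv.comp_clequiv (A : EE n ≃L[ℝ] EE n) {f : EE n → 𝕜} {G : EE n → EE n →L[ℝ] 𝕜}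
    (h : IsWeakDeriv univ f G) :
    IsWeakDeriv univ (fun y => f (A y)) (fun y => (G (A y)).comp (A : EE n →L[ℝ] EE n)) := by
  have := IsWeakDeriv.comp A.toHomeomorph.toOpenPartialHomeomorph
    (A.contDiff.contDiffOn) (A.symm.contDiff.contDiffOn) (f := f) (G := G) h
  refine this.congr isOpen_univ (fun y _ => rfl) (fun y _ => ?_)
  have e : fderiv ℝ (A : EE n → EE n) y = (A : EE n →L[ℝ] EE n) := A.fderiv
  change (G (A y)).comp (fderiv ℝ (A : EE n → EE n) y) = _
  rw [e]

lemma volume_ker_eq_zero {β : EE n →L[ℝ] ℝ} {b : EE n} (hb : β b = 1) :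
    volume {y : EE n | β y = 0} = 0 := by
  have : {y : EE n | β y = 0} = (LinearMap.ker (β : EE n →ₗ[ℝ] ℝ) : Set (EE n)) := by
    ext y; simp
  rw [this]
  refine Measure.addHaar_submodule volume _ fun h => ?_
  have : b ∈ LinearMap.ker (β : EE n →ₗ[ℝ] ℝ) := h ▸ Submodule.mem_top
  simp [hb] at this

/-- The divergence theorem on a half space for functions vanishing on the boundary. -/
lemma integral_halfSpace_fderiv_eq_zero {β : EE n →L[ℝ] ℝ} {b : EE n} (hb : β b = 1)
    {m : EE n → ℝ} (hm : ContDiff ℝ ∞ m) (hmc : HasCompactSupport m)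
    (h0 : ∀ y, β y = 0 → m y = 0) (v : EE n) :
    ∫ y, {y | β y ≤ 0}.indicator (fun y => fderiv ℝ m y v) y = 0 := by
  obtain ⟨C, hC⟩ := hm.lipschitzWith_of_hasCompactSupport hmc (by simp)
  -- extend by zero by precomposing with the projection to the half space
  let P : EE n → EE n := fun y => y - (max (β y) 0) • b
  have hP : ∃ C', LipschitzWith C' P := by
    have h1 : LipschitzWith ‖β‖₊ (fun y => max (β y) 0) := β.lipschitz.max_const 0
    have h2 := ((ContinuousLinearMap.toSpanSingleton ℝ b).lipschitz.comp h1)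
    have h3 := (LipschitzWith.id (α := EE n)).sub h2
    exact ⟨_, h3⟩
  obtain ⟨C', hP⟩ := hP
  let q : EE n → ℝ := {y | β y ≤ 0}.indicator m
  have hq : q = m ∘ P := by
    funext y
    by_cases hy : β y ≤ 0
    · simp [q, P, hy]
    · push Not at hy
      have : m (P y) = 0 := h0 _ (by simp [P, max_eq_left hy.le, hb])
      simp [q, this, hy]
  have hqL : LipschitzWith (C * C') q := hq ▸ hC.comp hP
  have hqc : HasCompactSupport q := HasCompactSupport.of_support_subset_isCompact hmc
    (fun y hy => subset_tsupport m fun h => hy (by simp [q, indicator, h]))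
  have key := LipschitzWith.integral_lineDeriv_mul_eq (μ := (volume : Measure (EE n)))
    (LipschitzWith.const (1 : ℝ)) hqL hqc (-v)
  have e0 : ∀ x : EE n, lineDeriv ℝ (fun _ : EE n => (1 : ℝ)) x (-v) = 0 := by
    intro x; simp [lineDeriv]
  simp only [e0, zero_mul, integral_zero, neg_neg, mul_one] at key
  refine Eq.trans ?_ key.symm
  refine integral_congr_ae ?_
  have hae : ∀ᵐ y : EE n, β y ≠ 0 := by
    rw [ae_iff]; simpa using volume_ker_eq_zero hb
  filter_upwards [hae] with y hy
  rcases lt_or_gt_of_ne hy with hy | hy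
  · have h1 : q =ᶠ[𝓝 y] m := by
      filter_upwards [(isOpen_lt β.continuous continuous_const).mem_nhds hy] with z hz
      have hz : β z < 0 := hz
      simp [q, hz.le]
    rw [indicator_of_mem (show y ∈ {y | β y ≤ 0} from hy.le)]
    have h2 := (((hm.differentiable (by simp)) y).hasFDerivAt.hasLineDerivAt v)
    exact (h2.congr_of_eventuallyEq h1).lineDeriv.symm
  · have h1 : q =ᶠ[𝓝 y] fun _ => 0 := by
      filter_upwards [(isOpen_lt continuous_const β.continuous).mem_nhds hy] with z hz
      have hz : 0 < β z := hz
      simp [q, hz]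
    rw [indicator_of_notMem (show y ∉ {y | β y ≤ 0} from not_le.2 hy)]
    have h2 := ((hasFDerivAt_const (𝕜 := ℝ) (0 : ℝ) y).hasLineDerivAt v)
    exact (h2.congr_of_eventuallyEq h1).lineDeriv.symm

lemma locallyIntegrableOn_indicator {F : Type*} [NormedAddCommGroup F] {D s : Set (EE n)}
    (hs : MeasurableSet s) {f : EE n → F} (hf : LocallyIntegrableOn f D) :
    LocallyIntegrableOn (s.indicator f) D := fun y hy =>
  let ⟨t, ht, h⟩ := hf y hy
  ⟨t, ht, h.indicator hs⟩

/-- An integral over `β ≤ 0` of `f₁ - f₂ ∘ A`, rewritten without composition on the functions: the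
reflection acts on the factor `q` instead. -/
lemma integral_sub_reflect {F : Type*} [NormedAddCommGroup F] [NormedSpace ℝ F]
    {β : EE n →L[ℝ] ℝ} {A : EE n ≃L[ℝ] EE n}
    (hA : ∀ y, 0 ≤ β (A y) ↔ β y ≤ 0) {q : EE n → ℝ} (hq : Continuous q)
    (hqc : HasCompactSupport q) {f₁ f₂ : EE n → F} (h₁ : LocallyIntegrableOn f₁ univ)
    (h₂ : LocallyIntegrableOn f₂ univ) (h₂' : LocallyIntegrableOn (fun y => f₂ (A y)) univ) :
    ∫ z, ({y | β y ≤ 0}.indicator q z • f₁ z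
        - (jac A * {y | 0 ≤ β y}.indicator (fun z => q (A.symm z)) z) • f₂ z)
      = ∫ y, {y | β y ≤ 0}.indicator q y • (f₁ y - f₂ (A y)) := by
  have mN : MeasurableSet {y : EE n | β y ≤ 0} :=
    (isClosed_le β.continuous continuous_const).measurableSet
  have mP : MeasurableSet {y : EE n | 0 ≤ β y} :=
    (isClosed_le continuous_const β.continuous).measurableSet
  obtain ⟨B, hB⟩ := hq.bounded_above_of_compact_support hqc
  have hb : ∀ y, |{y | β y ≤ 0}.indicator q y| ≤ max B 0 := fun y => by
    by_cases hy : y ∈ {y | β y ≤ 0}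
    · rw [indicator_of_mem hy]; exact (hB y).trans (le_max_left _ _)
    · rw [indicator_of_notMem hy]; simp
  have hz : ∀ y, y ∉ tsupport q → {y | β y ≤ 0}.indicator q y = 0 := fun y hy => by
    simp [indicator, image_eq_zero_of_notMem_tsupport hy]
  have hm : AEStronglyMeasurable ({y | β y ≤ 0}.indicator q) volume :=
    hq.aestronglyMeasurable.indicator mN
  have i1 := integrable_bdd_smul h₁ hqc (subset_univ _) hm hb hz
  have i2 := integrable_bdd_smul h₂' hqc (subset_univ _) hm hb hz
  have hqA : Continuous fun z => q (A.symm z) := hq.comp A.symm.continuous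
  have hqAc : HasCompactSupport fun z => q (A.symm z) :=
    hqc.comp_homeomorph A.symm.toHomeomorph
  have i3 : Integrable fun z => {y | 0 ≤ β y}.indicator (fun z => q (A.symm z)) z • f₂ z := by
    refine integrable_bdd_smul h₂ hqAc (subset_univ _) (hqA.aestronglyMeasurable.indicator mP)
      (B := max B 0) (fun y => ?_) (fun y hy => ?_)
    · by_cases hy : y ∈ {y | 0 ≤ β y}
      · rw [indicator_of_mem hy]; exact (hB _).trans (le_max_left _ _)
      · rw [indicator_of_notMem hy]; simp
    · have : q (A.symm y) = 0 :=
        image_eq_zero_of_notMem_tsupport (f := fun z => q (A.symm z)) hy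
      simp [indicator, this]
  have e := integral_comp_clequiv A
    (fun z => {y | 0 ≤ β y}.indicator (fun z => q (A.symm z)) z • f₂ z)
  have e' : ∀ y, {y | 0 ≤ β y}.indicator (fun z => q (A.symm z)) (A y)
      = {y | β y ≤ 0}.indicator q y := fun y => by
    by_cases hy : β y ≤ 0
    · have := (hA y).2 hy
      simp [hy, this]
    · have := mt (hA y).1 hy
      simp [hy, this]
  simp only [e'] at e
  have i4 : Integrable fun z =>
      jac A • {y | 0 ≤ β y}.indicator (fun z => q (A.symm z)) z • f₂ z := i3.smul (jac A)
  simp only [smul_sub, mul_smul]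
  rw [integral_sub i1 i4, integral_sub i1 i2, integral_smul, e]

/-- If `f` has a weak derivative and `A` is a linear equivalence exchanging the two half spaces and
fixing the hyperplane `β = 0`, then `f - f ∘ A` has zero trace there, so that its extension by
zero from `β ≤ 0` has a weak derivative without singular part. -/
theorem IsWeakDeriv.indicator_sub_comp {β : EE n →L[ℝ] ℝ} {b : EE n} (hb : β b = 1)
    {A : EE n ≃L[ℝ] EE n} (hA : ∀ y, 0 ≤ β (A y) ↔ β y ≤ 0) (hA0 : ∀ y, β y = 0 → A y = y)
    {f : EE n → 𝕜} {G : EE n → EE n →L[ℝ] 𝕜} (h : IsWeakDeriv univ f G) :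
    IsWeakDeriv univ ({y | β y ≤ 0}.indicator fun y => f y - f (A y))
      ({y | β y ≤ 0}.indicator fun y => G y - (G (A y)).comp (A : EE n →L[ℝ] EE n)) := by
  have mN : MeasurableSet {y : EE n | β y ≤ 0} :=
    (isClosed_le β.continuous continuous_const).measurableSet
  have mP : MeasurableSet {y : EE n | 0 ≤ β y} :=
    (isClosed_le continuous_const β.continuous).measurableSet
  have hA' := h.comp_clequiv A
  have hk := h.add (hA'.const_smul (-1))
  replace hk := hk.congr (f' := fun y => f y - f (A y))
    (G' := fun y => G y - (G (A y)).comp (A : EE n →L[ℝ] EE n)) isOpen_univ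
    (fun y _ => by simp [sub_eq_add_neg])
    (fun y _ => by ext v; simp [sub_eq_add_neg])
  refine ⟨locallyIntegrableOn_indicator mN hk.locInt,
    locallyIntegrableOn_indicator mN hk.locIntGrad, fun φ hφ v => ?_⟩
  have hφv := hφ.fderiv_apply v
  have cA : Continuous fun z : EE n => A.symm z := A.symm.continuous
  -- the test field `φ v` on `β ≤ 0`, minus its transport by `A` to `0 ≤ β`: it jumps across
  -- `β = 0`, but its normal component does not, so that its divergence has no singular part
  let ψ : EE n → ℝ := fun z => {y | β y ≤ 0}.indicator (fun y => fderiv ℝ φ y v) z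
    - jac A * {y | 0 ≤ β y}.indicator (fun z => fderiv ℝ φ (A.symm z) v) z
  let Ψ : EE n → EE n := fun z => {y | β y ≤ 0}.indicator φ z • v
    - (jac A * {y | 0 ≤ β y}.indicator (fun z => φ (A.symm z)) z) • A v
  obtain ⟨B1, hB1⟩ := hφv.exists_bound
  obtain ⟨B2, hB2⟩ := hφ.exists_bound
  have hB1p : 0 ≤ B1 := (abs_nonneg _).trans (hB1 0)
  have hB2p : 0 ≤ B2 := (abs_nonneg _).trans (hB2 0)
  have hind : ∀ (s : Set (EE n)) (q : EE n → ℝ) (B : ℝ), 0 ≤ B → (∀ y, |q y| ≤ B) →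
      ∀ y, |s.indicator q y| ≤ B := fun s q B hB hq y => by
    by_cases hy : y ∈ s
    · rw [indicator_of_mem hy]; exact hq y
    · rw [indicator_of_notMem hy]; simpa using hB
  have hKc : IsCompact (tsupport φ ∪ A '' tsupport φ) :=
    hφ.2.1.isCompact.union (hφ.2.1.isCompact.image A.continuous)
  have hK1 : ∀ z, z ∉ tsupport φ ∪ A '' tsupport φ → z ∉ tsupport φ ∧ A.symm z ∉ tsupport φ :=
    fun z hz => ⟨fun h => hz (Or.inl h), fun h => hz (Or.inr ⟨_, h, by simp⟩)⟩
  have key := h.integral_rough isOpen_univ hKc (subset_univ _) (ψ := ψ) (Ψ := Ψ)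
    (((hφv.1.continuous.aestronglyMeasurable.indicator mN)).sub
      (((hφv.1.continuous.comp cA).aestronglyMeasurable.indicator mP).const_mul _))
    (((hφ.1.continuous.aestronglyMeasurable.indicator mN).smul_const v).sub
      ((((hφ.1.continuous.comp cA).aestronglyMeasurable.indicator mP).const_mul _).smul_const _))
    (B := max (B1 + jac A * B1) (B2 * ‖v‖ + jac A * B2 * ‖A v‖))
    (fun z => by
      refine le_trans ?_ (le_max_left _ _)
      refine (abs_sub _ _).trans ?_
      rw [abs_mul, abs_of_pos (jac_pos A)]
      exact add_le_add (hind _ _ _ hB1p hB1 z) (mul_le_mul_of_nonneg_left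
        (hind _ _ _ hB1p (fun y => hB1 _) z) (jac_pos A).le))
    (fun z => by
      refine le_trans ?_ (le_max_right _ _)
      refine (norm_sub_le _ _).trans ?_
      rw [norm_smul, norm_smul, norm_mul, Real.norm_of_nonneg (jac_pos A).le]
      refine add_le_add (mul_le_mul_of_nonneg_right (hind _ _ _ hB2p hB2 z) (norm_nonneg _))
        (mul_le_mul_of_nonneg_right (mul_le_mul_of_nonneg_left
        (hind _ _ _ hB2p (fun y => hB2 _) z) (jac_pos A).le) (norm_nonneg _)))
    (fun z hz => by
      obtain ⟨h1, h2⟩ := hK1 z hz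
      simp [ψ, indicator, hφ.fderiv_eq_zero h1, hφ.fderiv_eq_zero h2])
    (fun z hz => by
      obtain ⟨h1, h2⟩ := hK1 z hz
      simp [Ψ, indicator, hφ.eq_zero h1, hφ.eq_zero h2])
    (by
      intro g hg hgc
      have lg : LocallyIntegrableOn g univ := hg.continuous.locallyIntegrable.locallyIntegrableOn _
      have lgA : LocallyIntegrableOn (fun y => g (A y)) univ :=
        (hg.continuous.comp A.continuous).locallyIntegrable.locallyIntegrableOn _
      have cg : ∀ w, Continuous fun y => fderiv ℝ g y w := fun w =>
        (hg.continuous_fderiv (by simp)).clm_apply continuous_const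
      have lg' : ∀ w, LocallyIntegrableOn (fun y => fderiv ℝ g y w) univ := fun w =>
        (cg w).locallyIntegrable.locallyIntegrableOn _
      have lgA' : ∀ w, LocallyIntegrableOn (fun y => fderiv ℝ g (A y) w) univ := fun w =>
        ((cg w).comp A.continuous).locallyIntegrable.locallyIntegrableOn _
      have e1 := integral_sub_reflect hA hφv.1.continuous hφv.2.1 lg lg lgA
      have e2 := integral_sub_reflect hA hφ.1.continuous hφ.2.1 (lg' v) (lg' (A v)) (lgA' (A v))
      have e1' : ∫ y, ψ y * g y = _ := Eq.trans (by
        congr 1; funext y; simp only [ψ, smul_eq_mul]; ring) e1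
      have e2' : ∫ y, fderiv ℝ g y (Ψ y) = _ := Eq.trans (by
        congr 1; funext y; simp only [Ψ, map_sub, map_smul, smul_eq_mul]) e2
      rw [e1', e2', eq_neg_iff_add_eq_zero]
      have dgA : ∀ y w, fderiv ℝ (fun y => g (A y)) y w = fderiv ℝ g (A y) (A w) := fun y w => by
        have := (((hg.differentiable (by simp)) (A y)).hasFDerivAt.comp y A.hasFDerivAt).fderiv
        change fderiv ℝ (g ∘ A) y w = _
        rw [this]; rfl
      have hk1 : ContDiff ℝ ∞ fun y => g y - g (A y) := hg.sub (hg.comp A.contDiff)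
      have hm := hφ.mul isOpen_univ hk1.contDiffOn
      have e3 := integral_halfSpace_fderiv_eq_zero hb hm.1 hm.2.1
        (fun y hy => by simp [hA0 y hy]) v
      have l1 : LocallyIntegrableOn (fun y => g y - g (A y)) univ :=
        hk1.continuous.locallyIntegrable.locallyIntegrableOn _
      have l2 : LocallyIntegrableOn (fun y => fderiv ℝ g y v - fderiv ℝ g (A y) (A v)) univ :=
        ((cg v).sub ((cg (A v)).comp A.continuous)).locallyIntegrable.locallyIntegrableOn _
      have i1 := integrable_bdd_smul l1 hφ.2.1 (subset_univ _)
        (hφv.1.continuous.aestronglyMeasurable.indicator mN)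
          (hind _ _ _ hB1p hB1) (fun y hy => by simp [indicator, hφ.fderiv_eq_zero hy])
      have i2 := integrable_bdd_smul l2 hφ.2.1 (subset_univ _)
        (hφ.1.continuous.aestronglyMeasurable.indicator mN)
          (hind _ _ _ hB2p hB2) (fun y hy => by simp [indicator, hφ.eq_zero hy])
      rw [← integral_add i1 i2]
      refine Eq.trans ?_ e3
      congr 1
      funext y
      by_cases hy : β y ≤ 0
      · simp only [mem_ofPred_eq, hy, indicator_of_mem, smul_eq_mul]
        have dsub : fderiv ℝ (fun y => g y - g (A y)) y
            = fderiv ℝ g y - fderiv ℝ (fun y => g (A y)) y :=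
          fderiv_fun_sub (hg.differentiable (by simp) y)
            ((hg.comp A.contDiff).differentiable (by simp) y)
        rw [hφ.fderiv_mul isOpen_univ hk1.contDiffOn, dsub, sub_apply, dgA]
        ring
      · simp [hy])
  have e1 := integral_sub_reflect hA hφv.1.continuous hφv.2.1 h.locInt h.locInt hA'.locInt
  have lGA : LocallyIntegrableOn (fun y => G (A y) (A v)) univ :=
    locallyIntegrableOn_clm_apply hA'.locIntGrad v
  have e2 := integral_sub_reflect hA hφ.1.continuous hφ.2.1
    (locallyIntegrableOn_clm_apply h.locIntGrad v)
    (locallyIntegrableOn_clm_apply h.locIntGrad (A v)) lGA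
  have e1' : ∫ y, ψ y • f y = _ := Eq.trans (by
    congr 1; funext y; simp only [ψ, sub_smul]) e1
  have e2' : ∫ y, G y (Ψ y) = _ := Eq.trans (by
    congr 1; funext y; simp only [Ψ, map_sub, map_smul]) e2
  rw [e1', e2'] at key
  refine Eq.trans ?_ (key.trans ?_)
  · congr 1
    funext y
    by_cases hy : β y ≤ 0 <;> simp [hy]
  · congr 2
    funext y
    by_cases hy : β y ≤ 0 <;> simp [hy]

end ScGeom
end

noncomputable section

namespace ScGeom

variable {n : ℕ} {𝕜 : Type*} [RCLike 𝕜]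

/-! Shortcut instances for spaces of linear and bilinear forms, on which the search for
the normed structure is slow. -/

instance instNormedAddCommGroupCovector : NormedAddCommGroup (EE n →L[ℝ] 𝕜) :=
  ContinuousLinearMap.toNormedAddCommGroup

instance instNormedSpaceCovector : NormedSpace ℝ (EE n →L[ℝ] 𝕜) :=
  ContinuousLinearMap.toNormedSpace

instance instNormedAddCommGroupBilinear : NormedAddCommGroup (EE n →L[ℝ] EE n →L[ℝ] 𝕜) :=
  ContinuousLinearMap.toNormedAddCommGroup

instance instNormedSpaceBilinear : NormedSpace ℝ (EE n →L[ℝ] EE n →L[ℝ] 𝕜) :=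
  ContinuousLinearMap.toNormedSpace

lemma reflEquiv_nonneg_iff {β : EE n →L[ℝ] ℝ} {b : EE n} (hb : β b = 1) {l : ℝ} (hl : 0 < l)
    (y : EE n) : 0 ≤ β (reflEquiv hb hl.ne' y) ↔ β y ≤ 0 := by
  change 0 ≤ β (reflMap β b l y) ↔ _
  rw [apply_reflMap hb]
  constructor
  · intro h; nlinarith
  · intro h; nlinarith

/-- Reflecting a scalar function, with weights of sum one. -/
lemma IsWeakDeriv.reflect {β : EE n →L[ℝ] ℝ} {b : EE n} (hb : β b = 1) {l₁ l₂ c₁ c₂ : ℝ}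
    (h₁ : 0 < l₁) (h₂ : 0 < l₂) (hc : c₁ + c₂ = 1) {f : EE n → 𝕜} {G : EE n → EE n →L[ℝ] 𝕜}
    (h : IsWeakDeriv univ f G) :
    IsWeakDeriv univ
      (fun y => if 0 < β y then f y
        else c₁ • f (reflMap β b l₁ y) + c₂ • f (reflMap β b l₂ y))
      (fun y => if 0 < β y then G y
        else c₁ • (G (reflMap β b l₁ y)).comp (reflMap β b l₁)
          + c₂ • (G (reflMap β b l₂ y)).comp (reflMap β b l₂)) := by
  have k₁ := h.indicator_sub_comp hb (A := reflEquiv hb h₁.ne') (reflEquiv_nonneg_iff hb h₁)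
    (fun y hy => reflMap_of_apply_eq_zero hy)
  have k₂ := h.indicator_sub_comp hb (A := reflEquiv hb h₂.ne') (reflEquiv_nonneg_iff hb h₂)
    (fun y hy => reflMap_of_apply_eq_zero hy)
  have hc' : c₁ = 1 - c₂ := by linarith
  refine (h.add ((k₁.const_smul (-c₁)).add (k₂.const_smul (-c₂)))).congr isOpen_univ
    (fun y _ => ?_) (fun y _ => ?_)
  · by_cases hy : 0 < β y
    · simp [hy, not_le.2 hy]
    · simp only [hy, if_false, indicator_of_mem (show y ∈ {y | β y ≤ 0} from not_lt.1 hy)]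
      change f y + (-c₁ • (f y - f (reflMap β b l₁ y)) + -c₂ • (f y - f (reflMap β b l₂ y))) = _
      rw [hc']
      module
  · by_cases hy : 0 < β y
    · have hy' : y ∉ {y | β y ≤ 0} := not_le.2 hy
      simp only [indicator_of_notMem hy', if_pos hy, smul_zero, smul_zero,
        add_zero, add_zero]
    · simp only [hy, if_false, indicator_of_mem (show y ∈ {y | β y ≤ 0} from not_lt.1 hy)]
      change G y + (-c₁ • (G y - (G (reflMap β b l₁ y)).comp (reflMap β b l₁))
        + -c₂ • (G y - (G (reflMap β b l₂ y)).comp (reflMap β b l₂))) = _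
      rw [hc']
      module

/-- The pullback of a bilinear form by a linear map. -/
def pull₂ (τ : EE n →L[ℝ] EE n →L[ℝ] 𝕜) (A : EE n →L[ℝ] EE n) : EE n →L[ℝ] EE n →L[ℝ] 𝕜 :=
  τ.bilinearComp A A

@[simp] lemma pull₂_apply (τ : EE n →L[ℝ] EE n →L[ℝ] 𝕜) (A : EE n →L[ℝ] EE n) (v w : EE n) :
    pull₂ τ A v w = τ (A v) (A w) := rfl

lemma norm_pull₂_le (τ : EE n →L[ℝ] EE n →L[ℝ] 𝕜) (A : EE n →L[ℝ] EE n) :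
    ‖pull₂ τ A‖ ≤ ‖τ‖ * ‖A‖ ^ 2 := by
  refine ContinuousLinearMap.opNorm_le_bound₂ _ (by positivity) fun v w => ?_
  rw [pull₂_apply]
  refine (τ.le_opNorm₂ _ _).trans ?_
  have h1 := A.le_opNorm v
  have h2 := A.le_opNorm w
  calc ‖τ‖ * ‖A v‖ * ‖A w‖ ≤ ‖τ‖ * (‖A‖ * ‖v‖) * (‖A‖ * ‖w‖) := by gcongr
    _ = _ := by ring

/-- The extension of a one-form across `β = 0` by the combination `3 A₁^* - 2 A₂^*` of pullbacks by
the reflections `A_l = reflMap β b l`: the weights match the tangential components (`3 - 2 = 1`)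
and the normal one (`-3 + 4 = 1`). Being built from pullbacks, it commutes with the symmetric
gradient. -/
def reflForm (β : EE n →L[ℝ] ℝ) (b : EE n) (w : EE n → EE n →L[ℝ] 𝕜) (y : EE n) :
    EE n →L[ℝ] 𝕜 :=
  if 0 < β y then w y
    else (3 : ℝ) • (w (reflMap β b 1 y)).comp (reflMap β b 1)
      + (-2 : ℝ) • (w (reflMap β b 2 y)).comp (reflMap β b 2)

/-- The gradient of `reflForm`. -/
def reflGrad (β : EE n →L[ℝ] ℝ) (b : EE n) (G : EE n → EE n →L[ℝ] EE n →L[ℝ] 𝕜) (y : EE n) :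
    EE n →L[ℝ] EE n →L[ℝ] 𝕜 :=
  if 0 < β y then G y
    else (3 : ℝ) • pull₂ (G (reflMap β b 1 y)) (reflMap β b 1)
      + (-2 : ℝ) • pull₂ (G (reflMap β b 2 y)) (reflMap β b 2)

/-- `reflForm` stays in `H¹` across the hyperplane. The components along `ker β` are reflected with
the weights `3` and `-2`; the normal component picks up the factors `-1` and `-2` from the two
reflections, hence has the weights `-3` and `4`. Both pairs have sum one. -/
lemma IsWeakDeriv₁.reflect {β : EE n →L[ℝ] ℝ} {b : EE n} (hb : β b = 1)
    {w : EE n → EE n →L[ℝ] 𝕜} {G : EE n → EE n →L[ℝ] EE n →L[ℝ] 𝕜} (h : IsWeakDeriv₁ univ w G) :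
    IsWeakDeriv₁ univ (reflForm β b w) (reflGrad β b G) := by
  intro a
  have hβ' : β (a - β a • b) = 0 := by simp [hb]
  have ha : a = (a - β a • b) + β a • b := by abel
  have ht := (h (a - β a • b)).reflect hb one_pos two_pos
    (show (3 : ℝ) + -2 = 1 by norm_num)
  have hn := (h b).reflect hb one_pos two_pos (show (-3 : ℝ) + 4 = 1 by norm_num)
  have e₁ : ∀ l, reflMap β b l a = (a - β a • b) + (-(l * β a)) • b := by
    intro l
    rw [reflMap_apply]
    module
  refine (ht.add (hn.const_smul (β a))).congr isOpen_univ (fun y _ => ?_) (fun y _ => ?_)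
  · by_cases hy : 0 < β y
    · simp [reflForm, hy]
    · simp only [reflForm, hy, if_false, add_apply, smul_apply, ContinuousLinearMap.comp_apply, e₁,
        map_add, map_smul]
      module
  · by_cases hy : 0 < β y
    · ext v
      simp [reflGrad, hy]
    · ext v
      simp only [reflGrad, hy, if_false, add_apply, smul_apply, ContinuousLinearMap.comp_apply, e₁,
        map_add, map_smul, ContinuousLinearMap.flip_apply, pull₂_apply]
      module

/-- Integrals over the whole space of a reflected function are controlled by integrals over
`β > 0`. -/
lemma lintegral_reflect_le {β : EE n →L[ℝ] ℝ} {b : EE n} (hb : β b = 1) (C : ℝ≥0) :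
    ∃ K : ℝ≥0, ∀ p q : EE n → ℝ≥0∞, AEMeasurable q volume → (∀ y, 0 < β y → p y ≤ q y) →
      (∀ y, β y ≤ 0 → p y ≤ C * (q (reflMap β b 1 y) + q (reflMap β b 2 y))) →
      ∫⁻ y, p y ≤ K * ∫⁻ y in {y | 0 < β y}, q y := by
  let A₁ := reflEquiv hb (one_ne_zero (α := ℝ))
  let A₂ := reflEquiv hb (two_ne_zero (α := ℝ))
  refine ⟨1 + C * (Real.toNNReal (jac A₁) + Real.toNNReal (jac A₂)), fun p q hq h1 h2 => ?_⟩
  have mP : MeasurableSet {y : EE n | 0 < β y} :=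
    (isOpen_lt continuous_const β.continuous).measurableSet
  have mP' : MeasurableSet {y : EE n | 0 ≤ β y} :=
    (isClosed_le continuous_const β.continuous).measurableSet
  have mN : MeasurableSet {y : EE n | β y ≤ 0} :=
    (isClosed_le β.continuous continuous_const).measurableSet
  have hcompl : {y : EE n | 0 < β y}ᶜ = {y | β y ≤ 0} := by ext y; simp
  have hnull : ∫⁻ y in {y : EE n | 0 ≤ β y}, q y = ∫⁻ y in {y | 0 < β y}, q y := by
    refine setLIntegral_congr ?_
    have : ∀ᵐ y : EE n, β y ≠ 0 := by
      rw [ae_iff]; simpa using volume_ker_eq_zero hb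
    filter_upwards [this] with y hy
    apply propext
    exact ⟨fun h => lt_of_le_of_ne h (Ne.symm hy), fun h => le_of_lt h⟩
  have hA : ∀ (A : EE n ≃L[ℝ] EE n), (∀ y, 0 ≤ β (A y) ↔ β y ≤ 0) →
      ∫⁻ y in {y | β y ≤ 0}, q (A y) = ENNReal.ofReal (jac A) * ∫⁻ y in {y | 0 < β y}, q y := by
    intro A hAs
    rw [← hnull, ← lintegral_indicator mP', ← lintegral_comp_clequiv A, ← lintegral_indicator mN]
    congr 1
    funext y
    by_cases hy : β y ≤ 0
    · have := (hAs y).2 hy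
      simp [hy, this]
    · have := mt (hAs y).1 hy
      simp [hy, this]
  have hA₁ := hA A₁ (reflEquiv_nonneg_iff hb one_pos)
  have hA₂ := hA A₂ (reflEquiv_nonneg_iff hb two_pos)
  have hqA : AEMeasurable (fun y => q (A₁ y)) volume := by
    refine hq.comp_quasiMeasurePreserving ⟨A₁.continuous.measurable, ?_⟩
    rw [map_clequiv_volume]
    exact Measure.smul_absolutelyContinuous
  rw [← lintegral_add_compl p mP, hcompl]
  calc (∫⁻ y in {y | 0 < β y}, p y) + ∫⁻ y in {y | β y ≤ 0}, p y
      ≤ (∫⁻ y in {y | 0 < β y}, q y)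
        + ∫⁻ y in {y | β y ≤ 0}, C * (q (A₁ y) + q (A₂ y)) := by
        gcongr ?_ + ?_
        · exact setLIntegral_mono' mP h1
        · exact setLIntegral_mono' mN h2
    _ = _ := by
        rw [lintegral_const_mul' _ _ ENNReal.coe_ne_top, lintegral_add_left' hqA.restrict, hA₁, hA₂]
        push_cast
        simp only [ENNReal.ofReal]
        ring

lemma lintegral_sq_lt_top_memLp {F : Type*} [NormedAddCommGroup F] {f : EE n → F}
    (hm : AEStronglyMeasurable f volume) (h : ∫⁻ y, ENNReal.ofReal (‖f y‖ ^ 2) < ⊤) :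
    MemLp f 2 volume := by
  refine ⟨hm, ?_⟩
  rw [eLpNorm_lt_top_iff_lintegral_rpow_enorm_lt_top (by simp) (by simp)]
  convert h using 2
  funext y
  rw [ENNReal.ofReal_pow (norm_nonneg _), ofReal_norm]
  simp

/-- Weak differentiability includes measurability, as part of local integrability. -/
lemma IsWeakDeriv₁.aestronglyMeasurable {w : EE n → EE n →L[ℝ] 𝕜}
    {G : EE n → EE n →L[ℝ] EE n →L[ℝ] 𝕜} (h : IsWeakDeriv₁ univ w G) :
    AEStronglyMeasurable w volume ∧ AEStronglyMeasurable G volume := by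
  constructor
  · exact (locallyIntegrableOn_univ.1 (locallyIntegrableOn_clm_iff.2 fun i =>
      (h (stdVec i)).locInt)).aestronglyMeasurable
  · refine (locallyIntegrableOn_univ.1 (locallyIntegrableOn_clm_iff.2 fun i =>
      locallyIntegrableOn_clm_iff.2 fun j => ?_)).aestronglyMeasurable
    exact locallyIntegrableOn_clm_apply (h (stdVec j)).locIntGrad (stdVec i)

lemma norm_comb_sq_le {F : Type*} [NormedAddCommGroup F] [NormedSpace ℝ F] {x y : F}
    {a b M : ℝ} (hx : ‖x‖ ≤ a * M) (hy : ‖y‖ ≤ b * M) :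
    ‖(3 : ℝ) • x + (-2 : ℝ) • y‖ ^ 2 ≤ 18 * M ^ 2 * (a ^ 2 + b ^ 2) := by
  have h1 : ‖(3 : ℝ) • x + (-2 : ℝ) • y‖ ≤ 3 * (a * M) + 2 * (b * M) := by
    refine (norm_add_le _ _).trans ?_
    rw [norm_smul, norm_smul]
    norm_num
    linarith
  have h0 := norm_nonneg ((3 : ℝ) • x + (-2 : ℝ) • y)
  have h2 : ‖(3 : ℝ) • x + (-2 : ℝ) • y‖ ^ 2 ≤ (3 * (a * M) + 2 * (b * M)) ^ 2 := by gcongr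
  nlinarith [sq_nonneg (3 * (a * M) - 2 * (b * M)), sq_nonneg (b * M), sq_nonneg (a * M)]

lemma ofReal_comb_le {p a b c : ℝ} {C : ℝ≥0} (h : p ≤ C * (a ^ 2 + b ^ 2)) (hc : c = p) :
    ENNReal.ofReal c ≤ C * (ENNReal.ofReal (a ^ 2) + ENNReal.ofReal (b ^ 2)) := by
  rw [← ENNReal.ofReal_add (sq_nonneg _) (sq_nonneg _), ← ENNReal.ofReal_coe_nnreal,
    ← ENNReal.ofReal_mul C.coe_nonneg, hc]
  exact ENNReal.ofReal_le_ofReal h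

/-- Pullback by linear maps commutes with taking the symmetric part. -/
lemma symPart_reflGrad (β : EE n →L[ℝ] ℝ) (b : EE n) (G : EE n → EE n →L[ℝ] EE n →L[ℝ] 𝕜)
    (y : EE n) : symPart (reflGrad β b G y) = reflGrad β b (fun y => symPart (G y)) y := by
  ext v w
  by_cases hy : 0 < β y
  · simp [reflGrad, hy]
  · simp only [reflGrad, hy, if_false, symPart_apply, add_apply, smul_apply, pull₂_apply]
    module

lemma aestronglyMeasurable_symPart {G : EE n → EE n →L[ℝ] EE n →L[ℝ] 𝕜}
    (mG : AEStronglyMeasurable G volume) :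
    AEStronglyMeasurable (fun y => symPart (G y)) volume := by
  have hc : Continuous (fun τ : EE n →L[ℝ] EE n →L[ℝ] 𝕜 => symPart τ) := by
    have h1 : Continuous (fun τ : EE n →L[ℝ] EE n →L[ℝ] 𝕜 => τ.flip) :=
      (ContinuousLinearMap.flipₗᵢ ℝ (EE n) (EE n) 𝕜).continuous
    exact (continuous_id.add h1).const_smul (1 / 2 : ℝ)
  exact hc.comp_aestronglyMeasurable mG

lemma ofReal_norm_reflForm_le {β : EE n →L[ℝ] ℝ} {b : EE n} {M : ℝ}
    (hM1 : ‖reflMap β b 1‖ ≤ M) (hM2 : ‖reflMap β b 2‖ ≤ M) (w : EE n → EE n →L[ℝ] 𝕜) (y : EE n)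
    (hy : β y ≤ 0) : ENNReal.ofReal (‖reflForm β b w y‖ ^ 2)
      ≤ (Real.toNNReal (18 * M ^ 2) : ℝ≥0∞) * (ENNReal.ofReal (‖w (reflMap β b 1 y)‖ ^ 2)
        + ENNReal.ofReal (‖w (reflMap β b 2 y)‖ ^ 2)) := by
  refine ofReal_comb_le ?_ rfl
  rw [Real.coe_toNNReal _ (by positivity), reflForm, if_neg (not_lt.2 hy)]
  refine norm_comb_sq_le ?_ ?_
  · exact (ContinuousLinearMap.opNorm_comp_le _ _).trans (by gcongr)
  · exact (ContinuousLinearMap.opNorm_comp_le _ _).trans (by gcongr)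

lemma ofReal_norm_reflGrad_le {β : EE n →L[ℝ] ℝ} {b : EE n} {M : ℝ}
    (hM1 : ‖reflMap β b 1‖ ≤ M) (hM2 : ‖reflMap β b 2‖ ≤ M)
    (G : EE n → EE n →L[ℝ] EE n →L[ℝ] 𝕜) (y : EE n) (hy : β y ≤ 0) :
    ENNReal.ofReal (‖reflGrad β b G y‖ ^ 2) ≤ (Real.toNNReal (18 * (M ^ 2) ^ 2) : ℝ≥0∞) *
      (ENNReal.ofReal (‖G (reflMap β b 1 y)‖ ^ 2)
        + ENNReal.ofReal (‖G (reflMap β b 2 y)‖ ^ 2)) := by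
  refine ofReal_comb_le ?_ rfl
  rw [Real.coe_toNNReal _ (by positivity), reflGrad, if_neg (not_lt.2 hy)]
  refine norm_comb_sq_le ?_ ?_
  · exact (norm_pull₂_le _ _).trans (by gcongr)
  · exact (norm_pull₂_le _ _).trans (by gcongr)

/-- A one-form in `H¹(ℝⁿ)` can be modified on one side of a hyperplane so that its full `H¹` norm
is controlled by itself and its symmetric gradient on the other side. -/
theorem exists_korn_extension {β : EE n →L[ℝ] ℝ} {b : EE n} (hb : β b = 1) :
    ∃ C : ℝ≥0, ∀ (w : EE n → EE n →L[ℝ] 𝕜) (G : EE n → EE n →L[ℝ] EE n →L[ℝ] 𝕜),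
      IsWeakDeriv₁ univ w G → ∫⁻ y, ENNReal.ofReal (‖w y‖ ^ 2) < ⊤ →
      ∫⁻ y, ENNReal.ofReal (‖G y‖ ^ 2) < ⊤ →
      ∃ w' G', IsWeakDeriv₁ univ w' G' ∧ (∀ y, 0 < β y → w' y = w y) ∧
        ∫⁻ y, ENNReal.ofReal (‖w' y‖ ^ 2)
          ≤ C * ∫⁻ y in {y | 0 < β y}, ENNReal.ofReal (‖w y‖ ^ 2) ∧
        ∫⁻ y, ENNReal.ofReal (‖G' y‖ ^ 2)
          ≤ C * ∫⁻ y in {y | 0 < β y}, ENNReal.ofReal (‖symPart (G y)‖ ^ 2) := by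
  set M : ℝ := max ‖reflMap β b 1‖ ‖reflMap β b 2‖
  have hM1 : ‖reflMap β b 1‖ ≤ M := le_max_left _ _
  have hM2 : ‖reflMap β b 2‖ ≤ M := le_max_right _ _
  obtain ⟨K₁, hK₁⟩ := lintegral_reflect_le hb (Real.toNNReal (18 * M ^ 2))
  obtain ⟨K₂, hK₂⟩ := lintegral_reflect_le hb (Real.toNNReal (18 * (M ^ 2) ^ 2))
  have hform := ofReal_norm_reflForm_le (𝕜 := 𝕜) hM1 hM2
  have hgrad := ofReal_norm_reflGrad_le (𝕜 := 𝕜) hM1 hM2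
  refine ⟨max K₁ (Real.toNNReal (4 * n ^ 2) * K₂), fun w G h hw hG =>
    ⟨reflForm β b w, reflGrad β b G, h.reflect hb, fun y hy => by simp [reflForm, hy], ?_, ?_⟩⟩
  · refine (hK₁ _ (fun y => ENNReal.ofReal (‖w y‖ ^ 2)) ?_ (fun y hy => by simp [reflForm, hy])
      (hform w)).trans ?_
    · exact (h.aestronglyMeasurable.1.norm.aemeasurable.pow_const 2).ennreal_ofReal
    · gcongr
      exact le_max_left _ _
  · have h' := h.reflect hb
    have mG := h.aestronglyMeasurable.2
    have msG := aestronglyMeasurable_symPart mG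
    have b1 : ∫⁻ y, ENNReal.ofReal (‖reflForm β b w y‖ ^ 2) < ⊤ := by
      refine (hK₁ _ (fun y => ENNReal.ofReal (‖w y‖ ^ 2)) ?_ (fun y hy => by simp [reflForm, hy])
        (hform w)).trans_lt ?_
      · exact (h.aestronglyMeasurable.1.norm.aemeasurable.pow_const 2).ennreal_ofReal
      · exact ENNReal.mul_lt_top ENNReal.coe_lt_top ((setLIntegral_le_lintegral _ _).trans_lt hw)
    have b2 : ∫⁻ y, ENNReal.ofReal (‖reflGrad β b G y‖ ^ 2) < ⊤ := by
      refine (hK₂ _ (fun y => ENNReal.ofReal (‖G y‖ ^ 2)) ?_ (fun y hy => by simp [reflGrad, hy])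
        (hgrad G)).trans_lt ?_
      · exact (mG.norm.aemeasurable.pow_const 2).ennreal_ofReal
      · exact ENNReal.mul_lt_top ENNReal.coe_lt_top ((setLIntegral_le_lintegral _ _).trans_lt hG)
    have l1 := lintegral_sq_lt_top_memLp h'.aestronglyMeasurable.1 b1
    have l2 := lintegral_sq_lt_top_memLp h'.aestronglyMeasurable.2 b2
    have kw := korn_whole_space h' (fun a => (ContinuousLinearMap.apply ℝ 𝕜 a).comp_memLp' l1)
      (fun v a => (ContinuousLinearMap.apply ℝ 𝕜 a).comp_memLp'
        ((ContinuousLinearMap.apply ℝ (EE n →L[ℝ] 𝕜) v).comp_memLp' l2))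
    refine kw.trans ?_
    simp_rw [symPart_reflGrad]
    calc ENNReal.ofReal (4 * n ^ 2)
          * ∫⁻ y, ENNReal.ofReal (‖reflGrad β b (fun y => symPart (G y)) y‖ ^ 2)
        ≤ ENNReal.ofReal (4 * n ^ 2)
          * (K₂ * ∫⁻ y in {y | 0 < β y}, ENNReal.ofReal (‖symPart (G y)‖ ^ 2)) := by
          gcongr
          refine hK₂ _ (fun y => ENNReal.ofReal (‖symPart (G y)‖ ^ 2)) ?_
            (fun y hy => by simp [reflGrad, hy]) (hgrad _)
          exact (msG.norm.aemeasurable.pow_const 2).ennreal_ofReal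
      _ = ((Real.toNNReal (4 * n ^ 2) * K₂ : ℝ≥0) : ℝ≥0∞)
          * ∫⁻ y in {y | 0 < β y}, ENNReal.ofReal (‖symPart (G y)‖ ^ 2) := by
          rw [← mul_assoc]
          push_cast
          rfl
      _ ≤ _ := by
          gcongr
          exact le_max_right _ _

end ScGeom
end

noncomputable section

namespace ScGeom

variable {n : ℕ} {𝕜 : Type*} [RCLike 𝕜]

instance instNormedAddCommGroupRealCovector : NormedAddCommGroup (EE n →L[ℝ] ℝ) :=
  ContinuousLinearMap.toNormedAddCommGroup

instance instNormedSpaceRealCovector : NormedSpace ℝ (EE n →L[ℝ] ℝ) :=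
  ContinuousLinearMap.toNormedSpace

instance instNormedAddCommGroupRealBilinear : NormedAddCommGroup (EE n →L[ℝ] EE n →L[ℝ] ℝ) :=
  ContinuousLinearMap.toNormedAddCommGroup

instance instNormedSpaceRealBilinear : NormedSpace ℝ (EE n →L[ℝ] EE n →L[ℝ] ℝ) :=
  ContinuousLinearMap.toNormedSpace

/-! ### Inner products and the Levi-Civita connection in coordinates -/

/-- The bilinear form `B` is an inner product. -/
structure IsInner (B : EE n →L[ℝ] EE n →L[ℝ] ℝ) : Prop where
  symm : ∀ v w, B v w = B w v
  pos : ∀ v, v ≠ 0 → 0 < B v v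

/-- The Gram matrix of a bilinear form in the standard basis. -/
def gramMat (B : EE n →L[ℝ] EE n →L[ℝ] ℝ) : Matrix (Fin n) (Fin n) ℝ :=
  Matrix.of fun i j => B (stdVec i) (stdVec j)

lemma gramMat_apply (B : EE n →L[ℝ] EE n →L[ℝ] ℝ) (i j : Fin n) :
    gramMat B i j = B (stdVec i) (stdVec j) := rfl

/-- Expansion of a bilinear map in the standard basis. -/
lemma bilin_apply_eq_sum {F : Type*} [NormedAddCommGroup F] [NormedSpace ℝ F]
    (B : EE n →L[ℝ] EE n →L[ℝ] F) (v w : EE n) :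
    B v w = ∑ i, ∑ j, (v i * w j) • B (stdVec i) (stdVec j) := by
  rw [clm_apply_eq_sum B v, sum_apply]
  refine Finset.sum_congr rfl fun i _ => ?_
  rw [smul_apply, clm_apply_eq_sum (B (stdVec i)) w, Finset.smul_sum]
  simp only [smul_smul]

/-- In particular the Gram matrix is invertible, so that `sharp` is not a junk value. -/
lemma IsInner.posDef_gramMat {B : EE n →L[ℝ] EE n →L[ℝ] ℝ} (h : IsInner B) :
    (gramMat B).PosDef := by
  refine Matrix.PosDef.of_dotProduct_mulVec_pos ?_ fun v hv => ?_
  · ext i j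
    simp [gramMat_apply, h.symm (stdVec i) (stdVec j)]
  · have h1 : (WithLp.toLp 2 v : EE n) ≠ 0 := by
      intro h0
      apply hv
      have := congrArg (WithLp.ofLp) h0
      simpa using this
    have h2 := h.pos _ h1
    rw [bilin_apply_eq_sum] at h2
    refine h2.trans_eq ?_
    simp only [dotProduct, Matrix.mulVec, gramMat_apply, Finset.mul_sum, smul_eq_mul]
    refine Finset.sum_congr rfl fun i _ => Finset.sum_congr rfl fun j _ => ?_
    change v i * v j * B (stdVec i) (stdVec j) = v i * (B (stdVec i) (stdVec j) * v j)
    ring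

/-- An orthonormal basis of an inner product factorizes the inverse of its Gram matrix. -/
lemma IsInner.exists_orthonormal {B : EE n →L[ℝ] EE n →L[ℝ] ℝ} (h : IsInner B) :
    ∃ q : Fin n → EE n, (∀ k l, B (q k) (q l) = if k = l then 1 else 0) ∧
      ∀ i j, (gramMat B)⁻¹ i j = ∑ k, q k i * q k j := by
  have hP := h.posDef_gramMat
  obtain ⟨Q, hQ⟩ : ∃ Q, (gramMat B)⁻¹ = star Q * Q := by
    open scoped MatrixOrder in
    exact CStarAlgebra.nonneg_iff_eq_star_mul_self.1 hP.inv.posSemidef.nonneg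
  rw [Matrix.star_eq_conjTranspose, Matrix.conjTranspose_eq_transpose_of_trivial] at hQ
  have hdet : IsUnit (gramMat B).det := hP.det_pos.ne'.isUnit
  refine ⟨fun k => WithLp.toLp 2 (Q k), fun k l => ?_, fun i j => ?_⟩
  · have e1 : Q * gramMat B * Q.transpose = 1 := by
      have h1 : Q.transpose * (Q * gramMat B) = 1 := by
        rw [← Matrix.mul_assoc, ← hQ, Matrix.nonsing_inv_mul _ hdet]
      exact mul_eq_one_comm.1 h1
    have e2 := congrFun (congrFun e1 k) l
    rw [Matrix.one_apply] at e2
    rw [← e2, bilin_apply_eq_sum, Matrix.mul_apply]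
    simp only [Matrix.mul_apply, Finset.sum_mul, Matrix.transpose_apply, gramMat_apply, smul_eq_mul]
    rw [Finset.sum_comm]
    refine Finset.sum_congr rfl fun i _ => Finset.sum_congr rfl fun j _ => ?_
    ring
  · rw [hQ, Matrix.mul_apply]
    rfl

lemma IsInner.eq_of_forall {B : EE n →L[ℝ] EE n →L[ℝ] ℝ} (h : IsInner B) {u u' : EE n}
    (huu : ∀ z, B u z = B u' z) : u = u' := by
  by_contra hne
  have := h.pos (u - u') (sub_ne_zero.2 hne)
  have e := huu (u - u')
  rw [map_sub B, sub_apply, e, sub_self] at this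
  exact lt_irrefl _ this

/-- The isomorphism from covectors to vectors given by a nondegenerate bilinear form. -/
def sharp (B : EE n →L[ℝ] EE n →L[ℝ] ℝ) : (EE n →L[ℝ] ℝ) →L[ℝ] EE n :=
  ∑ k, ∑ l, (gramMat B)⁻¹ k l •
    (ContinuousLinearMap.apply ℝ ℝ (stdVec l : EE n)).smulRight (stdVec k : EE n)

lemma sharp_apply (B : EE n →L[ℝ] EE n →L[ℝ] ℝ) (ξ : EE n →L[ℝ] ℝ) :
    sharp B ξ = ∑ k, ∑ l, ((gramMat B)⁻¹ k l * ξ (stdVec l)) • (stdVec k : EE n) := by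
  simp only [sharp, sum_apply, smul_apply, ContinuousLinearMap.smulRight_apply,
    ContinuousLinearMap.apply_apply, smul_smul]

lemma sharp_apply_coord (B : EE n →L[ℝ] EE n →L[ℝ] ℝ) (ξ : EE n →L[ℝ] ℝ) (k : Fin n) :
    sharp B ξ k = ∑ l, (gramMat B)⁻¹ k l * ξ (stdVec l) := by
  rw [sharp_apply]
  simp [stdVec, Finset.sum_apply, Pi.single_apply]

lemma IsInner.apply_sharp {B : EE n →L[ℝ] EE n →L[ℝ] ℝ} (h : IsInner B) (ξ : EE n →L[ℝ] ℝ)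
    (z : EE n) : B (sharp B ξ) z = ξ z := by
  have hdet : IsUnit (gramMat B).det := h.posDef_gramMat.det_pos.ne'.isUnit
  have : B (sharp B ξ) = ξ := by
    refine ContinuousLinearMap.ext fun z => ?_
    rw [clm_apply_eq_sum _ z, clm_apply_eq_sum ξ z]
    refine Finset.sum_congr rfl fun j _ => ?_
    congr 1
    have e1 := Matrix.mul_nonsing_inv _ hdet
    rw [sharp_apply]
    simp only [map_sum, map_smul, sum_apply, smul_apply, smul_eq_mul]
    have e2 : ∀ l, ∑ k, gramMat B j k * (gramMat B)⁻¹ k l = if j = l then 1 else 0 := by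
      intro l
      rw [← Matrix.mul_apply, e1, Matrix.one_apply]
    calc ∑ k, ∑ l, (gramMat B)⁻¹ k l * ξ (stdVec l) * B (stdVec k) (stdVec j)
        = ∑ l, ξ (stdVec l) * ∑ k, gramMat B j k * (gramMat B)⁻¹ k l := by
          rw [Finset.sum_comm]
          refine Finset.sum_congr rfl fun l _ => ?_
          rw [Finset.mul_sum]
          refine Finset.sum_congr rfl fun k _ => ?_
          rw [gramMat_apply, h.symm (stdVec j)]
          ring
      _ = ξ (stdVec j) := by simp [e2]
  rw [this]

/-- The Koszul form `½ (D(v; w, z) + D(w; v, z) - D(z; v, w))` of the derivative `D` of a metric. -/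
def koszul (D : EE n →L[ℝ] EE n →L[ℝ] EE n →L[ℝ] ℝ) : EE n →L[ℝ] EE n →L[ℝ] EE n →L[ℝ] ℝ :=
  (1 / 2 : ℝ) • (D + D.flip - ContinuousLinearMap.comp
    ((ContinuousLinearMap.flipₗᵢ ℝ (EE n) (EE n) ℝ).toContinuousLinearEquiv :
      (EE n →L[ℝ] EE n →L[ℝ] ℝ) →L[ℝ] (EE n →L[ℝ] EE n →L[ℝ] ℝ)) D.flip)

lemma koszul_apply (D : EE n →L[ℝ] EE n →L[ℝ] EE n →L[ℝ] ℝ) (v w z : EE n) :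
    koszul D v w z = (1 / 2 : ℝ) * (D v w z + D w v z - D z v w) := rfl

/-- The Levi-Civita connection coefficients of the metric `H` at `y`, as an `ℝⁿ`-valued bilinear
form. -/
def levi (H : EE n → EE n →L[ℝ] EE n →L[ℝ] ℝ) (y : EE n) : EE n →L[ℝ] EE n →L[ℝ] EE n :=
  (ContinuousLinearMap.compL ℝ (EE n) (EE n →L[ℝ] ℝ) (EE n) (sharp (H y))).comp
    (koszul (fderiv ℝ H y))

lemma levi_apply (H : EE n → EE n →L[ℝ] EE n →L[ℝ] ℝ) (y v w : EE n) :
    levi H y v w = sharp (H y) (koszul (fderiv ℝ H y) v w) := rfl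

/-- The Koszul formula. -/
lemma apply_levi {H : EE n → EE n →L[ℝ] EE n →L[ℝ] ℝ} {y : EE n} (h : IsInner (H y))
    (v w z : EE n) : H y (levi H y v w) z = koszul (fderiv ℝ H y) v w z := by
  rw [levi_apply, h.apply_sharp]

/-- Connection coefficients are bounded if the metric is bounded below and has bounded first
derivatives. -/
lemma norm_levi_le {H : EE n → EE n →L[ℝ] EE n →L[ℝ] ℝ} {y : EE n} (h : IsInner (H y))
    {C D : ℝ} (hC0 : 0 ≤ C) (hD0 : 0 ≤ D)
    (hC : ∀ v, ‖v‖ ^ 2 ≤ C * H y v v) (hD : ‖fderiv ℝ H y‖ ≤ D) : ‖levi H y‖ ≤ 2 * C * D := by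
  refine ContinuousLinearMap.opNorm_le_bound₂ _ (by positivity) fun v w => ?_
  set u := levi H y v w with hu
  have h3 : ∀ a b c : EE n, |fderiv ℝ H y a b c| ≤ D * ‖a‖ * ‖b‖ * ‖c‖ := by
    intro a b c
    calc |fderiv ℝ H y a b c| ≤ ‖fderiv ℝ H y a b‖ * ‖c‖ := (fderiv ℝ H y a b).le_opNorm c
      _ ≤ ‖fderiv ℝ H y a‖ * ‖b‖ * ‖c‖ := by
        gcongr
        exact (fderiv ℝ H y a).le_opNorm b
      _ ≤ ‖fderiv ℝ H y‖ * ‖a‖ * ‖b‖ * ‖c‖ := by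
        gcongr
        exact (fderiv ℝ H y).le_opNorm a
      _ ≤ _ := by gcongr
  have key : ‖u‖ ^ 2 ≤ (2 * C * D * ‖v‖ * ‖w‖) * ‖u‖ := by
    refine (hC u).trans ?_
    have e : H y u u = koszul (fderiv ℝ H y) v w u := apply_levi h v w u
    rw [e, koszul_apply]
    have h1 := abs_le.1 (h3 v w u)
    have h2 := abs_le.1 (h3 w v u)
    have h4 := abs_le.1 (h3 u v w)
    have : (1 / 2 : ℝ) * (fderiv ℝ H y v w u + fderiv ℝ H y w v u - fderiv ℝ H y u v w)
        ≤ 2 * D * ‖v‖ * ‖w‖ * ‖u‖ := by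
      have p : 0 ≤ D * ‖v‖ * ‖w‖ * ‖u‖ := by positivity
      linarith [h1.2, h2.2, h4.1, mul_comm ‖v‖ ‖w‖,
        show D * ‖w‖ * ‖v‖ * ‖u‖ = D * ‖v‖ * ‖w‖ * ‖u‖ by ring,
        show D * ‖u‖ * ‖v‖ * ‖w‖ = D * ‖v‖ * ‖w‖ * ‖u‖ by ring]
    calc _ ≤ C * (2 * D * ‖v‖ * ‖w‖ * ‖u‖) := by gcongr
      _ = _ := by ring
  by_cases hu0 : ‖u‖ = 0
  · rw [hu0]; positivity
  · have : 0 < ‖u‖ := lt_of_le_of_ne (norm_nonneg _) (Ne.symm hu0)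
    nlinarith

/-- The transformation law of the connection coefficients under a change of coordinates. -/
lemma levi_transform {Φ : EE n → EE n} {H H' : EE n → EE n →L[ℝ] EE n →L[ℝ] ℝ} {y : EE n}
    (hΦ : ContDiffAt ℝ ∞ Φ y) (hsurj : Function.Surjective (fderiv ℝ Φ y))
    (hH' : DifferentiableAt ℝ H' (Φ y)) (hI : IsInner (H y)) (hI' : IsInner (H' (Φ y)))
    (hH : H =ᶠ[𝓝 y] fun z => pull₂ (H' (Φ z)) (fderiv ℝ Φ z)) (v w : EE n) :
    fderiv ℝ Φ y (levi H y v w) = levi H' (Φ y) (fderiv ℝ Φ y v) (fderiv ℝ Φ y w)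
      + fderiv ℝ (fderiv ℝ Φ) y v w := by
  have dΦ : HasFDerivAt Φ (fderiv ℝ Φ y) y := (hΦ.differentiableAt (by simp)).hasFDerivAt
  have ddΦ : HasFDerivAt (fderiv ℝ Φ) (fderiv ℝ (fderiv ℝ Φ) y) y := by
    refine DifferentiableAt.hasFDerivAt ?_
    exact (hΦ.fderiv_right (m := 1) (WithTop.coe_le_coe.2 le_top)).differentiableAt (by simp)
  have dH' : HasFDerivAt (fun z => H' (Φ z)) ((fderiv ℝ H' (Φ y)).comp (fderiv ℝ Φ y)) y :=
    hH'.hasFDerivAt.comp y dΦ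
  have hsymm : ∀ a b, fderiv ℝ (fderiv ℝ Φ) y a b = fderiv ℝ (fderiv ℝ Φ) y b a := fun a b =>
    (hΦ.isSymmSndFDerivAt (by
      rw [minSmoothness_of_isRCLikeNormedField]; exact WithTop.coe_le_coe.2 le_top)) a b
  have hI : IsInner (H y) := hI
  have hdiffH : ∀ a b c, fderiv ℝ H y a b c
      = fderiv ℝ H' (Φ y) (fderiv ℝ Φ y a) (fderiv ℝ Φ y b) (fderiv ℝ Φ y c)
        + H' (Φ y) (fderiv ℝ (fderiv ℝ Φ) y a b) (fderiv ℝ Φ y c)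
        + H' (Φ y) (fderiv ℝ Φ y b) (fderiv ℝ (fderiv ℝ Φ) y a c) := by
    intro a b c
    have dP : DifferentiableAt ℝ (fun z => pull₂ (H' (Φ z)) (fderiv ℝ Φ z)) y := by
      have e : (fun z => pull₂ (H' (Φ z)) (fderiv ℝ Φ z)) = fun z =>
          ((ContinuousLinearMap.compL ℝ (EE n) (EE n) (EE n →L[ℝ] ℝ))
            (((ContinuousLinearMap.compL ℝ (EE n) (EE n) ℝ).flip (fderiv ℝ Φ z)).comp
              (H' (Φ z)))) (fderiv ℝ Φ z) := by
        funext z; rfl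
      rw [e]
      refine DifferentiableAt.clm_apply ?_ ddΦ.differentiableAt
      refine (ContinuousLinearMap.differentiableAt _).comp y ?_
      refine DifferentiableAt.clm_comp ?_ dH'.differentiableAt
      exact (ContinuousLinearMap.differentiableAt _).comp y ddΦ.differentiableAt
    have d1 : HasFDerivAt (fun z => pull₂ (H' (Φ z)) (fderiv ℝ Φ z) b c)
        ((fderiv ℝ H y).flip b |>.flip c) y := by
      rw [hH.fderiv_eq]
      exact ((dP.hasFDerivAt.clm_apply (hasFDerivAt_const b y)).clm_apply
        (hasFDerivAt_const c y)).congr_fderiv (by ext; simp)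
    have d2 : HasFDerivAt (fun z => H' (Φ z) (fderiv ℝ Φ z b) (fderiv ℝ Φ z c)) _ y :=
      (dH'.clm_apply (ddΦ.clm_apply (hasFDerivAt_const b y))).clm_apply
        (ddΦ.clm_apply (hasFDerivAt_const c y))
    have e := congrArg (fun L => L a) (d1.unique d2)
    simp only [ContinuousLinearMap.flip_apply] at e
    rw [e]
    simp
    ring
  -- both sides satisfy the Koszul formula of `H'`, and a metric separates vectors
  refine hI'.eq_of_forall fun z' => ?_
  obtain ⟨z, rfl⟩ := hsurj z'
  have e1 : H' (Φ y) (fderiv ℝ Φ y (levi H y v w)) (fderiv ℝ Φ y z) = H y (levi H y v w) z := by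
    rw [hH.eq_of_nhds]; rfl
  rw [e1, apply_levi hI, map_add, add_apply, apply_levi hI', koszul_apply, koszul_apply,
    hdiffH, hdiffH, hdiffH, hsymm w v, hsymm z v, hsymm z w,
    hI'.symm (fderiv ℝ Φ y v) (fderiv ℝ (fderiv ℝ Φ) y w z),
    hI'.symm (fderiv ℝ Φ y w) (fderiv ℝ (fderiv ℝ Φ) y v z)]
  ring

end ScGeom
end

noncomputable section

namespace ScGeom

variable {n : ℕ} {𝕜 : Type*} [RCLike 𝕜]

/-! ### Calculus of weakly differentiable one-forms -/

/-- The contraction `(v, a) ↦ w(Γ(v, a))` of a covector with a vector-valued bilinear form. -/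
def contract (w : EE n →L[ℝ] 𝕜) (Γ : EE n →L[ℝ] EE n →L[ℝ] EE n) : EE n →L[ℝ] EE n →L[ℝ] 𝕜 :=
  (ContinuousLinearMap.compL ℝ (EE n) (EE n) 𝕜 w).comp Γ

@[simp] lemma contract_apply (w : EE n →L[ℝ] 𝕜) (Γ : EE n →L[ℝ] EE n →L[ℝ] EE n) (v a : EE n) :
    contract w Γ v a = w (Γ v a) := rfl

lemma norm_contract_le (w : EE n →L[ℝ] 𝕜) (Γ : EE n →L[ℝ] EE n →L[ℝ] EE n) :
    ‖contract w Γ‖ ≤ ‖w‖ * ‖Γ‖ := by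
  refine ContinuousLinearMap.opNorm_le_bound₂ _ (by positivity) fun v a => ?_
  rw [contract_apply]
  calc ‖w (Γ v a)‖ ≤ ‖w‖ * ‖Γ v a‖ := w.le_opNorm _
    _ ≤ ‖w‖ * (‖Γ‖ * ‖v‖ * ‖a‖) := by gcongr; exact Γ.le_opNorm₂ v a
    _ = _ := by ring

lemma locallyIntegrableOn_apply_continuousOn {F : Type*} [NormedAddCommGroup F] [NormedSpace ℝ F]
    {D : Set (EE n)} (hD : IsOpen D) {u : EE n → EE n →L[ℝ] F}
    (hu : ∀ i, LocallyIntegrableOn (fun y => u y (stdVec i)) D) {A : EE n → EE n}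
    (hA : ContinuousOn A D) : LocallyIntegrableOn (fun y => u y (A y)) D := by
  have e : (fun y => u y (A y)) = fun y => ∑ i, (A y i) • u y (stdVec i) := by
    funext y; exact clm_apply_eq_sum _ _
  rw [e]
  refine locallyIntegrableOn_finsetSum fun i => (hu i).continuousOn_smul hD.isLocallyClosed ?_
  exact (EuclideanSpace.proj (𝕜 := ℝ) i).continuous.comp_continuousOn hA

/-- Raising an index of a continuous covector field with a continuous metric. -/
lemma continuousOn_sharp {D : Set (EE n)} {H : EE n → EE n →L[ℝ] EE n →L[ℝ] ℝ}
    (hH : ContinuousOn H D) (hI : ∀ y ∈ D, IsInner (H y)) {ξ : EE n → EE n →L[ℝ] ℝ}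
    (hξ : ContinuousOn ξ D) : ContinuousOn (fun y => sharp (H y) (ξ y)) D := by
  have hg : ContinuousOn (fun y => gramMat (H y)) D := by
    have h : ∀ i j, ContinuousOn (fun y => H y (stdVec i) (stdVec j)) D := fun i j =>
      (hH.clm_apply continuousOn_const).clm_apply continuousOn_const
    exact continuousOn_pi.2 fun i => continuousOn_pi.2 fun j => h i j
  have hinv : ContinuousOn (fun y => (gramMat (H y))⁻¹) D := by
    intro y hy
    refine ContinuousWithinAt.congr_of_eventuallyEq (f := fun y =>
      ((gramMat (H y)).det)⁻¹ • (gramMat (H y)).adjugate) ?_ ?_ ?_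
    · have h1 : ContinuousWithinAt (fun y => (gramMat (H y)).det) D y :=
        (Continuous.matrix_det
          (continuous_id (X := Matrix (Fin n) (Fin n) ℝ))).continuousAt.comp_continuousWithinAt
          (hg y hy)
      have h2 : ContinuousWithinAt (fun y => (gramMat (H y)).adjugate) D y :=
        (Continuous.matrix_adjugate
          (continuous_id (X := Matrix (Fin n) (Fin n) ℝ))).continuousAt.comp_continuousWithinAt
          (hg y hy)
      exact (h1.inv₀ (hI y hy).posDef_gramMat.det_pos.ne').smul h2
    · exact Filter.Eventually.of_forall fun z => by
        simp only [Matrix.inv_def, Ring.inverse_eq_inv']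
    · simp only [Matrix.inv_def, Ring.inverse_eq_inv']
  simp only [sharp_apply]
  refine continuousOn_finsetSum _ fun k _ => continuousOn_finsetSum _ fun l _ => ?_
  refine ContinuousOn.fun_smul (ContinuousOn.fun_mul ?_ ?_) continuousOn_const
  · exact continuousOn_pi.1 (continuousOn_pi.1 hinv k) l
  · exact hξ.clm_apply continuousOn_const

lemma continuousOn_levi_apply {D : Set (EE n)} (hD : IsOpen D)
    {H : EE n → EE n →L[ℝ] EE n →L[ℝ] ℝ} (hH : ContDiffOn ℝ ∞ H D)
    (hI : ∀ y ∈ D, IsInner (H y)) (v w : EE n) : ContinuousOn (fun y => levi H y v w) D := by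
  simp only [levi_apply]
  refine continuousOn_sharp hH.continuousOn hI ?_
  have hd : ContinuousOn (fderiv ℝ H) D := hH.continuousOn_fderiv_of_isOpen hD (by simp)
  refine continuousOn_clm_apply.2 fun z => ?_
  simp only [koszul_apply]
  refine continuousOn_const.mul (ContinuousOn.sub (ContinuousOn.add ?_ ?_) ?_)
  all_goals exact ((hd.clm_apply continuousOn_const).clm_apply
    continuousOn_const).clm_apply continuousOn_const

lemma IsWeakDeriv₁.congr {D : Set (EE n)} (hD : IsOpen D) {w w' : EE n → EE n →L[ℝ] 𝕜}
    {G G' : EE n → EE n →L[ℝ] EE n →L[ℝ] 𝕜} (h : IsWeakDeriv₁ D w G) (hw : EqOn w w' D)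
    (hG : EqOn G G' D) : IsWeakDeriv₁ D w' G' := fun a =>
  (h a).congr hD (fun y hy => by simp only [hw hy]) (fun y hy => by simp only [hG hy])

lemma IsWeakDeriv₁.mono {D D' : Set (EE n)} {w : EE n → EE n →L[ℝ] 𝕜}
    {G : EE n → EE n →L[ℝ] EE n →L[ℝ] 𝕜} (h : IsWeakDeriv₁ D w G) (hD : D' ⊆ D) :
    IsWeakDeriv₁ D' w G := fun a => (h a).mono hD

lemma IsWeakDeriv₁.zero (D : Set (EE n)) :
    IsWeakDeriv₁ D (fun _ => (0 : EE n →L[ℝ] 𝕜)) (fun _ => 0) := fun _ =>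
  (IsWeakDeriv.zero D : IsWeakDeriv D (fun _ : EE n => (0 : 𝕜)) _)

lemma IsWeakDeriv₁.of_local {D : Set (EE n)} {w : EE n → EE n →L[ℝ] 𝕜}
    {G : EE n → EE n →L[ℝ] EE n →L[ℝ] 𝕜}
    (h : ∀ y ∈ D, ∃ N, IsOpen N ∧ y ∈ N ∧ IsWeakDeriv₁ (D ∩ N) w G) : IsWeakDeriv₁ D w G :=
  fun a => IsWeakDeriv.of_local fun y hy =>
    let ⟨N, hN, hyN, h'⟩ := h y hy
    ⟨N, hN, hyN, h' a⟩

lemma IsWeakDeriv₁.smul {D : Set (EE n)} (hD : IsOpen D) {w : EE n → EE n →L[ℝ] 𝕜}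
    {G : EE n → EE n →L[ℝ] EE n →L[ℝ] 𝕜} (h : IsWeakDeriv₁ D w G) {a : EE n → ℝ}
    (ha : ContDiffOn ℝ ∞ a D) :
    IsWeakDeriv₁ D (fun y => a y • w y) (fun y => a y • G y + (fderiv ℝ a y).smulRight (w y)) := by
  intro b
  refine ((h b).smul hD ha).congr hD (fun y _ => rfl) (fun y _ => ?_)
  ext v
  simp

lemma IsWeakDeriv₁.sum {D : Set (EE n)} (hD : IsOpen D) {ι : Type*} (s : Finset ι)
    {w : ι → EE n → EE n →L[ℝ] 𝕜} {G : ι → EE n → EE n →L[ℝ] EE n →L[ℝ] 𝕜}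
    (h : ∀ i ∈ s, IsWeakDeriv₁ D (w i) (G i)) :
    IsWeakDeriv₁ D (fun y => ∑ i ∈ s, w i y) (fun y => ∑ i ∈ s, G i y) := by
  intro a
  refine (IsWeakDeriv.sum s fun i hi => h i hi a).congr hD (fun y _ => ?_) (fun y _ => ?_)
  · simp only [sum_apply]
  · ext v
    simp only [sum_apply, ContinuousLinearMap.flip_apply]

lemma IsWeakDeriv₁.locInt {D : Set (EE n)} {w : EE n → EE n →L[ℝ] 𝕜}
    {G : EE n → EE n →L[ℝ] EE n →L[ℝ] 𝕜} (h : IsWeakDeriv₁ D w G) (v a : EE n) :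
    LocallyIntegrableOn (fun y => G y v a) D :=
  locallyIntegrableOn_clm_apply (h a).locIntGrad v

/-- Pullback of a weakly differentiable one-form by a diffeomorphism. -/
lemma IsWeakDeriv₁.comp (Φ : OpenPartialHomeomorph (EE n) (EE n))
    (h1 : ContDiffOn ℝ ∞ Φ Φ.source) (h2 : ContDiffOn ℝ ∞ Φ.symm Φ.target)
    {w : EE n → EE n →L[ℝ] 𝕜} {G : EE n → EE n →L[ℝ] EE n →L[ℝ] 𝕜}
    (h : IsWeakDeriv₁ Φ.target w G) :
    IsWeakDeriv₁ Φ.source (fun y => (w (Φ y)).comp (fderiv ℝ Φ y))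
      (fun y => pull₂ (G (Φ y)) (fderiv ℝ Φ y)
        + contract (w (Φ y)) (fderiv ℝ (fderiv ℝ Φ) y)) := by
  intro a
  have hop := Φ.open_source
  have hd : ContDiffOn ℝ ∞ (fderiv ℝ Φ) Φ.source := h1.fderiv_of_isOpen hop (by simp)
  have ha : ∀ k : Fin n, ContDiffOn ℝ ∞ (fun y => fderiv ℝ Φ y a k) Φ.source := fun k =>
    (EuclideanSpace.proj (𝕜 := ℝ) k).contDiff.comp_contDiffOn (hd.clm_apply contDiffOn_const)
  have hs := IsWeakDeriv.sum Finset.univ fun k _ => ((h (stdVec k)).comp Φ h1 h2).smul hop (ha k)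
  refine hs.congr hop (fun y _ => ?_) (fun y hy => ?_)
  · simp only [ContinuousLinearMap.comp_apply]
    exact (clm_apply_eq_sum _ _).symm
  · ext v
    have hdy : HasFDerivAt (fderiv ℝ Φ) (fderiv ℝ (fderiv ℝ Φ) y) y :=
      ((hd.contDiffAt (hop.mem_nhds hy)).differentiableAt (by simp)).hasFDerivAt
    have hk : ∀ k : Fin n, fderiv ℝ (fun y => fderiv ℝ Φ y a k) y v
        = fderiv ℝ (fderiv ℝ Φ) y v a k := by
      intro k
      have := (EuclideanSpace.proj (𝕜 := ℝ) k).hasFDerivAt.comp y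
        (hdy.clm_apply (hasFDerivAt_const a y))
      have e := this.fderiv
      change fderiv ℝ (fun y => fderiv ℝ Φ y a k) y = _ at e
      rw [e]
      simp
    simp only [sum_apply, add_apply, smul_apply, ContinuousLinearMap.comp_apply,
      ContinuousLinearMap.flip_apply, ContinuousLinearMap.smulRight_apply, pull₂_apply,
      contract_apply, hk, Finset.sum_add_distrib]
    congr 1
    · exact (clm_apply_eq_sum _ _).symm
    · exact (clm_apply_eq_sum _ _).symm

/-- Weak differentiability from the integral identities against the coordinate vectors. -/
lemma IsWeakDeriv₁.of_stdVec {D : Set (EE n)} {w : EE n → EE n →L[ℝ] 𝕜}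
    {G : EE n → EE n →L[ℝ] EE n →L[ℝ] 𝕜}
    (hw : ∀ j, LocallyIntegrableOn (fun y => w y (stdVec j)) D)
    (hG : ∀ i j, LocallyIntegrableOn (fun y => G y (stdVec i) (stdVec j)) D)
    (h : ∀ φ, IsTest D φ → ∀ i j, ∫ y, fderiv ℝ φ y (stdVec i) • w y (stdVec j)
      = -∫ y, φ y • G y (stdVec i) (stdVec j)) : IsWeakDeriv₁ D w G := by
  have hj : ∀ j, IsWeakDeriv D (fun y => w y (stdVec j)) (fun y => (G y).flip (stdVec j)) := by
    intro j
    refine ⟨hw j, locallyIntegrableOn_clm_iff.2 fun i => hG i j, fun φ hφ v => ?_⟩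
    have i1 : ∀ i, Integrable fun y => fderiv ℝ φ y (stdVec i) • w y (stdVec j) := fun i =>
      hφ.integrable_fderiv_smul (hw j) _
    have i2 : ∀ i, Integrable fun y => φ y • G y (stdVec i) (stdVec j) := fun i =>
      hφ.integrable_smul (hG i j)
    have e1 : (fun y => fderiv ℝ φ y v • w y (stdVec j))
        = fun y => ∑ i, v i • (fderiv ℝ φ y (stdVec i) • w y (stdVec j)) := by
      funext y
      rw [clm_apply_eq_sum (fderiv ℝ φ y) v, Finset.sum_smul]
      simp only [smul_eq_mul, mul_smul]
    have e2 : (fun y => φ y • (G y).flip (stdVec j) v)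
        = fun y => ∑ i, v i • (φ y • G y (stdVec i) (stdVec j)) := by
      funext y
      rw [clm_apply_eq_sum ((G y).flip (stdVec j)) v, Finset.smul_sum]
      simp only [ContinuousLinearMap.flip_apply, smul_comm (φ y)]
    rw [e1, e2, integral_finsetSum _ fun i _ => (i1 i).fun_smul (v i),
      integral_finsetSum _ fun i _ => (i2 i).fun_smul (v i), ← Finset.sum_neg_distrib]
    refine Finset.sum_congr rfl fun i _ => ?_
    rw [integral_smul, integral_smul, h φ hφ i j, smul_neg]
  intro a
  have := IsWeakDeriv.sum Finset.univ fun j _ => (hj j).const_smul (a j)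
  have e1 : (fun y => w y a) = fun y => ∑ j, a j • w y (stdVec j) := by
    funext y; exact clm_apply_eq_sum _ _
  have e2 : (fun y => (G y).flip a) = fun y => ∑ j, a j • (G y).flip (stdVec j) := by
    funext y; exact clm_apply_eq_sum _ _
  rw [e1, e2]
  exact this

end ScGeom
end

noncomputable section

namespace ScGeom

variable {n : ℕ} {𝕜 : Type*} [RCLike 𝕜]
  {M : Type*} [TopologicalSpace M] [ChartedSpace (EuclideanSpace ℝ (Fin n)) M]

/-! ### Tensors in charts -/

/-- A smooth chart of `M`, not necessarily in the atlas. -/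
structure IsSmoothChart (a : OpenPartialHomeomorph M (EE n)) : Prop where
  smooth : ContMDiffOn (𝓡 n) (𝓡 n) ∞ a a.source
  smooth_symm : ContMDiffOn (𝓡 n) (𝓡 n) ∞ a.symm a.target

lemma isSmoothChart_of_mem_atlas [IsManifold (𝓡 n) ∞ M] {e : OpenPartialHomeomorph M (EE n)}
    (he : e ∈ atlas (EuclideanSpace ℝ (Fin n)) M) : IsSmoothChart e :=
  ⟨contMDiffOn_of_mem_maximalAtlas (IsManifold.subset_maximalAtlas he),
    contMDiffOn_symm_of_mem_maximalAtlas (IsManifold.subset_maximalAtlas he)⟩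

/-- The differential of the inverse of the chart `e`. All tangent spaces of `M` are `ℝⁿ`. -/
def chartD (e : OpenPartialHomeomorph M (EE n)) (y : EE n) : EE n →L[ℝ] EE n :=
  mfderiv (𝓡 n) (𝓡 n) e.symm y

/-- The differential of the chart `e`. -/
def chartDi (e : OpenPartialHomeomorph M (EE n)) (p : M) : EE n →L[ℝ] EE n :=
  mfderiv (𝓡 n) (𝓡 n) e p

/-- The expression of a one-form in the chart `e`. -/
def cu (e : OpenPartialHomeomorph M (EE n)) (u : M → EE n →L[ℝ] 𝕜) (y : EE n) : EE n →L[ℝ] 𝕜 :=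
  (u (e.symm y)).comp (chartD e y)

/-- The expression of a 2-tensor in the chart `e`. -/
def cτ (e : OpenPartialHomeomorph M (EE n)) (τ : M → EE n →L[ℝ] EE n →L[ℝ] 𝕜) (y : EE n) :
    EE n →L[ℝ] EE n →L[ℝ] 𝕜 :=
  pull₂ (τ (e.symm y)) (chartD e y)

lemma IsSmoothChart.hasMFDerivAt_symm {a : OpenPartialHomeomorph M (EE n)} (ha : IsSmoothChart a)
    {y : EE n} (hy : y ∈ a.target) :
    HasMFDerivAt (𝓡 n) (𝓡 n) a.symm y (chartD a y) :=
  ((ha.smooth_symm.contMDiffAt (a.open_target.mem_nhds hy)).mdifferentiableAt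
    (by simp)).hasMFDerivAt

lemma IsSmoothChart.hasMFDerivAt {a : OpenPartialHomeomorph M (EE n)} (ha : IsSmoothChart a)
    {p : M} (hp : p ∈ a.source) :
    HasMFDerivAt (𝓡 n) (𝓡 n) a p (chartDi a p) :=
  ((ha.smooth.contMDiffAt (a.open_source.mem_nhds hp)).mdifferentiableAt
    (by simp)).hasMFDerivAt

lemma IsSmoothChart.chartDi_comp_chartD {a : OpenPartialHomeomorph M (EE n)}
    (ha : IsSmoothChart a) {y : EE n} (hy : y ∈ a.target) :
    (chartDi a (a.symm y)).comp (chartD a y) = ContinuousLinearMap.id ℝ (EE n) := by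
  have h1 := (ha.hasMFDerivAt (a.map_target hy)).comp y (ha.hasMFDerivAt_symm hy)
  have h2 : HasMFDerivAt (𝓡 n) (𝓡 n) (a ∘ a.symm) y (ContinuousLinearMap.id ℝ (EE n)) := by
    refine (hasMFDerivAt_id (I := 𝓡 n) y).congr_of_eventuallyEq ?_
    filter_upwards [a.open_target.mem_nhds hy] with z hz
    exact a.right_inv hz
  exact hasMFDerivAt_unique h1 h2

lemma IsSmoothChart.chartD_comp_chartDi {a : OpenPartialHomeomorph M (EE n)}
    (ha : IsSmoothChart a) {p : M} (hp : p ∈ a.source) :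
    (chartD a (a p)).comp (chartDi a p) = ContinuousLinearMap.id ℝ (EE n) := by
  have h1 := (ha.hasMFDerivAt_symm (a.map_source hp)).comp p (ha.hasMFDerivAt hp)
  have h2 : HasMFDerivAt (𝓡 n) (𝓡 n) (a.symm ∘ a) p (ContinuousLinearMap.id ℝ (EE n)) := by
    refine (hasMFDerivAt_id (I := 𝓡 n) p).congr_of_eventuallyEq ?_
    filter_upwards [a.open_source.mem_nhds hp] with z hz
    exact a.left_inv hz
  exact hasMFDerivAt_unique h1 h2

lemma IsSmoothChart.chartD_injective {a : OpenPartialHomeomorph M (EE n)}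
    (ha : IsSmoothChart a) {y : EE n} (hy : y ∈ a.target) : Function.Injective (chartD a y) :=
  Function.LeftInverse.injective (g := chartDi a (a.symm y)) fun v =>
    congrArg (fun L => L v) (ha.chartDi_comp_chartD hy)

lemma IsSmoothChart.chartD_surjective {a : OpenPartialHomeomorph M (EE n)}
    (ha : IsSmoothChart a) {y : EE n} (hy : y ∈ a.target) : Function.Surjective (chartD a y) := by
  intro v
  have := congrArg (fun L => L v) (ha.chartD_comp_chartDi (a.map_target hy))
  rw [a.right_inv hy] at this
  exact ⟨_, this⟩

/-- The change of coordinates from `a` to `b` over the open set `O`. -/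
def transition (a b : OpenPartialHomeomorph M (EE n)) (O : Set M) (hO : IsOpen O) :
    OpenPartialHomeomorph (EE n) (EE n) :=
  (a.symm.trans b).restrOpen (chartDomain a O) (a.symm.isOpen_inter_preimage hO)

lemma transition_apply (a b : OpenPartialHomeomorph M (EE n)) {O : Set M} (hO : IsOpen O)
    (y : EE n) : transition a b O hO y = b (a.symm y) := rfl

lemma transition_symm_apply (a b : OpenPartialHomeomorph M (EE n)) {O : Set M} (hO : IsOpen O)
    (y : EE n) : (transition a b O hO).symm y = a (b.symm y) := rfl

lemma transition_source (a b : OpenPartialHomeomorph M (EE n)) {O : Set M} (hO : IsOpen O)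
    (hOb : O ⊆ b.source) : (transition a b O hO).source = chartDomain a O := by
  ext y
  simp only [transition, chartDomain, OpenPartialHomeomorph.restrOpen_source,
    OpenPartialHomeomorph.trans_source, OpenPartialHomeomorph.symm_source, mem_inter_iff,
    mem_preimage]
  exact ⟨fun h => h.2, fun h => ⟨⟨h.1, hOb h.2⟩, h⟩⟩

lemma transition_target (a b : OpenPartialHomeomorph M (EE n)) {O : Set M} (hO : IsOpen O)
    (hOa : O ⊆ a.source) (hOb : O ⊆ b.source) :
    (transition a b O hO).target = chartDomain b O := by
  ext z
  constructor
  · intro hz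
    have h1 := (transition a b O hO).map_target hz
    have h2 := (transition a b O hO).right_inv hz
    rw [transition_source a b hO hOb] at h1
    rw [transition_symm_apply] at h1 h2
    rw [transition_apply] at h2
    rw [← h2]
    refine ⟨b.map_source (hOb h1.2), ?_⟩
    rw [mem_preimage, b.left_inv (hOb h1.2)]
    exact h1.2
  · rintro ⟨hz, hzO⟩
    have h1 : a (b.symm z) ∈ (transition a b O hO).source := by
      rw [transition_source a b hO hOb]
      refine ⟨a.map_source (hOa hzO), ?_⟩
      rw [mem_preimage, a.left_inv (hOa hzO)]
      exact hzO
    have := (transition a b O hO).map_source h1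
    rwa [transition_apply, a.left_inv (hOa hzO), b.right_inv hz] at this

lemma contDiffOn_transition {a b : OpenPartialHomeomorph M (EE n)} (ha : IsSmoothChart a)
    (hb : IsSmoothChart b) {O : Set M} (hOb : O ⊆ b.source) :
    ContDiffOn ℝ ∞ (fun y => b (a.symm y)) (chartDomain a O) := by
  rw [← contMDiffOn_iff_contDiffOn]
  exact hb.smooth.comp (ha.smooth_symm.mono inter_subset_left) fun y hy => hOb hy.2

lemma isOpen_chartDomain (a : OpenPartialHomeomorph M (EE n)) {O : Set M} (hO : IsOpen O) :
    IsOpen (chartDomain a O) := a.symm.isOpen_inter_preimage hO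

/-- The chain rule for the coordinate change from `a` to `b`. -/
lemma chartD_eq_comp {a b : OpenPartialHomeomorph M (EE n)} (ha : IsSmoothChart a)
    (hb : IsSmoothChart b) {y : EE n} (hy : y ∈ chartDomain a b.source) :
    chartD a y = (chartD b (b (a.symm y))).comp (fderiv ℝ (fun y => b (a.symm y)) y) := by
  have hop := isOpen_chartDomain a b.open_source
  have h0 : DifferentiableAt ℝ (fun y => b (a.symm y)) y :=
    ((contDiffOn_transition ha hb subset_rfl).contDiffAt (hop.mem_nhds hy)).differentiableAt
      (by simp)
  have h1 := (hb.hasMFDerivAt_symm (b.map_source hy.2)).comp y h0.hasFDerivAt.hasMFDerivAt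
  refine hasMFDerivAt_unique (ha.hasMFDerivAt_symm hy.1) (h1.congr_of_eventuallyEq ?_)
  filter_upwards [hop.mem_nhds hy] with z hz
  exact (b.left_inv hz.2).symm

/-- The transformation law of one-forms. -/
lemma cu_eq_comp {a b : OpenPartialHomeomorph M (EE n)} (ha : IsSmoothChart a)
    (hb : IsSmoothChart b) {y : EE n} (hy : y ∈ chartDomain a b.source) (u : M → EE n →L[ℝ] 𝕜) :
    cu a u y = (cu b u (b (a.symm y))).comp (fderiv ℝ (fun y => b (a.symm y)) y) := by
  rw [cu, cu, chartD_eq_comp ha hb hy, b.left_inv hy.2]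
  rfl

/-- The transformation law of 2-tensors. -/
lemma cτ_eq_pull₂ {a b : OpenPartialHomeomorph M (EE n)} (ha : IsSmoothChart a)
    (hb : IsSmoothChart b) {y : EE n} (hy : y ∈ chartDomain a b.source)
    (τ : M → EE n →L[ℝ] EE n →L[ℝ] 𝕜) :
    cτ a τ y = pull₂ (cτ b τ (b (a.symm y))) (fderiv ℝ (fun y => b (a.symm y)) y) := by
  rw [cτ, cτ, chartD_eq_comp ha hb hy, b.left_inv hy.2]
  rfl

lemma fderiv_transition_surjective {a b : OpenPartialHomeomorph M (EE n)} (ha : IsSmoothChart a)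
    (hb : IsSmoothChart b) {y : EE n} (hy : y ∈ chartDomain a b.source) :
    Function.Surjective (fderiv ℝ (fun y => b (a.symm y)) y) := by
  intro v
  obtain ⟨w, hw⟩ := ha.chartD_surjective hy.1 (chartD b (b (a.symm y)) v)
  refine ⟨w, hb.chartD_injective (b.map_source hy.2) ?_⟩
  rw [← hw, chartD_eq_comp ha hb hy]
  rfl

/-- The cotensor `h` is a smooth Riemannian metric on the open set `O`. -/
structure IsMetricOn (h : M → EE n →L[ℝ] EE n →L[ℝ] ℝ) (O : Set M) : Prop where
  isOpen : IsOpen O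
  inner : ∀ p ∈ O, IsInner (h p)
  smooth : ∀ e, IsSmoothChart e → ContDiffOn ℝ ∞ (cτ e h) (chartDomain e O)

lemma IsMetricOn.inner_chart {h : M → EE n →L[ℝ] EE n →L[ℝ] ℝ} {O : Set M} (hh : IsMetricOn h O)
    {e : OpenPartialHomeomorph M (EE n)} (he : IsSmoothChart e) {y : EE n}
    (hy : y ∈ chartDomain e O) : IsInner (cτ e h y) := by
  refine ⟨fun v w => (hh.inner _ hy.2).symm _ _, fun v hv => (hh.inner _ hy.2).pos _ fun h0 => hv ?_⟩
  exact he.chartD_injective hy.1 (h0.trans (map_zero _).symm)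

/-- The connection coefficients of `h` in the chart `e`. -/
def conn (e : OpenPartialHomeomorph M (EE n)) (h : M → EE n →L[ℝ] EE n →L[ℝ] ℝ) (y : EE n) :
    EE n →L[ℝ] EE n →L[ℝ] EE n := levi (cτ e h) y

/-- The transformation law of the connection coefficients: the inhomogeneous term is the second
derivative of the coordinate change. -/
lemma IsMetricOn.conn_transform {h : M → EE n →L[ℝ] EE n →L[ℝ] ℝ} {O : Set M}
    (hh : IsMetricOn h O) {a b : OpenPartialHomeomorph M (EE n)} (ha : IsSmoothChart a)
    (hb : IsSmoothChart b) {y : EE n} (hy : y ∈ chartDomain a (O ∩ b.source)) (v w : EE n) :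
    fderiv ℝ (fun y => b (a.symm y)) y (conn a h y v w)
      = conn b h (b (a.symm y)) (fderiv ℝ (fun y => b (a.symm y)) y v)
          (fderiv ℝ (fun y => b (a.symm y)) y w)
        + fderiv ℝ (fderiv ℝ (fun y => b (a.symm y))) y v w := by
  have hyb : y ∈ chartDomain a b.source := ⟨hy.1, hy.2.2⟩
  have hya : y ∈ chartDomain a O := ⟨hy.1, hy.2.1⟩
  have hz : b (a.symm y) ∈ chartDomain b O := by
    refine ⟨b.map_source hy.2.2, ?_⟩
    rw [mem_preimage, b.left_inv hy.2.2]
    exact hy.2.1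
  refine levi_transform (Φ := fun y => b (a.symm y)) (H := cτ a h) (H' := cτ b h) ?_ ?_ ?_ ?_ ?_ ?_
    v w
  · exact (contDiffOn_transition ha hb subset_rfl).contDiffAt
      ((isOpen_chartDomain a b.open_source).mem_nhds hyb)
  · exact fderiv_transition_surjective ha hb hyb
  · exact ((hh.smooth b hb).contDiffAt
      ((isOpen_chartDomain b hh.isOpen).mem_nhds hz)).differentiableAt (by simp)
  · exact hh.inner_chart ha hya
  · exact hh.inner_chart hb hz
  · filter_upwards [(isOpen_chartDomain a b.open_source).mem_nhds hyb] with z hz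
    exact cτ_eq_pull₂ ha hb hz h

/-- In the chart `e` the tensor `W` is the weak covariant derivative of `u` over the open set `O`. -/
def IsWeakGradIn (h : M → EE n →L[ℝ] EE n →L[ℝ] ℝ) (e : OpenPartialHomeomorph M (EE n)) (O : Set M)
    (u : M → EE n →L[ℝ] 𝕜) (W : M → EE n →L[ℝ] EE n →L[ℝ] 𝕜) : Prop :=
  IsWeakDeriv₁ (chartDomain e O) (cu e u) (fun y => cτ e W y + contract (cu e u y) (conn e h y))

lemma chartDomain_mono (e : OpenPartialHomeomorph M (EE n)) {O O' : Set M} (h : O ⊆ O') :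
    chartDomain e O ⊆ chartDomain e O' := fun _ hy => ⟨hy.1, h hy.2⟩

lemma IsWeakGradIn.mono {h : M → EE n →L[ℝ] EE n →L[ℝ] ℝ} {e : OpenPartialHomeomorph M (EE n)}
    {O O' : Set M} {u : M → EE n →L[ℝ] 𝕜} {W : M → EE n →L[ℝ] EE n →L[ℝ] 𝕜}
    (hw : IsWeakGradIn h e O u W) (hO : O' ⊆ O) : IsWeakGradIn h e O' u W :=
  IsWeakDeriv₁.mono hw (chartDomain_mono e hO)

/-- Being a weak covariant derivative does not depend on the chart: the second derivatives of the
coordinate change from the chain rule cancel those in `IsMetricOn.conn_transform`. -/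
lemma IsWeakGradIn.change_chart {h : M → EE n →L[ℝ] EE n →L[ℝ] ℝ} {O₀ : Set M}
    (hh : IsMetricOn h O₀) {a b : OpenPartialHomeomorph M (EE n)} (ha : IsSmoothChart a)
    (hb : IsSmoothChart b) {O : Set M} (hO : IsOpen O) (hO₀ : O ⊆ O₀) (hOa : O ⊆ a.source)
    (hOb : O ⊆ b.source) {u : M → EE n →L[ℝ] 𝕜} {W : M → EE n →L[ℝ] EE n →L[ℝ] 𝕜}
    (hw : IsWeakGradIn h b O u W) : IsWeakGradIn h a O u W := by
  have hs := transition_source a b hO hOb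
  have ht := transition_target a b hO hOa hOb
  have h1 : ContDiffOn ℝ ∞ (transition a b O hO) (transition a b O hO).source := by
    rw [hs]; exact contDiffOn_transition ha hb hOb
  have h2 : ContDiffOn ℝ ∞ (transition a b O hO).symm (transition a b O hO).target := by
    rw [ht]; exact contDiffOn_transition hb ha hOa
  have hw' : IsWeakDeriv₁ (transition a b O hO).target (cu b u)
      (fun y => cτ b W y + contract (cu b u y) (conn b h y)) := by
    rw [ht]; exact hw
  have key := IsWeakDeriv₁.comp (transition a b O hO) h1 h2 hw'
  rw [hs] at key
  refine key.congr (isOpen_chartDomain a hO) (fun y hy => ?_) (fun y hy => ?_)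
  · exact (cu_eq_comp ha hb ⟨hy.1, hOb hy.2⟩ u).symm
  · have hyb : y ∈ chartDomain a b.source := ⟨hy.1, hOb hy.2⟩
    have e1 := cu_eq_comp ha hb hyb u
    have e2 := cτ_eq_pull₂ ha hb hyb W
    ext v w
    have e3 := hh.conn_transform ha hb (y := y) ⟨hy.1, hO₀ hy.2, hOb hy.2⟩ v w
    simp only [add_apply, e1, e2, pull₂_apply, contract_apply, ContinuousLinearMap.comp_apply, e3,
      map_add]
    rw [← add_assoc]
    rfl

end ScGeom
end

noncomputable section

namespace ScGeom

variable {n : ℕ} {𝕜 : Type*} [RCLike 𝕜]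
  {M : Type*} [TopologicalSpace M] [ChartedSpace (EuclideanSpace ℝ (Fin n)) M]

/-! ### Smoothness of tensors in charts -/

section Smooth

variable [IsManifold (𝓡 n) ∞ M]

lemma IsSmoothChart.contMDiffOn_coordField {e : OpenPartialHomeomorph M (EE n)}
    (he : IsSmoothChart e) (v : EE n) :
    ContMDiffOn (𝓡 n) (𝓡 n).tangent ∞
      (fun y => (⟨e.symm y, chartD e y v⟩ : TangentBundle (𝓡 n) M)) e.target := by
  have h1 := he.smooth_symm.contMDiffOn_tangentMapWithin (m := ∞) (by simp)
    e.open_target.uniqueMDiffOn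
  have h2 : ContMDiffOn (𝓡 n) (𝓡 n).tangent ∞
      (fun y => (⟨y, v⟩ : TangentBundle (𝓡 n) (EE n))) e.target :=
    contMDiffOn_vectorSpace_iff_contDiffOn.2 contDiffOn_const
  refine (h1.comp h2 fun y hy => hy).congr fun y hy => ?_
  have := tangentMapWithin_eq_tangentMap (p := (⟨y, v⟩ : TangentBundle (𝓡 n) (EE n)))
    (e.open_target.uniqueMDiffOn (I := 𝓡 n) y hy) (he.hasMFDerivAt_symm hy).mdifferentiableAt
  exact this.symm

lemma IsSmoothChart.contDiffOn_cτ {e : OpenPartialHomeomorph M (EE n)} (he : IsSmoothChart e)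
    {h : TwoTensor n M ℝ}
    (hh : ContMDiff (𝓡 n)
      ((𝓡 n).prod 𝓘(ℝ, EuclideanSpace ℝ (Fin n) →L[ℝ] EuclideanSpace ℝ (Fin n) →L[ℝ] ℝ)) ∞
      (fun p : M => Bundle.TotalSpace.mk'
        (EuclideanSpace ℝ (Fin n) →L[ℝ] EuclideanSpace ℝ (Fin n) →L[ℝ] ℝ)
        (E := fun p : M => T n p →L[ℝ] T n p →L[ℝ] ℝ) p (h p))) :
    ContDiffOn ℝ ∞ (cτ e h) e.target := by
  refine contDiffOn_clm_apply.2 fun v => contDiffOn_clm_apply.2 fun w => ?_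
  have key : ContMDiffOn (𝓡 n) ((𝓡 n).prod 𝓘(ℝ, ℝ)) ∞
      (fun y => Bundle.TotalSpace.mk' ℝ (E := Bundle.Trivial M ℝ) (e.symm y)
        (h (e.symm y) (chartD e y v) (chartD e y w))) e.target := by
    apply ContMDiffOn.clm_bundle_apply₂ (F₁ := EuclideanSpace ℝ (Fin n))
      (F₂ := EuclideanSpace ℝ (Fin n))
    · exact hh.comp_contMDiffOn he.smooth_symm
    · exact he.contMDiffOn_coordField v
    · exact he.contMDiffOn_coordField w
  rw [← contMDiffOn_iff_contDiffOn]
  intro y hy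
  have := key y hy
  rw [Bundle.contMDiffWithinAt_totalSpace] at this
  exact this.2

end Smooth

lemma IsSmoothChart.contDiffOn_comp_symm {e : OpenPartialHomeomorph M (EE n)}
    (he : IsSmoothChart e) {f : M → ℝ} {O : Set M} (hf : ContMDiffOn (𝓡 n) 𝓘(ℝ, ℝ) ∞ f O) :
    ContDiffOn ℝ ∞ (fun y => f (e.symm y)) (chartDomain e O) := by
  rw [← contMDiffOn_iff_contDiffOn]
  exact hf.comp (he.smooth_symm.mono inter_subset_left) fun y hy => hy.2

lemma IsSmoothChart.fderiv_comp_symm {e : OpenPartialHomeomorph M (EE n)} (he : IsSmoothChart e)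
    {f : M → ℝ} {y : EE n} (hy : y ∈ e.target)
    (hf : MDifferentiableAt (𝓡 n) 𝓘(ℝ, ℝ) f (e.symm y)) :
    fderiv ℝ (fun y => f (e.symm y)) y
      = ContinuousLinearMap.comp (show EE n →L[ℝ] ℝ from dForm (n := n) f (e.symm y))
        (chartD e y) := by
  have h1 := hf.hasMFDerivAt.comp y (he.hasMFDerivAt_symm hy)
  have h2 : HasFDerivAt (fun y => f (e.symm y)) (ContinuousLinearMap.comp
    (show EE n →L[ℝ] ℝ from dForm (n := n) f (e.symm y)) (chartD e y)) y :=
    hasMFDerivAt_iff_hasFDerivAt.1 h1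
  exact h2.fderiv

section Metrics

variable [IsManifold (𝓡 n) ∞ M]

lemma isMetricOn_univ (g : Bundle.ContMDiffRiemannianMetric (𝓡 n) ∞ (EuclideanSpace ℝ (Fin n))
      (fun p : M => TangentSpace (𝓡 n) p)) : IsMetricOn (n := n) (M := M) g.inner univ := by
  refine ⟨isOpen_univ, fun p _ => ⟨g.symm p, g.pos p⟩, fun e he => ?_⟩
  exact (he.contDiffOn_cτ g.contMDiff).mono inter_subset_left

variable {x : M → ℝ}

/-- The scattering metric in a chart. -/
lemma cτ_form (hx : IsBdf (n := n) x) (gsc : ScMetric n x) {e : OpenPartialHomeomorph M (EE n)}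
    (he : IsSmoothChart e) {y : EE n} (hy : y ∈ e.target) :
    cτ e gsc.form y = ((x (e.symm y)) ^ 4)⁻¹ • (fderiv ℝ (fun z => x (e.symm z)) y).smulRight
      (fderiv ℝ (fun z => x (e.symm z)) y) + ((x (e.symm y)) ^ 2)⁻¹ • cτ e gsc.h y := by
  rw [he.fderiv_comp_symm hy (hx.smooth.mdifferentiable (by simp) _)]
  rfl

lemma isOpen_pos (hx : IsBdf (n := n) x) : IsOpen {p | 0 < x p} :=
  isOpen_lt continuous_const hx.smooth.continuous

/-- A scattering metric is a smooth Riemannian metric on `x > 0`; nothing is claimed at the boundary,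
where its coefficients are singular. -/
lemma isMetricOn_form (hx : IsBdf (n := n) x) (gsc : ScMetric n x) :
    IsMetricOn (n := n) (M := M) gsc.form {p | 0 < x p} := by
  refine ⟨isOpen_pos hx, fun p hp => ⟨fun v w => ?_, gsc.pos_interior p hp⟩, fun e he => ?_⟩
  · have := gsc.symm p v w
    change ((x p) ^ 4)⁻¹ * (dForm x p v * dForm x p w) + ((x p) ^ 2)⁻¹ * gsc.h p v w
      = ((x p) ^ 4)⁻¹ * (dForm x p w * dForm x p v) + ((x p) ^ 2)⁻¹ * gsc.h p w v
    rw [this]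
    ring
  · have hxe : ContDiffOn ℝ ∞ (fun y => x (e.symm y)) (chartDomain e {p | 0 < x p}) :=
      he.contDiffOn_comp_symm hx.smooth.contMDiffOn
    have hd : ContDiffOn ℝ ∞ (fderiv ℝ fun y => x (e.symm y)) (chartDomain e {p | 0 < x p}) :=
      hxe.fderiv_of_isOpen (isOpen_chartDomain e (isOpen_pos hx)) (by simp)
    have hpos : ∀ y ∈ chartDomain e {p | 0 < x p}, x (e.symm y) ≠ 0 := fun y hy => hy.2.ne'
    refine ContDiffOn.congr ?_ fun y hy => cτ_form hx gsc he hy.1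
    have h1 : ContDiffOn ℝ ∞ (fun y => ((x (e.symm y)) ^ 4)⁻¹) (chartDomain e {p | 0 < x p}) :=
      (hxe.pow 4).inv fun y hy => pow_ne_zero 4 (hpos y hy)
    have h2 : ContDiffOn ℝ ∞ (fun y => ((x (e.symm y)) ^ 2)⁻¹) (chartDomain e {p | 0 < x p}) :=
      (hxe.pow 2).inv fun y hy => pow_ne_zero 2 (hpos y hy)
    have h3 : ContDiffOn ℝ ∞ (cτ e gsc.h) (chartDomain e {p | 0 < x p}) :=
      (he.contDiffOn_cτ gsc.smooth).mono inter_subset_left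
    exact (h1.smul (hd.smulRight hd)).add (h2.smul h3)

end Metrics

/-! ### Weak gradients -/

/-- The Christoffel symbols, defined by the classical formula with the inverse Gram matrix, are the
coefficients of `conn`, defined by the Koszul formula. -/
lemma christoffel_eq {e : OpenPartialHomeomorph M (EE n)} {h : TwoTensor n M ℝ} {y : EE n}
    (hd : DifferentiableAt ℝ (cτ e h) y) (k i j : Fin n) :
    christoffel e h k i j y = conn e h y (stdVec i) (stdVec j) k := by
  have hp : ∀ i j l, pderiv i (compTwo e h j l) y
      = fderiv ℝ (cτ e h) y (stdVec i) (stdVec j) (stdVec l) := by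
    intro i j l
    have d1 := (hd.hasFDerivAt.clm_apply (hasFDerivAt_const (stdVec j : EE n) y)).clm_apply
        (hasFDerivAt_const (stdVec l : EE n) y)
    have e1 : HasFDerivAt (compTwo e h j l) _ y := d1
    rw [pderiv, e1.fderiv]
    simp
  change _ = levi (cτ e h) y (stdVec i) (stdVec j) k
  rw [levi_apply, sharp_apply_coord, christoffel, Finset.mul_sum]
  refine Finset.sum_congr rfl fun l _ => ?_
  rw [koszul_apply, hp, hp, hp]
  have : (gram e h y)⁻¹ = (gramMat (cτ e h y))⁻¹ := rfl
  rw [this]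
  ring

/-- The term `Γᵏᵢⱼ wₖ` of a covariant derivative in invariant form. -/
lemma contract_conn_eq {e : OpenPartialHomeomorph M (EE n)} {h : TwoTensor n M ℝ} {y : EE n}
    (hd : DifferentiableAt ℝ (cτ e h) y) (u : OneForm n M 𝕜) (i j : Fin n) :
    ∑ k, christoffel e h k i j y • compOne e u k y
      = contract (cu e u y) (conn e h y) (stdVec i) (stdVec j) := by
  rw [contract_apply, clm_apply_eq_sum (cu e u y)]
  exact Finset.sum_congr rfl fun k _ => by rw [christoffel_eq hd]; rfl

lemma IsMetricOn.differentiableAt {h : M → EE n →L[ℝ] EE n →L[ℝ] ℝ} {O : Set M}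
    (hh : IsMetricOn h O) {e : OpenPartialHomeomorph M (EE n)} (he : IsSmoothChart e) {y : EE n}
    (hy : y ∈ chartDomain e O) : DifferentiableAt ℝ (cτ e h) y :=
  ((hh.smooth e he).contDiffAt ((isOpen_chartDomain e hh.isOpen).mem_nhds hy)).differentiableAt
    (by simp)

/-- The zeroth order terms of a covariant derivative have continuous coefficients. -/
lemma IsMetricOn.locallyIntegrableOn_contract {h : M → EE n →L[ℝ] EE n →L[ℝ] ℝ} {O O' : Set M}
    (hh : IsMetricOn h O') (hO : IsOpen O) (hOO' : O ⊆ O') {e : OpenPartialHomeomorph M (EE n)}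
    (he : IsSmoothChart e) {w : EE n → EE n →L[ℝ] 𝕜}
    (hw : ∀ i, LocallyIntegrableOn (fun y => w y (stdVec i)) (chartDomain e O)) (v a : EE n) :
    LocallyIntegrableOn (fun y => contract (w y) (conn e h y) v a) (chartDomain e O) := by
  refine locallyIntegrableOn_apply_continuousOn (isOpen_chartDomain e hO) hw ?_
  exact (continuousOn_levi_apply (isOpen_chartDomain e hh.isOpen) (hh.smooth e he)
    (fun y hy => hh.inner_chart he hy) v a).mono (chartDomain_mono e hOO')

lemma setIntegral_congr_isTest {D : Set (EE n)} {φ : EE n → ℝ} (hφ : IsTest D φ)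
    {f f' : EE n → 𝕜} (hf : EqOn f f' D) : ∫ y, φ y • f y = ∫ y, φ y • f' y := by
  congr 1
  funext y
  by_cases hy : y ∈ D
  · rw [hf hy]
  · have : φ y = 0 := by
      by_contra h0
      exact hy (hφ.2.2 (subset_tsupport φ h0))
    rw [this, zero_smul, zero_smul]

section Grad

variable [IsManifold (𝓡 n) ∞ M]

/-- A weak covariant derivative, given in terms of the charts of the atlas, is one in every smooth
chart. -/
lemma IsWeakGrad.isWeakGradIn {h : TwoTensor n M ℝ} {O O' : Set M}
    (hh : IsMetricOn (n := n) (M := M) h O') (hO : IsOpen O) (hOO' : O ⊆ O') {u : OneForm n M 𝕜}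
    {W : TwoTensor n M 𝕜} (hw : IsWeakGrad h O u W) {a : OpenPartialHomeomorph M (EE n)}
    (ha : IsSmoothChart a) : IsWeakGradIn (n := n) (M := M) h a O u W := by
  have key : ∀ e ∈ atlas (EuclideanSpace ℝ (Fin n)) M,
      IsWeakGradIn (n := n) (M := M) h e O u W := by
    intro e he
    have hes := isSmoothChart_of_mem_atlas he
    have l1 : ∀ i, LocallyIntegrableOn (fun y => cu e u y (stdVec i)) (chartDomain e O) :=
      hw.1 e he
    refine IsWeakDeriv₁.of_stdVec l1 (fun i j => ?_) fun φ hφ i j => ?_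
    · exact locallyIntegrableOn_add (hw.2.1 e he i j)
        (hh.locallyIntegrableOn_contract hO hOO' hes l1 _ _)
    · refine (hw.2.2 e he φ hφ i j).trans ?_
      congr 1
      refine setIntegral_congr_isTest hφ fun y hy => ?_
      rw [contract_conn_eq (hh.differentiableAt hes (chartDomain_mono e hOO' hy))]
      rfl
  refine IsWeakDeriv₁.of_local fun y hy => ?_
  let e := chartAt (EuclideanSpace ℝ (Fin n)) (a.symm y)
  have he : e ∈ atlas (EuclideanSpace ℝ (Fin n)) M := chart_mem_atlas _ _
  have hye : a.symm y ∈ e.source := mem_chart_source _ _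
  refine ⟨chartDomain a e.source, isOpen_chartDomain a e.open_source, ⟨hy.1, hye⟩, ?_⟩
  have hop : IsOpen (O ∩ (e.source ∩ a.source)) :=
    hO.inter (e.open_source.inter a.open_source)
  have h1 : IsWeakGradIn (n := n) (M := M) h a (O ∩ (e.source ∩ a.source)) u W :=
    IsWeakGradIn.change_chart hh ha (isSmoothChart_of_mem_atlas he) hop
      (inter_subset_left.trans hOO') (fun p hp => hp.2.2) (fun p hp => hp.2.1)
      ((key e he).mono inter_subset_left)
  refine IsWeakDeriv₁.mono h1 ?_
  rintro z ⟨⟨hz, hzO⟩, _, hze⟩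
  exact ⟨hz, hzO, hze, a.map_target hz⟩

/-- A weak covariant derivative may be checked locally, in any smooth charts. -/
lemma isWeakGrad_of_local {h : TwoTensor n M ℝ} {O O' : Set M}
    (hh : IsMetricOn (n := n) (M := M) h O') (hO : IsOpen O) (hOO' : O ⊆ O') {u : OneForm n M 𝕜}
    {W : TwoTensor n M 𝕜}
    (hw : ∀ p ∈ O, ∃ a, IsSmoothChart a ∧ ∃ N, IsOpen N ∧ p ∈ N ∧ N ⊆ a.source ∧
      IsWeakGradIn (n := n) (M := M) h a (O ∩ N) u W) : IsWeakGrad h O u W := by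
  have key : ∀ e, IsSmoothChart e → IsWeakGradIn (n := n) (M := M) h e O u W := by
    intro e he
    refine IsWeakDeriv₁.of_local fun y hy => ?_
    obtain ⟨a, ha, N, hN, hyN, hNa, h1⟩ := hw (e.symm y) hy.2
    refine ⟨chartDomain e N, isOpen_chartDomain e hN, ⟨hy.1, hyN⟩, ?_⟩
    have h2 : IsWeakGradIn (n := n) (M := M) h e (O ∩ (N ∩ e.source)) u W :=
      IsWeakGradIn.change_chart hh he ha (hO.inter (hN.inter e.open_source))
        (inter_subset_left.trans hOO') (fun p hp => hp.2.2) (fun p hp => hNa hp.2.1)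
        (h1.mono fun p hp => ⟨hp.1, hp.2.1⟩)
    refine IsWeakDeriv₁.mono h2 ?_
    rintro z ⟨⟨hz, hzO⟩, _, hze⟩
    exact ⟨hz, hzO, hze, e.map_target hz⟩
  have l1 : ∀ e ∈ atlas (EuclideanSpace ℝ (Fin n)) M, ∀ i,
      LocallyIntegrableOn (fun y => cu e u y (stdVec i)) (chartDomain e O) := fun e he i =>
    (key e (isSmoothChart_of_mem_atlas he) (stdVec i)).locInt
  refine ⟨l1, fun e he i j => ?_, fun e he φ hφ i j => ?_⟩
  · have hes := isSmoothChart_of_mem_atlas he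
    have h1 := (key e hes).locInt (stdVec i) (stdVec j)
    have h2 := hh.locallyIntegrableOn_contract hO hOO' hes (l1 e he) (stdVec i) (stdVec j)
    refine locallyIntegrableOn_congr_eqOn (isOpen_chartDomain e hO)
      (locallyIntegrableOn_add h1 (h2.neg)) fun y _ => ?_
    exact add_neg_cancel_right (cτ e W y (stdVec i) (stdVec j)) _
  · have hes := isSmoothChart_of_mem_atlas he
    refine ((key e hes (stdVec j)).integral_eq φ hφ (stdVec i)).trans ?_
    congr 1
    refine setIntegral_congr_isTest hφ fun y hy => ?_
    rw [contract_conn_eq (hh.differentiableAt hes (chartDomain_mono e hOO' hy))]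
    rfl

/-- A weak symmetric gradient may be computed from the full weak derivatives in charts, when these
exist. -/
lemma isWeakSymGrad_of_chart {h : TwoTensor n M ℝ} {O O' : Set M}
    (hh : IsMetricOn (n := n) (M := M) h O') (hO : IsOpen O) (hOO' : O ⊆ O') {u : OneForm n M 𝕜}
    {S : TwoTensor n M 𝕜}
    (hw : ∀ e ∈ atlas (EuclideanSpace ℝ (Fin n)) M, ∃ G, IsWeakDeriv₁ (chartDomain e O) (cu e u) G ∧
      ∀ y ∈ chartDomain e O, symPart (G y) = cτ e S y + contract (cu e u y) (conn e h y)) :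
    IsWeakSymGrad h O u S := by
  have l1 : ∀ e ∈ atlas (EuclideanSpace ℝ (Fin n)) M, ∀ i,
      LocallyIntegrableOn (fun y => cu e u y (stdVec i)) (chartDomain e O) := by
    intro e he i
    obtain ⟨G, hG, -⟩ := hw e he
    exact (hG (stdVec i)).locInt
  refine ⟨l1, fun e he i j => ?_, fun e he φ hφ i j => ?_⟩
  · have hes := isSmoothChart_of_mem_atlas he
    obtain ⟨G, hG, hS⟩ := hw e he
    have h1 := (locallyIntegrableOn_add (hG.locInt (stdVec i) (stdVec j))
      (hG.locInt (stdVec j) (stdVec i))).smul (1 / 2 : ℝ)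
    have h2 := hh.locallyIntegrableOn_contract hO hOO' hes (l1 e he) (stdVec i) (stdVec j)
    refine locallyIntegrableOn_congr_eqOn (isOpen_chartDomain e hO)
      (locallyIntegrableOn_add h1 (h2.neg)) fun y hy => ?_
    have e1 := congrArg (fun B => B (stdVec i) (stdVec j)) (hS y hy)
    change symPart (G y) (stdVec i) (stdVec j) + -_ = _
    simp only [add_apply] at e1
    rw [e1]
    exact add_neg_cancel_right (cτ e S y (stdVec i) (stdVec j)) _
  · have hes := isSmoothChart_of_mem_atlas he
    obtain ⟨G, hG, hS⟩ := hw e he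
    have a1 := (hG (stdVec j)).integral_eq φ hφ (stdVec i)
    have a2 := (hG (stdVec i)).integral_eq φ hφ (stdVec j)
    have i1 := hφ.integrable_fderiv_smul (hG (stdVec j)).locInt (stdVec i)
    have i2 := hφ.integrable_fderiv_smul (hG (stdVec i)).locInt (stdVec j)
    have i3 := hφ.integrable_smul (hG.locInt (stdVec i) (stdVec j))
    have i4 := hφ.integrable_smul (hG.locInt (stdVec j) (stdVec i))
    calc ∫ y, (1 / 2 : ℝ) • (pderiv i φ y • compOne e u j y + pderiv j φ y • compOne e u i y)
        = (1 / 2 : ℝ) • (-(∫ y, φ y • G y (stdVec i) (stdVec j))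
            + -∫ y, φ y • G y (stdVec j) (stdVec i)) := by
          rw [integral_smul]
          congr 1
          exact (integral_add i1 i2).trans (congrArg₂ (· + ·) a1 a2)
      _ = -∫ y, φ y • symPart (G y) (stdVec i) (stdVec j) := by
          rw [← neg_add, ← integral_add i3 i4, smul_neg, ← integral_smul]
          congr 2
          funext y
          rw [symPart_apply, smul_comm (φ y), smul_add (φ y)]
      _ = _ := by
          congr 1
          refine setIntegral_congr_isTest hφ fun y hy => ?_
          rw [contract_conn_eq (hh.differentiableAt hes (chartDomain_mono e hOO' hy)), hS y hy]
          rfl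

end Grad

end ScGeom
end

noncomputable section

namespace ScGeom

variable {n : ℕ} {𝕜 : Type*} [RCLike 𝕜]
  {M : Type*} [TopologicalSpace M] [ChartedSpace (EuclideanSpace ℝ (Fin n)) M]

/-! ### Fibre norms and volume -/

lemma sum_rotate {ι κ μ : Type*} [Fintype ι] [Fintype κ] [Fintype μ] (f : ι → κ → μ → ℝ) :
    ∑ i, ∑ j, ∑ k, f i j k = ∑ k, ∑ i, ∑ j, f i j k := by
  calc ∑ i, ∑ j, ∑ k, f i j k = ∑ i, ∑ k, ∑ j, f i j k :=
        Finset.sum_congr rfl fun i _ => Finset.sum_comm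
    _ = _ := Finset.sum_comm

/-- `q` is an orthonormal basis for the inner product `B`. -/
structure IsONB (B : EE n →L[ℝ] EE n →L[ℝ] ℝ) (q : Fin n → EE n) : Prop where
  ortho : ∀ k l, B (q k) (q l) = if k = l then 1 else 0
  expand : ∀ v, v = ∑ k, B v (q k) • q k
  inv_gram : ∀ i j, (gramMat B)⁻¹ i j = ∑ k, q k i * q k j

lemma IsInner.exists_isONB {B : EE n →L[ℝ] EE n →L[ℝ] ℝ} (h : IsInner B) : ∃ q, IsONB B q := by
  obtain ⟨q, h1, h2⟩ := h.exists_orthonormal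
  refine ⟨q, h1, fun v => ?_, h2⟩
  have hdet : IsUnit (gramMat B).det := h.posDef_gramMat.det_pos.ne'.isUnit
  ext i
  have e0 : (∑ k, B v (q k) • q k) i = ∑ k, B v (q k) * q k i := by
    simp
  rw [e0]
  have e1 : ∀ a, ∑ b, gramMat B a b * (gramMat B)⁻¹ b i = if a = i then 1 else 0 := by
    intro a
    rw [← Matrix.mul_apply, Matrix.mul_nonsing_inv _ hdet, Matrix.one_apply]
  calc v i = ∑ a, v a * (if a = i then 1 else 0) := by simp
    _ = ∑ a, ∑ b, ∑ k, v a * (gramMat B a b * (q k b * q k i)) := by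
      refine Finset.sum_congr rfl fun a _ => ?_
      rw [← e1 a, Finset.mul_sum]
      refine Finset.sum_congr rfl fun b _ => ?_
      rw [h2, Finset.mul_sum, Finset.mul_sum]
    _ = ∑ k, ∑ a, ∑ b, v a * (gramMat B a b * (q k b * q k i)) :=
      sum_rotate _
    _ = ∑ k, B v (q k) * q k i := by
      refine Finset.sum_congr rfl fun k _ => ?_
      rw [bilin_apply_eq_sum B v (q k), Finset.sum_mul]
      refine Finset.sum_congr rfl fun a _ => ?_
      rw [Finset.sum_mul]
      refine Finset.sum_congr rfl fun b _ => ?_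
      rw [gramMat_apply, smul_eq_mul]
      ring

lemma IsONB.sum_sq {B : EE n →L[ℝ] EE n →L[ℝ] ℝ} {q : Fin n → EE n}
    (hq : IsONB B q) (v : EE n) : ∑ k, (B v (q k)) ^ 2 = B v v := by
  have : B v v = B v (∑ k, B v (q k) • q k) := by rw [← hq.expand v]
  rw [this, map_sum]
  refine Finset.sum_congr rfl fun k _ => ?_
  rw [map_smul, smul_eq_mul]
  ring

lemma re_mul_star (z : 𝕜) : RCLike.re (z * star z) = ‖z‖ ^ 2 := by
  rw [RCLike.star_def, RCLike.mul_conj]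
  norm_cast

/-- A Hermitian form with the real matrix `Qᵀ Q` is a sum of squares. -/
lemma sum_mul_re_mul_star {ι κ : Type*} [Fintype ι] [Fintype κ] (Q : κ → ι → ℝ) (u : ι → 𝕜) :
    ∑ i, ∑ j, (∑ k, Q k i * Q k j) * RCLike.re (u i * star (u j))
      = ∑ k, ‖∑ i, Q k i • u i‖ ^ 2 := by
  have e : ∀ k, ‖∑ i, Q k i • u i‖ ^ 2
      = ∑ i, ∑ j, Q k i * Q k j * RCLike.re (u i * star (u j)) := by
    intro k
    rw [← re_mul_star, star_sum, Finset.sum_mul_sum, map_sum]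
    refine Finset.sum_congr rfl fun i _ => ?_
    rw [map_sum]
    refine Finset.sum_congr rfl fun j _ => ?_
    rw [star_smul, star_trivial, smul_mul_smul_comm, RCLike.smul_re]
  simp_rw [e, Finset.sum_mul]
  exact sum_rotate _

/-- The pointwise norm of a one-form, defined with the inverse Gram matrix, is the sum of the squares
of its values on an orthonormal basis. -/
lemma normSqOne_eq {h : TwoTensor n M ℝ} {p : M} {q : Fin n → EE n} (hq : IsONB (n := n) (h p) q)
    (u : OneForm n M 𝕜) : normSqOne h u p = ∑ k, ‖u p (q k)‖ ^ 2 := by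
  have h1 : ∀ i j, invGram h p i j = ∑ k, q k i * q k j := hq.inv_gram
  have h2 := sum_mul_re_mul_star (fun k i => q k i)
    (fun i => u p (stdVec i : EuclideanSpace ℝ (Fin n)))
  unfold normSqOne
  simp only [h1]
  rw [h2]
  refine Finset.sum_congr rfl fun k _ => ?_
  exact congrArg (fun z => ‖z‖ ^ 2) (clm_apply_eq_sum (F := 𝕜) (u p) (q k)).symm

/-- The pointwise norm of a 2-tensor in terms of an orthonormal basis. -/
lemma normSqTwo_eq {h : TwoTensor n M ℝ} {p : M} {q : Fin n → EE n} (hq : IsONB (n := n) (h p) q)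
    (τ : TwoTensor n M 𝕜) : normSqTwo h τ p = ∑ k, ∑ l, ‖τ p (q k) (q l)‖ ^ 2 := by
  have h1 : ∀ i j, invGram h p i j = ∑ k, q k i * q k j := hq.inv_gram
  have h2 := sum_mul_re_mul_star (fun (k : Fin n × Fin n) (i : Fin n × Fin n) =>
      q k.1 i.1 * q k.2 i.2)
    (fun i => τ p (stdVec i.1 : EuclideanSpace ℝ (Fin n))
      (stdVec i.2 : EuclideanSpace ℝ (Fin n)))
  have h3 : ∀ k l, τ p (q k) (q l) = ∑ i : Fin n × Fin n, (q k i.1 * q l i.2) •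
      τ p (stdVec i.1 : EuclideanSpace ℝ (Fin n)) (stdVec i.2 : EuclideanSpace ℝ (Fin n)) := by
    intro k l
    rw [Fintype.sum_prod_type]
    exact bilin_apply_eq_sum (F := 𝕜) (show EE n →L[ℝ] EE n →L[ℝ] 𝕜 from τ p) (q k) (q l)
  simp only [h3]
  rw [← Fintype.sum_prod_type (f := fun kl : Fin n × Fin n =>
    ‖∑ i : Fin n × Fin n, (q kl.1 i.1 * q kl.2 i.2) •
      τ p (stdVec i.1 : EuclideanSpace ℝ (Fin n)) (stdVec i.2 : EuclideanSpace ℝ (Fin n))‖ ^ 2),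
    ← h2, Fintype.sum_prod_type]
  unfold normSqTwo
  refine Finset.sum_congr rfl fun i _ => Finset.sum_congr rfl fun j _ => ?_
  rw [Fintype.sum_prod_type]
  refine Finset.sum_congr rfl fun a _ => Finset.sum_congr rfl fun b _ => ?_
  congr 1
  rw [h1, h1, Finset.sum_mul_sum, Fintype.sum_prod_type]
  refine Finset.sum_congr rfl fun k _ => Finset.sum_congr rfl fun l _ => ?_
  ring

lemma norm_sum_smul_sq_le {ι : Type*} [Fintype ι] (c : ι → ℝ) (z : ι → 𝕜) :
    ‖∑ i, c i • z i‖ ^ 2 ≤ (∑ i, c i ^ 2) * ∑ i, ‖z i‖ ^ 2 := by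
  have h1 : ‖∑ i, c i • z i‖ ≤ ∑ i, |c i| * ‖z i‖ :=
    (norm_sum_le _ _).trans_eq (Finset.sum_congr rfl fun i _ => by rw [norm_smul, Real.norm_eq_abs])
  calc ‖∑ i, c i • z i‖ ^ 2 ≤ (∑ i, |c i| * ‖z i‖) ^ 2 := by gcongr
    _ ≤ (∑ i, |c i| ^ 2) * ∑ i, ‖z i‖ ^ 2 := Finset.sum_mul_sq_le_sq_mul_sq _ _ _
    _ = _ := by simp only [sq_abs]

/-- Two-sided bounds of a metric by the Euclidean one. -/
structure IsBounded (B : EE n →L[ℝ] EE n →L[ℝ] ℝ) (C : ℝ) : Prop where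
  inner : IsInner B
  lower : ∀ v, ‖v‖ ^ 2 ≤ C * B v v
  upper : ‖B‖ ≤ C

lemma IsBounded.apply_le {B : EE n →L[ℝ] EE n →L[ℝ] ℝ} {C : ℝ} (h : IsBounded B C) (v : EE n) :
    B v v ≤ C * ‖v‖ ^ 2 := by
  calc B v v ≤ ‖B v v‖ := le_abs_self _
    _ ≤ ‖B‖ * ‖v‖ * ‖v‖ := B.le_opNorm₂ v v
    _ ≤ C * ‖v‖ * ‖v‖ := by gcongr; exact h.upper
    _ = _ := by ring

lemma IsBounded.nonneg {B : EE n →L[ℝ] EE n →L[ℝ] ℝ} {C : ℝ} (h : IsBounded B C) : 0 ≤ C :=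
  (norm_nonneg _).trans h.upper

/-- Orthonormal vectors have bounded Euclidean length. -/
lemma IsONB.norm_sq_le {B : EE n →L[ℝ] EE n →L[ℝ] ℝ} {C : ℝ} (h : IsBounded B C)
    {r : Fin n → EE n} (hr : IsONB B r) (k : Fin n) : ‖r k‖ ^ 2 ≤ C := by
  have := h.lower (r k)
  rwa [hr.ortho, if_pos rfl, mul_one] at this

/-- The Euclidean norm of a covector is controlled by its values on an orthonormal basis for `B`. -/
lemma norm_sq_le_sum {B : EE n →L[ℝ] EE n →L[ℝ] ℝ} {C : ℝ} (h : IsBounded B C)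
    {r : Fin n → EE n} (hr : IsONB B r) (w : EE n →L[ℝ] 𝕜) :
    ‖w‖ ^ 2 ≤ C * ∑ k, ‖w (r k)‖ ^ 2 := by
  have hC := h.nonneg
  set s := ∑ k, ‖w (r k)‖ ^ 2 with hs
  have hs0 : 0 ≤ s := Finset.sum_nonneg fun k _ => by positivity
  rw [← Real.le_sqrt (norm_nonneg _) (by positivity)]
  refine ContinuousLinearMap.opNorm_le_bound _ (Real.sqrt_nonneg _) fun v => ?_
  have h1 : ‖w v‖ ^ 2 ≤ (C * ‖v‖ ^ 2) * s := by
    conv_lhs => rw [hr.expand v, map_sum]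
    simp only [map_smul]
    refine (norm_sum_smul_sq_le _ _).trans ?_
    rw [hr.sum_sq]
    gcongr
    exact h.apply_le v
  rw [← Real.sqrt_sq (norm_nonneg v), ← Real.sqrt_mul (by positivity)]
  exact Real.le_sqrt_of_sq_le (h1.trans_eq (by ring))

/-- The Euclidean norm of a bilinear form is controlled by its values on an orthonormal basis for
`B`. -/
lemma norm_sq_le_sum₂ {B : EE n →L[ℝ] EE n →L[ℝ] ℝ} {C : ℝ} (h : IsBounded B C)
    {r : Fin n → EE n} (hr : IsONB B r) (τ : EE n →L[ℝ] EE n →L[ℝ] 𝕜) :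
    ‖τ‖ ^ 2 ≤ C ^ 2 * ∑ k, ∑ l, ‖τ (r k) (r l)‖ ^ 2 := by
  have hC := h.nonneg
  set s := ∑ k, ∑ l, ‖τ (r k) (r l)‖ ^ 2 with hs
  have hs0 : 0 ≤ s := Finset.sum_nonneg fun k _ => Finset.sum_nonneg fun l _ => by positivity
  rw [← Real.le_sqrt (norm_nonneg _) (by positivity)]
  refine ContinuousLinearMap.opNorm_le_bound₂ _ (Real.sqrt_nonneg _) fun v w => ?_
  have h1 : ‖τ v w‖ ^ 2 ≤ (C * ‖v‖ ^ 2) * (C * ‖w‖ ^ 2) * s := by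
    have e : τ v w = ∑ kl : Fin n × Fin n, (B v (r kl.1) * B w (r kl.2)) • τ (r kl.1) (r kl.2) := by
      rw [Fintype.sum_prod_type]
      conv_lhs => rw [hr.expand v, hr.expand w]
      simp only [map_sum, map_smul, sum_apply, smul_apply, Finset.smul_sum, smul_smul]
      rw [Finset.sum_comm]
      refine Finset.sum_congr rfl fun k _ => Finset.sum_congr rfl fun l _ => ?_
      rw [mul_comm]
    rw [e]
    refine (norm_sum_smul_sq_le _ _).trans ?_
    rw [Fintype.sum_prod_type, Fintype.sum_prod_type]
    simp only [mul_pow]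
    rw [← Finset.sum_mul_sum, hr.sum_sq, hr.sum_sq]
    have := h.apply_le v
    have := h.apply_le w
    have : 0 ≤ B w w := by rw [← hr.sum_sq]; positivity
    gcongr
  have e2 : √(C ^ 2 * s) * ‖v‖ * ‖w‖ = √((C * ‖v‖ ^ 2) * (C * ‖w‖ ^ 2) * s) := by
    rw [show (C * ‖v‖ ^ 2) * (C * ‖w‖ ^ 2) * s = (C ^ 2 * s) * (‖v‖ * ‖w‖) ^ 2 by ring,
      Real.sqrt_mul (mul_nonneg (sq_nonneg _) hs0), Real.sqrt_sq (by positivity), mul_assoc]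
  rw [e2]
  exact Real.le_sqrt_of_sq_le h1

section Chart

variable {h : TwoTensor n M ℝ} {e : OpenPartialHomeomorph M (EE n)} {y : EE n} {C : ℝ}

/-- An orthonormal basis of the metric at a point, together with its expression in a chart. -/
lemma exists_isONB_chart (he : IsSmoothChart e) (hy : y ∈ e.target)
    (hI : IsInner (n := n) (h (e.symm y))) :
    ∃ r : Fin n → EE n, IsONB (cτ e h y) r ∧ IsONB (n := n) (h (e.symm y)) fun k => chartD e y (r k) := by
  obtain ⟨q, hq⟩ := hI.exists_isONB
  choose r hr using fun k => he.chartD_surjective hy (q k)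
  have hq' : IsONB (n := n) (h (e.symm y)) fun k => chartD e y (r k) := by simpa only [hr] using hq
  have hI' : IsInner (cτ e h y) := by
    refine ⟨fun v w => hI.symm _ _, fun v hv => hI.pos _ fun h0 => hv ?_⟩
    exact he.chartD_injective hy (h0.trans (map_zero _).symm)
  have ho : ∀ k l, cτ e h y (r k) (r l) = if k = l then 1 else 0 := fun k l => hq'.ortho k l
  have hex : ∀ v, v = ∑ k, cτ e h y v (r k) • r k := by
    intro v
    refine he.chartD_injective hy ?_
    rw [map_sum]
    simp only [map_smul]
    exact hq'.expand _
  refine ⟨r, ⟨ho, hex, fun i j => ?_⟩, hq'⟩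
  have hdet : IsUnit (gramMat (cτ e h y)).det := hI'.posDef_gramMat.det_pos.ne'.isUnit
  have e1 : (gramMat (cτ e h y))⁻¹ = Matrix.of fun i j => ∑ k, r k i * r k j := by
    refine Matrix.inv_eq_right_inv ?_
    ext a i
    rw [Matrix.mul_apply, Matrix.one_apply]
    have e2 := congrArg (fun w : EE n => w i) (hex (stdVec a))
    have e3 : (stdVec a : EE n) i = if a = i then 1 else 0 := by
      simp [stdVec, eq_comm]
    simp only [e3] at e2
    rw [e2]
    have e4 : (∑ k, cτ e h y (stdVec a) (r k) • r k) i = ∑ k, cτ e h y (stdVec a) (r k) * r k i := by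
      simp
    rw [e4]
    have e5 : ∀ k, cτ e h y (stdVec a) (r k) = ∑ b, gramMat (cτ e h y) a b * r k b := by
      intro k
      rw [clm_apply_eq_sum (cτ e h y (stdVec a)) (r k)]
      refine Finset.sum_congr rfl fun b _ => ?_
      rw [gramMat_apply, smul_eq_mul, mul_comm]
    simp only [e5, Matrix.of_apply, Finset.mul_sum, Finset.sum_mul]
    rw [Finset.sum_comm]
    refine Finset.sum_congr rfl fun k _ => Finset.sum_congr rfl fun b _ => ?_
    ring
  rw [e1]
  rfl

/-- In a chart with bounded metric, the pointwise norm of a one-form is controlled by its Euclidean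
norm; `norm_cu_sq_le` is the converse. -/
lemma normSqOne_le (he : IsSmoothChart e) (hy : y ∈ e.target)
    (hI : IsInner (n := n) (h (e.symm y))) (hC : IsBounded (cτ e h y) C) (u : OneForm n M 𝕜) :
    normSqOne h u (e.symm y) ≤ n * C * ‖cu (n := n) (M := M) e u y‖ ^ 2 := by
  obtain ⟨r, hr, hq⟩ := exists_isONB_chart he hy hI
  rw [normSqOne_eq hq]
  calc ∑ k, ‖u (e.symm y) (chartD e y (r k))‖ ^ 2
      ≤ ∑ _k : Fin n, C * ‖cu (n := n) (M := M) e u y‖ ^ 2 := by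
        refine Finset.sum_le_sum fun k _ => ?_
        have h1 : ‖u (e.symm y) (chartD e y (r k))‖ ≤ ‖cu (n := n) (M := M) e u y‖ * ‖r k‖ :=
          (cu (n := n) (M := M) e u y).le_opNorm (r k)
        calc _ ≤ (‖cu (n := n) (M := M) e u y‖ * ‖r k‖) ^ 2 := by gcongr
          _ = ‖r k‖ ^ 2 * ‖cu (n := n) (M := M) e u y‖ ^ 2 := by ring
          _ ≤ _ := by gcongr; exact hr.norm_sq_le hC k
    _ = _ := by simp; ring

lemma norm_cu_sq_le (he : IsSmoothChart e) (hy : y ∈ e.target)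
    (hI : IsInner (n := n) (h (e.symm y))) (hC : IsBounded (cτ e h y) C) (u : OneForm n M 𝕜) :
    ‖cu (n := n) (M := M) e u y‖ ^ 2 ≤ C * normSqOne h u (e.symm y) := by
  obtain ⟨r, hr, hq⟩ := exists_isONB_chart he hy hI
  rw [normSqOne_eq hq]
  exact norm_sq_le_sum hC hr _

/-- In a chart with bounded metric, the pointwise norm of a 2-tensor is controlled by its Euclidean
norm; `norm_cτ_sq_le` is the converse. -/
lemma normSqTwo_le (he : IsSmoothChart e) (hy : y ∈ e.target)
    (hI : IsInner (n := n) (h (e.symm y))) (hC : IsBounded (cτ e h y) C) (τ : TwoTensor n M 𝕜) :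
    normSqTwo h τ (e.symm y) ≤ (n * C) ^ 2 * ‖cτ (n := n) (M := M) e τ y‖ ^ 2 := by
  obtain ⟨r, hr, hq⟩ := exists_isONB_chart he hy hI
  have hC0 := hC.nonneg
  rw [normSqTwo_eq hq]
  calc ∑ k, ∑ l, ‖τ (e.symm y) (chartD e y (r k)) (chartD e y (r l))‖ ^ 2
      ≤ ∑ _k : Fin n, ∑ _l : Fin n, C * C * ‖cτ (n := n) (M := M) e τ y‖ ^ 2 := by
        refine Finset.sum_le_sum fun k _ => Finset.sum_le_sum fun l _ => ?_
        have h1 : ‖τ (e.symm y) (chartD e y (r k)) (chartD e y (r l))‖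
            ≤ ‖cτ (n := n) (M := M) e τ y‖ * ‖r k‖ * ‖r l‖ :=
          (cτ (n := n) (M := M) e τ y).le_opNorm₂ (r k) (r l)
        calc _ ≤ (‖cτ (n := n) (M := M) e τ y‖ * ‖r k‖ * ‖r l‖) ^ 2 := by gcongr
          _ = ‖r k‖ ^ 2 * ‖r l‖ ^ 2 * ‖cτ (n := n) (M := M) e τ y‖ ^ 2 := by ring
          _ ≤ _ := by
            gcongr
            · exact hr.norm_sq_le hC k
            · exact hr.norm_sq_le hC l
    _ = _ := by simp; ring

lemma norm_cτ_sq_le (he : IsSmoothChart e) (hy : y ∈ e.target)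
    (hI : IsInner (n := n) (h (e.symm y))) (hC : IsBounded (cτ e h y) C) (τ : TwoTensor n M 𝕜) :
    ‖cτ (n := n) (M := M) e τ y‖ ^ 2 ≤ C ^ 2 * normSqTwo h τ (e.symm y) := by
  obtain ⟨r, hr, hq⟩ := exists_isONB_chart he hy hI
  rw [normSqTwo_eq hq]
  exact norm_sq_le_sum₂ hC hr _

end Chart

lemma abs_det_le_of_abs_le {A : Matrix (Fin n) (Fin n) ℝ} {K : ℝ} (h : ∀ i j, |A i j| ≤ K) :
    |A.det| ≤ n.factorial * K ^ n := by
  have := Matrix.det_le (abv := IsAbsoluteValue.toAbsoluteValue (abs : ℝ → ℝ)) (A := A) (x := K) h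
  simpa using this

/-- The volume density of a metric is bounded above and below. -/
lemma exists_density_bound (n : ℕ) (C : ℝ) : ∃ K : ℝ≥0, ∀ B : EE n →L[ℝ] EE n →L[ℝ] ℝ, IsBounded B C →
    ENNReal.ofReal (√(gramMat B).det) ≤ K ∧ 1 ≤ K * ENNReal.ofReal (√(gramMat B).det) := by
  refine ⟨Real.toNNReal √(n.factorial * C ^ n) + Real.toNNReal √(n.factorial * (n * C) ^ n),
    fun B hB => ?_⟩
  have hC := hB.nonneg
  have hpos := hB.inner.posDef_gramMat.det_pos
  have h1 : (gramMat B).det ≤ n.factorial * C ^ n := by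
    refine (le_abs_self _).trans (abs_det_le_of_abs_le fun i j => ?_)
    calc |gramMat B i j| ≤ ‖B‖ * ‖(stdVec i : EE n)‖ * ‖(stdVec j : EE n)‖ := B.le_opNorm₂ _ _
      _ ≤ C := by rw [norm_stdVec, norm_stdVec, mul_one, mul_one]; exact hB.upper
  have h2 : ((gramMat B).det)⁻¹ ≤ n.factorial * (n * C) ^ n := by
    obtain ⟨r, hr⟩ := hB.inner.exists_isONB
    have : ((gramMat B).det)⁻¹ = ((gramMat B)⁻¹).det := by
      rw [Matrix.det_nonsing_inv, Ring.inverse_eq_inv']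
    rw [this]
    refine (le_abs_self _).trans (abs_det_le_of_abs_le fun i j => ?_)
    rw [hr.inv_gram]
    calc |∑ k, r k i * r k j| ≤ ∑ k, |r k i * r k j| := Finset.abs_sum_le_sum_abs _ _
      _ ≤ ∑ _k : Fin n, C := by
        refine Finset.sum_le_sum fun k _ => ?_
        rw [abs_mul]
        calc |r k i| * |r k j| ≤ ‖r k‖ * ‖r k‖ := by
              gcongr <;> exact abs_apply_le_norm _ _
          _ ≤ C := by rw [← sq]; exact hr.norm_sq_le hB k
      _ = n * C := by simp
  push_cast
  constructor
  · refine le_add_right ?_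
    exact ENNReal.ofReal_le_ofReal (Real.sqrt_le_sqrt h1)
  · rw [add_mul]
    refine le_add_left ?_
    change 1 ≤ ENNReal.ofReal _ * _
    rw [← ENNReal.ofReal_mul (Real.sqrt_nonneg _), ← Real.sqrt_mul (by positivity),
      ENNReal.one_le_ofReal, Real.one_le_sqrt]
    calc 1 = ((gramMat B).det)⁻¹ * (gramMat B).det := (inv_mul_cancel₀ hpos.ne').symm
      _ ≤ _ := by gcongr

end ScGeom
end

noncomputable section

namespace ScGeom

variable {n : ℕ} {M : Type*} [TopologicalSpace M] [ChartedSpace (EuclideanSpace ℝ (Fin n)) M]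

/-! ### The Riemannian volume in charts -/

lemma det_gramMat_pull₂ (B : EE n →L[ℝ] EE n →L[ℝ] ℝ) (J : EE n →L[ℝ] EE n) :
    (gramMat (pull₂ B J)).det = J.det ^ 2 * (gramMat B).det := by
  set b := (EuclideanSpace.basisFun (Fin n) ℝ).toBasis
  set A := LinearMap.toMatrix b b (J : EE n →ₗ[ℝ] EE n) with hA
  have hAij : ∀ i j, A i j = J (stdVec j) i := by
    intro i j
    rw [hA, LinearMap.toMatrix_apply]
    simp [b, stdVec]
  have hdet : A.det = J.det := LinearMap.det_toMatrix b _
  have e : gramMat (pull₂ B J) = A.transpose * gramMat B * A := by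
    ext i j
    rw [gramMat_apply, pull₂_apply, bilin_apply_eq_sum]
    simp only [Matrix.mul_apply, Finset.sum_mul, Matrix.transpose_apply, hAij, gramMat_apply,
      smul_eq_mul]
    rw [Finset.sum_comm]
    refine Finset.sum_congr rfl fun k _ => Finset.sum_congr rfl fun l _ => ?_
    ring
  rw [e, Matrix.det_mul, Matrix.det_mul, Matrix.det_transpose, hdet]
  ring

/-- The volume density of `h` in the chart `e`. -/
def density (e : OpenPartialHomeomorph M (EE n)) (h : M → EE n →L[ℝ] EE n →L[ℝ] ℝ) (y : EE n) :
    ℝ≥0∞ := ENNReal.ofReal (√(gramMat (cτ e h y)).det)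

variable [MeasurableSpace M] [BorelSpace M]

lemma aemeasurable_symm (e : OpenPartialHomeomorph M (EE n)) (ρ : EE n → ℝ≥0∞) :
    AEMeasurable e.symm ((volume.restrict e.target).withDensity ρ) :=
  (e.continuousOn_symm.aemeasurable e.open_target.measurableSet).mono_ac
    (withDensity_absolutelyContinuous _ _)

lemma measurableSet_chartDomain (e : OpenPartialHomeomorph M (EE n)) {B : Set M}
    (hB : MeasurableSet B) : MeasurableSet (chartDomain e B) := by
  have h1 : Measurable (e.target.domRestrict e.symm) :=
    (continuousOn_iff_continuous_domRestrict.1 e.continuousOn_symm).measurable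
  have h2 := e.open_target.measurableSet.subtype_image (h1 hB)
  convert h2 using 1
  ext y
  constructor
  · rintro ⟨hy, hyB⟩
    exact ⟨⟨y, hy⟩, hyB, rfl⟩
  · rintro ⟨⟨z, hz⟩, hzB, rfl⟩
    exact ⟨hz, hzB⟩

lemma chartVol_apply (h : TwoTensor n M ℝ) (e : OpenPartialHomeomorph M (EE n)) {B : Set M}
    (hB : MeasurableSet B) :
    chartVol h e B = ∫⁻ y in chartDomain e B, density (n := n) (M := M) e h y := by
  have h1 : chartVol h e B = ((volume.restrict e.target).withDensity
      (density (n := n) (M := M) e h)) (e.symm ⁻¹' B) :=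
    Measure.map_apply_of_aemeasurable (aemeasurable_symm e _) hB
  rw [h1, withDensity_apply', Measure.restrict_restrict' e.open_target.measurableSet, inter_comm]
  rfl

lemma chartVol_inter_source (h : TwoTensor n M ℝ) (e : OpenPartialHomeomorph M (EE n)) {B : Set M}
    (hB : MeasurableSet B) : chartVol h e (B ∩ e.source) = chartVol h e B := by
  rw [chartVol_apply h e hB, chartVol_apply h e (hB.inter e.open_source.measurableSet)]
  congr 2
  ext y
  exact ⟨fun hy => ⟨hy.1, hy.2.1⟩, fun hy => ⟨hy.1, hy.2, e.map_target hy.1⟩⟩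

/-- The chart volumes agree on overlaps. -/
lemma chartVol_congr (h : TwoTensor n M ℝ) {a b : OpenPartialHomeomorph M (EE n)}
    (ha : IsSmoothChart a) (hb : IsSmoothChart b) {B : Set M} (hB : MeasurableSet B)
    (hBa : B ⊆ a.source) (hBb : B ⊆ b.source) : chartVol h a B = chartVol h b B := by
  rw [chartVol_apply h a hB, chartVol_apply h b hB]
  have him : (fun y => b (a.symm y)) '' chartDomain a B = chartDomain b B := by
    ext z
    constructor
    · rintro ⟨y, ⟨hy, hyB⟩, rfl⟩
      refine ⟨b.map_source (hBb hyB), ?_⟩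
      change b.symm (b (a.symm y)) ∈ B
      rw [b.left_inv (hBb hyB)]
      exact hyB
    · rintro ⟨hz, hzB⟩
      refine ⟨a (b.symm z), ⟨a.map_source (hBa hzB), ?_⟩, ?_⟩
      · change a.symm (a (b.symm z)) ∈ B
        rw [a.left_inv (hBa hzB)]
        exact hzB
      · change b (a.symm (a (b.symm z))) = z
        rw [a.left_inv (hBa hzB), b.right_inv hz]
  have hinj : InjOn (fun y => b (a.symm y)) (chartDomain a B) := by
    intro y hy z hz hyz
    exact a.symm.injOn hy.1 hz.1 (b.injOn (hBb hy.2) (hBb hz.2) hyz)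
  have hsub : chartDomain a B ⊆ chartDomain a b.source := chartDomain_mono a hBb
  have hd : ∀ y ∈ chartDomain a B, HasFDerivWithinAt (fun y => b (a.symm y))
      (fderiv ℝ (fun y => b (a.symm y)) y) (chartDomain a B) y := fun y hy =>
    (((contDiffOn_transition ha hb subset_rfl).contDiffAt
      ((isOpen_chartDomain a b.open_source).mem_nhds (hsub hy))).differentiableAt
      (by simp)).hasFDerivAt.hasFDerivWithinAt
  rw [← him, lintegral_image_eq_lintegral_abs_det_fderiv_mul volume
    (measurableSet_chartDomain a hB) hd hinj]
  refine setLIntegral_congr_fun (measurableSet_chartDomain a hB) fun y hy => ?_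
  simp only [density]
  rw [← ENNReal.ofReal_mul (abs_nonneg _), cτ_eq_pull₂ (n := n) ha hb (hsub hy) h,
    det_gramMat_pull₂, Real.sqrt_mul (sq_nonneg _), Real.sqrt_sq_eq_abs]

variable [IsManifold (𝓡 n) ∞ M]

/-- One inequality between the volume in a smooth chart and the volume of the manifold, which is a
supremum over the atlas. -/
lemma chartVol_le_vol (h : TwoTensor n M ℝ) {a e : OpenPartialHomeomorph M (EE n)}
    (ha : IsSmoothChart a) (he : e ∈ atlas (EuclideanSpace ℝ (Fin n)) M)
    (hae : a.source ⊆ e.source) : chartVol h a ≤ vol h := by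
  have h1 : chartVol h e ≤ vol h :=
    le_iSup₂ (f := fun e (_ : e ∈ atlas (EuclideanSpace ℝ (Fin n)) M) => chartVol h e) e he
  refine Measure.le_iff.2 fun B hB => ?_
  rw [← chartVol_inter_source h a hB,
    chartVol_congr h ha (isSmoothChart_of_mem_atlas he) (hB.inter a.open_source.measurableSet)
      inter_subset_right (inter_subset_right.trans hae)]
  exact (h1 _).trans (measure_mono inter_subset_left)

/-- On its source, every smooth chart computes the volume, even though the volume is defined as a
supremum of measures and not by a partition of unity. -/
lemma vol_restrict_le_chartVol (h : TwoTensor n M ℝ) {a : OpenPartialHomeomorph M (EE n)}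
    (ha : IsSmoothChart a) : (vol h).restrict a.source ≤ chartVol h a := by
  have ms := a.open_source.measurableSet
  -- each chart volume, hence their supremum, is at most `chartVol h a` plus the volume off the
  -- chart
  have h1 : vol h ≤ chartVol h a + (vol h).restrict a.sourceᶜ := by
    refine iSup₂_le fun e he => Measure.le_iff.2 fun B hB => ?_
    have hes := isSmoothChart_of_mem_atlas he
    have h2 : chartVol h e ≤ vol h :=
      le_iSup₂ (f := fun e (_ : e ∈ atlas (EuclideanSpace ℝ (Fin n)) M) => chartVol h e) e he
    rw [← measure_inter_add_sdiff B ms, Measure.add_apply, Measure.restrict_apply hB]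
    refine add_le_add ?_ (h2 _)
    rw [← chartVol_inter_source h e (hB.inter ms),
      chartVol_congr h hes ha ((hB.inter ms).inter e.open_source.measurableSet)
        inter_subset_right (inter_subset_left.trans inter_subset_right)]
    exact measure_mono (inter_subset_left.trans inter_subset_left)
  refine Measure.le_iff.2 fun B hB => ?_
  rw [Measure.restrict_apply hB]
  refine (h1 _).trans ?_
  rw [Measure.add_apply, Measure.restrict_apply (hB.inter ms), inter_assoc, inter_compl_self,
    inter_empty, measure_empty, add_zero]
  exact measure_mono inter_subset_left

section Integral

variable {h : TwoTensor n M ℝ} {O : Set M} {a : OpenPartialHomeomorph M (EE n)}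

/-- The density being finite and measurable, `f` need not be measurable. -/
lemma lintegral_chartVol_density (hh : IsMetricOn (n := n) (M := M) h O) (ha : IsSmoothChart a)
    (haO : a.source ⊆ O) (f : EE n → ℝ≥0∞) :
    ∫⁻ y, f y ∂((volume.restrict a.target).withDensity (density (n := n) (M := M) a h))
      = ∫⁻ y in a.target, density (n := n) (M := M) a h y * f y := by
  have hsub : a.target ⊆ chartDomain a O := fun y hy => ⟨hy, haO (a.map_target hy)⟩
  have hc : ContinuousOn (fun y => gramMat (cτ (n := n) (M := M) a h y)) a.target := by
    have h1 : ∀ i j, ContinuousOn (fun y => cτ (n := n) (M := M) a h y (stdVec i) (stdVec j))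
        a.target := fun i j =>
      (((hh.smooth a ha).continuousOn.mono hsub).clm_apply continuousOn_const).clm_apply
        continuousOn_const
    exact continuousOn_pi.2 fun i => continuousOn_pi.2 fun j => h1 i j
  have hm : AEMeasurable (density (n := n) (M := M) a h) (volume.restrict a.target) := by
    have h2 : ContinuousOn (fun y => √(gramMat (cτ (n := n) (M := M) a h y)).det) a.target :=
      Real.continuous_sqrt.comp_continuousOn
        ((Continuous.matrix_det (continuous_id (X := Matrix (Fin n) (Fin n) ℝ))).comp_continuousOn
          hc)
    exact (h2.aemeasurable a.open_target.measurableSet).ennreal_ofReal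
  exact lintegral_withDensity_eq_lintegral_mul_non_measurable₀ _ hm
    (Filter.Eventually.of_forall fun _ => ENNReal.ofReal_lt_top) f

/-- Integrals over the source of a chart with density bounded above. Measurability of `f` is not
needed for this direction of the push-forward formula. -/
lemma setLIntegral_vol_le (hh : IsMetricOn (n := n) (M := M) h O) (ha : IsSmoothChart a)
    (haO : a.source ⊆ O) {K : ℝ≥0} (hK : ∀ y ∈ a.target, density (n := n) (M := M) a h y ≤ K)
    (f : M → ℝ≥0∞) :
    ∫⁻ p in a.source, f p ∂vol h ≤ K * ∫⁻ y in a.target, f (a.symm y) := by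
  calc ∫⁻ p in a.source, f p ∂vol h ≤ ∫⁻ p, f p ∂chartVol h a :=
        lintegral_mono' (vol_restrict_le_chartVol h ha) le_rfl
    _ ≤ ∫⁻ y, f (a.symm y)
        ∂((volume.restrict a.target).withDensity (density (n := n) (M := M) a h)) :=
      lintegral_map_le _ _
    _ = ∫⁻ y in a.target, density (n := n) (M := M) a h y * f (a.symm y) :=
      lintegral_chartVol_density hh ha haO _
    _ ≤ ∫⁻ y in a.target, K * f (a.symm y) :=
      setLIntegral_mono' a.open_target.measurableSet fun y hy => by gcongr; exact hK y hy
    _ = _ := lintegral_const_mul' _ _ ENNReal.coe_ne_top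

/-- The converse of `setLIntegral_vol_le` for a density bounded below, again for arbitrary `f`: the
chart pushes the Riemannian volume forward to the weighted Lebesgue measure. -/
lemma setLIntegral_target_le (hh : IsMetricOn (n := n) (M := M) h O) (ha : IsSmoothChart a)
    (haO : a.source ⊆ O) {e : OpenPartialHomeomorph M (EE n)}
    (he : e ∈ atlas (EuclideanSpace ℝ (Fin n)) M) (hae : a.source ⊆ e.source) {K : ℝ≥0}
    (hK : ∀ y ∈ a.target, 1 ≤ K * density (n := n) (M := M) a h y) (f : M → ℝ≥0∞) :
    ∫⁻ y in a.target, f (a.symm y) ≤ K * ∫⁻ p in a.source, f p ∂vol h := by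
  set μ := (volume.restrict a.target).withDensity (density (n := n) (M := M) a h) with hμ
  set ν := chartVol h a with hν
  have ms := a.open_source.measurableSet
  have hνs : ν a.sourceᶜ = 0 := by
    rw [hν, ← chartVol_inter_source h a ms.compl, inter_comm, inter_compl_self, measure_empty]
  have hνr : ν.restrict a.source = ν :=
    Measure.restrict_eq_self_of_ae_mem (by rw [ae_iff]; exact hνs)
  have ma : AEMeasurable a ν := by
    rw [← hνr]; exact a.continuousOn.aemeasurable ms
  have hμν : μ = ν.map a := by
    have h1 : ν.map a = μ.map (a ∘ a.symm) :=
      AEMeasurable.map_map_of_aemeasurable ma (aemeasurable_symm a _)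
    rw [h1]
    have h2 : (a ∘ a.symm) =ᵐ[μ] id := by
      have : ∀ᵐ y ∂(volume.restrict a.target), (a ∘ a.symm) y = id y :=
        (ae_restrict_iff' a.open_target.measurableSet).2
          (Filter.Eventually.of_forall fun y hy => a.right_inv hy)
      exact (withDensity_absolutelyContinuous _ _) this
    rw [Measure.map_congr h2, Measure.map_id]
  calc ∫⁻ y in a.target, f (a.symm y)
      ≤ ∫⁻ y in a.target, K * (density (n := n) (M := M) a h y * f (a.symm y)) :=
        setLIntegral_mono' a.open_target.measurableSet fun y hy => by
          rw [← mul_assoc]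
          calc f (a.symm y) = 1 * f (a.symm y) := (one_mul _).symm
            _ ≤ _ := by gcongr; exact hK y hy
    _ = K * ∫⁻ y, f (a.symm y) ∂μ := by
        rw [lintegral_const_mul' _ _ ENNReal.coe_ne_top, lintegral_chartVol_density hh ha haO]
    _ ≤ K * ∫⁻ p, f (a.symm (a p)) ∂ν := by
        rw [hμν]
        gcongr
        exact lintegral_map_le _ _
    _ = K * ∫⁻ p in a.source, f p ∂ν := by
        congr 1
        rw [← hνr, Measure.restrict_restrict ms, inter_self]
        exact setLIntegral_congr_fun ms fun p hp => by simp only [a.left_inv hp]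
    _ ≤ _ := by
        gcongr
        exact chartVol_le_vol h ha he hae

end Integral

end ScGeom
end

noncomputable section

namespace ScGeom

variable {n : ℕ} {𝕜 : Type*} [RCLike 𝕜]

/-! ### Cutting off and extending in one adapted chart -/

lemma norm_symPart_le (τ : EE n →L[ℝ] EE n →L[ℝ] 𝕜) : ‖symPart τ‖ ≤ ‖τ‖ := by
  refine ContinuousLinearMap.opNorm_le_bound₂ _ (norm_nonneg _) fun v w => ?_
  rw [symPart_apply, norm_smul]
  have h1 := τ.le_opNorm₂ v w
  have h2 := τ.le_opNorm₂ w v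
  have h3 := norm_add_le (τ v w) (τ w v)
  have h4 : ‖τ‖ * ‖w‖ * ‖v‖ = ‖τ‖ * ‖v‖ * ‖w‖ := by ring
  rw [Real.norm_eq_abs, abs_of_pos (by norm_num : (0 : ℝ) < 1 / 2)]
  linarith

lemma symPart_add (τ τ' : EE n →L[ℝ] EE n →L[ℝ] 𝕜) : symPart (τ + τ') = symPart τ + symPart τ' := by
  ext v w
  simp only [symPart_apply, add_apply]
  module

lemma symPart_sub (τ τ' : EE n →L[ℝ] EE n →L[ℝ] 𝕜) : symPart (τ - τ') = symPart τ - symPart τ' := by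
  ext v w
  simp only [symPart_apply, sub_apply]
  module

lemma symPart_smul (c : ℝ) (τ : EE n →L[ℝ] EE n →L[ℝ] 𝕜) : symPart (c • τ) = c • symPart τ := by
  ext v w
  simp only [symPart_apply, smul_apply]
  module

lemma symPart_zero : symPart (0 : EE n →L[ℝ] EE n →L[ℝ] 𝕜) = 0 := by
  ext v w
  simp [symPart_apply]

lemma ofReal_sq_le_of_le {z A s t : ℝ} (hz : 0 ≤ z) (h : z ≤ A * (s + t)) :
    ENNReal.ofReal (z ^ 2)
      ≤ ENNReal.ofReal (2 * A ^ 2) * (ENNReal.ofReal (s ^ 2) + ENNReal.ofReal (t ^ 2)) := by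
  rw [← ENNReal.ofReal_add (sq_nonneg _) (sq_nonneg _), ← ENNReal.ofReal_mul (by positivity)]
  refine ENNReal.ofReal_le_ofReal ?_
  calc z ^ 2 ≤ (A * (s + t)) ^ 2 := by gcongr
    _ = A ^ 2 * (s + t) ^ 2 := by ring
    _ ≤ A ^ 2 * (2 * (s ^ 2 + t ^ 2)) := by
      gcongr
      nlinarith [sq_nonneg (s - t)]
    _ = _ := by ring

/-- A product with a cutoff function, extended by zero, is weakly differentiable on `ℝⁿ` if the
support of the cutoff function is closed in `ℝⁿ`. -/
lemma IsWeakDeriv₁.zeroExtend {D K : Set (EE n)} (hD : IsOpen D) (hK : IsClosed K) (hKD : K ⊆ D)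
    {w : EE n → EE n →L[ℝ] 𝕜} {G : EE n → EE n →L[ℝ] EE n →L[ℝ] 𝕜} (h : IsWeakDeriv₁ D w G)
    {χ : EE n → ℝ} (hχ : ContDiffOn ℝ ∞ χ D) (h0 : ∀ y ∈ D \ K, χ y = 0) :
    IsWeakDeriv₁ univ (D.indicator fun y => χ y • w y)
      (D.indicator fun y => χ y • G y + (fderiv ℝ χ y).smulRight (w y)) := by
  refine IsWeakDeriv₁.of_local fun y _ => ?_
  by_cases hy : y ∈ D
  · refine ⟨D, hD, hy, ?_⟩
    rw [univ_inter]
    refine (h.smul hD hχ).congr hD (fun z hz => ?_) (fun z hz => ?_)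
    · rw [indicator_of_mem hz]
    · rw [indicator_of_mem hz]
  · refine ⟨Kᶜ, hK.isOpen_compl, fun hyK => hy (hKD hyK), ?_⟩
    rw [univ_inter]
    refine (IsWeakDeriv₁.zero Kᶜ).congr hK.isOpen_compl (fun z hz => ?_) (fun z hz => ?_)
    · by_cases hzD : z ∈ D
      · rw [indicator_of_mem hzD, h0 z ⟨hzD, hz⟩, zero_smul]
      · rw [indicator_of_notMem hzD]
    · by_cases hzD : z ∈ D
      · have e : χ =ᶠ[𝓝 z] fun _ => 0 := by
          filter_upwards [(hD.sdiff hK).mem_nhds ⟨hzD, hz⟩] with q hq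
          exact h0 q hq
        have e2 : fderiv ℝ χ z = 0 := by rw [e.fderiv_eq]; simp
        rw [indicator_of_mem hzD, h0 z ⟨hzD, hz⟩, e2, zero_smul, ContinuousLinearMap.zero_smulRight,
          add_zero]
      · rw [indicator_of_notMem hzD]

variable {M : Type*} [TopologicalSpace M] [ChartedSpace (EuclideanSpace ℝ (Fin n)) M]

/-- A chart `a` of `V ∩ P`, with `P` the region on which the metric `h₁` lives, in which `h₁` is
uniformly equivalent to the Euclidean metric, the connection coefficients of `h₁` and `h₂` and the
differential of the weight `φ` are bounded, and in which `Ω` is the half-space `β > 0`. Although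
`a` need not extend to `V`, cutoff functions on `V` look nice in it. -/
structure IsAdaptedChart (P : Set M) (h₁ h₂ : M → EE n →L[ℝ] EE n →L[ℝ] ℝ) (φ : M → ℝ)
    (Ω V : Set M) (a : OpenPartialHomeomorph M (EE n)) (β : EE n →L[ℝ] ℝ) (b : EE n)
    (C : ℝ) : Prop where
  isSmoothChart : IsSmoothChart a
  isOpen : IsOpen V
  source_eq : a.source = V ∩ P
  source_subset : ∃ e ∈ atlas (EuclideanSpace ℝ (Fin n)) M, a.source ⊆ e.source
  apply_vec : β b = 1
  mem_iff : ∀ q ∈ a.source, (q ∈ Ω ↔ 0 < β (a q))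
  bounded : ∀ y ∈ a.target, IsBounded (cτ a h₁ y) C
  conn₁_le : ∀ y ∈ a.target, ‖conn a h₁ y‖ ≤ C
  conn₂_le : ∀ y ∈ a.target, ‖conn a h₂ y‖ ≤ C
  weight_le : ∀ y ∈ a.target, ‖fderiv ℝ (fun z => φ (a.symm z)) y‖ ≤ C
  cutoff_le : ∀ χ : M → ℝ, ContMDiff (𝓡 n) 𝓘(ℝ, ℝ) ∞ χ →
    ∃ C', ∀ y ∈ a.target, ‖fderiv ℝ (fun z => χ (a.symm z)) y‖ ≤ C'
  closed : ∀ K ⊆ V, IsCompact K → IsClosed (a '' (K ∩ P))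

lemma normSqOne_zero (h : TwoTensor n M ℝ) {u : OneForm n M 𝕜} {p : M} (hu : u p = 0) :
    normSqOne h u p = 0 := by
  have h0 : ∀ v : EuclideanSpace ℝ (Fin n), u p v = 0 := fun v => by rw [hu]; rfl
  simp [normSqOne, h0]

lemma normSqTwo_zero (h : TwoTensor n M ℝ) {τ : TwoTensor n M 𝕜} {p : M} (hτ : τ p = 0) :
    normSqTwo h τ p = 0 := by
  have h0 : ∀ v w : EuclideanSpace ℝ (Fin n), τ p v w = 0 := fun v w => by rw [hτ]; rfl
  simp [normSqTwo, h0]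

variable [MeasurableSpace M] [BorelSpace M] [IsManifold (𝓡 n) ∞ M]

section Norms

variable {P : Set M} {h₁ h₂ : TwoTensor n M ℝ} {φ : M → ℝ} {Ω V : Set M}
  {a : OpenPartialHomeomorph M (EE n)} {β : EE n →L[ℝ] ℝ} {b : EE n} {C : ℝ}

lemma IsAdaptedChart.source_subset_left (ha : IsAdaptedChart (n := n) (M := M) P h₁ h₂ φ Ω V a β b C) :
    a.source ⊆ P := ha.source_eq ▸ inter_subset_right

lemma IsAdaptedChart.chartDomain_eq (ha : IsAdaptedChart (n := n) (M := M) P h₁ h₂ φ Ω V a β b C) :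
    chartDomain a P = a.target := by
  ext y
  exact ⟨fun hy => hy.1, fun hy => ⟨hy, ha.source_subset_left (a.map_target hy)⟩⟩

/-- In an adapted chart, the Riemannian volume of `h₁` is comparable to Lebesgue measure. -/
lemma IsAdaptedChart.exists_lintegral_le (ha : IsAdaptedChart (n := n) (M := M) P h₁ h₂ φ Ω V a β b C)
    (hh : IsMetricOn (n := n) (M := M) h₁ P) :
    ∃ K : ℝ≥0, (∀ f : M → ℝ≥0∞, ∫⁻ p in a.source, f p ∂vol h₁
        ≤ K * ∫⁻ y in a.target, f (a.symm y)) ∧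
      ∀ f : M → ℝ≥0∞, ∫⁻ y in a.target, f (a.symm y) ≤ K * ∫⁻ p in a.source, f p ∂vol h₁ := by
  obtain ⟨K, hK⟩ := exists_density_bound n C
  obtain ⟨e, he, hae⟩ := ha.source_subset
  exact ⟨K, setLIntegral_vol_le hh ha.isSmoothChart ha.source_subset_left
      fun y hy => (hK _ (ha.bounded y hy)).1,
    setLIntegral_target_le hh ha.isSmoothChart ha.source_subset_left he hae
      fun y hy => (hK _ (ha.bounded y hy)).2⟩

lemma IsAdaptedChart.inner (ha : IsAdaptedChart (n := n) (M := M) P h₁ h₂ φ Ω V a β b C)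
    (hh : IsMetricOn (n := n) (M := M) h₁ P) {y : EE n} (hy : y ∈ a.target) :
    IsInner (n := n) (h₁ (a.symm y)) :=
  hh.inner _ (ha.source_subset_left (a.map_target hy))

end Norms

end ScGeom
end

noncomputable section

namespace ScGeom

variable {n : ℕ} {𝕜 : Type*} [RCLike 𝕜]
variable {M : Type*} [TopologicalSpace M] [ChartedSpace (EuclideanSpace ℝ (Fin n)) M]

open scoped Classical in
/-- The one-form on `M` with coordinate expression `w` in the chart `a`, zero outside the chart. -/
def chartForm (a : OpenPartialHomeomorph M (EE n)) (w : EE n → EE n →L[ℝ] 𝕜) (p : M) :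
    EE n →L[ℝ] 𝕜 :=
  if p ∈ a.source then (w (a p)).comp (chartDi a p) else 0

open scoped Classical in
/-- The 2-tensor on `M` with coordinate expression `G` in the chart `a`, zero outside the chart. -/
def chartTensor (a : OpenPartialHomeomorph M (EE n)) (G : EE n → EE n →L[ℝ] EE n →L[ℝ] 𝕜) (p : M) :
    EE n →L[ℝ] EE n →L[ℝ] 𝕜 :=
  if p ∈ a.source then pull₂ (G (a p)) (chartDi a p) else 0

lemma cu_chartForm {a : OpenPartialHomeomorph M (EE n)} (ha : IsSmoothChart a)
    (w : EE n → EE n →L[ℝ] 𝕜) {y : EE n} (hy : y ∈ a.target) : cu a (chartForm a w) y = w y := by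
  rw [cu, chartForm, if_pos (a.map_target hy), a.right_inv hy, ContinuousLinearMap.comp_assoc,
    ha.chartDi_comp_chartD hy, ContinuousLinearMap.comp_id]

lemma cτ_chartTensor {a : OpenPartialHomeomorph M (EE n)} (ha : IsSmoothChart a)
    (G : EE n → EE n →L[ℝ] EE n →L[ℝ] 𝕜) {y : EE n} (hy : y ∈ a.target) :
    cτ a (chartTensor a G) y = G y := by
  have h1 : ∀ v, chartDi a (a.symm y) (chartD a y v) = v := fun v =>
    congrArg (fun L => L v) (ha.chartDi_comp_chartD hy)
  rw [cτ, chartTensor, if_pos (a.map_target hy), a.right_inv hy]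
  ext v w
  simp only [pull₂_apply, h1]

/-- A one-form is recovered from its expression in a chart. -/
lemma cu_comp_chartDi {a : OpenPartialHomeomorph M (EE n)} (ha : IsSmoothChart a)
    (u : M → EE n →L[ℝ] 𝕜) {p : M} (hp : p ∈ a.source) :
    (cu a u (a p)).comp (chartDi a p) = u p := by
  rw [cu, a.left_inv hp, ContinuousLinearMap.comp_assoc, ha.chartD_comp_chartDi hp,
    ContinuousLinearMap.comp_id]

variable [MeasurableSpace M] [BorelSpace M] [IsManifold (𝓡 n) ∞ M]

section Chart

variable {P : Set M} {h₁ h₂ : TwoTensor n M ℝ} {φ : M → ℝ} {Ω V : Set M}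
  {a : OpenPartialHomeomorph M (EE n)} {β : EE n →L[ℝ] ℝ} {b : EE n} {C : ℝ}

/-- The gradient, in an adapted chart, of a one-form with a cutoff factor. -/
def cutoffGrad (a : OpenPartialHomeomorph M (EE n)) (h₁ : M → EE n →L[ℝ] EE n →L[ℝ] ℝ) (ψ : M → ℝ)
    (w : EE n → EE n →L[ℝ] 𝕜) (G : EE n → EE n →L[ℝ] EE n →L[ℝ] 𝕜) (y : EE n) :
    EE n →L[ℝ] EE n →L[ℝ] 𝕜 :=
  ψ (a.symm y) • G y + (fderiv ℝ (fun z => ψ (a.symm z)) y).smulRight (w y)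
    - contract (ψ (a.symm y) • w y) (conn a h₁ y)

lemma eq_zero_of_notMem_tsupport {ψ : M → ℝ} {p : M} (hp : p ∉ tsupport ψ) : ψ p = 0 := by
  by_contra h
  exact hp (subset_tsupport ψ h)

lemma fderiv_comp_symm_eq_zero {ψ : M → ℝ} {y : EE n} (hy : y ∈ a.target)
    (hp : a.symm y ∉ tsupport ψ) : fderiv ℝ (fun z => ψ (a.symm z)) y = 0 := by
  have e : (fun z => ψ (a.symm z)) =ᶠ[𝓝 y] fun _ => 0 := by
    have hopen := isOpen_chartDomain a (isClosed_tsupport ψ).isOpen_compl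
    filter_upwards [hopen.mem_nhds ⟨hy, hp⟩] with z hz
    exact eq_zero_of_notMem_tsupport hz.2
  rw [e.fderiv_eq]
  simp

/-- A one-form on `ℝⁿ`, cut off in an adapted chart, is a weakly differentiable one-form on all of
`P`: near points of `P` outside the chart it vanishes. -/
lemma isWeakGrad_chartForm (ha : IsAdaptedChart (n := n) (M := M) P h₁ h₂ φ Ω V a β b C)
    (hh : IsMetricOn (n := n) (M := M) h₁ P) {ψ : M → ℝ} (hψ : ContMDiff (𝓡 n) 𝓘(ℝ, ℝ) ∞ ψ)
    (hψV : tsupport ψ ⊆ V) {w : EE n → EE n →L[ℝ] 𝕜} {G : EE n → EE n →L[ℝ] EE n →L[ℝ] 𝕜}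
    (hw : IsWeakDeriv₁ univ w G) :
    IsWeakGrad (n := n) (M := M) h₁ P (chartForm a fun y => ψ (a.symm y) • w y)
      (chartTensor a (cutoffGrad (n := n) (M := M) a h₁ ψ w G)) := by
  have has := ha.isSmoothChart
  refine isWeakGrad_of_local (n := n) (M := M) (𝕜 := 𝕜) hh hh.isOpen subset_rfl fun p hp => ?_
  by_cases hpa : p ∈ a.source
  · refine ⟨a, has, a.source, a.open_source, hpa, subset_rfl, ?_⟩
    have hD : chartDomain a (P ∩ a.source) ⊆ a.target := fun y hy => hy.1
    have hop : IsOpen (chartDomain a (P ∩ a.source)) :=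
      isOpen_chartDomain a (hh.isOpen.inter a.open_source)
    have hψa : ContDiffOn ℝ ∞ (fun y => ψ (a.symm y)) (chartDomain a (P ∩ a.source)) :=
      has.contDiffOn_comp_symm hψ.contMDiffOn
    refine ((hw.mono (subset_univ _)).smul hop hψa).congr hop (fun y hy => ?_) (fun y hy => ?_)
    · exact (cu_chartForm has (fun y => ψ (a.symm y) • w y) (hD hy)).symm
    · simp only [cu_chartForm (𝕜 := 𝕜) has _ (hD hy), cτ_chartTensor (𝕜 := 𝕜) has _ (hD hy), cutoffGrad]
      exact (sub_add_cancel _ _).symm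
  · let e := chartAt (EuclideanSpace ℝ (Fin n)) p
    have he : IsSmoothChart (n := n) e := isSmoothChart_of_mem_atlas (chart_mem_atlas _ _)
    have hpψ : p ∉ tsupport ψ := fun h => hpa (ha.source_eq ▸ ⟨hψV h, hp⟩)
    refine ⟨e, he, e.source ∩ (tsupport ψ)ᶜ,
      e.open_source.inter (isClosed_tsupport ψ).isOpen_compl, ⟨mem_chart_source _ _, hpψ⟩,
      inter_subset_left, ?_⟩
    have hU : ∀ q, q ∉ tsupport ψ → chartForm (n := n) a (fun y => ψ (a.symm y) • w y) q = 0 := by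
      intro q hq
      rw [chartForm]
      split_ifs with hqa
      · rw [a.left_inv hqa, eq_zero_of_notMem_tsupport hq, zero_smul,
          ContinuousLinearMap.zero_comp]
      · rfl
    have hW : ∀ q, q ∉ tsupport ψ →
        chartTensor (n := n) a (cutoffGrad (n := n) (M := M) a h₁ ψ w G) q = 0 := by
      intro q hq
      rw [chartTensor]
      split_ifs with hqa
      · have e1 : fderiv ℝ (fun z => ψ (a.symm z)) (a q) = 0 :=
          fderiv_comp_symm_eq_zero (a.map_source hqa) (by rwa [a.left_inv hqa])
        ext v z
        simp [cutoffGrad, e1, a.left_inv hqa, eq_zero_of_notMem_tsupport hq]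
      · rfl
    have hop : IsOpen (chartDomain e (P ∩ (e.source ∩ (tsupport ψ)ᶜ))) :=
      isOpen_chartDomain e (hh.isOpen.inter
        (e.open_source.inter (isClosed_tsupport ψ).isOpen_compl))
    refine (IsWeakDeriv₁.zero _).congr hop (fun y hy => ?_) (fun y hy => ?_)
    · rw [cu, hU _ hy.2.2.2, ContinuousLinearMap.zero_comp]
    · ext v z
      simp [cu, cτ, hU _ hy.2.2.2, hW _ hy.2.2.2]

/-- Every almost everywhere measurable function has a measurable majorant with the same
integral. -/
lemma exists_measurable_majorant {f : EE n → ℝ≥0∞} (hf : AEMeasurable f) :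
    ∃ g, Measurable g ∧ (∀ y, f y ≤ g y) ∧ ∫⁻ y, g y = ∫⁻ y, f y := by
  obtain ⟨N, hN, mN, hN0⟩ := exists_measurable_superset_of_null (ae_iff.1 hf.ae_eq_mk)
  refine ⟨fun y => hf.mk f y + N.indicator (fun _ => ⊤) y,
    hf.measurable_mk.add (measurable_const.indicator mN), fun y => ?_, ?_⟩
  · change f y ≤ hf.mk f y + N.indicator (fun _ => ⊤) y
    by_cases hy : y ∈ N
    · rw [indicator_of_mem hy, add_top]
      exact le_top
    · rw [indicator_of_notMem hy, add_zero]
      have : ¬¬f y = hf.mk f y := fun h => hy (hN h)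
      exact (not_not.1 this).le
  · rw [lintegral_add_left hf.measurable_mk, lintegral_indicator_const mN, hN0, mul_zero, add_zero]
    exact (lintegral_congr_ae hf.ae_eq_mk).symm

/-- Functions on `M` that are bounded in an adapted chart by an integrable function have a
measurable integrable majorant. -/
lemma IsAdaptedChart.exists_majorant (ha : IsAdaptedChart (n := n) (M := M) P h₁ h₂ φ Ω V a β b C)
    (hh : IsMetricOn (n := n) (M := M) h₁ P) :
    ∃ K : ℝ≥0, ∀ (c : ℝ≥0) (f : EE n → ℝ≥0∞) (N : M → ℝ≥0∞), AEMeasurable f →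
      (∀ p ∉ a.source, N p = 0) → (∀ y ∈ a.target, N (a.symm y) ≤ c * f y) →
      ∃ m : M → ℝ≥0∞, Measurable m ∧ (∀ p, N p ≤ m p) ∧
        ∫⁻ p in P, m p ∂vol h₁ ≤ K * c * ∫⁻ y, f y := by
  classical
  obtain ⟨K, hK, -⟩ := ha.exists_lintegral_le hh
  refine ⟨K, fun c f N hf hN0 hN => ?_⟩
  obtain ⟨g, mg, hfg, hg⟩ := exists_measurable_majorant hf
  have ms : MeasurableSet a.source := a.open_source.measurableSet
  set a' : M → EE n := a.source.piecewise a (fun _ => 0)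
  have ma' : Measurable a' := a.continuousOn.measurable_piecewise continuousOn_const ms
  have ha' : ∀ p ∈ a.source, a' p = a p := fun p hp => piecewise_eq_of_mem _ _ _ hp
  refine ⟨a.source.indicator fun p => c * g (a' p), ((mg.comp ma').const_mul _).indicator ms,
    fun p => ?_, ?_⟩
  · by_cases hp : p ∈ a.source
    · rw [indicator_of_mem hp, ha' p hp]
      have h1 := hN _ (a.map_source hp)
      rw [a.left_inv hp] at h1
      exact h1.trans (by gcongr; exact hfg _)
    · rw [hN0 p hp]
      exact zero_le
  · calc ∫⁻ p in P, a.source.indicator (fun p => c * g (a' p)) p ∂vol h₁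
        ≤ ∫⁻ p, a.source.indicator (fun p => c * g (a' p)) p ∂vol h₁ :=
          setLIntegral_le_lintegral _ _
      _ = ∫⁻ p in a.source, c * g (a' p) ∂vol h₁ := lintegral_indicator ms _
      _ ≤ K * ∫⁻ y in a.target, c * g (a' (a.symm y)) := hK _
      _ = K * ∫⁻ y in a.target, c * g y := by
          congr 1
          refine setLIntegral_congr_fun a.open_target.measurableSet fun y hy => ?_
          simp only [ha' _ (a.map_target hy), a.right_inv hy]
      _ ≤ K * ∫⁻ y, c * g y := by gcongr; exact Measure.restrict_le_self
      _ = K * c * ∫⁻ y, f y := by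
          rw [lintegral_const_mul' _ _ ENNReal.coe_ne_top, hg, mul_assoc]

/-- The squared pointwise norms of a one-form transplanted from an adapted chart, and of its
covariant derivative, are controlled by the `H¹` norm on `ℝⁿ`. Measurable majorants replace the
norms themselves, whose integrals could fail to be additive. -/
lemma exists_majorant_chartForm
    (ha : IsAdaptedChart (n := n) (M := M) P h₁ h₂ φ Ω V a β b C)
    (hh : IsMetricOn (n := n) (M := M) h₁ P) {ψ : M → ℝ} (hψ : ContMDiff (𝓡 n) 𝓘(ℝ, ℝ) ∞ ψ)
    {B : ℝ} (hB : ∀ p, |ψ p| ≤ B) :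
    ∃ K : ℝ≥0, ∀ (w : EE n → EE n →L[ℝ] 𝕜) (G : EE n → EE n →L[ℝ] EE n →L[ℝ] 𝕜),
      (AEMeasurable fun y => ENNReal.ofReal (‖w y‖ ^ 2)) →
      (AEMeasurable fun y => ENNReal.ofReal (‖G y‖ ^ 2)) →
      (∃ m : M → ℝ≥0∞, Measurable m ∧ (∀ p, ENNReal.ofReal (normSqOne h₁
          (chartForm (n := n) a fun y => ψ (a.symm y) • w y) p) ≤ m p) ∧
        ∫⁻ p in P, m p ∂vol h₁ ≤ K * ∫⁻ y, ENNReal.ofReal (‖w y‖ ^ 2)) ∧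
      ∃ m : M → ℝ≥0∞, Measurable m ∧ (∀ p, ENNReal.ofReal (normSqTwo h₁
          (chartTensor a (cutoffGrad (n := n) (M := M) a h₁ ψ w G)) p) ≤ m p) ∧
        ∫⁻ p in P, m p ∂vol h₁
          ≤ K * ∫⁻ y, (ENNReal.ofReal (‖G y‖ ^ 2) + ENNReal.ofReal (‖w y‖ ^ 2)) := by
  have has := ha.isSmoothChart
  obtain ⟨K, hK⟩ := ha.exists_majorant hh
  obtain ⟨C', hC'⟩ := ha.cutoff_le ψ hψ
  set A : ℝ := |B| + |C'| + |B| * |C| with hA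
  have hA0 : 0 ≤ A := by positivity
  have hBA : |B| ≤ A := by
    have := abs_nonneg C'
    have : 0 ≤ |B| * |C| := by positivity
    linarith
  set c : ℝ≥0 := Real.toNNReal (n * |C| * A ^ 2 + (n * C) ^ 2 * (2 * A ^ 2))
  refine ⟨K * c, fun w G mw mG => ⟨?_, ?_⟩⟩
  · rw [ENNReal.coe_mul]
    refine hK c _ _ mw (fun p hp => ?_) (fun y hy => ?_)
    · exact (congrArg ENNReal.ofReal (normSqOne_zero h₁ (if_neg hp))).trans ENNReal.ofReal_zero
    · change _ ≤ ENNReal.ofReal _ * _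
      rw [← ENNReal.ofReal_mul (by positivity)]
      refine ENNReal.ofReal_le_ofReal ?_
      refine (normSqOne_le has hy (ha.inner hh hy) (ha.bounded y hy) _).trans ?_
      rw [cu_chartForm has _ hy, norm_smul]
      have h1 : ‖ψ (a.symm y)‖ ≤ A := (hB _).trans ((le_abs_self B).trans hBA)
      calc n * C * (‖ψ (a.symm y)‖ * ‖w y‖) ^ 2 ≤ n * |C| * (A * ‖w y‖) ^ 2 := by
            gcongr; exact le_abs_self C
        _ = n * |C| * A ^ 2 * ‖w y‖ ^ 2 := by ring
        _ ≤ _ := by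
          gcongr
          exact le_add_of_nonneg_right (by positivity)
  · rw [ENNReal.coe_mul]
    refine hK c _ _ (mG.add mw) (fun p hp => ?_) (fun y hy => ?_)
    · exact (congrArg ENNReal.ofReal (normSqTwo_zero h₁ (if_neg hp))).trans ENNReal.ofReal_zero
    · change _ ≤ ENNReal.ofReal _ * _
      have h1 : ‖ψ (a.symm y)‖ ≤ |B| := (hB _).trans (le_abs_self B)
      have h2 : ‖cutoffGrad (n := n) (M := M) a h₁ ψ w G y‖ ≤ A * (‖G y‖ + ‖w y‖) := by
        have b1 : ‖ψ (a.symm y) • G y‖ ≤ |B| * ‖G y‖ := by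
          rw [norm_smul]; gcongr
        have b2 : ‖(fderiv ℝ (fun z => ψ (a.symm z)) y).smulRight (w y)‖ ≤ |C'| * ‖w y‖ := by
          rw [ContinuousLinearMap.norm_smulRight_apply]
          gcongr
          exact (hC' y hy).trans (le_abs_self _)
        have b3 : ‖contract (ψ (a.symm y) • w y) (conn (n := n) (M := M) a h₁ y)‖
            ≤ |B| * |C| * ‖w y‖ := by
          refine (norm_contract_le _ _).trans ?_
          rw [norm_smul]
          calc ‖ψ (a.symm y)‖ * ‖w y‖ * ‖conn (n := n) (M := M) a h₁ y‖
              ≤ |B| * ‖w y‖ * |C| := by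
                gcongr
                exact (ha.conn₁_le y hy).trans (le_abs_self _)
            _ = _ := by ring
        calc ‖cutoffGrad (n := n) (M := M) a h₁ ψ w G y‖
            ≤ |B| * ‖G y‖ + |C'| * ‖w y‖ + |B| * |C| * ‖w y‖ :=
              (norm_sub_le _ _).trans (add_le_add ((norm_add_le _ _).trans (add_le_add b1 b2)) b3)
          _ ≤ _ := by
            have p1 : 0 ≤ (|C'| + |B| * |C|) * ‖G y‖ := by positivity
            have p2 : 0 ≤ |B| * ‖w y‖ := by positivity
            rw [hA]
            nlinarith
      have h3 := ofReal_sq_le_of_le (norm_nonneg _) h2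
      calc ENNReal.ofReal (normSqTwo h₁
            (chartTensor (n := n) a (cutoffGrad (n := n) (M := M) a h₁ ψ w G)) (a.symm y))
          ≤ ENNReal.ofReal ((n * C) ^ 2)
            * ENNReal.ofReal (‖cutoffGrad (n := n) (M := M) a h₁ ψ w G y‖ ^ 2) := by
            rw [← ENNReal.ofReal_mul (sq_nonneg _)]
            refine ENNReal.ofReal_le_ofReal ?_
            refine (normSqTwo_le has hy (ha.inner hh hy) (ha.bounded y hy) _).trans ?_
            rw [cτ_chartTensor has _ hy]
        _ ≤ ENNReal.ofReal ((n * C) ^ 2) * (ENNReal.ofReal (2 * A ^ 2)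
            * (ENNReal.ofReal (‖G y‖ ^ 2) + ENNReal.ofReal (‖w y‖ ^ 2))) := by gcongr
        _ = ENNReal.ofReal ((n * C) ^ 2 * (2 * A ^ 2))
            * (ENNReal.ofReal (‖G y‖ ^ 2) + ENNReal.ofReal (‖w y‖ ^ 2)) := by
            rw [← mul_assoc, ← ENNReal.ofReal_mul (sq_nonneg _)]
        _ ≤ _ := by
            gcongr
            exact le_add_of_nonneg_left (by positivity)

/-- Integrals over `β > 0` in an adapted chart are controlled by integrals over `Ω`. -/
lemma exists_lintegral_halfSpace_le
    (ha : IsAdaptedChart (n := n) (M := M) P h₁ h₂ φ Ω V a β b C)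
    (hh : IsMetricOn (n := n) (M := M) h₁ P) (hΩ : MeasurableSet Ω) :
    ∃ K : ℝ≥0, ∀ (f : M → ℝ≥0∞) (F : EE n → ℝ≥0∞) (c : ℝ≥0), (∀ y ∉ a.target, F y = 0) →
      (∀ y ∈ a.target, F y ≤ c * f (a.symm y)) →
      (∫⁻ y in {y | 0 < β y}, F y ≤ K * c * ∫⁻ p in Ω, f p ∂vol h₁) ∧
      ∫⁻ y, F y ≤ K * c * ∫⁻ p in P, f p ∂vol h₁ := by
  obtain ⟨K, -, hK⟩ := ha.exists_lintegral_le hh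
  refine ⟨K, fun f F c h0 hF => ⟨?_, ?_⟩⟩
  · have mβ : MeasurableSet {y : EE n | 0 < β y} :=
      (isOpen_lt continuous_const β.continuous).measurableSet
    rw [← lintegral_indicator mβ]
    have e1 : ∀ y, {y : EE n | 0 < β y}.indicator F y
        ≤ a.target.indicator (fun y => c * (Ω.indicator f) (a.symm y)) y := by
      intro y
      by_cases hy : y ∈ a.target
      · rw [indicator_of_mem hy]
        by_cases hyβ : 0 < β y
        · have hyΩ : a.symm y ∈ Ω := by
            rw [ha.mem_iff _ (a.map_target hy), a.right_inv hy]
            exact hyβ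
          rw [indicator_of_mem (show y ∈ {y : EE n | 0 < β y} from hyβ), indicator_of_mem hyΩ]
          exact hF y hy
        · rw [indicator_of_notMem (show y ∉ {y : EE n | 0 < β y} from hyβ)]
          exact zero_le
      · refine le_trans ?_ zero_le
        by_cases hyβ : y ∈ {y : EE n | 0 < β y}
        · rw [indicator_of_mem hyβ, h0 y hy]
        · rw [indicator_of_notMem hyβ]
    calc ∫⁻ y, {y : EE n | 0 < β y}.indicator F y
        ≤ ∫⁻ y, a.target.indicator (fun y => c * (Ω.indicator f) (a.symm y)) y := lintegral_mono e1
      _ = c * ∫⁻ y in a.target, (Ω.indicator f) (a.symm y) := by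
        rw [lintegral_indicator a.open_target.measurableSet,
          lintegral_const_mul' _ _ ENNReal.coe_ne_top]
      _ ≤ c * (K * ∫⁻ p in a.source, (Ω.indicator f) p ∂vol h₁) := by gcongr; exact hK _
      _ ≤ c * (K * ∫⁻ p, (Ω.indicator f) p ∂vol h₁) := by
        gcongr; exact Measure.restrict_le_self
      _ = _ := by rw [lintegral_indicator hΩ]; ring
  · have e1 : ∀ y, F y ≤ a.target.indicator (fun y => c * f (a.symm y)) y := by
      intro y
      by_cases hy : y ∈ a.target
      · rw [indicator_of_mem hy]
        exact hF y hy
      · rw [h0 y hy]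
        exact zero_le
    calc ∫⁻ y, F y ≤ ∫⁻ y, a.target.indicator (fun y => c * f (a.symm y)) y := lintegral_mono e1
      _ = c * ∫⁻ y in a.target, f (a.symm y) := by
        rw [lintegral_indicator a.open_target.measurableSet,
          lintegral_const_mul' _ _ ENNReal.coe_ne_top]
      _ ≤ c * (K * ∫⁻ p in a.source, f p ∂vol h₁) := by gcongr; exact hK _
      _ ≤ c * (K * ∫⁻ p in P, f p ∂vol h₁) := by
        gcongr; exact ha.source_subset_left
      _ = _ := by ring

end Chart

end ScGeom
end

noncomputable section

namespace ScGeom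

variable {n : ℕ} {𝕜 : Type*} [RCLike 𝕜]
variable {M : Type*} [TopologicalSpace M] [ChartedSpace (EuclideanSpace ℝ (Fin n)) M]
  [MeasurableSpace M] [BorelSpace M] [IsManifold (𝓡 n) ∞ M]

lemma IsWeakDeriv₁.aemeasurable {D : Set (EE n)} (hD : IsOpen D) {w : EE n → EE n →L[ℝ] 𝕜}
    {G : EE n → EE n →L[ℝ] EE n →L[ℝ] 𝕜} (h : IsWeakDeriv₁ D w G) :
    AEMeasurable (D.indicator fun y => ENNReal.ofReal (‖w y‖ ^ 2)) := by
  rw [aemeasurable_indicator_iff hD.measurableSet]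
  have h1 : LocallyIntegrableOn w D := locallyIntegrableOn_clm_iff.2 fun i => (h _).locInt
  exact (h1.aestronglyMeasurable.norm.aemeasurable.pow_const 2).ennreal_ofReal

lemma IsWeakDeriv₁.aemeasurable_grad {w : EE n → EE n →L[ℝ] 𝕜}
    {G : EE n → EE n →L[ℝ] EE n →L[ℝ] 𝕜} (h : IsWeakDeriv₁ univ w G) :
    AEMeasurable fun y => ENNReal.ofReal (‖G y‖ ^ 2) := by
  have h1 : LocallyIntegrableOn (fun y => (G y).flip) univ :=
    locallyIntegrableOn_clm_iff.2 fun i => (h _).locIntGrad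
  have h2 := h1.aestronglyMeasurable.norm.aemeasurable
  rw [Measure.restrict_univ] at h2
  simp only [ContinuousLinearMap.opNorm_flip] at h2
  exact (h2.pow_const 2).ennreal_ofReal

lemma ofReal_norm_sq_add_le {A : ℝ} {E₁ E₂ E₃ : Type*} [NormedAddCommGroup E₁]
    [NormedAddCommGroup E₂] [NormedAddCommGroup E₃] {D : Set (EE n)} {f : EE n → E₁} {g : EE n → E₂}
    {k : EE n → E₃} (h : ∀ y ∈ D, ‖f y‖ ≤ A * (‖g y‖ + ‖k y‖)) (y : EE n) :
    D.indicator (fun y => ENNReal.ofReal (‖f y‖ ^ 2)) y ≤ ENNReal.ofReal (2 * A ^ 2) *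
      (D.indicator (fun y => ENNReal.ofReal (‖g y‖ ^ 2)) y
        + D.indicator (fun y => ENNReal.ofReal (‖k y‖ ^ 2)) y) := by
  by_cases hy : y ∈ D
  · simp only [indicator_of_mem hy]
    exact ofReal_sq_le_of_le (norm_nonneg _) (h y hy)
  · simp only [indicator_of_notMem hy]
    exact zero_le

section Chart

variable {P : Set M} {h₁ h₂ : TwoTensor n M ℝ} {φ : M → ℝ} {Ω V : Set M}
  {a : OpenPartialHomeomorph M (EE n)} {β : EE n →L[ℝ] ℝ} {b : EE n} {C : ℝ}

/-- The 2-tensor `S` is, in the chart `a`, the conjugated symmetric gradient for the connection of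
`h₂` and the weight `exp φ` of a one-form `v` with covariant derivative `W` for the connection of
`h₁`. -/
def IsConjSymGrad (h₁ h₂ : M → EE n →L[ℝ] EE n →L[ℝ] ℝ) (φ : M → ℝ)
    (a : OpenPartialHomeomorph M (EE n)) (v : M → EE n →L[ℝ] 𝕜)
    (W S : M → EE n →L[ℝ] EE n →L[ℝ] 𝕜) : Prop :=
  ∀ y ∈ a.target, cτ a S y = symPart (cτ a W y
    + contract (cu a v y) (conn a h₁ y - conn a h₂ y)
    + (fderiv ℝ (fun z => φ (a.symm z)) y).smulRight (cu a v y))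

lemma contract_sub (w : EE n →L[ℝ] 𝕜) (Γ Γ' : EE n →L[ℝ] EE n →L[ℝ] EE n) :
    contract w (Γ - Γ') = contract w Γ - contract w Γ' := by
  ext v z
  simp only [contract_apply, sub_apply, map_sub]

set_option maxHeartbeats 1000000 in
/-- The estimates for a one-form in an adapted chart: finiteness of the conjugated symmetric
gradient, and extension of `χ v` from `Ω` by means of Korn's inequality. -/
theorem IsAdaptedChart.exists_extension
    (ha : IsAdaptedChart (n := n) (M := M) P h₁ h₂ φ Ω V a β b C)
    (hh : IsMetricOn (n := n) (M := M) h₁ P) (hΩ : MeasurableSet Ω) (hΩP : Ω ⊆ P) {χ ψ : M → ℝ}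
    (hχ : ContMDiff (𝓡 n) 𝓘(ℝ, ℝ) ∞ χ) (hψ : ContMDiff (𝓡 n) 𝓘(ℝ, ℝ) ∞ ψ)
    (hχK : IsCompact (tsupport χ)) (hχV : tsupport χ ⊆ V) (hψV : tsupport ψ ⊆ V)
    (hψχ : ∀ p ∈ tsupport χ, ψ p = 1) (hχ1 : ∀ p, |χ p| ≤ 1) (hψ1 : ∀ p, |ψ p| ≤ 1) :
    ∃ K : ℝ≥0, ∀ (v : OneForm n M 𝕜) (W S : TwoTensor n M 𝕜), IsWeakGrad h₁ P v W →
      IsConjSymGrad (n := n) (M := M) h₁ h₂ φ a v W S →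
      ∫⁻ p in P, ENNReal.ofReal (normSqOne h₁ v p) ∂vol h₁ < ⊤ →
      ∫⁻ p in P, ENNReal.ofReal (normSqTwo h₁ W p) ∂vol h₁ < ⊤ →
      ∫⁻ p in a.source, ENNReal.ofReal (normSqTwo h₁ S p) ∂vol h₁ < ⊤ ∧
      ∃ (U : OneForm n M 𝕜) (Z : TwoTensor n M 𝕜), IsWeakGrad h₁ P U Z ∧
        (∀ p ∈ Ω, U p = χ p • v p) ∧
        (∃ m : M → ℝ≥0∞, Measurable m ∧ (∀ p, ENNReal.ofReal (normSqOne h₁ U p) ≤ m p) ∧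
          ∫⁻ p in P, m p ∂vol h₁ ≤ K * ((∫⁻ p in Ω, ENNReal.ofReal (normSqTwo h₁ S p) ∂vol h₁)
            + ∫⁻ p in Ω, ENNReal.ofReal (normSqOne h₁ v p) ∂vol h₁)) ∧
        ∃ m : M → ℝ≥0∞, Measurable m ∧ (∀ p, ENNReal.ofReal (normSqTwo h₁ Z p) ≤ m p) ∧
          ∫⁻ p in P, m p ∂vol h₁ ≤ K * ((∫⁻ p in Ω, ENNReal.ofReal (normSqTwo h₁ S p) ∂vol h₁)
            + ∫⁻ p in Ω, ENNReal.ofReal (normSqOne h₁ v p) ∂vol h₁) := by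
  have has := ha.isSmoothChart
  have hDe := ha.chartDomain_eq
  obtain ⟨K₀, hK₀, -⟩ := ha.exists_lintegral_le hh
  obtain ⟨K₁, hK₁⟩ := exists_lintegral_halfSpace_le ha hh hΩ
  obtain ⟨K₂, hK₂⟩ := exists_majorant_chartForm (𝕜 := 𝕜) ha hh hψ hψ1
  obtain ⟨K₃, hK₃⟩ := exists_korn_extension (𝕜 := 𝕜) ha.apply_vec
  obtain ⟨C', hC'⟩ := ha.cutoff_le χ hχ
  set D : Set (EE n) := a.target with hD
  have oD : IsOpen D := a.open_target
  set A : ℝ := 1 + 3 * |C| + |C'| with hA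
  have hA1 : 1 ≤ A := by
    have := abs_nonneg C
    have := abs_nonneg C'
    linarith
  set c : ℝ≥0 := Real.toNNReal (2 * A ^ 2) with hc
  set c₁ : ℝ≥0 := Real.toNNReal C
  set c₂ : ℝ≥0 := Real.toNNReal (C ^ 2)
  set k : ℝ≥0 := K₁ * c₁ + K₁ * c₂ with hk
  set K₄ : ℝ≥0 := K₃ * (1 + c) * k
  refine ⟨K₂ * K₄ + K₂ * K₄, fun v W S hvW hS hv hW => ?_⟩
  set v' : EE n → EE n →L[ℝ] 𝕜 := cu (n := n) (M := M) a v with hv'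
  set Γ₁ := conn (n := n) (M := M) a h₁ with hΓ₁
  set Γ₂ := conn (n := n) (M := M) a h₂ with hΓ₂
  set G : EE n → EE n →L[ℝ] EE n →L[ℝ] 𝕜 := fun y =>
    cτ (n := n) (M := M) a W y + contract (v' y) (Γ₁ y) with hG
  set χa : EE n → ℝ := fun y => χ (a.symm y) with hχa
  have hvG : IsWeakDeriv₁ D v' G := by
    have h := hvW.isWeakGradIn hh hh.isOpen subset_rfl has
    exact hDe ▸ h
  -- the squared coordinate norms on the chart, and their integrals
  set Fv : EE n → ℝ≥0∞ := D.indicator fun y => ENNReal.ofReal (‖v' y‖ ^ 2) with hFv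
  set FT : TwoTensor n M 𝕜 → EE n → ℝ≥0∞ := fun T =>
    D.indicator fun y => ENNReal.ofReal (‖cτ (n := n) (M := M) a T y‖ ^ 2) with hFT
  have mFv : AEMeasurable Fv := hvG.aemeasurable oD
  have bFv := hK₁ (fun p => ENNReal.ofReal (normSqOne h₁ v p)) Fv c₁
    (fun y hy => indicator_of_notMem hy _) (fun y hy => by
      rw [hFv, indicator_of_mem hy]
      change _ ≤ ENNReal.ofReal C * _
      rw [← ENNReal.ofReal_mul (ha.bounded y hy).nonneg]
      exact ENNReal.ofReal_le_ofReal (norm_cu_sq_le has hy (ha.inner hh hy) (ha.bounded y hy) v))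
  have bFT : ∀ T : TwoTensor n M 𝕜, _ := fun T =>
    hK₁ (fun p => ENNReal.ofReal (normSqTwo h₁ T p)) (FT T) c₂
    (fun y hy => indicator_of_notMem hy _) (fun y hy => by
      simp only [hFT]
      rw [indicator_of_mem hy]
      change _ ≤ ENNReal.ofReal (C ^ 2) * _
      rw [← ENNReal.ofReal_mul (sq_nonneg C)]
      exact ENNReal.ofReal_le_ofReal (norm_cτ_sq_le has hy (ha.inner hh hy) (ha.bounded y hy) T))
  -- pointwise bounds on the chart
  have n₁ : ∀ y ∈ D, ‖contract (v' y) (Γ₁ y)‖ ≤ |C| * ‖v' y‖ := fun y hy => by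
    refine (norm_contract_le _ _).trans ?_
    rw [mul_comm]
    gcongr
    exact (ha.conn₁_le y hy).trans (le_abs_self _)
  have n₂ : ∀ y ∈ D, ‖contract (v' y) (Γ₂ y)‖ ≤ |C| * ‖v' y‖ := fun y hy => by
    refine (norm_contract_le _ _).trans ?_
    rw [mul_comm]
    gcongr
    exact (ha.conn₂_le y hy).trans (le_abs_self _)
  have nφ : ∀ y ∈ D, ‖(fderiv ℝ (fun z => φ (a.symm z)) y).smulRight (v' y)‖ ≤ |C| * ‖v' y‖ :=
    fun y hy => by
      rw [ContinuousLinearMap.norm_smulRight_apply]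
      gcongr
      exact (ha.weight_le y hy).trans (le_abs_self _)
  have nχ : ∀ y ∈ D, ‖(fderiv ℝ χa y).smulRight (v' y)‖ ≤ |C'| * ‖v' y‖ := fun y hy => by
    rw [ContinuousLinearMap.norm_smulRight_apply]
    gcongr
    exact (hC' y hy).trans (le_abs_self _)
  have hCC : 0 ≤ |C| := abs_nonneg C
  have hCC' : 0 ≤ |C'| := abs_nonneg C'
  have nχ1 : ∀ (y : EE n) {E : Type _} [NormedAddCommGroup E] [NormedSpace ℝ E] (z : E),
      ‖χa y • z‖ ≤ ‖z‖ := fun y E _ _ z => by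
    rw [norm_smul]
    exact mul_le_of_le_one_left (norm_nonneg _) (hχ1 _)
  have dS : ∀ y ∈ D, ‖cτ (n := n) (M := M) a S y‖
      ≤ A * (‖cτ (n := n) (M := M) a W y‖ + ‖v' y‖) := fun y hy => by
    rw [hS y hy, contract_sub]
    refine (norm_symPart_le _).trans ?_
    have t1 := norm_add_le (cτ (n := n) (M := M) a W y
      + (contract (v' y) (Γ₁ y) - contract (v' y) (Γ₂ y)))
      ((fderiv ℝ (fun z => φ (a.symm z)) y).smulRight (v' y))
    have t2 := norm_add_le (cτ (n := n) (M := M) a W y)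
      (contract (v' y) (Γ₁ y) - contract (v' y) (Γ₂ y))
    have t3 := norm_sub_le (contract (v' y) (Γ₁ y)) (contract (v' y) (Γ₂ y))
    have t4 := n₁ y hy
    have t5 := n₂ y hy
    have t6 := nφ y hy
    have p1 : 0 ≤ (A - 1) * ‖cτ (n := n) (M := M) a W y‖ :=
      mul_nonneg (by linarith) (norm_nonneg _)
    have p2 : 0 ≤ (A - 3 * |C|) * ‖v' y‖ := mul_nonneg (by linarith) (norm_nonneg _)
    linarith
  have dG : ∀ y ∈ D, ‖χa y • G y + (fderiv ℝ χa y).smulRight (v' y)‖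
      ≤ A * (‖cτ (n := n) (M := M) a W y‖ + ‖v' y‖) := fun y hy => by
    have t1 := norm_add_le (χa y • G y) ((fderiv ℝ χa y).smulRight (v' y))
    have t2 := nχ1 y (G y)
    have t3 := norm_add_le (cτ (n := n) (M := M) a W y) (contract (v' y) (Γ₁ y))
    have t4 := n₁ y hy
    have t5 := nχ y hy
    have p1 : 0 ≤ (A - 1) * ‖cτ (n := n) (M := M) a W y‖ :=
      mul_nonneg (by linarith) (norm_nonneg _)
    have p2 : 0 ≤ (A - |C| - |C'|) * ‖v' y‖ := mul_nonneg (by linarith) (norm_nonneg _)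
    linarith
  have dsym : ∀ y ∈ D, ‖symPart (χa y • G y + (fderiv ℝ χa y).smulRight (v' y))‖
      ≤ A * (‖cτ (n := n) (M := M) a S y‖ + ‖v' y‖) := fun y hy => by
    -- the symmetric gradient of `v` is `S` up to terms of order zero
    have e1 : symPart (G y) = cτ (n := n) (M := M) a S y + symPart (contract (v' y) (Γ₂ y))
        - symPart ((fderiv ℝ (fun z => φ (a.symm z)) y).smulRight (v' y)) := by
      rw [hS y hy, contract_sub, symPart_add, symPart_add, symPart_add, symPart_sub]
      abel
    rw [symPart_add, symPart_smul, e1]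
    set X₁ := symPart (contract (v' y) (Γ₂ y))
    set X₂ := symPart ((fderiv ℝ (fun z => φ (a.symm z)) y).smulRight (v' y))
    set X₃ := symPart ((fderiv ℝ χa y).smulRight (v' y))
    have t1 := norm_add_le (χa y • (cτ (n := n) (M := M) a S y + X₁ - X₂)) X₃
    have t2 := nχ1 y (cτ (n := n) (M := M) a S y + X₁ - X₂)
    have t3 := norm_sub_le (cτ (n := n) (M := M) a S y + X₁) X₂
    have t4 := norm_add_le (cτ (n := n) (M := M) a S y) X₁
    have t5 : ‖X₁‖ ≤ |C| * ‖v' y‖ := (norm_symPart_le _).trans (n₂ y hy)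
    have t6 : ‖X₂‖ ≤ |C| * ‖v' y‖ := (norm_symPart_le _).trans (nφ y hy)
    have t7 : ‖X₃‖ ≤ |C'| * ‖v' y‖ := (norm_symPart_le _).trans (nχ y hy)
    have p1 : 0 ≤ (A - 1) * ‖cτ (n := n) (M := M) a S y‖ :=
      mul_nonneg (by linarith) (norm_nonneg _)
    have p2 : 0 ≤ (A - 2 * |C| - |C'|) * ‖v' y‖ := mul_nonneg (by linarith) (norm_nonneg _)
    linarith
  have hFvtop : ∫⁻ y, Fv y < ⊤ :=
    bFv.2.trans_lt (ENNReal.mul_lt_top (ENNReal.mul_lt_top ENNReal.coe_lt_top ENNReal.coe_lt_top) hv)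
  have hFWtop : ∫⁻ y, FT W y < ⊤ := (bFT W).2.trans_lt
    (ENNReal.mul_lt_top (ENNReal.mul_lt_top ENNReal.coe_lt_top ENNReal.coe_lt_top) hW)
  have hsum : ∫⁻ y, c * (FT W y + Fv y) < ⊤ := by
    rw [lintegral_const_mul' _ _ ENNReal.coe_ne_top, lintegral_add_right' _ mFv]
    exact ENNReal.mul_lt_top ENNReal.coe_lt_top (ENNReal.add_lt_top.2 ⟨hFWtop, hFvtop⟩)
  refine ⟨?_, ?_⟩
  · refine (hK₀ _).trans_lt (ENNReal.mul_lt_top ENNReal.coe_lt_top ?_)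
    calc ∫⁻ y in D, ENNReal.ofReal (normSqTwo h₁ S (a.symm y))
        ≤ ∫⁻ y in D, ENNReal.ofReal ((n * C) ^ 2) * (c * (FT W y + Fv y)) := by
          refine setLIntegral_mono' oD.measurableSet fun y hy => ?_
          have h1 := ofReal_norm_sq_add_le dS y
          rw [indicator_of_mem hy] at h1
          refine le_trans ?_ (mul_le_mul_right h1 _)
          rw [← ENNReal.ofReal_mul (sq_nonneg _)]
          exact ENNReal.ofReal_le_ofReal
            (normSqTwo_le has hy (ha.inner hh hy) (ha.bounded y hy) S)
      _ ≤ ∫⁻ y, ENNReal.ofReal ((n * C) ^ 2) * (c * (FT W y + Fv y)) :=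
          setLIntegral_le_lintegral _ _
      _ < ⊤ := by
          rw [lintegral_const_mul' _ _ ENNReal.ofReal_ne_top]
          exact ENNReal.mul_lt_top ENNReal.ofReal_lt_top hsum
  -- the localized one-form, extended by zero to the whole space
  set w : EE n → EE n →L[ℝ] 𝕜 := D.indicator fun y => χa y • v' y with hw
  set Gw : EE n → EE n →L[ℝ] EE n →L[ℝ] 𝕜 :=
    D.indicator fun y => χa y • G y + (fderiv ℝ χa y).smulRight (v' y) with hGw
  have hχaD : ContDiffOn ℝ ∞ χa D := by
    have := has.contDiffOn_comp_symm (O := P) hχ.contMDiffOn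
    rwa [hDe] at this
  have hwG : IsWeakDeriv₁ univ w Gw := by
    refine hvG.zeroExtend oD (ha.closed _ hχV hχK) ?_ hχaD ?_
    · rintro _ ⟨p, hp, rfl⟩
      exact a.map_source (ha.source_eq ▸ ⟨hχV hp.1, hp.2⟩)
    · intro y hy
      refine eq_zero_of_notMem_tsupport (ψ := χ) (p := a.symm y) fun hp => hy.2 ⟨_, ⟨hp, ?_⟩, a.right_inv hy.1⟩
      exact ha.source_subset_left (a.map_target hy.1)
  have bw : ∀ y, ENNReal.ofReal (‖w y‖ ^ 2) ≤ Fv y := fun y => by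
    by_cases hy : y ∈ D
    · rw [hw, hFv, indicator_of_mem hy, indicator_of_mem hy]
      have := nχ1 y (v' y)
      gcongr
    · rw [hw, indicator_of_notMem hy]
      simp
  have bG : ∀ y, ENNReal.ofReal (‖Gw y‖ ^ 2) ≤ c * (FT W y + Fv y) := fun y => by
    refine le_trans (le_of_eq ?_) (ofReal_norm_sq_add_le dG y)
    by_cases hy : y ∈ D
    · rw [hGw, indicator_of_mem hy, indicator_of_mem hy]
    · rw [hGw, indicator_of_notMem hy, indicator_of_notMem hy]
      simp
  have bsym : ∀ y, ENNReal.ofReal (‖symPart (Gw y)‖ ^ 2) ≤ c * (FT S y + Fv y) := fun y => by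
    refine le_trans (le_of_eq ?_) (ofReal_norm_sq_add_le dsym y)
    by_cases hy : y ∈ D
    · rw [hGw, indicator_of_mem hy, indicator_of_mem hy]
    · rw [hGw, indicator_of_notMem hy, indicator_of_notMem hy, symPart_zero]
      simp
  obtain ⟨w', G', hw'G', hw'w, hI₁, hI₂⟩ := hK₃ w Gw hwG ((lintegral_mono bw).trans_lt hFvtop)
    ((lintegral_mono bG).trans_lt hsum)
  set IS := ∫⁻ p in Ω, ENNReal.ofReal (normSqTwo h₁ S p) ∂vol h₁
  set Iv := ∫⁻ p in Ω, ENNReal.ofReal (normSqOne h₁ v p) ∂vol h₁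
  have hkS : (K₁ * c₂ : ℝ≥0∞) ≤ k := by
    rw [hk]; push_cast; exact le_add_self
  have hkv : (K₁ * c₁ : ℝ≥0∞) ≤ k := by
    rw [hk]; push_cast; exact le_self_add
  have hv1 : ∫⁻ y in {y | 0 < β y}, Fv y ≤ k * Iv := bFv.1.trans (by gcongr)
  have hS1 : ∫⁻ y in {y | 0 < β y}, FT S y ≤ k * IS := (bFT S).1.trans (by gcongr)
  have J₁ : ∫⁻ y, ENNReal.ofReal (‖w' y‖ ^ 2) ≤ K₄ * (IS + Iv) := by
    calc ∫⁻ y, ENNReal.ofReal (‖w' y‖ ^ 2) ≤ K₃ * (k * Iv) :=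
          hI₁.trans (by gcongr; exact (lintegral_mono bw).trans hv1)
      _ = (K₃ * 1 * k) * Iv := by ring
      _ ≤ (K₃ * (1 + c) * k) * (IS + Iv) := by
          gcongr
          · exact le_self_add
          · exact le_add_self
      _ = _ := rfl
  have J₂ : ∫⁻ y, ENNReal.ofReal (‖G' y‖ ^ 2) ≤ K₄ * (IS + Iv) := by
    calc ∫⁻ y, ENNReal.ofReal (‖G' y‖ ^ 2)
        ≤ K₃ * ∫⁻ y in {y | 0 < β y}, c * (FT S y + Fv y) :=
          hI₂.trans (by gcongr; exact bsym _)
      _ = K₃ * (c * ((∫⁻ y in {y | 0 < β y}, FT S y) + ∫⁻ y in {y | 0 < β y}, Fv y)) := by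
          rw [lintegral_const_mul' _ _ ENNReal.coe_ne_top, lintegral_add_right' _ mFv.restrict]
      _ ≤ K₃ * (c * (k * IS + k * Iv)) := by gcongr
      _ = (K₃ * c * k) * (IS + Iv) := by ring
      _ ≤ (K₃ * (1 + c) * k) * (IS + Iv) := by
          gcongr
          exact le_add_self
      _ = _ := rfl
  have mw' : AEMeasurable fun y => ENNReal.ofReal (‖w' y‖ ^ 2) := by
    simpa using hw'G'.aemeasurable isOpen_univ
  have mG' : AEMeasurable fun y => ENNReal.ofReal (‖G' y‖ ^ 2) := hw'G'.aemeasurable_grad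
  obtain ⟨⟨m₁, mm₁, hm₁, hU⟩, m₂, mm₂, hm₂, hZ⟩ := hK₂ w' G' mw' mG'
  -- the second cutoff function `ψ` makes the extension live in the chart; it is one where `χ`
  -- is nonzero, so that nothing changes on `Ω`
  refine ⟨chartForm a fun y => ψ (a.symm y) • w' y,
    chartTensor a (cutoffGrad (n := n) (M := M) a h₁ ψ w' G'),
    isWeakGrad_chartForm ha hh hψ hψV hw'G', fun p hp => ?_, ⟨m₁, mm₁, hm₁, ?_⟩, m₂, mm₂, hm₂, ?_⟩
  · by_cases hpa : p ∈ a.source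
    · have hβ : 0 < β (a p) := (ha.mem_iff p hpa).1 hp
      have e1 : w' (a p) = χ p • v' (a p) := by
        rw [hw'w _ hβ, hw, indicator_of_mem (a.map_source hpa)]
        simp only [hχa, a.left_inv hpa]
      have e2 : chartForm (n := n) a (fun y => ψ (a.symm y) • w' y) p
          = ψ p • χ p • (v p : EE n →L[ℝ] 𝕜) := by
        rw [chartForm, if_pos hpa, a.left_inv hpa, e1]
        exact congrArg (fun z => ψ p • χ p • z) (cu_comp_chartDi has v hpa)
      refine e2.trans ?_
      by_cases hχp : p ∈ tsupport χ
      · rw [hψχ p hχp]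
        exact one_smul ℝ _
      · rw [eq_zero_of_notMem_tsupport hχp]
        have e3 : ∀ (t : ℝ) (z : EE n →L[ℝ] 𝕜), t • (0 : ℝ) • z = (0 : ℝ) • z := by simp
        exact e3 _ _
    · have hχp : p ∉ tsupport χ := fun h => hpa (ha.source_eq ▸ ⟨hχV h, hΩP hp⟩)
      rw [eq_zero_of_notMem_tsupport hχp]
      exact (if_neg hpa).trans (zero_smul ℝ (v p : EE n →L[ℝ] 𝕜)).symm
  · calc _ ≤ K₂ * ∫⁻ y, ENNReal.ofReal (‖w' y‖ ^ 2) := hU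
      _ ≤ K₂ * (K₄ * (IS + Iv)) := by gcongr
      _ = (K₂ * K₄) * (IS + Iv) := by ring
      _ ≤ (K₂ * K₄ + K₂ * K₄) * (IS + Iv) := by
          gcongr
          exact le_self_add
      _ = _ := by push_cast; rfl
  · calc _ ≤ K₂ * ∫⁻ y, (ENNReal.ofReal (‖G' y‖ ^ 2) + ENNReal.ofReal (‖w' y‖ ^ 2)) := hZ
      _ = K₂ * ((∫⁻ y, ENNReal.ofReal (‖G' y‖ ^ 2)) + ∫⁻ y, ENNReal.ofReal (‖w' y‖ ^ 2)) := by
          rw [lintegral_add_right' _ mw']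
      _ ≤ K₂ * (K₄ * (IS + Iv) + K₄ * (IS + Iv)) := by gcongr
      _ = (K₂ * K₄ + K₂ * K₄) * (IS + Iv) := by ring
      _ = _ := by push_cast; rfl

end Chart

end ScGeom
end

noncomputable section

namespace ScGeom

variable {n : ℕ}

/-! ### Charts with prescribed coordinate functions -/

/-- Linearly independent linear forms have a dual family of vectors. -/
lemma exists_dual_vectors {ι : Type*} [Finite ι] {l : ι → EE n →L[ℝ] ℝ}
    (h : LinearIndependent ℝ l) :
    ∃ v : ι → EE n, (∀ i, l i (v i) = 1) ∧ ∀ i j, i ≠ j → l i (v j) = 0 := by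
  have h' : LinearIndependent ℝ fun i => (l i : EE n →ₗ[ℝ] ℝ) :=
    h.map' (ContinuousLinearMap.coeLM ℝ) (LinearMap.ker_eq_bot.2 ContinuousLinearMap.coe_injective)
  have key : ∀ j, ∃ v : EE n, l j v = 1 ∧ ∀ i, i ≠ j → l i v = 0 := by
    intro j
    by_contra! hcon
    refine linearIndependent_iff_notMem_span.1 h' j ?_
    have e1 : (fun i => (l i : EE n →ₗ[ℝ] ℝ)) '' (univ \ {j})
        = range fun i : {i // i ≠ j} => (l i : EE n →ₗ[ℝ] ℝ) := by
      ext L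
      simp [mem_image, mem_range]
    rw [e1]
    refine mem_span_of_iInf_ker_le_ker fun v hv => ?_
    have hv' : ∀ i, i ≠ j → l i v = 0 := fun i hi => by
      have := (Submodule.mem_iInf _).1 hv ⟨i, hi⟩
      exact this
    by_contra hne
    have hne' : l j v ≠ 0 := hne
    obtain ⟨i, hi, h0⟩ := hcon ((l j v)⁻¹ • v) (by simp [hne'])
    exact h0 (by simp [hv' i hi])
  choose v hv1 hv2 using key
  exact ⟨v, hv1, fun i j hij => hv2 j i hij⟩

variable {M : Type*} [TopologicalSpace M] [ChartedSpace (EuclideanSpace ℝ (Fin n)) M]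

lemma IsSmoothChart.mono {a b : OpenPartialHomeomorph M (EE n)} (hb : IsSmoothChart b)
    (h1 : ∀ q, a q = b q) (h2 : ∀ y, a.symm y = b.symm y) (h3 : a.source ⊆ b.source)
    (h4 : a.target ⊆ b.target) : IsSmoothChart a :=
  ⟨(hb.smooth.mono h3).congr fun q _ => h1 q, (hb.smooth_symm.mono h4).congr fun y _ => h2 y⟩

lemma IsSmoothChart.trans {e : OpenPartialHomeomorph M (EE n)} (he : IsSmoothChart e)
    {Φ : OpenPartialHomeomorph (EE n) (EE n)} (h1 : ContDiffOn ℝ ∞ Φ Φ.source)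
    (h2 : ContDiffOn ℝ ∞ Φ.symm Φ.target) : IsSmoothChart (e.trans Φ) := by
  constructor
  · have h1' : ContMDiffOn (𝓡 n) (𝓡 n) ∞ Φ Φ.source := contMDiffOn_iff_contDiffOn.2 h1
    rw [OpenPartialHomeomorph.trans_source]
    exact h1'.comp (he.smooth.mono inter_subset_left) fun q hq => hq.2
  · have h2' : ContMDiffOn (𝓡 n) (𝓡 n) ∞ Φ.symm Φ.target := contMDiffOn_iff_contDiffOn.2 h2
    rw [OpenPartialHomeomorph.trans_target]
    exact he.smooth_symm.comp (h2'.mono inter_subset_left) fun q hq => hq.2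

/-- Inverse function theorem: a smooth map with invertible differential changes a chart into
another one. -/
lemma IsSmoothChart.exists_comp {e : OpenPartialHomeomorph M (EE n)} (he : IsSmoothChart e)
    {p : M} (hp : p ∈ e.source) {Φ : EE n → EE n} {O : Set (EE n)} (hO : IsOpen O) (hpO : e p ∈ O)
    (hΦ : ContDiffOn ℝ ∞ Φ O) (hid : fderiv ℝ Φ (e p) = ContinuousLinearMap.id ℝ (EE n)) :
    ∃ b : OpenPartialHomeomorph M (EE n), IsSmoothChart b ∧ p ∈ b.source ∧
      b.source ⊆ e.source ∩ e ⁻¹' O ∧ ∀ q, b q = Φ (e q) := by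
  have hΦp : ContDiffAt ℝ ∞ Φ (e p) := hΦ.contDiffAt (hO.mem_nhds hpO)
  have hd : HasFDerivAt Φ ((ContinuousLinearEquiv.refl ℝ (EE n) : EE n ≃L[ℝ] EE n) :
      EE n →L[ℝ] EE n) (e p) := by
    have := (hΦp.differentiableAt (by simp)).hasFDerivAt
    rwa [hid] at this
  set Ψ₀ := hΦp.toOpenPartialHomeomorph Φ hd (by simp) with hΨ₀
  have hcd : ContDiffOn ℝ ∞ (fderiv ℝ Φ) O := hΦ.fderiv_of_isOpen hO (by simp)
  set R : Set (EE n →L[ℝ] EE n) :=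
    range ((↑) : (EE n ≃L[ℝ] EE n) → EE n →L[ℝ] EE n)
  have hO' : IsOpen (O ∩ fderiv ℝ Φ ⁻¹' R) :=
    hcd.continuousOn.isOpen_inter_preimage hO ContinuousLinearEquiv.isOpen
  set Ψ := Ψ₀.restrOpen _ hO' with hΨ
  have hΨs : Ψ.source = Ψ₀.source ∩ (O ∩ fderiv ℝ Φ ⁻¹' R) :=
    OpenPartialHomeomorph.restrOpen_source _ _ _
  have hΨc : ∀ z, Ψ z = Φ z := fun z => rfl
  have h1 : ContDiffOn ℝ ∞ Ψ Ψ.source :=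
    hΦ.mono (hΨs ▸ inter_subset_right.trans inter_subset_left)
  have h2 : ContDiffOn ℝ ∞ Ψ.symm Ψ.target := fun y hy => by
    have hy' := Ψ.map_target hy
    rw [hΨs] at hy'
    obtain ⟨L, hL⟩ := hy'.2.2
    have hc : ContDiffAt ℝ ∞ Φ (Ψ.symm y) := hΦ.contDiffAt (hO.mem_nhds hy'.2.1)
    refine (Ψ.contDiffAt_symm (f₀' := L) hy ?_ hc).contDiffWithinAt
    rw [hL]
    exact (hc.differentiableAt (by simp)).hasFDerivAt
  refine ⟨e.trans Ψ, he.trans h1 h2, ?_, ?_, fun q => rfl⟩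
  · rw [OpenPartialHomeomorph.trans_source, hΨs]
    refine ⟨hp, ContDiffAt.mem_toOpenPartialHomeomorph_source hΦp hd _, hpO, ?_⟩
    rw [mem_preimage, hid]
    exact ⟨ContinuousLinearEquiv.refl ℝ (EE n), rfl⟩
  · rw [OpenPartialHomeomorph.trans_source, hΨs]
    exact fun q hq => ⟨hq.1, hq.2.2.1⟩

/-- Functions with linearly independent differentials are coordinates of a chart. -/
lemma IsSmoothChart.exists_straight {ι : Type*} [Fintype ι] [DecidableEq ι]
    {e : OpenPartialHomeomorph M (EE n)}
    (he : IsSmoothChart e) {p : M} (hp : p ∈ e.source) {f : ι → EE n → ℝ} {O : Set (EE n)}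
    (hO : IsOpen O) (hpO : e p ∈ O) (hf : ∀ j, ContDiffOn ℝ ∞ (f j) O)
    (hli : LinearIndependent ℝ fun j => fderiv ℝ (f j) (e p)) :
    ∃ b : OpenPartialHomeomorph M (EE n), IsSmoothChart b ∧ p ∈ b.source ∧
      b.source ⊆ e.source ∩ e ⁻¹' O ∧ ∃ (α : ι → EE n →L[ℝ] ℝ) (v : ι → EE n),
        (∀ i, α i (v i) = 1) ∧ (∀ i j, i ≠ j → α i (v j) = 0) ∧ ∀ j q, α j (b q) = f j (e q) := by
  obtain ⟨v, hv1, hv2⟩ := exists_dual_vectors hli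
  set α : ι → EE n →L[ℝ] ℝ := fun j => fderiv ℝ (f j) (e p)
  set Φ : EE n → EE n := fun z => z + ∑ j, (f j z - α j z) • v j with hΦ
  have hΦs : ContDiffOn ℝ ∞ Φ O := by
    refine contDiffOn_id.add ?_
    refine ContDiffOn.sum fun j _ => ?_
    exact ((hf j).sub (α j).contDiff.contDiffOn).smul contDiffOn_const
  have hid : fderiv ℝ Φ (e p) = ContinuousLinearMap.id ℝ (EE n) := by
    have h1 : ∀ j, HasFDerivAt (fun z => (f j z - α j z) • v j) (0 : EE n →L[ℝ] EE n) (e p) := by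
      intro j
      have h2 := (((hf j).contDiffAt (hO.mem_nhds hpO)).differentiableAt (by simp)).hasFDerivAt
      have h3 := (h2.sub (α j).hasFDerivAt).smul_const (v j)
      have e3 : (fderiv ℝ (f j) (e p) - α j).smulRight (v j) = 0 := by
        rw [sub_self, ContinuousLinearMap.zero_smulRight]
      rw [e3] at h3
      exact h3
    have h4 := (hasFDerivAt_id (𝕜 := ℝ) (e p)).add (HasFDerivAt.fun_sum fun j (_ : j ∈ Finset.univ) => h1 j)
    simp only [Finset.sum_const_zero, add_zero] at h4
    exact h4.fderiv
  obtain ⟨b, hb, hpb, hbs, hbΦ⟩ := he.exists_comp hp hO hpO hΦs hid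
  refine ⟨b, hb, hpb, hbs, α, v, hv1, hv2, fun j q => ?_⟩
  rw [hbΦ, hΦ]
  simp only [map_add, map_sum, map_smul, smul_eq_mul]
  rw [Finset.sum_eq_single j]
  · rw [hv1]; ring
  · intro i _ hij
    rw [hv2 j i hij.symm, mul_zero]
  · simp

/-- The restriction of a chart to a small ball around a point. -/
lemma IsSmoothChart.exists_ball {e : OpenPartialHomeomorph M (EE n)} (he : IsSmoothChart e) {p : M}
    (hp : p ∈ e.source) {q : EE n → Prop} (hq : ∀ᶠ z in 𝓝 (e p), q z) :
    ∃ b : OpenPartialHomeomorph M (EE n), IsSmoothChart b ∧ p ∈ b.source ∧ b.source ⊆ e.source ∧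
      (∀ p, b p = e p) ∧ (∀ y, b.symm y = e.symm y) ∧ ∃ K, IsCompact K ∧ b.target ⊆ K ∧
        K ⊆ e.target ∧ ∀ z ∈ b.target, q z := by
  have h1 : {z | q z} ∩ e.target ∈ 𝓝 (e p) :=
    Filter.inter_mem hq (e.open_target.mem_nhds (e.map_source hp))
  obtain ⟨ε, hε, hball⟩ := Metric.nhds_basis_closedBall.mem_iff.1 h1
  have hO : IsOpen (e.source ∩ e ⁻¹' Metric.ball (e p) ε) :=
    e.isOpen_inter_preimage Metric.isOpen_ball
  set b := e.restrOpen _ hO with hb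
  have hbs : b.source = e.source ∩ (e.source ∩ e ⁻¹' Metric.ball (e p) ε) :=
    OpenPartialHomeomorph.restrOpen_source _ _ _
  have hbe : ∀ q, b q = e q := fun _ => rfl
  have hbt : b.target ⊆ Metric.closedBall (e p) ε := fun z hz => by
    have h2 := b.map_target hz
    rw [hbs] at h2
    have h3 : e (b.symm z) = z := b.right_inv hz
    rw [← h3]
    exact Metric.ball_subset_closedBall h2.2.2
  refine ⟨b, he.mono hbe (fun _ => rfl) (hbs ▸ inter_subset_left) fun z hz => (hball (hbt hz)).2,
    ?_, hbs ▸ inter_subset_left, hbe, fun _ => rfl, Metric.closedBall (e p) ε,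
    isCompact_closedBall _ _, hbt, fun z hz => (hball hz).2, fun z hz => (hball (hbt hz)).1⟩
  rw [hbs]
  exact ⟨hp, hp, Metric.mem_ball_self hε⟩

end ScGeom
end

noncomputable section

namespace ScGeom

variable {n : ℕ}

/-! ### Adapted charts at interior points -/

/-- By compactness of the unit sphere. -/
lemma IsInner.exists_lower {B : EE n →L[ℝ] EE n →L[ℝ] ℝ} (h : IsInner B) :
    ∃ c : ℝ, 0 < c ∧ ∀ v, ‖v‖ ^ 2 ≤ c * B v v := by
  have hcont : Continuous fun v => B v v := B.continuous.clm_apply continuous_id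
  have hnn : ∀ v, 0 ≤ B v v := fun v => by
    by_cases hv : v = 0
    · simp [hv]
    · exact (h.pos v hv).le
  rcases (Metric.sphere (0 : EE n) 1).eq_empty_or_nonempty with he | hne
  · refine ⟨1, one_pos, fun v => ?_⟩
    have hv : v = 0 := by
      by_contra hv
      have : (‖v‖⁻¹ • v) ∈ Metric.sphere (0 : EE n) 1 := by
        rw [mem_sphere_zero_iff_norm, norm_smul, norm_inv, norm_norm,
          inv_mul_cancel₀ (norm_ne_zero_iff.2 hv)]
      rw [he] at this
      exact this
    simp [hv]
  · obtain ⟨u, hu, hmin⟩ := (isCompact_sphere (0 : EE n) 1).exists_isMinOn hne hcont.continuousOn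
    have hu0 : u ≠ 0 := fun h0 => by simp [h0] at hu
    have hm := h.pos u hu0
    refine ⟨(B u u)⁻¹, inv_pos.2 hm, fun v => ?_⟩
    by_cases hv : v = 0
    · simp [hv]
    have hnv : 0 < ‖v‖ := norm_pos_iff.2 hv
    have h1 : B u u ≤ B (‖v‖⁻¹ • v) (‖v‖⁻¹ • v) := hmin (by
      rw [mem_sphere_zero_iff_norm, norm_smul, norm_inv, norm_norm, inv_mul_cancel₀ hnv.ne'])
    rw [map_smul, map_smul, smul_apply, smul_eq_mul, smul_eq_mul] at h1
    rw [inv_mul_eq_div, le_div_iff₀ hm]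
    calc ‖v‖ ^ 2 * B u u ≤ ‖v‖ ^ 2 * (‖v‖⁻¹ * (‖v‖⁻¹ * B v v)) := by gcongr
      _ = B v v := by field_simp

/-- Uniform equivalence to the Euclidean metric is an open condition. -/
lemma IsInner.eventually_bounds {B : EE n → EE n →L[ℝ] EE n →L[ℝ] ℝ} {z₀ : EE n}
    (h : IsInner (B z₀)) (hB : ContinuousAt B z₀) :
    ∃ C : ℝ, ∀ᶠ z in 𝓝 z₀, (∀ v, ‖v‖ ^ 2 ≤ C * B z v v) ∧ ‖B z‖ ≤ C := by
  obtain ⟨c, hc, hl⟩ := h.exists_lower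
  refine ⟨max (2 * c) (‖B z₀‖ + 1), ?_⟩
  have h1 : ∀ᶠ z in 𝓝 z₀, ‖B z - B z₀‖ < (2 * c)⁻¹ := by
    have := (hB.sub continuousAt_const).norm (f := fun z => B z - B z₀)
    have h0 : ‖B z₀ - B z₀‖ < (2 * c)⁻¹ := by
      rw [sub_self, norm_zero]; positivity
    exact this.eventually_lt_const h0
  filter_upwards [h1, hB.norm.eventually_lt_const (lt_add_one _)] with z hz hz2
  refine ⟨fun v => ?_, hz2.le.trans (le_max_right _ _)⟩
  have e1 : |(B z - B z₀) v v| ≤ (2 * c)⁻¹ * ‖v‖ ^ 2 := by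
    calc |(B z - B z₀) v v| ≤ ‖B z - B z₀‖ * ‖v‖ * ‖v‖ := (B z - B z₀).le_opNorm₂ v v
      _ = ‖B z - B z₀‖ * ‖v‖ ^ 2 := by ring
      _ ≤ _ := by gcongr
  have e2 : B z v v = B z₀ v v + (B z - B z₀) v v := by
    rw [sub_apply, sub_apply]; ring
  have e3 : (2 * c)⁻¹ * ‖v‖ ^ 2 ≤ B z v v := by
    have h5 : c⁻¹ * ‖v‖ ^ 2 ≤ B z₀ v v := by
      rw [inv_mul_le_iff₀ hc]
      exact hl v
    have h6 := neg_le_of_abs_le e1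
    have h7 : (2 * c)⁻¹ * ‖v‖ ^ 2 = c⁻¹ * ‖v‖ ^ 2 - (2 * c)⁻¹ * ‖v‖ ^ 2 := by
      field_simp; ring
    linarith
  have e4 : 0 ≤ B z v v := le_trans (by positivity) e3
  calc ‖v‖ ^ 2 ≤ 2 * c * B z v v := by rwa [inv_mul_le_iff₀ (by positivity)] at e3
    _ ≤ _ := by gcongr; exact le_max_left _ _

lemma IsBounded.mono {B : EE n →L[ℝ] EE n →L[ℝ] ℝ} {C C' : ℝ} (h : IsBounded B C) (hC : C ≤ C') :
    IsBounded B C' := by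
  refine ⟨h.inner, fun v => (h.lower v).trans ?_, h.upper.trans hC⟩
  have : 0 ≤ B v v := by
    by_cases hv : v = 0
    · simp [hv]
    · exact (h.inner.pos v hv).le
  gcongr

variable {M : Type*} [TopologicalSpace M] [ChartedSpace (EuclideanSpace ℝ (Fin n)) M]

/-- Metric and connection coefficients are locally bounded in a chart. -/
lemma IsMetricOn.eventually_bounds {h : M → EE n →L[ℝ] EE n →L[ℝ] ℝ} {O : Set M}
    (hh : IsMetricOn h O) {b : OpenPartialHomeomorph M (EE n)} (hb : IsSmoothChart b) {z₀ : EE n}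
    (hz₀ : z₀ ∈ chartDomain b O) :
    ∃ C : ℝ, ∀ᶠ z in 𝓝 z₀, IsBounded (cτ b h z) C ∧ ‖conn b h z‖ ≤ C := by
  have hop : IsOpen (chartDomain b O) := isOpen_chartDomain b hh.isOpen
  have hs := hh.smooth b hb
  obtain ⟨C, hC⟩ := (hh.inner_chart hb hz₀).eventually_bounds
    (hs.continuousOn.continuousAt (hop.mem_nhds hz₀))
  have hd : ContinuousAt (fderiv ℝ (cτ b h)) z₀ :=
    (hs.continuousOn_fderiv_of_isOpen hop (by simp)).continuousAt (hop.mem_nhds hz₀)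
  set D := ‖fderiv ℝ (cτ b h) z₀‖ + 1
  refine ⟨max C (2 * |C| * D), ?_⟩
  filter_upwards [hC, hop.mem_nhds hz₀, hd.norm.eventually_lt_const (lt_add_one _)]
    with z hz hzO hzd
  have hI := hh.inner_chart hb hzO
  refine ⟨IsBounded.mono ⟨hI, hz.1, hz.2⟩ (le_max_left _ _), ?_⟩
  refine le_trans ?_ (le_max_right _ _)
  refine norm_levi_le hI (abs_nonneg _) (by positivity) (fun v => ?_) hzd.le
  rw [abs_of_nonneg ((norm_nonneg _).trans hz.2)]
  exact hz.1 v

variable [IsManifold (𝓡 n) ∞ M]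

/-- Around points of `P` every chart that flattens the boundary of `Ω` becomes adapted after
shrinking, since everything in sight is smooth there. -/
lemma exists_isAdaptedChart_interior {P Ω : Set M} {h₁ h₂ : M → EE n →L[ℝ] EE n →L[ℝ] ℝ}
    {φ : M → ℝ} {β : EE n →L[ℝ] ℝ} {v : EE n} {b : OpenPartialHomeomorph M (EE n)}
    (hb : IsSmoothChart b) (hbe : ∃ e ∈ atlas (EuclideanSpace ℝ (Fin n)) M, b.source ⊆ e.source)
    {p : M} (hp : p ∈ b.source) (hbP : b.source ⊆ P) (hh₁ : IsMetricOn h₁ P)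
    (hh₂ : IsMetricOn h₂ univ) (hφ : ContMDiffOn (𝓡 n) 𝓘(ℝ, ℝ) ∞ φ P) (hβ : β v = 1)
    (hiff : ∀ q ∈ b.source, (q ∈ Ω ↔ 0 < β (b q))) :
    ∃ V a C, p ∈ V ∧ IsAdaptedChart P h₁ h₂ φ Ω V a β v C := by
  have hz₀ : b p ∈ b.target := b.map_source hp
  have hdom : chartDomain b P = b.target := by
    ext y
    exact ⟨fun h => h.1, fun h => ⟨h, hbP (b.map_target h)⟩⟩
  have hsm : ∀ {χ : M → ℝ}, ContMDiffOn (𝓡 n) 𝓘(ℝ, ℝ) ∞ χ P →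
      ContinuousOn (fderiv ℝ fun z => χ (b.symm z)) b.target := fun {χ} hχ => by
    have h1 := hb.contDiffOn_comp_symm hχ
    rw [hdom] at h1
    exact h1.continuousOn_fderiv_of_isOpen b.open_target (by simp)
  obtain ⟨C₁, hC₁⟩ := hh₁.eventually_bounds hb (hdom.symm ▸ hz₀)
  obtain ⟨C₂, hC₂⟩ := hh₂.eventually_bounds hb (z₀ := b p) ⟨hz₀, mem_univ _⟩
  obtain ⟨a, ha, hpa, hab, hae, hae', K, hK, haK, hKb, hq⟩ := hb.exists_ball hp (hC₁.and hC₂)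
  obtain ⟨C₃, hC₃⟩ := hK.exists_bound_of_continuousOn ((hsm hφ).mono hKb)
  have hes : (a.symm : EE n → M) = b.symm := funext hae'
  have hcτ : ∀ (h : M → EE n →L[ℝ] EE n →L[ℝ] ℝ), cτ a h = cτ b h := fun h => by
    funext y
    have h1 : chartD a y = chartD b y :=
      congrArg (fun f : EE n → M => (show EE n →L[ℝ] EE n from mfderiv (𝓡 n) (𝓡 n) f y)) hes
    simp only [cτ, h1, hes]
  have hconn : ∀ (h : M → EE n →L[ℝ] EE n →L[ℝ] ℝ), conn a h = conn b h := fun h => by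
    funext y
    simp only [conn, hcτ]
  refine ⟨a.source, a, max C₁ (max C₂ C₃), hpa, ⟨ha, a.open_source,
    (inter_eq_left.2 (hab.trans hbP)).symm, ?_, hβ, fun q hqa => ?_, fun y hy => ?_, fun y hy => ?_,
    fun y hy => ?_, fun y hy => ?_, fun χ hχ => ?_, fun L hL hLc => ?_⟩⟩
  · obtain ⟨e, he, h⟩ := hbe
    exact ⟨e, he, hab.trans h⟩
  · rw [hae]
    exact hiff q (hab hqa)
  · rw [hcτ]
    exact (hq y hy).1.1.mono (le_max_left _ _)
  · rw [hconn]
    exact (hq y hy).1.2.trans (le_max_left _ _)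
  · rw [hconn]
    exact (hq y hy).2.2.trans ((le_max_left _ _).trans (le_max_right _ _))
  · simp only [hes]
    exact (hC₃ y (haK hy)).trans ((le_max_right _ _).trans (le_max_right _ _))
  · obtain ⟨C', hC'⟩ := hK.exists_bound_of_continuousOn ((hsm hχ.contMDiffOn).mono hKb)
    refine ⟨C', fun y hy => ?_⟩
    simp only [hes]
    exact hC' y (haK hy)
  · rw [inter_eq_left.2 (hL.trans (hab.trans hbP))]
    exact (hLc.image_of_continuousOn (a.continuousOn.mono hL)).isClosed

end ScGeom
end

noncomputable section

namespace ScGeom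

variable {n : ℕ}

/-! ### The projective inversion -/

/-- The involution `z ↦ (z + e) / α(z) - e` of `{α > 0}`, where `α(e) = 1`. If `α` is a boundary
defining function then it maps a neighbourhood of the boundary `{α = 0}` to a neighbourhood of
infinity; scattering metrics become asymptotically Euclidean. -/
def inversion (α : EE n →L[ℝ] ℝ) (e y : EE n) : EE n := (α y)⁻¹ • (y + e) - e

/-- Up to the factor `α(z)`, the differential of `inversion α e` at the preimage of `z`. -/
def inversionD (α : EE n →L[ℝ] ℝ) (e z : EE n) : EE n →L[ℝ] EE n :=
  ContinuousLinearMap.id ℝ (EE n) - α.smulRight (z + e)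

section Inversion

variable {α : EE n →L[ℝ] ℝ} {e : EE n}

lemma inversionD_apply (z v : EE n) : inversionD α e z v = v - α v • (z + e) := rfl

lemma inversion_add (y : EE n) : inversion α e y + e = (α y)⁻¹ • (y + e) := by
  rw [inversion, sub_add_cancel]

lemma apply_inversion (he : α e = 1) {y : EE n} (hy : α y ≠ 0) : α (inversion α e y) = (α y)⁻¹ := by
  rw [inversion, map_sub, map_smul, map_add, he, smul_eq_mul]
  field_simp
  ring

lemma inversion_inversion (he : α e = 1) {y : EE n} (hy : α y ≠ 0) :
    inversion α e (inversion α e y) = y := by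
  rw [inversion, apply_inversion he hy, inversion_add, inv_inv, smul_smul, mul_inv_cancel₀ hy,
    one_smul, add_sub_cancel_right]

lemma hasFDerivAt_inversion {y : EE n} (hy : α y ≠ 0) :
    HasFDerivAt (inversion α e) ((α y)⁻¹ • inversionD α e (inversion α e y)) y := by
  have h1 : HasFDerivAt (fun y => (α y)⁻¹) (-(α y ^ 2)⁻¹ • α) y := by
    have := (hasDerivAt_inv hy).comp_hasFDerivAt y α.hasFDerivAt
    exact this
  have h2 := (h1.smul ((hasFDerivAt_id y).add_const e)).sub_const e
  refine h2.congr_fderiv ?_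
  ext1 v
  simp only [add_apply, smul_apply, ContinuousLinearMap.smulRight_apply, inversionD_apply,
    inversion_add, ContinuousLinearMap.id_apply, smul_eq_mul, id]
  rw [smul_sub, smul_smul, smul_smul, sub_eq_add_neg, ← neg_smul]
  congr 2
  field_simp

lemma isOpen_ne_zero (α : EE n →L[ℝ] ℝ) : IsOpen {y | α y ≠ 0} :=
  isOpen_ne_fun α.continuous continuous_const

lemma fderiv_inversion {y : EE n} (hy : α y ≠ 0) :
    fderiv ℝ (inversion α e) y = (α y)⁻¹ • inversionD α e (inversion α e y) :=
  (hasFDerivAt_inversion hy).fderiv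

/-- The second derivative of the inversion decays like `α⁻²`, one order faster than the first. -/
lemma fderiv_fderiv_inversion {y : EE n} (hy : α y ≠ 0) (v w : EE n) :
    fderiv ℝ (fderiv ℝ (inversion α e)) y v w = -((α y)⁻¹ ^ 2 •
      (α v • inversionD α e (inversion α e y) w + α w • inversionD α e (inversion α e y) v)) := by
  have e1 : fderiv ℝ (inversion α e) =ᶠ[𝓝 y]
      fun y => (α y)⁻¹ • inversionD α e (inversion α e y) := by
    filter_upwards [(isOpen_ne_zero α).mem_nhds hy] with z hz
    exact fderiv_inversion hz
  have h1 : HasFDerivAt (fun y => (α y)⁻¹) (-(α y ^ 2)⁻¹ • α) y :=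
    (hasDerivAt_inv hy).comp_hasFDerivAt y α.hasFDerivAt
  have h2 : HasFDerivAt (fun z => inversionD α e z w) (-(α w) • ContinuousLinearMap.id ℝ (EE n))
      (inversion α e y) := by
    have := (((hasFDerivAt_id (𝕜 := ℝ) (inversion α e y)).add_const e).const_smul (α w)).const_sub w
    exact this.congr_fderiv (_root_.neg_smul _ _).symm
  have h3 := h1.smul (h2.comp y (hasFDerivAt_inversion hy))
  have h4 : DifferentiableAt ℝ (fun y => (α y)⁻¹ • inversionD α e (inversion α e y)) y := by
    refine (h1.differentiableAt).smul ?_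
    refine DifferentiableAt.const_sub ?_ _
    have h5 : DifferentiableAt ℝ (fun z => inversion α e z + e) y :=
      (hasFDerivAt_inversion hy).differentiableAt.add_const e
    exact ((ContinuousLinearMap.smulRightL ℝ (EE n) (EE n) α).differentiableAt).comp y h5
  rw [e1.fderiv_eq]
  have h6 : fderiv ℝ (fun y => (α y)⁻¹ • inversionD α e (inversion α e y)) y v w
      = fderiv ℝ (fun y => (α y)⁻¹ • inversionD α e (inversion α e y) w) y v := by
    have := (h4.hasFDerivAt.clm_apply (hasFDerivAt_const w y)).fderiv
    have h7 := congrArg (fun L => L v) this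
    simpa using h7.symm
  rw [h6]
  have h8 := congrArg (fun L => L v) h3.fderiv
  refine h8.trans ?_
  simp only [add_apply, smul_apply, ContinuousLinearMap.smulRight_apply,
    ContinuousLinearMap.comp_apply, ContinuousLinearMap.id_apply, Function.comp_apply, smul_eq_mul]
  module

lemma contDiffOn_inversion : ContDiffOn ℝ ∞ (inversion α e) {y | 0 < α y} := by
  have h1 : ContDiffOn ℝ ∞ (fun y => (α y)⁻¹) {y | 0 < α y} :=
    α.contDiff.contDiffOn.inv fun y hy => ne_of_gt hy
  have h2 : ContDiffOn ℝ ∞ (fun y : EE n => y + e) {y | 0 < α y} :=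
    (contDiff_id.add contDiff_const).contDiffOn
  exact (h1.smul h2).sub contDiffOn_const

lemma isOpen_pos_clm (α : EE n →L[ℝ] ℝ) : IsOpen {y | 0 < α y} :=
  isOpen_lt continuous_const α.continuous

lemma inversion_mem (he : α e = 1) {y : EE n} (hy : 0 < α y) : 0 < α (inversion α e y) := by
  rw [apply_inversion he hy.ne']
  exact inv_pos.2 hy

/-- `inversion` as a partial homeomorphism. -/
def inversionHomeo (he : α e = 1) : OpenPartialHomeomorph (EE n) (EE n) where
  toFun := inversion α e
  invFun := inversion α e
  source := {y | 0 < α y}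
  target := {y | 0 < α y}
  map_source' _ hy := inversion_mem he hy
  map_target' _ hy := inversion_mem he hy
  left_inv' _ hy := inversion_inversion he (ne_of_gt hy)
  right_inv' _ hy := inversion_inversion he (ne_of_gt hy)
  open_source := isOpen_pos_clm α
  open_target := isOpen_pos_clm α
  continuousOn_toFun := contDiffOn_inversion.continuousOn
  continuousOn_invFun := contDiffOn_inversion.continuousOn

/-- The inverse of `α(z) inversionD α e z`, up to the factor `α(z)²`. -/
lemma inversionD_solve (he : α e = 1) (z q : EE n) :
    inversionD α e z (α z • q - α q • (z + e)) = α z • q := by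
  simp only [inversionD_apply, map_sub, map_smul, map_add, he]
  module

lemma inversionD_injective (he : α e = 1) {z : EE n} (hz : α z ≠ 0) :
    Function.Injective (inversionD α e z) := by
  rw [injective_iff_map_eq_zero]
  intro v hv
  rw [inversionD_apply, sub_eq_zero] at hv
  have h1 := congrArg α hv
  rw [map_smul, map_add, he, smul_eq_mul] at h1
  have h2 : α v = 0 := by
    have : α v * α z = 0 := by linarith
    exact (mul_eq_zero.1 this).resolve_right hz
  rw [hv, h2, zero_smul]

/-- The connection coefficients of a metric that is smooth up to the boundary, in the coordinates
given by the inversion. -/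
lemma levi_inversion (he : α e = 1) {H H' : EE n → EE n →L[ℝ] EE n →L[ℝ] ℝ} {y : EE n}
    (hy : 0 < α y) (hH' : DifferentiableAt ℝ H' (inversion α e y)) (hI : IsInner (H y))
    (hI' : IsInner (H' (inversion α e y)))
    (hH : H =ᶠ[𝓝 y] fun z => pull₂ (H' (inversion α e z)) (fderiv ℝ (inversion α e) z))
    {v w z q : EE n} (hz : z = inversion α e y)
    (hq : q = levi H' z (inversionD α e z v) (inversionD α e z w)
      - (α v • inversionD α e z w + α w • inversionD α e z v)) :
    levi H y v w = α z • q - α q • (z + e) := by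
  have hyne := hy.ne'
  have hs : α z = (α y)⁻¹ := by rw [hz, apply_inversion he hyne]
  have hsne : α z ≠ 0 := by rw [hs]; exact inv_ne_zero hyne
  have hfd : fderiv ℝ (inversion α e) y = α z • inversionD α e z := by
    rw [fderiv_inversion hyne, hs, hz]
  have hsurj : Function.Surjective (fderiv ℝ (inversion α e) y) := by
    intro u
    refine ⟨(α z)⁻¹ • (α z)⁻¹ • (α z • u - α u • (z + e)), ?_⟩
    rw [map_smul, map_smul, hfd, smul_apply, inversionD_solve he, smul_smul, smul_smul, smul_smul]
    field_simp
    simp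
  have h1 := levi_transform (contDiffOn_inversion.contDiffAt ((isOpen_pos_clm α).mem_nhds hy))
    hsurj hH' hI hI' hH v w
  rw [fderiv_fderiv_inversion hyne, hfd, ← hz, ← hs] at h1
  refine inversionD_injective he hsne ?_
  rw [inversionD_solve he]
  have h2 : α z • inversionD α e z (levi H y v w) = α z • α z • q := by
    refine h1.trans ?_
    rw [hq]
    simp only [smul_apply, map_smul]
    module
  exact smul_right_injective _ hsne h2

/-- Connection coefficients that are smooth up to the boundary are bounded in the inverted
coordinates. -/
lemma norm_levi_inversion_le (he : α e = 1) {H H' : EE n → EE n →L[ℝ] EE n →L[ℝ] ℝ} {y : EE n}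
    (hy : 0 < α y) (hH' : DifferentiableAt ℝ H' (inversion α e y)) (hI : IsInner (H y))
    (hI' : IsInner (H' (inversion α e y)))
    (hH : H =ᶠ[𝓝 y] fun z => pull₂ (H' (inversion α e z)) (fderiv ℝ (inversion α e) z))
    {A B D : ℝ} (hA : ‖inversionD α e (inversion α e y)‖ ≤ A)
    (hB : ‖levi H' (inversion α e y)‖ ≤ B) (hD : ‖inversion α e y + e‖ ≤ D)
    (hs : α (inversion α e y) ≤ 1) :
    ‖levi H y‖ ≤ (1 + ‖α‖ * D) * (B * A ^ 2 + 2 * ‖α‖ * A) := by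
  have hA0 := (norm_nonneg _).trans hA
  have hB0 : 0 ≤ B := (norm_nonneg (levi H' (inversion α e y))).trans hB
  have hD0 := (norm_nonneg _).trans hD
  refine ContinuousLinearMap.opNorm_le_bound₂ _ (by positivity) fun v w => ?_
  set z := inversion α e y with hz
  set q := levi H' z (inversionD α e z v) (inversionD α e z w)
      - (α v • inversionD α e z w + α w • inversionD α e z v) with hq
  rw [levi_inversion he hy hH' hI hI' hH hz hq]
  have hL : ∀ u, ‖inversionD α e z u‖ ≤ A * ‖u‖ := fun u =>
    (inversionD α e z).le_of_opNorm_le hA u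
  have hqn : ‖q‖ ≤ (B * A ^ 2 + 2 * ‖α‖ * A) * ‖v‖ * ‖w‖ := by
    have t1 : ‖levi H' z (inversionD α e z v) (inversionD α e z w)‖
        ≤ B * (A * ‖v‖) * (A * ‖w‖) := by
      refine ((levi H' z).le_opNorm₂ _ _).trans ?_
      gcongr
      · exact hL v
      · exact hL w
    have t2 : ‖α v • inversionD α e z w‖ ≤ (‖α‖ * ‖v‖) * (A * ‖w‖) := by
      rw [norm_smul]
      gcongr
      · exact α.le_opNorm v
      · exact hL w
    have t3 : ‖α w • inversionD α e z v‖ ≤ (‖α‖ * ‖w‖) * (A * ‖v‖) := by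
      rw [norm_smul]
      gcongr
      · exact α.le_opNorm w
      · exact hL v
    calc ‖q‖ ≤ B * (A * ‖v‖) * (A * ‖w‖)
          + ((‖α‖ * ‖v‖) * (A * ‖w‖) + (‖α‖ * ‖w‖) * (A * ‖v‖)) :=
          (norm_sub_le _ _).trans (add_le_add t1 ((norm_add_le _ _).trans (add_le_add t2 t3)))
      _ = _ := by ring
  have hs0 : 0 ≤ α z := (inversion_mem he hy).le
  calc ‖α z • q - α q • (z + e)‖ ≤ 1 * ‖q‖ + (‖α‖ * ‖q‖) * D := by
        refine (norm_sub_le _ _).trans (add_le_add ?_ ?_)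
        · rw [norm_smul, Real.norm_eq_abs, abs_of_nonneg hs0]
          gcongr
        · rw [norm_smul]
          gcongr
          exact α.le_opNorm q
    _ = (1 + ‖α‖ * D) * ‖q‖ := by ring
    _ ≤ (1 + ‖α‖ * D) * ((B * A ^ 2 + 2 * ‖α‖ * A) * ‖v‖ * ‖w‖) := by gcongr
    _ = _ := by ring

end Inversion

end ScGeom
end

noncomputable section

namespace ScGeom

variable {n : ℕ}

/-! ### Adapted charts at boundary points -/

/-- A scattering metric in the coordinates given by the inversion, at the point with original
coordinates `z`; here `B` is the coefficient `h` of `x⁻²` in the original coordinates. -/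
def scBilin (α : EE n →L[ℝ] ℝ) (e : EE n) (B : EE n → EE n →L[ℝ] EE n →L[ℝ] ℝ) (z : EE n) :
    EE n →L[ℝ] EE n →L[ℝ] ℝ :=
  α.smulRight α + pull₂ (B z) (inversionD α e z)

lemma contDiffOn_scBilin {α : EE n →L[ℝ] ℝ} {e : EE n} {B : EE n → EE n →L[ℝ] EE n →L[ℝ] ℝ}
    {D : Set (EE n)} (hB : ContDiffOn ℝ ∞ B D) : ContDiffOn ℝ ∞ (scBilin α e B) D := by
  refine contDiffOn_clm_apply.2 fun v => contDiffOn_clm_apply.2 fun w => ?_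
  have hL : ∀ v, ContDiffOn ℝ ∞ (fun z => inversionD α e z v) D := fun v => by
    refine ContDiff.contDiffOn ?_
    have h1 : ContDiff ℝ ∞ fun z : EE n => α v • (z + e) :=
      (contDiff_id.add contDiff_const).const_smul (α v)
    exact contDiff_const.sub h1
  exact contDiffOn_const.add ((hB.clm_apply (hL v)).clm_apply (hL w))

variable {M : Type*} [TopologicalSpace M] [ChartedSpace (EuclideanSpace ℝ (Fin n)) M]
  [IsManifold (𝓡 n) ∞ M]

/-- The logarithm of the weight: `exp (weight x F r) = e^{F/x} x^r`. -/
def weight (x : M → ℝ) (F r : ℝ) (p : M) : ℝ := F / x p + r * Real.log (x p)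

lemma contMDiffOn_weight {x : M → ℝ} (hx : IsBdf (n := n) x) (F r : ℝ) :
    ContMDiffOn (𝓡 n) 𝓘(ℝ, ℝ) ∞ (weight x F r) {q | 0 < x q} := by
  have h1 : ContDiffOn ℝ ∞ (fun t : ℝ => F / t + r * Real.log t) (Ioi 0) := by
    refine (contDiffOn_const.div contDiffOn_id fun t ht => ne_of_gt ht).add ?_
    exact contDiffOn_const.mul (Real.contDiffOn_log.mono fun t ht => ne_of_gt ht)
  exact h1.contMDiffOn.comp hx.smooth.contMDiffOn fun q hq => hq

section

variable {x : M → ℝ} {α : EE n →L[ℝ] ℝ} {e : EE n} {b : OpenPartialHomeomorph M (EE n)}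

/-- Non-degeneracy of a scattering metric at the boundary. -/
lemma isInner_scBilin (hx : IsBdf (n := n) x) (gsc : ScMetric n x) (hb : IsSmoothChart b)
    (hα : ∀ q ∈ b.source, α (b q) = x q) (he : α e = 1) {z : EE n} (hz : z ∈ b.target)
    (hz0 : α z = 0) : IsInner (scBilin α e (cτ b gsc.h) z) := by
  have hαz : ∀ y ∈ b.target, x (b.symm y) = α y := fun y hy => by
    rw [← hα _ (b.map_target hy), b.right_inv hy]
  have hdx : ∀ w, dForm (n := n) x (b.symm z) (chartD b z w) = α w := fun w => by
    have h1 := hb.fderiv_comp_symm hz (hx.smooth.mdifferentiable (by simp) (b.symm z))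
    have h2 : (fun y => x (b.symm y)) =ᶠ[𝓝 z] α := by
      filter_upwards [b.open_target.mem_nhds hz] with y hy
      exact hαz y hy
    rw [h2.fderiv_eq, α.fderiv] at h1
    exact (congrArg (fun L => L w) h1).symm
  have hpos : ∀ w, w ≠ 0 → α w = 0 → 0 < cτ b gsc.h z w w := fun w hw hαw => by
    refine gsc.pos_boundary (b.symm z) (by rw [hαz z hz, hz0]) (chartD b z w) (fun h0 => hw ?_) ?_
    · exact hb.chartD_injective hz (h0.trans (map_zero _).symm)
    · rw [hdx, hαw]
  have hLα : ∀ v, α (inversionD α e z v) = 0 := fun v => by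
    rw [inversionD_apply, map_sub, map_smul, map_add, he, hz0]
    simp
  refine ⟨fun v w => ?_, fun v hv => ?_⟩
  · change α v * α w + cτ b gsc.h z (inversionD α e z v) (inversionD α e z w)
      = α w * α v + cτ b gsc.h z (inversionD α e z w) (inversionD α e z v)
    rw [mul_comm]
    congr 1
    exact gsc.symm _ _ _
  · change 0 < α v * α v + cτ b gsc.h z (inversionD α e z v) (inversionD α e z v)
    by_cases hαv : α v = 0
    · have e1 : inversionD α e z v = v := by rw [inversionD_apply, hαv, zero_smul, sub_zero]
      rw [hαv, e1, zero_mul, zero_add]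
      exact hpos v hv hαv
    · have e1 : 0 ≤ cτ b gsc.h z (inversionD α e z v) (inversionD α e z v) := by
        by_cases h0 : inversionD α e z v = 0
        · rw [h0, map_zero]
        · exact (hpos _ h0 (hLα v)).le
      have e2 : 0 < α v * α v := mul_self_pos.2 hαv
      linarith

/-- Around a point of the artificial boundary `x = 0`, coordinates in which `x` is the linear form
`α` become an adapted chart when composed with the inversion. It sends `x = 0` to infinity and, by
the hypothesis on `β`, preserves the half space `β > 0`. -/
lemma exists_isAdaptedChart_boundary (hx : IsBdf (n := n) x) (gsc : ScMetric n x)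
    {h₂ : M → EE n →L[ℝ] EE n →L[ℝ] ℝ} (hh₂ : IsMetricOn h₂ univ) (F r : ℝ) {Ω : Set M}
    (hb : IsSmoothChart b) (hbe : ∃ e ∈ atlas (EuclideanSpace ℝ (Fin n)) M, b.source ⊆ e.source)
    {p : M} (hp : p ∈ b.source) (hxp : x p = 0)
    (hα : ∀ q ∈ b.source, α (b q) = x q) (he : α e = 1) {β : EE n →L[ℝ] ℝ} {v : EE n}
    (hβ : β v = 1) (hβκ : ∀ z, 0 < α z → (0 < β (inversion α e z) ↔ 0 < β z))
    (hiff : ∀ q ∈ b.source, 0 < x q → (q ∈ Ω ↔ 0 < β (b q))) :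
    ∃ V a C, p ∈ V ∧ IsAdaptedChart (n := n) (M := M) {q | 0 < x q} gsc.form h₂
      (weight x F r) Ω V a β v C := by
  set κ := inversion α e with hκ
  set h := cτ (n := n) (M := M) b gsc.h with hh
  have hz₀ : b p ∈ b.target := b.map_source hp
  have hαz₀ : α (b p) = 0 := by rw [hα p hp, hxp]
  have hhs : ContDiffOn ℝ ∞ h b.target := hb.contDiffOn_cτ gsc.smooth
  have hBs := contDiffOn_scBilin (α := α) (e := e) hhs
  -- bounds near the boundary point
  obtain ⟨C₁, hC₁⟩ := (isInner_scBilin hx gsc hb hα he hz₀ hαz₀).eventually_bounds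
    (hBs.continuousOn.continuousAt (b.open_target.mem_nhds hz₀))
  have hd : ContinuousAt (fderiv ℝ (scBilin α e h)) (b p) :=
    (hBs.continuousOn_fderiv_of_isOpen b.open_target (by simp)).continuousAt
      (b.open_target.mem_nhds hz₀)
  have hD := hd.norm.eventually_lt_const (lt_add_one _)
  set D := ‖fderiv ℝ (scBilin α e h) (b p)‖ + 1
  obtain ⟨C₂, hC₂⟩ := hh₂.eventually_bounds hb (z₀ := b p) ⟨hz₀, mem_univ _⟩
  have hLc : Continuous fun z => inversionD α e z :=
    continuous_const.sub ((ContinuousLinearMap.smulRightL ℝ (EE n) (EE n) α).continuous.comp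
      (continuous_id.add continuous_const))
  have hA := hLc.continuousAt.norm.eventually_lt_const (lt_add_one ‖inversionD α e (b p)‖)
  set A := ‖inversionD α e (b p)‖ + 1
  have hE := ((continuous_id.add (continuous_const (y := e))).continuousAt
    (x := b p)).norm.eventually_lt_const (lt_add_one _)
  set E := ‖id (b p) + e‖ + 1
  have h1 : ∀ᶠ z in 𝓝 (b p), α z < 1 :=
    α.continuous.continuousAt.eventually_lt_const (by rw [hαz₀]; exact one_pos)
  obtain ⟨b', hb', hpb', hbb', hbe', hbe'', K, hK, hbK, hKb, hq⟩ := hb.exists_ball hp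
    (hC₁.and (hD.and (hC₂.and (hA.and (hE.and h1)))))
  have hA0 : 0 ≤ A := by positivity
  have hD0 : 0 ≤ D := by positivity
  have hα' : ∀ q ∈ b'.source, α (b' q) = x q := fun q hq => by rw [hbe']; exact hα q (hbb' hq)
  set a := b'.trans (inversionHomeo he) with ha
  have has : IsSmoothChart a := hb'.trans contDiffOn_inversion contDiffOn_inversion
  have hsource : a.source = b'.source ∩ {q | 0 < x q} := by
    rw [ha, OpenPartialHomeomorph.trans_source]
    ext q
    refine and_congr_right fun hqs => ?_
    change 0 < α (b' q) ↔ 0 < x q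
    rw [hα' q hqs]
  have haq : ∀ q, a q = κ (b q) := fun q => congrArg κ (hbe' q)
  have hay : ∀ y, a.symm y = b.symm (κ y) := fun y => hbe'' (κ y)
  have htar : ∀ y ∈ a.target, 0 < α y ∧ κ y ∈ b'.target := fun y hy => by
    rw [ha, OpenPartialHomeomorph.trans_target] at hy
    exact hy
  have hbsub : b'.target ⊆ b.target := hbK.trans hKb
  have hzb : ∀ y ∈ a.target, κ y ∈ b.target := fun y hy => hbsub (htar y hy).2
  have hbay : ∀ y ∈ a.target, b (a.symm y) = κ y := fun y hy => by
    rw [hay, b.right_inv (hzb y hy)]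
  have hev : ∀ y ∈ a.target, (fun z => b (a.symm z)) =ᶠ[𝓝 y] κ := fun y hy => by
    filter_upwards [a.open_target.mem_nhds hy] with z hz
    exact hbay z hz
  have hpull : ∀ (τ : M → EE n →L[ℝ] EE n →L[ℝ] ℝ), ∀ y ∈ a.target,
      cτ a τ y = pull₂ (cτ b τ (κ y)) (fderiv ℝ κ y) := fun τ y hy => by
    have h2 := cτ_eq_pull₂ has hb (y := y) ⟨hy, hbb' (hsource ▸ a.map_target hy).1⟩ τ
    rw [hbay y hy, (hev y hy).fderiv_eq] at h2
    exact h2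
  have hκd : ∀ y ∈ a.target, HasFDerivAt κ (α (κ y) • inversionD α e (κ y)) y := fun y hy => by
    have := hasFDerivAt_inversion (e := e) (htar y hy).1.ne'
    rwa [← apply_inversion he (htar y hy).1.ne'] at this
  have hs1 : ∀ y ∈ a.target, 0 < α (κ y) ∧ α (κ y) < 1 := fun y hy =>
    ⟨inversion_mem he (htar y hy).1, (hq _ (htar y hy).2).2.2.2.2.2⟩
  have hκn : ∀ y ∈ a.target, ‖fderiv ℝ κ y‖ ≤ A := fun y hy => by
    rw [(hκd y hy).fderiv, norm_smul, Real.norm_eq_abs, abs_of_pos (hs1 y hy).1]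
    calc α (κ y) * ‖inversionD α e (κ y)‖ ≤ 1 * A := by
          gcongr
          · exact (hs1 y hy).2.le
          · exact (hq _ (htar y hy).2).2.2.2.1.le
      _ = A := one_mul A
  have hxz : ∀ z ∈ b.target, x (b.symm z) = α z := fun z hz => by
    rw [← hα _ (b.map_target hz), b.right_inv hz]
  -- the inversion cancels the singular factors `x⁻⁴` and `x⁻²` of the scattering metric
  have hform : ∀ y ∈ a.target, cτ a gsc.form y = scBilin α e h (κ y) := fun y hy => by
    have hz := hzb y hy
    have e1 : fderiv ℝ (fun z => x (b.symm z)) (κ y) = α := by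
      have h2 : (fun z => x (b.symm z)) =ᶠ[𝓝 (κ y)] α := by
        filter_upwards [b.open_target.mem_nhds hz] with z hz
        exact hxz z hz
      rw [h2.fderiv_eq, α.fderiv]
    have hs := (hs1 y hy).1.ne'
    refine (hpull _ y hy).trans ?_
    rw [(hκd y hy).fderiv]
    have e2 := cτ_form hx gsc hb hz
    rw [e1, hxz _ hz] at e2
    ext1 v
    ext1 w
    rw [pull₂_apply]
    have e3 := congrArg (fun B : EE n →L[ℝ] EE n →L[ℝ] ℝ =>
      B ((α (κ y) • inversionD α e (κ y)) v) ((α (κ y) • inversionD α e (κ y)) w)) e2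
    refine e3.trans ?_
    -- `dx` gains one more factor `x` than the other covectors
    have e4 : ∀ v, α (inversionD α e (κ y) v) = -(α (κ y) * α v) := fun v => by
      rw [inversionD_apply, map_sub, map_smul, map_add, he, smul_eq_mul]; ring
    change (α (κ y) ^ 4)⁻¹ * (α (α (κ y) • inversionD α e (κ y) v)
        * α (α (κ y) • inversionD α e (κ y) w))
      + (α (κ y) ^ 2)⁻¹ * h (κ y) (α (κ y) • inversionD α e (κ y) v)
        (α (κ y) • inversionD α e (κ y) w)
      = α v * α w + h (κ y) (inversionD α e (κ y) v) (inversionD α e (κ y) w)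
    simp only [map_smul, smul_apply, smul_eq_mul, e4]
    field_simp
  -- `1/x` is the coordinate `α`, so that `d(F/x)` and `d(log x) = -dα/α` are bounded
  have hxa : ∀ y ∈ a.target, x (a.symm y) = (α y)⁻¹ := fun y hy => by
    rw [hay, hxz _ (hzb y hy), hκ, apply_inversion he (htar y hy).1.ne']
  have hPa : ∀ y ∈ a.target, y ∈ chartDomain a {q | 0 < x q} := fun y hy =>
    ⟨hy, (hsource ▸ a.map_target hy).2⟩
  have hC₁0 : 0 ≤ C₁ := (norm_nonneg (scBilin α e h (b p))).trans hC₁.self_of_nhds.2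
  set C₃ := 2 * C₁ * (D * A)
  set C₄ := (1 + ‖α‖ * E) * (C₂ * A ^ 2 + 2 * ‖α‖ * A)
  set C₅ := (|F| + |r|) * ‖α‖
  set C := max (max C₁ C₃) (max C₄ C₅) with hC
  have i1 : C₁ ≤ C := (le_max_left _ _).trans (le_max_left _ _)
  have i3 : C₃ ≤ C := (le_max_right _ _).trans (le_max_left _ _)
  have i4 : C₄ ≤ C := (le_max_left _ _).trans (le_max_right _ _)
  have i5 : C₅ ≤ C := (le_max_right _ _).trans (le_max_right _ _)
  have hinner : ∀ y ∈ a.target, IsInner (cτ (n := n) (M := M) a gsc.form y) := fun y hy =>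
    (isMetricOn_form hx gsc).inner_chart has (hPa y hy)
  refine ⟨b'.source, a, C, hpb', ⟨has, b'.open_source, hsource, ?_, hβ, fun q hqa => ?_,
    fun y hy => ?_, fun y hy => ?_, fun y hy => ?_, fun y hy => ?_, fun χ hχ => ?_,
    fun L hL hLc => ?_⟩⟩
  · obtain ⟨e', he', h2⟩ := hbe
    exact ⟨e', he', (hsource ▸ inter_subset_left).trans (hbb'.trans h2)⟩
  · have hqa' := hsource ▸ hqa
    rw [hiff q (hbb' hqa'.1) hqa'.2, haq]
    refine (hβκ _ ?_).symm
    rw [hα q (hbb' hqa'.1)]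
    exact hqa'.2
  · have h2 := (hq _ (htar y hy).2).1
    refine IsBounded.mono ⟨hinner y hy, fun v => ?_, ?_⟩ i1
    · have h3 := h2.1 v
      rw [← hform y hy] at h3
      exact h3
    · have h3 := h2.2
      rw [← hform y hy] at h3
      exact h3
  · refine le_trans ?_ i3
    have hz := hzb y hy
    have h2 : HasFDerivAt (scBilin α e h) (fderiv ℝ (scBilin α e h) (κ y)) (κ y) :=
      ((hBs.contDiffAt (b.open_target.mem_nhds hz)).differentiableAt (by simp)).hasFDerivAt
    have h3 : fderiv ℝ (cτ (n := n) (M := M) a gsc.form) y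
        = (fderiv ℝ (scBilin α e h) (κ y)).comp (fderiv ℝ κ y) := by
      have h4 : cτ (n := n) (M := M) a gsc.form =ᶠ[𝓝 y] fun y => scBilin α e h (κ y) := by
        filter_upwards [a.open_target.mem_nhds hy] with z hz
        exact hform z hz
      rw [h4.fderiv_eq, (hκd y hy).fderiv]
      exact (h2.comp y (hκd y hy)).fderiv
    refine norm_levi_le (hinner y hy) hC₁0 (by positivity) (fun v => ?_) ?_
    · have h4 := (hq _ (htar y hy).2).1.1 v
      rw [← hform y hy] at h4
      exact h4
    · rw [h3]
      refine (ContinuousLinearMap.opNorm_comp_le _ _).trans ?_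
      gcongr
      · exact (hq _ (htar y hy).2).2.1.le
      · exact hκn y hy
  · refine le_trans ?_ i4
    have hz := hzb y hy
    have h2 := (hh₂.smooth b hb).contDiffAt ((isOpen_chartDomain b isOpen_univ).mem_nhds
      (⟨hz, mem_univ _⟩ : κ y ∈ chartDomain b univ))
    refine norm_levi_inversion_le he (htar y hy).1 (H' := cτ b h₂)
      (h2.differentiableAt (by simp)) (hh₂.inner_chart has ⟨hy, mem_univ _⟩)
      (hh₂.inner_chart hb ⟨hz, mem_univ _⟩) ?_ (hq _ (htar y hy).2).2.2.2.1.le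
      (hq _ (htar y hy).2).2.2.1.2 (hq _ (htar y hy).2).2.2.2.2.1.le (hs1 y hy).2.le
    filter_upwards [a.open_target.mem_nhds hy] with z hz
    exact hpull h₂ z hz
  · refine le_trans ?_ i5
    change ‖fderiv ℝ (fun z => F / x (a.symm z) + r * Real.log (x (a.symm z))) y‖ ≤ C₅
    have h2 : (fun z => F / x (a.symm z) + r * Real.log (x (a.symm z)))
        =ᶠ[𝓝 y] fun z => F * α z + r * -Real.log (α z) := by
      filter_upwards [a.open_target.mem_nhds hy] with z hz
      rw [hxa z hz, Real.log_inv, div_inv_eq_mul]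
    have hy0 := (htar y hy).1
    have h3 : HasFDerivAt (fun z => F * α z + r * -Real.log (α z))
        (F • α + r • -((α y)⁻¹ • α)) y :=
      (α.hasFDerivAt.const_mul F).add (((α.hasFDerivAt (x := y)).log hy0.ne').neg.const_mul r)
    rw [h2.fderiv_eq, h3.fderiv]
    have h4 : (α y)⁻¹ ≤ 1 := by
      rw [← apply_inversion he hy0.ne']
      exact (hs1 y hy).2.le
    calc ‖F • α + r • -((α y)⁻¹ • α)‖ ≤ |F| * ‖α‖ + |r| * (1 * ‖α‖) := by
          refine (norm_add_le _ _).trans ?_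
          rw [norm_smul, norm_smul, norm_neg, norm_smul, Real.norm_eq_abs, Real.norm_eq_abs,
            Real.norm_eq_abs, abs_of_pos (inv_pos.2 hy0)]
          gcongr
      _ = C₅ := by ring
  · have h2 : ContDiffOn ℝ ∞ (fun z => χ (b.symm z)) b.target := by
      have := hb.contDiffOn_comp_symm (hχ.contMDiffOn (s := univ))
      exact this.mono fun z hz => ⟨hz, mem_univ _⟩
    obtain ⟨C', hC'⟩ := hK.exists_bound_of_continuousOn
      ((h2.continuousOn_fderiv_of_isOpen b.open_target (by simp)).mono hKb)
    refine ⟨C' * A, fun y hy => ?_⟩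
    have hz := hzb y hy
    have h3 : HasFDerivAt (fun z => χ (b.symm z)) (fderiv ℝ (fun z => χ (b.symm z)) (κ y)) (κ y) :=
      ((h2.contDiffAt (b.open_target.mem_nhds hz)).differentiableAt (by simp)).hasFDerivAt
    have h4 : (fun z => χ (a.symm z)) = (fun z => χ (b.symm z)) ∘ κ := by
      funext z
      exact congrArg χ (hay z)
    rw [h4, (h3.comp y (hκd y hy)).fderiv, ← (hκd y hy).fderiv]
    refine (ContinuousLinearMap.opNorm_comp_le _ _).trans ?_
    have h5 := hC' _ (hbK (htar y hy).2)
    have h6 := (norm_nonneg _).trans h5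
    gcongr
    exact hκn y hy
  -- the condition `α ≥ 1` may be added because `α > 1` on the target of the chart; it keeps away
  -- from the locus `α = 0` where the inversion is not continuous
  · have e1 : a '' (L ∩ {q | 0 < x q}) = {y | 1 ≤ α y} ∩ κ ⁻¹' (b '' L) := by
      ext y
      constructor
      · rintro ⟨q, ⟨hqL, hqx⟩, rfl⟩
        have hqa : q ∈ a.source := hsource ▸ ⟨hL hqL, hqx⟩
        have hy := a.map_source hqa
        refine ⟨?_, q, hqL, ?_⟩
        · have h2 := hs1 _ hy
          rw [hκ, apply_inversion he (htar _ hy).1.ne'] at h2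
          exact ((inv_lt_one₀ (htar _ hy).1).1 h2.2).le
        · rw [← hbay _ hy, a.left_inv hqa]
      · rintro ⟨hy1, q, hqL, hqy⟩
        have hy0 : 0 < α y := one_pos.trans_le hy1
        have hqx : 0 < x q := by
          rw [← hα q (hbb' (hL hqL)), hqy]
          exact inversion_mem he hy0
        refine ⟨q, ⟨hqL, hqx⟩, ?_⟩
        rw [haq, hqy]
        exact inversion_inversion he hy0.ne'
    rw [e1]
    have hc : ContinuousOn κ {y | 1 ≤ α y} :=
      contDiffOn_inversion.continuousOn.mono fun y hy => one_pos.trans_le (show 1 ≤ α y from hy)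
    refine hc.preimage_isClosed_of_isClosed (isClosed_le continuous_const α.continuous) ?_
    exact (hLc.image_of_continuousOn
      (b.continuousOn.mono (hL.trans hbb'))).isClosed

end

end ScGeom
end

noncomputable section

namespace ScGeom

variable {n : ℕ} {M : Type*} [TopologicalSpace M] [ChartedSpace (EuclideanSpace ℝ (Fin n)) M]

/-! ### Adapted charts around the closure of the domain -/

/-- The differential of a function at a point, in the standard trivialization. -/
def dAt (f : M → ℝ) (p : M) : EE n →L[ℝ] ℝ := dForm (n := n) f p

/-- The chain rule for a function read in a chart. -/
lemma IsSmoothChart.fderiv_comp_symm_apply {e : OpenPartialHomeomorph M (EE n)}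
    (he : IsSmoothChart e) {f : M → ℝ} {p : M} (hp : p ∈ e.source)
    (hf : MDifferentiableAt (𝓡 n) 𝓘(ℝ, ℝ) f p) :
    fderiv ℝ (fun y => f (e.symm y)) (e p) = (dAt f p).comp (chartD e (e p)) := by
  have h1 : e.symm (e p) = p := e.left_inv hp
  have h2 := he.fderiv_comp_symm (e.map_source hp) (f := f) (by rw [h1]; exact hf)
  refine h2.trans ?_
  change (dAt f (e.symm (e p))).comp _ = _
  rw [h1]

/-- Linear independence of differentials may be tested in a chart. -/
lemma IsSmoothChart.linearIndependent_comp {ι : Type*} {e : OpenPartialHomeomorph M (EE n)}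
    (he : IsSmoothChart e) {p : M} (hp : p ∈ e.source) {f : ι → M → ℝ}
    (hf : ∀ j, MDifferentiableAt (𝓡 n) 𝓘(ℝ, ℝ) (f j) p)
    (hli : LinearIndependent ℝ fun j => dAt (n := n) (f j) p) :
    LinearIndependent ℝ fun j => fderiv ℝ (fun y => f j (e.symm y)) (e p) := by
  set P : (EE n →L[ℝ] ℝ) →ₗ[ℝ] EE n →L[ℝ] ℝ :=
    (ContinuousLinearMap.precomp ℝ (chartD e (e p)) :
      (EE n →L[ℝ] ℝ) →L[ℝ] EE n →L[ℝ] ℝ).toLinearMap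
  have hinj : LinearMap.ker P = ⊥ := by
    refine LinearMap.ker_eq_bot'.2 fun l hl => ?_
    ext v
    obtain ⟨w, rfl⟩ := he.chartD_surjective (e.map_source hp) v
    exact congrArg (fun L : EE n →L[ℝ] ℝ => L w) hl
  have h := hli.map' P hinj
  have e1 : (fun j => fderiv ℝ (fun y => f j (e.symm y)) (e p))
      = P ∘ fun j => dAt (n := n) (f j) p := by
    funext j
    exact he.fderiv_comp_symm_apply hp (hf j)
  rw [e1]
  exact h

variable [IsManifold (𝓡 n) ∞ M] {x : M → ℝ} {Ω : Set M}

lemma IsScDomain.subset_pos (hΩ : IsScDomain (n := n) x Ω) : Ω ⊆ {p | 0 < x p} := by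
  intro p hp
  obtain ⟨V, ρ, -, hpV, -, hV, -⟩ := hΩ.local_form p (subset_closure hp)
  have : p ∈ Ω ∩ V := ⟨hp, hpV⟩
  rw [hV] at this
  exact this.2.1

lemma IsScDomain.isOpen (hx : IsBdf (n := n) x) (hΩ : IsScDomain (n := n) x Ω) : IsOpen Ω := by
  rw [isOpen_iff_mem_nhds]
  intro p hp
  obtain ⟨V, ρ, hVo, hpV, hρ, hV, -⟩ := hΩ.local_form p (subset_closure hp)
  have h1 : IsOpen ({q | 0 < x q} ∩ (V ∩ ρ ⁻¹' Ioi 0)) :=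
    (isOpen_pos hx).inter (hρ.continuousOn.isOpen_inter_preimage hVo isOpen_Ioi)
  have h2 : p ∈ Ω ∩ V := ⟨hp, hpV⟩
  rw [hV] at h2
  refine Filter.mem_of_superset (h1.mem_nhds ⟨h2.2.1, h2.1, h2.2.2⟩) fun q hq => ?_
  have h3 : q ∈ Ω ∩ V := by
    rw [hV]
    exact ⟨hq.2.1, hq.1, hq.2.2⟩
  exact h3.1

/-- Every point of the closure of a scattering domain has an adapted chart, for the weight
`e^{F/x} x^r`. -/
theorem IsScDomain.exists_isAdaptedChart (hx : IsBdf (n := n) x) (gsc : ScMetric n x)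
    (hΩ : IsScDomain (n := n) x Ω) {h₂ : M → EE n →L[ℝ] EE n →L[ℝ] ℝ} (hh₂ : IsMetricOn h₂ univ)
    (F r : ℝ) (hn : 0 < n) {p : M} (hp : p ∈ closure Ω) :
    ∃ V a β v C, p ∈ V ∧ IsAdaptedChart (n := n) (M := M) {q | 0 < x q} gsc.form h₂
      (weight x F r) Ω V a β v C := by
  obtain ⟨V, ρ, hVo, hpV, hρ, hV, hcor⟩ := hΩ.local_form p hp
  have hmem : ∀ q ∈ V, (q ∈ Ω ↔ 0 < x q ∧ 0 < ρ q) := fun q hq => by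
    have h1 : q ∈ Ω ∩ V ↔ q ∈ {q ∈ V | 0 < x q ∧ 0 < ρ q} := by rw [hV]
    exact ⟨fun h => (h1.1 ⟨h, hq⟩).2, fun h => (h1.2 ⟨hq, h⟩).1⟩
  have hxc : Continuous x := hx.smooth.continuous
  have hxp : 0 ≤ x p := by
    have h1 : closure Ω ⊆ {q | 0 ≤ x q} :=
      closure_minimal (fun q hq => (show 0 < x q from hΩ.subset_pos hq).le) (isClosed_le continuous_const hxc)
    exact h1 hp
  have hρp : 0 ≤ ρ p := by
    by_contra! hneg
    have h1 : IsOpen (V ∩ ρ ⁻¹' Iio 0) := hρ.continuousOn.isOpen_inter_preimage hVo isOpen_Iio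
    obtain ⟨q, hq, hqΩ⟩ := mem_closure_iff.1 hp _ h1 ⟨hpV, hneg⟩
    have h2 : ρ q < 0 := hq.2
    exact absurd ((hmem q hq.1).1 hqΩ).2 (not_lt.2 h2.le)
  have hφ := contMDiffOn_weight hx F r
  have hρd : MDifferentiableAt (𝓡 n) 𝓘(ℝ, ℝ) ρ p :=
    (hρ.contMDiffAt (hVo.mem_nhds hpV)).mdifferentiableAt (by simp)
  have hxd : MDifferentiableAt (𝓡 n) 𝓘(ℝ, ℝ) x p := hx.smooth.mdifferentiable (by simp) p
  let e := chartAt (EuclideanSpace ℝ (Fin n)) p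
  have heA : e ∈ atlas (EuclideanSpace ℝ (Fin n)) M := chart_mem_atlas _ p
  have he : IsSmoothChart (n := n) e := isSmoothChart_of_mem_atlas heA
  have hpe : p ∈ e.source := mem_chart_source _ p
  have hmemO : ∀ {N : Set M}, p ∈ N → e p ∈ chartDomain e N := fun {N} hpN => by
    refine ⟨e.map_source hpe, ?_⟩
    rw [mem_preimage, e.left_inv hpe]
    exact hpN
  have hsrcO : ∀ {N : Set M} {q : M}, q ∈ e.source ∩ e ⁻¹' chartDomain e N → q ∈ N :=
    fun {N q} hq => by
      have h1 : e.symm (e q) ∈ N := hq.2.2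
      rwa [e.left_inv hq.1] at h1
  have hVρ : IsOpen (V ∩ ρ ⁻¹' Ioi 0) := hρ.continuousOn.isOpen_inter_preimage hVo isOpen_Ioi
  rcases hxp.lt_or_eq with hxpos | hx0
  · rcases hρp.lt_or_eq with hρpos | hρ0
    -- an interior point: any coordinate, shifted to be positive, serves as `β`
    · let i₀ : Fin n := ⟨0, hn⟩
      let l : EE n →L[ℝ] ℝ := EuclideanSpace.proj i₀
      let f : Unit → EE n → ℝ := fun _ z => 1 + l z - l (e p)
      let N := {q | 0 < x q} ∩ (V ∩ ρ ⁻¹' Ioi 0)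
      have hl : l ≠ 0 := fun h0 => by
        have h1 : l (stdVec i₀) = 1 := by simp [l, stdVec]
        rw [h0] at h1
        exact zero_ne_one h1
      have hfl : ∀ z, fderiv ℝ (f ()) z = l := fun z =>
        ((l.hasFDerivAt.const_add 1).sub_const _).fderiv
      have hfc : Continuous (f ()) := (continuous_const.add l.continuous).sub continuous_const
      have hfs : ContDiff ℝ ∞ (f ()) := (contDiff_const.add l.contDiff).sub contDiff_const
      have hO : IsOpen (chartDomain e N ∩ {z | 0 < f () z}) :=
        (isOpen_chartDomain e ((isOpen_pos hx).inter hVρ)).inter (isOpen_lt continuous_const hfc)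
      obtain ⟨b, hb, hpb, hbs, α, v, hα1, -, hα⟩ := he.exists_straight hpe (f := f) hO
        ⟨hmemO ⟨hxpos, hpV, hρpos⟩, by simp [f]⟩ (fun _ => hfs.contDiffOn)
        (by
          rw [linearIndependent_unique_iff]
          change fderiv ℝ (f ()) (e p) ≠ 0
          rw [hfl]
          exact hl)
      have hbN : ∀ q ∈ b.source, q ∈ N ∧ 0 < f () (e q) := fun q hq =>
        ⟨hsrcO ⟨(hbs hq).1, (hbs hq).2.1⟩, (hbs hq).2.2⟩
      obtain ⟨V', a, C, h⟩ := exists_isAdaptedChart_interior hb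
        ⟨e, heA, hbs.trans inter_subset_left⟩ hpb (fun q hq => (hbN q hq).1.1)
        (isMetricOn_form hx gsc) hh₂ hφ (hα1 ()) (Ω := Ω) fun q hq => by
          rw [hα]
          exact iff_of_true ((hmem q (hbN q hq).1.2.1).2 ⟨(hbN q hq).1.1, (hbN q hq).1.2.2⟩)
            (hbN q hq).2
      exact ⟨V', a, α (), v (), C, h⟩
    -- a point of the interior boundary away from `x = 0`: take `β = ρ`
    · let N := {q | 0 < x q} ∩ V
      have hN : IsOpen N := (isOpen_pos hx).inter hVo
      obtain ⟨b, hb, hpb, hbs, α, v, hα1, -, hα⟩ := he.exists_straight hpe (ι := Unit)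
        (f := fun _ z => ρ (e.symm z)) (isOpen_chartDomain e hN) (hmemO ⟨hxpos, hpV⟩)
        (fun _ => he.contDiffOn_comp_symm (hρ.mono inter_subset_right))
        (he.linearIndependent_comp hpe (f := fun _ : Unit => ρ) (fun _ => hρd) (by
          rw [linearIndependent_unique_iff]
          exact (hcor hρ0.symm).1))
      have hbN : ∀ q ∈ b.source, q ∈ N := fun q hq => hsrcO (hbs hq)
      obtain ⟨V', a, C, h⟩ := exists_isAdaptedChart_interior hb
        ⟨e, heA, hbs.trans inter_subset_left⟩ hpb (fun q hq => (hbN q hq).1)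
        (isMetricOn_form hx gsc) hh₂ hφ (hα1 ()) (Ω := Ω) fun q hq => by
          rw [hα, e.left_inv (hbs hq).1, hmem q (hbN q hq).2]
          exact and_iff_right (hbN q hq).1
      exact ⟨V', a, α (), v (), C, h⟩
  · rcases hρp.lt_or_eq with hρpos | hρ0
    -- a point of the artificial boundary only: locally `Ω` is `x > 0`, and `β = α` is positive on
    -- the chart
    · obtain ⟨b, hb, hpb, hbs, α, v, hα1, -, hα⟩ := he.exists_straight hpe (ι := Unit)
        (f := fun _ z => x (e.symm z)) (isOpen_chartDomain e hVρ) (hmemO ⟨hpV, hρpos⟩)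
        (fun _ => he.contDiffOn_comp_symm hx.smooth.contMDiffOn)
        (he.linearIndependent_comp hpe (f := fun _ : Unit => x) (fun _ => hxd) (by
          rw [linearIndependent_unique_iff]
          exact hx.dx_ne_zero p hx0.symm))
      have hbN : ∀ q ∈ b.source, q ∈ V ∩ ρ ⁻¹' Ioi 0 := fun q hq => hsrcO (hbs hq)
      have hαx : ∀ q ∈ b.source, α () (b q) = x q := fun q hq => by
        rw [hα, e.left_inv (hbs hq).1]
      obtain ⟨V', a, C, h⟩ := exists_isAdaptedChart_boundary hx gsc hh₂ F r (Ω := Ω) hb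
        ⟨e, heA, hbs.trans inter_subset_left⟩ hpb hx0.symm hαx (hα1 ()) (hα1 ())
        (fun z hz => iff_of_true (inversion_mem (hα1 ()) hz) hz) fun q hq hxq => by
          rw [hαx q hq, hmem q (hbN q hq).1]
          exact and_iff_left (hbN q hq).2
      exact ⟨V', a, α (), v (), C, h⟩
    -- a corner: `x` and `ρ` are both coordinates by transversality, and the inversion multiplies the
    -- coordinate `β = ρ` by a positive factor because `v 0` lies in its kernel
    · let f : Fin 2 → M → ℝ := ![x, ρ]
      obtain ⟨b, hb, hpb, hbs, α, v, hα1, hα0, hα⟩ := he.exists_straight hpe (ι := Fin 2)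
        (f := fun j z => f j (e.symm z)) (isOpen_chartDomain e hVo) (hmemO hpV)
        (fun j => he.contDiffOn_comp_symm (by
          fin_cases j
          · exact hx.smooth.contMDiffOn
          · exact hρ))
        (he.linearIndependent_comp hpe (f := f) (fun j => by
          fin_cases j
          · exact hxd
          · exact hρd) (by
          have h1 := (hcor hρ0.symm).2 hx0.symm
          have h2 : (fun j => dAt (n := n) (f j) p) = ![dAt x p, dAt ρ p] := by
            funext j
            fin_cases j <;> rfl
          rw [h2]
          exact h1))
      have hbN : ∀ q ∈ b.source, q ∈ V := fun q hq => hsrcO (hbs hq)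
      have hαx : ∀ q ∈ b.source, α 0 (b q) = x q := fun q hq => by
        rw [hα, e.left_inv (hbs hq).1]
        rfl
      have hαρ : ∀ q ∈ b.source, α 1 (b q) = ρ q := fun q hq => by
        rw [hα, e.left_inv (hbs hq).1]
        rfl
      obtain ⟨V', a, C, h⟩ := exists_isAdaptedChart_boundary hx gsc hh₂ F r (Ω := Ω) hb
        ⟨e, heA, hbs.trans inter_subset_left⟩ hpb hx0.symm hαx (hα1 0) (hα1 1)
        (fun z hz => by
          have h1 : α 1 (inversion (α 0) (v 0) z) = (α 0 z)⁻¹ * α 1 z := by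
            rw [inversion, map_sub, map_smul, map_add, hα0 1 0 one_ne_zero, smul_eq_mul]
            ring
          rw [h1]
          exact mul_pos_iff_of_pos_left (inv_pos.2 hz)) fun q hq hxq => by
          rw [hαρ q hq, hmem q (hbN q hq)]
          exact and_iff_right hxq
      exact ⟨V', a, α 1, v 1, C, h⟩

end ScGeom
end

noncomputable section

namespace ScGeom

variable {n : ℕ} {𝕜 : Type*} [RCLike 𝕜]
  {M : Type*} [TopologicalSpace M] [ChartedSpace (EuclideanSpace ℝ (Fin n)) M]

/-! ### The conjugated symmetric gradient -/

/-- The Levi-Civita connection is torsion free. -/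
lemma IsMetricOn.conn_comm {h : M → EE n →L[ℝ] EE n →L[ℝ] ℝ} {O : Set M} (hh : IsMetricOn h O)
    {a : OpenPartialHomeomorph M (EE n)} (ha : IsSmoothChart a) {y : EE n}
    (hy : y ∈ chartDomain a O) (v w : EE n) : conn a h y v w = conn a h y w v := by
  have hop : IsOpen (chartDomain a O) := isOpen_chartDomain a hh.isOpen
  have hd : DifferentiableAt ℝ (cτ a h) y :=
    ((hh.smooth a ha).contDiffAt (hop.mem_nhds hy)).differentiableAt (by simp)
  have hsymm : ∀ z v w, fderiv ℝ (cτ a h) y z v w = fderiv ℝ (cτ a h) y z w v := fun z v w => by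
    have h1 : ∀ v w, fderiv ℝ (fun y => cτ a h y v w) y z = fderiv ℝ (cτ a h) y z v w :=
      fun v w => by
        have h2 := ((hd.hasFDerivAt.clm_apply (hasFDerivAt_const v y)).clm_apply
          (hasFDerivAt_const w y)).fderiv
        have h3 := congrArg (fun L => L z) h2
        simpa using h3
    rw [← h1, ← h1]
    have h4 : (fun y => cτ a h y v w) =ᶠ[𝓝 y] fun y => cτ a h y w v := by
      filter_upwards [hop.mem_nhds hy] with q hq
      exact (hh.inner_chart ha hq).symm v w
    rw [h4.fderiv_eq]
  change levi _ _ _ _ = levi _ _ _ _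
  rw [levi_apply, levi_apply]
  congr 1
  ext z
  rw [koszul_apply, koszul_apply, hsymm z v w]
  ring

lemma symPart_eq_self {τ : EE n →L[ℝ] EE n →L[ℝ] 𝕜} (h : ∀ v w, τ v w = τ w v) :
    symPart τ = τ := by
  ext v w
  rw [symPart_apply, h w v]
  module

/-- The expression in the chart `a` of the symmetric gradient for the connection of `h₂`,
conjugated by `exp φ`, of the one-form `v` with covariant derivative `W` for the connection of
`h₁`. -/
def conjSym (h₁ h₂ : M → EE n →L[ℝ] EE n →L[ℝ] ℝ) (φ : M → ℝ) (v : M → EE n →L[ℝ] 𝕜)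
    (W : M → EE n →L[ℝ] EE n →L[ℝ] 𝕜) (a : OpenPartialHomeomorph M (EE n)) (y : EE n) :
    EE n →L[ℝ] EE n →L[ℝ] 𝕜 :=
  symPart (cτ a W y + contract (cu a v y) (conn a h₁ y - conn a h₂ y)
    + (fderiv ℝ (fun z => φ (a.symm z)) y).smulRight (cu a v y))

/-- The expressions `conjSym` transform as a 2-tensor: the difference of two connections is a
tensor. -/
lemma conjSym_eq_pull₂ {h₁ h₂ : M → EE n →L[ℝ] EE n →L[ℝ] ℝ} {P : Set M} (hh₁ : IsMetricOn h₁ P)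
    (hh₂ : IsMetricOn h₂ P) {φ : M → ℝ} (hφ : ContMDiffOn (𝓡 n) 𝓘(ℝ, ℝ) ∞ φ P)
    {a b : OpenPartialHomeomorph M (EE n)} (ha : IsSmoothChart a) (hb : IsSmoothChart b) {y : EE n}
    (hy : y ∈ chartDomain a (P ∩ b.source)) (v : M → EE n →L[ℝ] 𝕜)
    (W : M → EE n →L[ℝ] EE n →L[ℝ] 𝕜) :
    conjSym h₁ h₂ φ v W a y = pull₂ (conjSym h₁ h₂ φ v W b (b (a.symm y)))
      (fderiv ℝ (fun y => b (a.symm y)) y) := by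
  have hyb : y ∈ chartDomain a b.source := ⟨hy.1, hy.2.2⟩
  have hz : b (a.symm y) ∈ chartDomain b P := by
    refine ⟨b.map_source hy.2.2, ?_⟩
    rw [mem_preimage, b.left_inv hy.2.2]
    exact hy.2.1
  have hop := isOpen_chartDomain a b.open_source
  have hd : DifferentiableAt ℝ (fun y => b (a.symm y)) y :=
    ((contDiffOn_transition ha hb subset_rfl).contDiffAt (hop.mem_nhds hyb)).differentiableAt
      (by simp)
  have hφb : DifferentiableAt ℝ (fun z => φ (b.symm z)) (b (a.symm y)) :=
    ((hb.contDiffOn_comp_symm hφ).contDiffAt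
      ((isOpen_chartDomain b hh₁.isOpen).mem_nhds hz)).differentiableAt (by simp)
  have e0 : fderiv ℝ (fun z => φ (a.symm z)) y = (fderiv ℝ (fun z => φ (b.symm z))
      (b (a.symm y))).comp (fderiv ℝ (fun y => b (a.symm y)) y) := by
    have h1 : (fun z => φ (a.symm z)) =ᶠ[𝓝 y] fun z => φ (b.symm (b (a.symm z))) := by
      filter_upwards [hop.mem_nhds hyb] with z hz
      rw [b.left_inv hz.2]
    rw [h1.fderiv_eq]
    exact (hφb.hasFDerivAt.comp y hd.hasFDerivAt).fderiv
  have e1 := cu_eq_comp ha hb hyb v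
  have e2 := cτ_eq_pull₂ ha hb hyb W
  have e3 := hh₁.conn_transform ha hb hy
  have e4 := hh₂.conn_transform ha hb hy
  rw [conjSym, conjSym, e0, e1, e2]
  ext s t
  simp only [symPart_apply, add_apply, pull₂_apply, contract_apply, sub_apply, map_sub,
    ContinuousLinearMap.comp_apply, ContinuousLinearMap.smulRight_apply, e3, e4, map_add, smul_apply]
  module

/-- The symmetric gradient for the connection of `h₂`, conjugated by `exp φ`, of a one-form `v` with
covariant derivative `W` for the connection of `h₁`. -/
def conjSymGrad (h₁ h₂ : M → EE n →L[ℝ] EE n →L[ℝ] ℝ) (φ : M → ℝ) (v : M → EE n →L[ℝ] 𝕜)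
    (W : M → EE n →L[ℝ] EE n →L[ℝ] 𝕜) (p : M) : EE n →L[ℝ] EE n →L[ℝ] 𝕜 :=
  let c := chartAt (EuclideanSpace ℝ (Fin n)) p
  pull₂ (conjSym h₁ h₂ φ v W c (c p)) (chartDi c p)

variable [IsManifold (𝓡 n) ∞ M]

/-- `conjSymGrad` has the expression `conjSym` in all charts, not only in the preferred ones. -/
lemma cτ_conjSymGrad {h₁ h₂ : M → EE n →L[ℝ] EE n →L[ℝ] ℝ} {P : Set M} (hh₁ : IsMetricOn h₁ P)
    (hh₂ : IsMetricOn h₂ P) {φ : M → ℝ} (hφ : ContMDiffOn (𝓡 n) 𝓘(ℝ, ℝ) ∞ φ P)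
    {a : OpenPartialHomeomorph M (EE n)} (ha : IsSmoothChart a) {y : EE n}
    (hy : y ∈ chartDomain a P) (v : M → EE n →L[ℝ] 𝕜) (W : M → EE n →L[ℝ] EE n →L[ℝ] 𝕜) :
    cτ a (conjSymGrad h₁ h₂ φ v W) y = conjSym h₁ h₂ φ v W a y := by
  set c := chartAt (EuclideanSpace ℝ (Fin n)) (a.symm y) with hc
  have hcs : IsSmoothChart (n := n) c := isSmoothChart_of_mem_atlas (chart_mem_atlas _ _)
  have hyc : a.symm y ∈ c.source := mem_chart_source _ _
  rw [conjSym_eq_pull₂ hh₁ hh₂ hφ ha hcs ⟨hy.1, hy.2, hyc⟩, cτ, conjSymGrad,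
    chartD_eq_comp ha hcs ⟨hy.1, hyc⟩]
  have h1 : ∀ s, chartDi c (a.symm y) (chartD c (c (a.symm y)) s) = s := fun s => by
    have h2 := hcs.chartDi_comp_chartD (c.map_source hyc)
    rw [c.left_inv hyc] at h2
    exact congrArg (fun L => L s) h2
  ext s t
  simp only [pull₂_apply, ContinuousLinearMap.comp_apply]
  rw [← hc, h1, h1]

variable [MeasurableSpace M] [BorelSpace M]

/-- The weak symmetric gradient of `exp φ` times a weakly differentiable one-form. -/
lemma isWeakSymGrad_conjSymGrad {h₁ h₂ : TwoTensor n M ℝ} {P Ω : Set M}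
    (hh₁ : IsMetricOn (n := n) (M := M) h₁ P) (hh₂ : IsMetricOn (n := n) (M := M) h₂ P)
    (hΩ : IsOpen Ω) (hΩP : Ω ⊆ P) {φ : M → ℝ} (hφ : ContMDiffOn (𝓡 n) 𝓘(ℝ, ℝ) ∞ φ P)
    {v u : OneForm n M 𝕜} {W S : TwoTensor n M 𝕜} (hvW : IsWeakGrad h₁ P v W)
    (hu : ∀ p ∈ Ω, u p = Real.exp (φ p) • v p)
    (hS : ∀ p ∈ Ω, S p
      = Real.exp (φ p) • conjSymGrad (n := n) (M := M) h₁ h₂ φ v W p) :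
    IsWeakSymGrad h₂ Ω u S := by
  refine isWeakSymGrad_of_chart hh₂ hΩ hΩP fun e he => ?_
  have hes := isSmoothChart_of_mem_atlas he
  have hop : IsOpen (chartDomain e Ω) := isOpen_chartDomain e hΩ
  have hsub : chartDomain e Ω ⊆ chartDomain e P := chartDomain_mono e hΩP
  set E : EE n → ℝ := fun y => Real.exp (φ (e.symm y)) with hE
  have hφe : ContDiffOn ℝ ∞ (fun y => φ (e.symm y)) (chartDomain e Ω) :=
    (hes.contDiffOn_comp_symm hφ).mono hsub
  have h1 : IsWeakDeriv₁ (chartDomain e P) (cu (n := n) (M := M) e v) _ :=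
    hvW.isWeakGradIn hh₁ hh₁.isOpen subset_rfl hes
  have h2 := (h1.mono hsub).smul hop hφe.exp
  have hcu : ∀ y ∈ chartDomain e Ω, cu (n := n) (M := M) e u y
      = E y • cu (n := n) (M := M) e v y := fun y hy =>
    congrArg (fun L : EE n →L[ℝ] 𝕜 => L.comp (chartD e y)) (hu _ hy.2)
  refine ⟨_, h2.congr hop (fun y hy => (hcu y hy).symm) fun y hy => rfl, fun y hy => ?_⟩
  have hφd : HasFDerivAt (fun y => φ (e.symm y)) (fderiv ℝ (fun y => φ (e.symm y)) y) y :=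
    ((hφe.contDiffAt (hop.mem_nhds hy)).differentiableAt (by simp)).hasFDerivAt
  have hEd : fderiv ℝ E y = E y • fderiv ℝ (fun y => φ (e.symm y)) y := hφd.exp.fderiv
  have hcS : cτ (n := n) (M := M) e S y
      = E y • conjSym (n := n) (M := M) h₁ h₂ φ v W e y := by
    refine (congrArg (fun B : EE n →L[ℝ] EE n →L[ℝ] 𝕜 => pull₂ B (chartD e y))
      (hS _ hy.2)).trans ?_
    exact congrArg (fun B => E y • B) (cτ_conjSymGrad hh₁ hh₂ hφ hes (hsub hy) v W)
  have hsym : symPart (contract (cu (n := n) (M := M) e v y) (conn (n := n) (M := M) e h₂ y))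
      = contract (cu (n := n) (M := M) e v y) (conn (n := n) (M := M) e h₂ y) :=
    symPart_eq_self fun s t => by
      rw [contract_apply, contract_apply, hh₂.conn_comm hes (hsub hy)]
  have hcc : contract (cu (n := n) (M := M) e u y) (conn (n := n) (M := M) e h₂ y)
      = E y • symPart (contract (cu (n := n) (M := M) e v y) (conn (n := n) (M := M) e h₂ y)) := by
    rw [hsym, hcu y hy]
    rfl
  have hsm : (fderiv ℝ E y).smulRight (cu (n := n) (M := M) e v y)
      = E y • (fderiv ℝ (fun y => φ (e.symm y)) y).smulRight (cu (n := n) (M := M) e v y) := by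
    rw [hEd]
    ext s t
    simp only [ContinuousLinearMap.smulRight_apply, smul_apply, smul_eq_mul, mul_smul]
  rw [hcc, hcS]
  change symPart (E y • _ + (fderiv ℝ E y).smulRight (cu (n := n) (M := M) e v y)) = _
  rw [hsm, ← smul_add, symPart_smul, ← smul_add]
  refine congrArg (fun B => E y • B) ?_
  change _ = symPart _ + _
  rw [← symPart_add, contract_sub]
  congr 1
  abel

end ScGeom
end

noncomputable section

namespace ScGeom

variable {n : ℕ} {𝕜 : Type*} [RCLike 𝕜]
  {M : Type*} [TopologicalSpace M] [ChartedSpace (EuclideanSpace ℝ (Fin n)) M]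

/-! ### Patching the local extensions -/

lemma norm_sum_sq_le {ι E : Type*} [Fintype ι] [NormedAddCommGroup E] (z : ι → E) :
    ‖∑ k, z k‖ ^ 2 ≤ Fintype.card ι * ∑ k, ‖z k‖ ^ 2 := by
  calc ‖∑ k, z k‖ ^ 2 ≤ (∑ k, ‖z k‖) ^ 2 := by gcongr; exact norm_sum_le _ _
    _ ≤ _ := sq_sum_le_card_mul_sum_sq

/-- The pointwise Cauchy–Schwarz inequality for a finite sum of one-forms. -/
lemma normSqOne_sum_le {h : TwoTensor n M ℝ} {p : M} (hI : IsInner (n := n) (h p)) {ι : Type*}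
    [Fintype ι] {U : ι → OneForm n M 𝕜} {u : OneForm n M 𝕜} (hu : u p = ∑ k, U k p) :
    normSqOne h u p ≤ Fintype.card ι * ∑ k, normSqOne h (U k) p := by
  obtain ⟨q, hq⟩ := hI.exists_isONB
  simp only [normSqOne_eq hq]
  rw [Finset.sum_comm, Finset.mul_sum]
  refine Finset.sum_le_sum fun k _ => ?_
  have h1 : u p (q k) = ∑ l, U l p (q k) := by rw [hu]; exact sum_apply _ _ _
  rw [h1]
  exact norm_sum_sq_le _

/-- The pointwise Cauchy–Schwarz inequality for a finite sum of 2-tensors. -/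
lemma normSqTwo_sum_le {h : TwoTensor n M ℝ} {p : M} (hI : IsInner (n := n) (h p)) {ι : Type*}
    [Fintype ι] {Z : ι → TwoTensor n M 𝕜} {z : TwoTensor n M 𝕜} (hz : z p = ∑ k, Z k p) :
    normSqTwo h z p ≤ Fintype.card ι * ∑ k, normSqTwo h (Z k) p := by
  obtain ⟨q, hq⟩ := hI.exists_isONB
  simp only [normSqTwo_eq hq]
  have h0 : ∑ i, ∑ k, ∑ l, ‖Z i p (q k) (q l)‖ ^ 2 = ∑ k, ∑ l, ∑ i, ‖Z i p (q k) (q l)‖ ^ 2 := by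
    rw [Finset.sum_comm]
    exact Finset.sum_congr rfl fun k _ => Finset.sum_comm
  rw [h0, Finset.mul_sum]
  refine Finset.sum_le_sum fun k _ => ?_
  rw [Finset.mul_sum]
  refine Finset.sum_le_sum fun l _ => ?_
  have h1 : z p (q k) (q l) = ∑ i, Z i p (q k) (q l) := by
    have h2 : ∀ B : ι → EE n →L[ℝ] EE n →L[ℝ] 𝕜, (∑ i, B i) (q k) (q l) = ∑ i, B i (q k) (q l) :=
      fun B => by rw [sum_apply, sum_apply]
    rw [hz]
    exact h2 _
  rw [h1]
  exact norm_sum_sq_le _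

/-- Finite partitions of unity over a compact set, with further cutoff functions equal to one on
the supports. -/
lemma exists_cutoffs [IsManifold (𝓡 n) ∞ M] [T2Space M] [SecondCountableTopology M] {K : Set M}
    (hK : IsCompact K) (V : K → Set M) (hV : ∀ p, IsOpen (V p)) (hpV : ∀ p : K, (p : M) ∈ V p) :
    ∃ (t : Finset K) (χ ψ : t → M → ℝ), (∀ p ∈ K, ∑ k, χ k p = 1) ∧ ∀ k : t,
      ContMDiff (𝓡 n) 𝓘(ℝ, ℝ) ∞ (χ k) ∧ ContMDiff (𝓡 n) 𝓘(ℝ, ℝ) ∞ (ψ k) ∧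
      IsCompact (tsupport (χ k)) ∧ tsupport (χ k) ⊆ V k ∧ tsupport (ψ k) ⊆ V k ∧
      (∀ p ∈ tsupport (χ k), ψ k p = 1) ∧ (∀ p, |χ k p| ≤ 1) ∧ ∀ p, |ψ k p| ≤ 1 := by
  have : LocallyCompactSpace M := ChartedSpace.locallyCompactSpace (EuclideanSpace ℝ (Fin n)) M
  choose L hL hpL hLV using fun p : K => exists_compact_subset (hV p) (hpV p)
  choose L' hL' hLL' hLV' using fun p : K => exists_compact_between (hL p) (hV p) (hLV p)
  obtain ⟨t, ht⟩ := hK.elim_nhds_subcover' (fun p hp => interior (L ⟨p, hp⟩))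
    fun p hp => isOpen_interior.mem_nhds (hpL ⟨p, hp⟩)
  obtain ⟨f, hf⟩ := SmoothPartitionOfUnity.exists_isSubordinate (𝓡 n) hK.isClosed
    (fun k : t => interior (L k)) (fun k => isOpen_interior) (fun p hp => by
      obtain ⟨k, hk, hpk⟩ := mem_iUnion₂.1 (ht hp)
      exact mem_iUnion.2 ⟨⟨k, hk⟩, hpk⟩)
  choose g hg1 hg0 hg using fun k : t =>
    exists_contMDiffMap_one_nhds_of_subset_interior (n := ⊤) (𝓡 n) (hL k).isClosed (hLL' k)
  have hfL : ∀ k, tsupport (f k) ⊆ L k := fun k => (hf k).trans interior_subset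
  refine ⟨t, fun k => f k, fun k => g k, fun p hp => ?_, fun k => ⟨(f k).contMDiff,
    (g k).contMDiff, (hL k).of_isClosed_subset (isClosed_tsupport _) (hfL k),
    (hfL k).trans (hLV k), ?_, fun p hp => ?_, fun p => ?_, fun p => ?_⟩⟩
  · rw [← finsum_eq_sum_of_fintype]
    exact f.sum_eq_one hp
  · refine (closure_minimal (fun p hp => ?_) (hL' k).isClosed).trans (hLV' k)
    by_contra hpL'
    exact hp (hg0 k p hpL')
  · exact (hg1 k).self_of_nhdsSet p (hfL k hp)
  · rw [abs_of_nonneg (f.nonneg k p)]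
    exact f.le_one k p
  · rw [abs_of_nonneg (hg k p).1]
    exact (hg k p).2

variable [IsManifold (𝓡 n) ∞ M] [MeasurableSpace M] [BorelSpace M]

/-- Weak covariant derivatives are additive and depend only on the values on `O`. -/
lemma IsWeakGrad.of_sum {h : TwoTensor n M ℝ} {O : Set M} (hh : IsMetricOn (n := n) (M := M) h O)
    {ι : Type*} [Fintype ι] {U : ι → OneForm n M 𝕜} {Z : ι → TwoTensor n M 𝕜}
    (hU : ∀ k, IsWeakGrad h O (U k) (Z k)) {u : OneForm n M 𝕜} {z : TwoTensor n M 𝕜}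
    (hu : ∀ p ∈ O, u p = ∑ k, U k p) (hz : ∀ p ∈ O, z p = ∑ k, Z k p) : IsWeakGrad h O u z := by
  refine isWeakGrad_of_local (n := n) (M := M) (𝕜 := 𝕜) hh hh.isOpen subset_rfl fun p hp => ?_
  let e := chartAt (EuclideanSpace ℝ (Fin n)) p
  have he : IsSmoothChart (n := n) e := isSmoothChart_of_mem_atlas (chart_mem_atlas _ _)
  refine ⟨e, he, e.source, e.open_source, mem_chart_source _ p, subset_rfl, ?_⟩
  have hop : IsOpen (chartDomain e (O ∩ e.source)) :=
    isOpen_chartDomain e (hh.isOpen.inter e.open_source)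
  have h1 : ∀ k ∈ Finset.univ, IsWeakDeriv₁ (chartDomain e (O ∩ e.source))
      (cu (n := n) (M := M) e (U k)) (fun y => cτ (n := n) (M := M) e (Z k) y
        + contract (cu (n := n) (M := M) e (U k) y) (conn (n := n) (M := M) e h y)) := fun k _ =>
    ((hU k).isWeakGradIn hh hh.isOpen subset_rfl he).mono (inter_subset_left)
  have hcu : ∀ y ∈ chartDomain e (O ∩ e.source), ∑ k, cu (n := n) (M := M) e (U k) y
      = cu (n := n) (M := M) e u y := fun y hy => by
    have h3 : ∀ (w : ι → EE n →L[ℝ] 𝕜) (L : EE n →L[ℝ] EE n), ∑ k, (w k).comp L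
        = (∑ k, w k).comp L := fun w L => by
      ext v
      simp only [sum_apply, ContinuousLinearMap.comp_apply]
    exact (h3 (fun k => U k (e.symm y)) (chartD e y)).trans
      (congrArg (fun w : EE n →L[ℝ] 𝕜 => w.comp (chartD e y)) (hu _ hy.2.1).symm)
  have hcτ : ∀ y ∈ chartDomain e (O ∩ e.source), ∑ k, cτ (n := n) (M := M) e (Z k) y
      = cτ (n := n) (M := M) e z y := fun y hy => by
    have h3 : ∀ (w : ι → EE n →L[ℝ] EE n →L[ℝ] 𝕜) (L : EE n →L[ℝ] EE n), ∑ k, pull₂ (w k) L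
        = pull₂ (∑ k, w k) L := fun w L => by
      ext v
      simp only [sum_apply, pull₂_apply]
    exact (h3 (fun k => Z k (e.symm y)) (chartD e y)).trans
      (congrArg (fun w : EE n →L[ℝ] EE n →L[ℝ] 𝕜 => pull₂ w (chartD e y)) (hz _ hy.2.1).symm)
  refine (IsWeakDeriv₁.sum hop Finset.univ h1).congr hop hcu fun y hy => ?_
  simp only [Finset.sum_add_distrib, hcτ y hy]
  rw [← hcu y hy]
  refine congrArg (cτ (n := n) (M := M) e z y + ·) ?_
  ext s t
  simp only [sum_apply, contract_apply]

/-- The Korn inequality in terms of squared norms, for the unweighted one-form `v`. -/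
theorem exists_extension [T2Space M] [SecondCountableTopology M] (hn : 0 < n) {x : M → ℝ}
    (hx : IsBdf (n := n) x) (gsc : ScMetric n x) {Ω : Set M} (hΩ : IsScDomain (n := n) x Ω)
    {h₂ : TwoTensor n M ℝ} (hh₂ : IsMetricOn (n := n) (M := M) h₂ univ) (F r : ℝ) :
    ∃ K : ℝ≥0, ∀ (v : OneForm n M 𝕜) (W S : TwoTensor n M 𝕜),
      IsWeakGrad gsc.form {p | 0 < x p} v W →
      S = conjSymGrad (n := n) (M := M) gsc.form h₂ (weight x F r) v W →
      ∫⁻ p in {p | 0 < x p}, ENNReal.ofReal (normSqOne gsc.form v p) ∂vol gsc.form < ⊤ →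
      ∫⁻ p in {p | 0 < x p}, ENNReal.ofReal (normSqTwo gsc.form W p) ∂vol gsc.form < ⊤ →
      ∫⁻ p in Ω, ENNReal.ofReal (normSqTwo gsc.form S p) ∂vol gsc.form < ⊤ ∧
      ∃ (U : OneForm n M 𝕜) (Z : TwoTensor n M 𝕜), IsWeakGrad gsc.form {p | 0 < x p} U Z ∧
        (∀ p ∈ Ω, U p = v p) ∧
        (∫⁻ p in {p | 0 < x p}, ENNReal.ofReal (normSqTwo gsc.form Z p) ∂vol gsc.form)
          + ∫⁻ p in {p | 0 < x p}, ENNReal.ofReal (normSqOne gsc.form U p) ∂vol gsc.form ≤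
          K * ((∫⁻ p in Ω, ENNReal.ofReal (normSqTwo gsc.form S p) ∂vol gsc.form)
            + ∫⁻ p in Ω, ENNReal.ofReal (normSqOne gsc.form v p) ∂vol gsc.form) := by
  set P : Set M := {p | 0 < x p} with hP
  have hh₁ := isMetricOn_form hx gsc
  have hh₂P : IsMetricOn (n := n) (M := M) h₂ P := ⟨hh₁.isOpen, fun p _ => hh₂.inner p (mem_univ p),
    fun e he => (hh₂.smooth e he).mono (chartDomain_mono e (subset_univ _))⟩
  have hφ := contMDiffOn_weight (n := n) hx F r
  have hΩo : IsOpen Ω := hΩ.isOpen hx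
  choose V a β b C hpV ha using fun p : closure Ω => hΩ.exists_isAdaptedChart hx gsc hh₂ F r hn p.2
  obtain ⟨t, χ, ψ, hsum, hcut⟩ := exists_cutoffs (n := n) hΩ.isCompact_closure V
    (fun p => (ha p).isOpen) hpV
  choose hχ hψ hχK hχV hψV hψχ hχ1 hψ1 using hcut
  choose K hK using fun k : t => (ha k).exists_extension (𝕜 := 𝕜) hh₁ hΩo.measurableSet
    hΩ.subset_pos (hχ k) (hψ k) (hχK k) (hχV k) (hψV k) (hψχ k) (hχ1 k) (hψ1 k)
  set N : ℝ≥0 := (Fintype.card t : ℝ≥0) with hN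
  refine ⟨N * ∑ k, K k + N * ∑ k, K k, fun v W S hvW hS hv hW => ?_⟩
  have hconj : ∀ k : t, IsConjSymGrad (n := n) (M := M) gsc.form h₂ (weight x F r) (a k) v W S :=
    fun k y hy => by
      rw [hS]
      exact cτ_conjSymGrad hh₁ hh₂P hφ (ha k).isSmoothChart
        ⟨hy, (ha k).source_subset_left ((a k).map_target hy)⟩ v W
  have hK' := fun k => hK k v W S hvW (hconj k) hv hW
  refine ⟨?_, ?_⟩
  · have hcover : Ω ⊆ ⋃ k : t, (a k).source := by
      intro p hp
      have h1 : ∃ k, χ k p ≠ 0 := by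
        by_contra! h0
        have h2 := hsum p (subset_closure hp)
        simp [h0] at h2
      obtain ⟨k, hk⟩ := h1
      refine mem_iUnion.2 ⟨k, ?_⟩
      rw [(ha k).source_eq]
      exact ⟨hχV k (subset_tsupport _ hk), hΩ.subset_pos hp⟩
    calc ∫⁻ p in Ω, ENNReal.ofReal (normSqTwo gsc.form S p) ∂vol gsc.form
        ≤ ∫⁻ p in ⋃ k : t, (a k).source, ENNReal.ofReal (normSqTwo gsc.form S p) ∂vol gsc.form :=
          lintegral_mono_set hcover
      _ ≤ ∑' k : t, ∫⁻ p in (a k).source, ENNReal.ofReal (normSqTwo gsc.form S p) ∂vol gsc.form :=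
          lintegral_iUnion_le _ _
      _ < ⊤ := by
          rw [tsum_fintype]
          exact ENNReal.sum_lt_top.2 fun k _ => (hK' k).1
  choose U Z hUZ hU hmU hmZ using fun k => (hK' k).2
  choose m₁ hm₁ hUm hI₁ using hmU
  choose m₂ hm₂ hZm hI₂ using hmZ
  set J := (∫⁻ p in Ω, ENNReal.ofReal (normSqTwo gsc.form S p) ∂vol gsc.form)
            + ∫⁻ p in Ω, ENNReal.ofReal (normSqOne gsc.form v p) ∂vol gsc.form
  refine ⟨fun p => ∑ k, U k p, fun p => ∑ k, Z k p, IsWeakGrad.of_sum hh₁ hUZ (fun _ _ => rfl)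
    fun _ _ => rfl, fun p hp => ?_, ?_⟩
  · have h1 : ∀ w : EE n →L[ℝ] 𝕜, ∑ k, χ k p • w = w := fun w => by
      rw [← Finset.sum_smul, hsum p (subset_closure hp), one_smul]
    refine (Finset.sum_congr rfl fun k _ => hU k p hp).trans ?_
    exact h1 _
  · have mP : MeasurableSet P := hh₁.isOpen.measurableSet
    have key : ∀ (f : M → ℝ) (q : t → M → ℝ) (m : t → M → ℝ≥0∞), (∀ k, Measurable (m k)) →
        (∀ k p, ENNReal.ofReal (q k p) ≤ m k p) → (∀ p ∈ P, f p ≤ Fintype.card t * ∑ k, q k p) →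
        (∀ k, ∫⁻ p in P, m k p ∂vol gsc.form ≤ K k * J) →
        ∫⁻ p in P, ENNReal.ofReal (f p) ∂vol gsc.form ≤ (N * ∑ k, K k : ℝ≥0) * J := by
      intro f q m hm hqm hfq hmJ
      calc ∫⁻ p in P, ENNReal.ofReal (f p) ∂vol gsc.form
          ≤ ∫⁻ p in P, N * ∑ k, m k p ∂vol gsc.form := by
            refine setLIntegral_mono' mP fun p hp => ?_
            refine (ENNReal.ofReal_le_ofReal (hfq p hp)).trans ?_
            rw [ENNReal.ofReal_mul (Nat.cast_nonneg _), ENNReal.ofReal_natCast]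
            refine mul_le_mul' (by simp [hN]) ?_
            calc ENNReal.ofReal (∑ k, q k p) ≤ ENNReal.ofReal (∑ k, max (q k p) 0) :=
                  ENNReal.ofReal_le_ofReal (Finset.sum_le_sum fun k _ => le_max_left _ _)
              _ = ∑ k, ENNReal.ofReal (max (q k p) 0) :=
                  ENNReal.ofReal_sum_of_nonneg fun k _ => le_max_right _ _
              _ ≤ ∑ k, m k p := Finset.sum_le_sum fun k _ => by
                  refine le_trans (le_of_eq ?_) (hqm k p)
                  rcases le_total (q k p) 0 with h0 | h0
                  · rw [max_eq_right h0, ENNReal.ofReal_zero, ENNReal.ofReal_of_nonpos h0]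
                  · rw [max_eq_left h0]
        _ = N * ∑ k, ∫⁻ p in P, m k p ∂vol gsc.form := by
            rw [lintegral_const_mul' _ _ ENNReal.coe_ne_top,
              lintegral_finsetSum _ fun k _ => hm k]
        _ ≤ N * ∑ k, K k * J := by
            gcongr with k
            exact hmJ k
        _ = _ := by
            rw [← Finset.sum_mul, ← mul_assoc]
            push_cast
            rfl
    have i₁ := key _ _ m₂ hm₂ hZm (fun p hp => normSqTwo_sum_le (z := fun p => ∑ k, Z k p)
      (hh₁.inner p hp) rfl) hI₂
    have i₂ := key _ _ m₁ hm₁ hUm (fun p hp => normSqOne_sum_le (u := fun p => ∑ k, U k p)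
      (hh₁.inner p hp) rfl) hI₁
    refine (add_le_add i₁ i₂).trans (le_of_eq ?_)
    rw [← add_mul]
    push_cast
    rfl

end ScGeom
end

/-! ### Norms -/

section

namespace ScGeom

variable {n : ℕ} {𝕜 : Type*} [RCLike 𝕜]
  {M : Type*} [TopologicalSpace M] [ChartedSpace (EuclideanSpace ℝ (Fin n)) M] [MeasurableSpace M]

/-- Squared `L²` norms avoid fractional powers of integrals. -/
lemma l2One_sq (h : TwoTensor n M ℝ) (O : Set M) (u : OneForm n M 𝕜) :
    l2One h O u ^ 2 = ∫⁻ p in O, ENNReal.ofReal (normSqOne h u p) ∂vol h := by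
  rw [l2One, ← ENNReal.rpow_natCast, ← ENNReal.rpow_mul]
  norm_num

lemma l2Two_sq (h : TwoTensor n M ℝ) (O : Set M) (τ : TwoTensor n M 𝕜) :
    l2Two h O τ ^ 2 = ∫⁻ p in O, ENNReal.ofReal (normSqTwo h τ p) ∂vol h := by
  rw [l2Two, ← ENNReal.rpow_natCast, ← ENNReal.rpow_mul]
  norm_num

lemma l2One_congr (h : TwoTensor n M ℝ) {O : Set M} (hO : MeasurableSet O) {u u' : OneForm n M 𝕜}
    (hu : ∀ p ∈ O, u p = u' p) : l2One h O u = l2One h O u' := by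
  rw [l2One, l2One, setLIntegral_congr_fun hO fun p hp => ?_]
  simp only [normSqOne, hu p hp]

lemma l2Two_congr (h : TwoTensor n M ℝ) {O : Set M} (hO : MeasurableSet O) {τ τ' : TwoTensor n M 𝕜}
    (hτ : ∀ p ∈ O, τ p = τ' p) : l2Two h O τ = l2Two h O τ' := by
  rw [l2Two, l2Two, setLIntegral_congr_fun hO fun p hp => ?_]
  simp only [normSqTwo, hτ p hp]

/-- From squared norms to norms, using `s² + t² ≤ (s + t)²`. -/
lemma rpow_half_le {I s t : ℝ≥0∞} {K : ℝ≥0} (h : I ≤ K * (s ^ 2 + t ^ 2)) :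
    I ^ (1 / 2 : ℝ) ≤ (K ^ (1 / 2 : ℝ) : ℝ≥0) * (s + t) := by
  have h1 : s ^ 2 + t ^ 2 ≤ (s + t) ^ (2 : ℝ) := by
    rw [ENNReal.rpow_two, add_sq]
    gcongr
    exact le_self_add
  calc I ^ (1 / 2 : ℝ) ≤ (K * (s + t) ^ (2 : ℝ)) ^ (1 / 2 : ℝ) :=
        ENNReal.rpow_le_rpow (h.trans (mul_le_mul' le_rfl h1)) (by norm_num)
    _ = _ := by
        rw [ENNReal.mul_rpow_of_nonneg _ _ (by norm_num), ← ENNReal.rpow_mul,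
          ENNReal.coe_rpow_of_nonneg _ (by norm_num)]
        norm_num

/-- Valid for `x > 0` only, where the real power is an exponential of the logarithm. -/
lemma exp_weight {x : M → ℝ} {p : M} (hp : 0 < x p) (F r : ℝ) :
    Real.exp (weight x F r p) = Real.exp (F / x p) * x p ^ r := by
  rw [weight, Real.exp_add, Real.rpow_def_of_pos hp, mul_comm r]

end ScGeom

end

theorem lemma4p5 {n : ℕ} {M : Type*} [TopologicalSpace M] [T2Space M] [SecondCountableTopology M]
    [ChartedSpace (EuclideanSpace ℝ (Fin n)) M] [IsManifold (𝓡 n) ∞ M]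
    [MeasurableSpace M] [BorelSpace M] {𝕜 : Type*} [RCLike 𝕜]
    (x : M → ℝ) (hx : ScGeom.IsBdf (n := n) x)
    (g : Bundle.ContMDiffRiemannianMetric (𝓡 n) ∞ (EuclideanSpace ℝ (Fin n))
      (fun p : M => TangentSpace (𝓡 n) p))
    (gsc : ScGeom.ScMetric n x)
    (Ω : Set M) (hΩ : ScGeom.IsScDomain (n := n) x Ω)
    (F : ℝ) (hF : 0 < F) (r : ℝ) :
    ∃ C : ℝ≥0, ∀ u : ScGeom.OneForm n M 𝕜, ScGeom.scBarH1Norm gsc Ω r u < ⊤ →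
      ∃ S : ScGeom.TwoTensor n M 𝕜, ScGeom.IsWeakSymGradF x F g.inner Ω u S ∧
        ScGeom.l2Two gsc.form Ω (ScGeom.mulTwo (fun p => x p ^ (-r)) S) < ⊤ ∧
        ScGeom.scBarH1Norm gsc Ω r u ≤
          C * (ScGeom.l2Two gsc.form Ω (ScGeom.mulTwo (fun p => x p ^ (-r)) S) +
            ScGeom.l2One gsc.form Ω (ScGeom.mulOne (fun p => x p ^ (-r)) u)) := by
  open ScGeom in
  -- in dimension zero all tensors and all norms vanish
  rcases Nat.eq_zero_or_pos n with rfl | hn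
  · refine ⟨0, fun u _ => ⟨0, ⟨fun _ _ i => i.elim0, fun _ _ i => i.elim0,
      fun _ _ _ _ i => i.elim0⟩, by simp [l2Two, normSqTwo], ?_⟩⟩
    refine (iInf₂_le u fun _ _ => rfl).trans ((iInf₂_le 0 ⟨fun _ _ i => i.elim0,
      fun _ _ i => i.elim0, fun _ _ _ _ i => i.elim0⟩).trans ?_)
    simp [l2Two, normSqTwo, l2One, normSqOne]
  set P : Set M := {p | 0 < x p} with hP
  have hh₂ : IsMetricOn (n := n) (M := M) g.inner univ := isMetricOn_univ g
  have hh₁ : IsMetricOn (n := n) (M := M) gsc.form P := isMetricOn_form hx gsc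
  have hh₂P : IsMetricOn (n := n) (M := M) g.inner P :=
    ⟨hh₁.isOpen, fun p _ => hh₂.inner p (mem_univ p),
      fun e he => (hh₂.smooth e he).mono (chartDomain_mono e (subset_univ _))⟩
  have mP : MeasurableSet P := hh₁.isOpen.measurableSet
  have hΩo := hΩ.isOpen hx
  have hΩP : Ω ⊆ P := hΩ.subset_pos
  obtain ⟨K, hK⟩ := exists_extension (𝕜 := 𝕜) hn hx gsc hΩ hh₂ F r
  refine ⟨K ^ (1 / 2 : ℝ), fun u hu => ?_⟩
  -- some extension `U₀` of `u` to `x > 0` has finite norm; the unweighted one-form is `x^{-r} U₀`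
  obtain ⟨U₀, hu⟩ := iInf_lt_iff.1 hu
  obtain ⟨hU₀u, hu⟩ := iInf_lt_iff.1 hu
  obtain ⟨W, hu⟩ := iInf_lt_iff.1 hu
  obtain ⟨hvW, hu⟩ := iInf_lt_iff.1 hu
  set v : OneForm n M 𝕜 := mulOne (fun p => x p ^ (-r)) U₀ with hv
  rw [ENNReal.rpow_lt_top_iff_of_pos (by norm_num), ENNReal.add_lt_top, l2One_sq, l2Two_sq] at hu
  set S' : TwoTensor n M 𝕜 :=
    conjSymGrad (n := n) (M := M) gsc.form g.inner (weight x F r) v W with hS'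
  obtain ⟨hfin, U, Z, hUZ, hUv, hle⟩ := hK v W S' hvW rfl hu.2 hu.1
  have hxr : ∀ p, 0 < x p → x p ^ (-r) * x p ^ r = 1 := fun p hp => by
    rw [← Real.rpow_add hp, neg_add_cancel, Real.rpow_zero]
  have one₁ : ∀ p, 0 < x p → ∀ z : EE n →L[ℝ] 𝕜, x p ^ (-r) • x p ^ r • z = z :=
    fun p hp z => by rw [smul_smul, hxr p hp, one_smul]
  have one₂ : ∀ p, 0 < x p → ∀ z : EE n →L[ℝ] 𝕜, x p ^ r • x p ^ (-r) • z = z :=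
    fun p hp z => by rw [smul_smul, mul_comm, hxr p hp, one_smul]
  have two₁ : ∀ p, 0 < x p → ∀ z : EE n →L[ℝ] EE n →L[ℝ] 𝕜, x p ^ (-r) • x p ^ r • z = z :=
    fun p hp z => by rw [smul_smul, hxr p hp, one_smul]
  have hS : l2Two gsc.form Ω (mulTwo (fun p => x p ^ (-r)) (mulTwo (fun p => x p ^ r) S'))
      = l2Two gsc.form Ω S' :=
    l2Two_congr _ hΩo.measurableSet fun p hp => two₁ p (hΩP hp) (S' p)
  have hvu : l2One gsc.form Ω (mulOne (fun p => x p ^ (-r)) u) = l2One gsc.form Ω v :=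
    l2One_congr _ hΩo.measurableSet fun p hp =>
      congrArg (fun z : EE n →L[ℝ] 𝕜 => x p ^ (-r) • z) (hU₀u p hp).symm
  have hvU : ∀ p ∈ Ω, u p = x p ^ r • v p := fun p hp =>
    (hU₀u p hp).symm.trans (one₂ p (hΩP hp) (U₀ p)).symm
  -- the conjugation by `e^{F/x} x^r` of `v` is the one by `e^{F/x}` of `u = x^r v`, times `x^{-r}`
  refine ⟨mulTwo (fun p => x p ^ r) S', ?_, ?_, ?_⟩
  · refine isWeakSymGrad_conjSymGrad hh₁ hh₂P hΩo hΩP (contMDiffOn_weight hx F r) hvW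
      (fun p hp => ?_) fun p hp => ?_
    · refine (congrArg (fun z : EE n →L[ℝ] 𝕜 => Real.exp (F / x p) • z) (hvU p hp)).trans ?_
      rw [exp_weight (hΩP hp)]
      exact smul_smul _ _ _
    · rw [exp_weight (hΩP hp)]
      exact smul_smul _ _ _
  · rw [hS, ← ENNReal.rpow_lt_top_iff_of_pos (y := 2) (by norm_num), ENNReal.rpow_two, l2Two_sq]
    exact hfin
  · rw [hS, hvu]
    have hU : ∀ p ∈ P, mulOne (fun p => x p ^ (-r)) (mulOne (fun p => x p ^ r) U) p = U p :=
      fun p hp => one₁ p hp (U p)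
    -- `x^{-r} x^r U` agrees with `U` on `x > 0` only, so this is not a rewriting
    have hUZ' : IsWeakGrad gsc.form P
        (mulOne (fun p => x p ^ (-r)) (mulOne (fun p => x p ^ r) U)) Z :=
      IsWeakGrad.of_sum (ι := Unit) hh₁ (fun _ => hUZ)
        (fun p hp => (hU p hp).trans
          (Fintype.sum_unique fun _ : Unit => (U p : EE n →L[ℝ] 𝕜)).symm)
        fun p _ => (Fintype.sum_unique fun _ : Unit => (Z p : EE n →L[ℝ] EE n →L[ℝ] 𝕜)).symm
    have hUext : ∀ p ∈ Ω, mulOne (fun p => x p ^ r) U p = u p := fun p hp =>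
      (congrArg (fun z : EE n →L[ℝ] 𝕜 => x p ^ r • z) (hUv p hp)).trans (hvU p hp).symm
    refine (iInf₂_le _ hUext).trans ((iInf₂_le Z hUZ').trans (rpow_half_le ?_))
    rw [l2One_congr _ mP hU, l2One_sq, l2Two_sq, l2Two_sq, l2One_sq]
    exact hle
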